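/- **Kac exact sequence.** All locally compact groups are Hausdorff and second countable. Let $G$ be a locally compact group and $G_1,G_2\subset G$ a *matched pair*: closed subgroups with $G_1\cap G_2=\{e\}$ and $G\setminus G_1G_2$ of Haar measure zero. Let $A$ be a *Polish $G$-module*, i.e. a Polish abelian topological group with a jointly continuous action of $G$ by automorphisms. For a standard Borel space $X$ with a measure class, $\mathrm L(X,A)$ is the group of Borel maps $X\to A$ modulo equality almost everywhere. *Measurable group cohomology.* For a locally compact group $H$ acting continuously on $A$, $H^n(H,A)$ is the cohomology of the complex $(\mathrm L(H^n,A))_{n\ge 0}$ (with respect to Haar measure) with coboundary $$(\mathrm df)(g_0,\dots,g_n)=g_0\cdot f(g_1,\dots,g_n)+\sum_{i=1}^{n}(-1)^i f(g_0,\dots,g_{i-1}g_i,\dots,g_n)+(-1)^{n+1}f(g_0,\dots,g_{n-1}).$$ *Bicomplex.* For $p,q\ge0$ let $\Gamma_{pq}$ be the space of all families $X=((g_{ij})_{1\le i\le p,\,0\le j\le q},(s_{ij})_{0\le i\le p,\,1\le j\le q})$ with $g_{ij}\in G_1$ (vertical edges of a $p\times q$ grid), $s_{ij}\in G_2$ (horizontal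 edges) and $s_{i-1,j}\,g_{ij}=g_{i,j-1}\,s_{ij}$ for $1\le i\le p$, $1\le j\le q$. It carries the measure class pulled back from $G_1^p\times G_2^q$ along the injective map, with conull range, that picks out the first column and the first row. Let $\partial^h_k$ (resp. $\partial^v_k$) remove the $k$-th column line (resp. row line) of the grid, multiplying adjacent edges, and put $$(\mathrm d^hF)(X)=s_{01}\cdot F(\partial^h_0X)+\sum_{k=1}^{q+1}(-1)^kF(\partial^h_kX),\qquad (\mathrm d^vF)(X)=g_{10}\cdot F(\partial^v_0X)+\sum_{k=1}^{p+1}(-1)^kF(\partial^v_kX)$$ for $F\in\mathrm L(\Gamma_{pq},A)$. Let $D^n(A)=\bigoplus_{p+q=n}\mathrm L(\Gamma_{pq},A)$ with $\mathrm d=\mathrm d^h+(-1)^q\mathrm d^v$ on $\mathrm L(\Gamma_{pq},A)$. Since $\Gamma_{n0}=G_1^n$ and $\Gamma_{0n}=G_2^n$, there is a cochain map $J:D^n(A)\to K^n(A)=\mathrm L(G_1^n,A)\oplus\mathrm L(G_2^n,A)$, $J(F)=(F_{n0},F_{0n})$ (for $n=0$: $a\mapsto(a,a)$). *Kac cohomology.*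 $H^n(\mathrm{m.p.},A)$ is the $n$-th cohomology of the mapping cone $M^n=D^{n+1}(A)\oplus K^n(A)$ $(n\ge-1)$, where $K^{-1}=0$, with coboundary $\mathrm d(F,K)=(\mathrm dF,-\mathrm dK+JF)$. **Theorem.** (1) There is a long exact sequence $$0\to A^G\to A^{G_1}\oplus A^{G_2}\to H^0(\mathrm{m.p.},A)\to H^1(G,A)\to H^1(G_1,A)\oplus H^1(G_2,A)\to H^1(\mathrm{m.p.},A)\to H^2(G,A)\to\cdots$$ continuing for all degrees $n$ as $H^n(G,A)\to H^n(G_1,A)\oplus H^n(G_2,A)\to H^n(\mathrm{m.p.},A)\to H^{n+1}(G,A)\to\cdots$. Its maps are the following. The first map is $a\mapsto(a,a)$. The maps into $H^n(\mathrm{m.p.},A)$ are induced by $K\mapsto(0,K)$. There are isomorphisms $\Phi_n:H^n(G,A)\to H^n(D(A))$ that send the class of each Borel map $f:G^n\to A$ with $\mathrm df=0$ everywhere to the class of $$I(f)(X)=\sum_{\gamma}(-1)^{\#\{\text{squares above }\gamma\}}f(\gamma),\qquad X\in\Gamma_{pq},\ p+q=n,$$ where $\gamma$ runs over the paths in $X$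 from the top left to the bottom right corner that go right or down, and $f(\gamma)$ is $f$ evaluated on the successive edges of $\gamma$. The maps $H^n(\mathrm{m.p.},A)\to H^{n+1}(G,A)$ are $[(F,K)]\mapsto\Phi_{n+1}^{-1}[F]$. The maps $H^n(G,A)\to H^n(G_1,A)\oplus H^n(G_2,A)$ are $J_*\circ\Phi_n$; on the class of each Borel $f$ as above they are given by restriction, $[f]\mapsto([f|_{G_1^n}],[f|_{G_2^n}])$. (2) Let $\mathbb T=\mathbb R/\mathbb Z$ with trivial action of $G$, and write $x=p_1(x)p_2(x)$ with $p_i(x)\in G_i$ for almost all $x\in G$. Let the *group of extensions* be the group of pairs $(U,V)\in\mathrm L(G_2\times G_1^2,\mathbb T)\oplus\mathrm L(G_2^2\times G_1,\mathbb T)$ with $$U(p_2(sg),h,k)-U(s,gh,k)+U(s,g,hk)-U(s,g,h)=0,$$ $$V(t,r,g)-V(st,r,g)+V(s,tr,g)-V(s,t,p_1(rg))=0,$$ $$U(t,g,h)-U(st,g,h)+U(s,p_1(tg),p_1(p_2(tg)h))+V(p_2(sp_1(tg)),p_2(tg),h)-V(s,t,gh)+V(s,t,g)=0$$ for almost all $s,t,r\in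 G_2$, $g,h,k\in G_1$, modulo the pairs $$U_R(s,g,h)=-R(p_2(sg),h)+R(s,gh)-R(s,g),\qquad V_R(s,t,g)=R(t,g)-R(st,g)+R(s,p_1(tg)),$$ with $R\in\mathrm L(G_2\times G_1,\mathbb T)$. Then the group of extensions is isomorphic to $H^2(\mathrm{m.p.},\mathbb T)$, by the map that sends the class of $(U,V)$ to the class of $(F,0)\in M^2$, where $F_{21}(X)=U(s_{01},g_{11},g_{21})$, $F_{12}(X)=V(s_{01},s_{02},g_{12})$ and $F_{30}=F_{03}=0$. -/

import Mathlib

open MeasureTheory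

namespace Kac

/-! ### Cohomology of measurable cochains modulo null cochains -/

section General

variable {M N P : Type*} [AddCommGroup M] [AddCommGroup N] [AddCommGroup P]

/-- Cochains in `N` that are measurable and whose coboundary is a null cochain. -/
def cocycles (measN : AddSubgroup N) (nullP : AddSubgroup P) (d : N →+ P) : AddSubgroup N :=
  measN ⊓ nullP.comap d

/-- Cochains that are equal, up to a null cochain, to the coboundary of a measurable cochain. -/
def coboundaries (measM : AddSubgroup M) (nullN : AddSubgroup N) (d : M →+ N) : AddSubgroup N :=
  measM.map d ⊔ nullN

/-- The quotient of the cocycles `Z` by those that are coboundaries.  With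
`Z = cocycles measN nullP d'` and `B = coboundaries measM nullN d`, this is the cohomology, at the
middle term, of the complex `measM / null ⟶ measN / null ⟶ measP / null` of classes of
measurable cochains modulo equality almost everywhere, computed on representatives. -/
abbrev Cohomology (Z B : AddSubgroup N) : Type _ := Z ⧸ B.addSubgroupOf Z

/-- `Represents x f`: the cochain `f` is a cocycle, and `x` is its cohomology class. -/
def Represents {Z B : AddSubgroup N} (x : Cohomology Z B) (f : N) : Prop :=
  ∃ hf : f ∈ Z, x = QuotientAddGroup.mk ⟨f, hf⟩

/-- The Borel measurable functions from `X` to `A`. -/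
def measFun (X A : Type*) [MeasurableSpace X] [AddCommGroup A] [MeasurableSpace A]
    [MeasurableAdd₂ A] [MeasurableNeg A] : AddSubgroup (X → A) where
  carrier := {f | Measurable f}
  add_mem' hf hg := Measurable.add hf hg
  zero_mem' := measurable_const
  neg_mem' hf := Measurable.neg hf

/-- The functions that vanish almost everywhere. -/
def nullFun {X : Type*} [MeasurableSpace X] (μ : Measure X) (A : Type*) [AddCommGroup A] :
    AddSubgroup (X → A) where
  carrier := {f | ∀ᵐ x ∂μ, f x = 0}
  add_mem' {f g} hf hg := by
    have hf' : ∀ᵐ x ∂μ, f x = 0 := hf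
    have hg' : ∀ᵐ x ∂μ, g x = 0 := hg
    change ∀ᵐ x ∂μ, (f + g) x = 0
    filter_upwards [hf', hg'] with x h1 h2
    simp [h1, h2]
  zero_mem' := by
    change ∀ᵐ x ∂μ, (0 : X → A) x = 0
    simp
  neg_mem' {f} hf := by
    have hf' : ∀ᵐ x ∂μ, f x = 0 := hf
    change ∀ᵐ x ∂μ, (-f) x = 0
    filter_upwards [hf'] with x h1
    simp [h1]

end General

/-! ### Measurable group cohomology -/

section GroupCohomology

/-- The face `∂ₖ : Hⁿ⁺¹ → Hⁿ`: it drops the first entry for `k = 0`, multiplies the entries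
number `k - 1` and `k` for `1 ≤ k ≤ n`, and drops the last entry for `k = n + 1`. -/
def face {H : Type*} [Mul H] {n : ℕ} (k : Fin (n + 2)) (x : Fin (n + 1) → H) : Fin n → H :=
  Fin.cases (fun i => x i.succ) (fun j => Fin.contractNth j (· * ·) x) k

variable (H : Type*) [Group H] (A : Type*) [AddCommGroup A] [DistribMulAction H A]

/-- The inhomogeneous group coboundary
`(d f)(g₀, …, gₙ) = g₀ • f(∂₀ g) + ∑_{1 ≤ k ≤ n + 1} (-1)ᵏ f(∂ₖ g)`. -/
def groupD (n : ℕ) : ((Fin n → H) → A) →+ ((Fin (n + 1) → H) → A) where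
  toFun f g := g 0 • f (face 0 g) +
    ∑ k : Fin (n + 1), (-1 : ℤ) ^ ((k : ℕ) + 1) • f (face k.succ g)
  map_zero' := by ext; simp
  map_add' f f' := by
    ext
    simp only [Pi.add_apply, smul_add, Finset.sum_add_distrib]
    abel

variable [MeasurableSpace H] (μ : Measure H)
  [MeasurableSpace A] [MeasurableAdd₂ A] [MeasurableNeg A]

/-- Null functions on `Hⁿ`, for the `n`-fold product of the measure `μ`. -/
noncomputable def groupNull (n : ℕ) : AddSubgroup ((Fin n → H) → A) :=
  nullFun (Measure.pi fun _ : Fin n => μ) A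

noncomputable def groupCocycles (n : ℕ) : AddSubgroup ((Fin n → H) → A) :=
  cocycles (measFun (Fin n → H) A) (groupNull H A μ (n + 1)) (groupD H A n)

noncomputable def groupCoboundaries : (n : ℕ) → AddSubgroup ((Fin n → H) → A)
  | 0 => groupNull H A μ 0
  | n + 1 => coboundaries (measFun (Fin n → H) A) (groupNull H A μ (n + 1)) (groupD H A n)

/-- The measurable cohomology `Hⁿ(H, A)`: the cohomology of the complex `(L(Hⁿ, A))ₙ`, where `μ`
is a Haar measure of `H`. -/
abbrev GroupCohomology (n : ℕ) : Type _ :=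
  Cohomology (groupCocycles H A μ n) (groupCoboundaries H A μ n)

end GroupCohomology

/-! ### Matched pairs and the spaces `Γ_{pq}` -/

section MatchedPair

variable {G : Type*} [Group G]

/-- `G₁, G₂ ⊆ G` is a matched pair, where `μ` is a Haar measure of `G`. -/
structure IsMatchedPair [TopologicalSpace G] [MeasurableSpace G] (G₁ G₂ : Subgroup G)
    (μ : Measure G) : Prop where
  isClosed_left : IsClosed (G₁ : Set G)
  isClosed_right : IsClosed (G₂ : Set G)
  inf_eq_bot : G₁ ⊓ G₂ = ⊥
  measure_compl : μ {x | ¬ ∃ g ∈ G₁, ∃ s ∈ G₂, x = g * s} = 0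

variable (G₁ G₂ : Subgroup G)

/-- The space `Γ_{pq}` of `p × q` grids with vertical edges labelled by `G₁`, horizontal edges
labelled by `G₂`, in which every small square commutes.  For `X ∈ Γ_{pq}`, the label `X.1.1 i j` is
the vertical edge `g_{i+1,j}` (row `i + 1`, column line `j`), and `X.1.2 i j` is the horizontal edge
`s_{i,j+1}`. -/
def Grid (p q : ℕ) : Set ((Fin p → Fin (q + 1) → G₁) × (Fin (p + 1) → Fin q → G₂)) :=
  {X | ∀ (i : Fin p) (j : Fin q),
    (X.2 i.castSucc j : G) * (X.1 i j.succ : G) = (X.1 i j.castSucc : G) * (X.2 i.succ j : G)}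

variable {G₁ G₂}

theorem coe_face {K : Subgroup G} {n : ℕ} (k : Fin (n + 2)) (x : Fin (n + 1) → K) (j : Fin n) :
    ((face k x j : K) : G) = face k (fun i => (x i : G)) j := by
  refine Fin.cases ?_ (fun m => ?_) k
  · simp [face]
  · simp only [face, Fin.cases_succ]
    unfold Fin.contractNth
    split_ifs <;> simp

theorem face_comm {n : ℕ} (x y : Fin (n + 1) → G) (c : Fin (n + 2) → G)
    (h : ∀ j, x j * c j.succ = c j.castSucc * y j) (k : Fin (n + 2)) (j : Fin n) :
    face k x j * c (k.succAbove j.succ) = c (k.succAbove j.castSucc) * face k y j := by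
  refine Fin.cases ?_ (fun m => ?_) k
  · simpa [face, Fin.succAbove_zero] using h j.succ
  · simp only [face, Fin.cases_succ]
    rcases lt_trichotomy (j : ℕ) m with hj | hj | hj
    · rw [Fin.contractNth_apply_of_lt _ _ _ _ hj, Fin.contractNth_apply_of_lt _ _ _ _ hj,
        Fin.succAbove_of_castSucc_lt, Fin.succAbove_of_castSucc_lt]
      · exact h j.castSucc
      · simp only [Fin.lt_def, Fin.val_castSucc, Fin.val_succ]; omega
      · simp only [Fin.lt_def, Fin.val_castSucc, Fin.val_succ]; omega
    · rw [Fin.contractNth_apply_of_eq _ _ _ _ hj, Fin.contractNth_apply_of_eq _ _ _ _ hj,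
        Fin.succAbove_of_le_castSucc, Fin.succAbove_of_castSucc_lt]
      · rw [mul_assoc, h j.succ, ← mul_assoc, ← mul_assoc]
        congr 1
        exact h j.castSucc
      · simp only [Fin.lt_def, Fin.val_castSucc, Fin.val_succ]; omega
      · simp only [Fin.le_def, Fin.val_castSucc, Fin.val_succ]; omega
    · rw [Fin.contractNth_apply_of_gt _ _ _ _ hj, Fin.contractNth_apply_of_gt _ _ _ _ hj,
        Fin.succAbove_of_le_castSucc, Fin.succAbove_of_le_castSucc]
      · exact h j.succ
      · simp only [Fin.le_def, Fin.val_castSucc, Fin.val_succ]; omega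
      · simp only [Fin.le_def, Fin.val_castSucc, Fin.val_succ]; omega

/-- The horizontal face `∂ʰₖ`: it removes the column line number `k`, multiplying adjacent
horizontal edges. -/
def hFace {p q : ℕ} (k : Fin (q + 2)) (X : Grid G₁ G₂ p (q + 1)) : Grid G₁ G₂ p q :=
  ⟨(fun i j => X.1.1 i (k.succAbove j), fun i => face k (X.1.2 i)), by
    intro i j
    simp only [coe_face]
    exact face_comm _ _ (fun j => (X.1.1 i j : G)) (fun j => X.2 i j) k j⟩

/-- The vertical face `∂ᵛₖ`: it removes the row line number `k`, multiplying adjacent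
vertical edges. -/
def vFace {p q : ℕ} (k : Fin (p + 2)) (X : Grid G₁ G₂ (p + 1) q) : Grid G₁ G₂ p q :=
  ⟨(fun i j => face k (fun i' => X.1.1 i' j) i, fun i j => X.1.2 (k.succAbove i) j), by
    intro i j
    simp only [coe_face]
    exact (face_comm (fun i' => (X.1.1 i' j.castSucc : G)) (fun i' => (X.1.1 i' j.succ : G))
      (fun i' => (X.1.2 i' j : G)) (fun i' => (X.2 i' j).symm) k i).symm⟩

/-- The first column and the first row of a grid. -/
def colRow {p q : ℕ} (X : Grid G₁ G₂ p q) : (Fin p → G₁) × (Fin q → G₂) :=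
  (fun i => X.1.1 i 0, fun j => X.1.2 0 j)

/-- A measure on `Γ_{pq}` in its natural measure class, pulled back from the product
`G₁ᵖ × G₂ᵠ` along the map that picks out the first column and the first row (which is injective
with conull range for a matched pair). -/
noncomputable def gridMeasure [MeasurableSpace G] (μ₁ : Measure G₁) (μ₂ : Measure G₂) (p q : ℕ) :
    Measure (Grid G₁ G₂ p q) :=
  Measure.comap colRow
    ((Measure.pi fun _ : Fin p => μ₁).prod (Measure.pi fun _ : Fin q => μ₂))

end MatchedPair

/-! ### The bicomplex, its total complex and the Kac cohomology -/

section KacCohomology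

variable {G : Type*} [Group G] (G₁ G₂ : Subgroup G)
  (A : Type*) [AddCommGroup A] [DistribMulAction G A]

/-- The horizontal coboundary
`(dʰ F)(X) = s₀₁ • F(∂ʰ₀ X) + ∑_{1 ≤ k ≤ q + 1} (-1)ᵏ F(∂ʰₖ X)`. -/
def dh (p q : ℕ) : (Grid G₁ G₂ p q → A) →+ (Grid G₁ G₂ p (q + 1) → A) where
  toFun F X := (X.1.2 0 0 : G) • F (hFace 0 X) +
    ∑ k : Fin (q + 1), (-1 : ℤ) ^ ((k : ℕ) + 1) • F (hFace k.succ X)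
  map_zero' := by ext; simp
  map_add' f f' := by
    ext
    simp only [Pi.add_apply, smul_add, Finset.sum_add_distrib]
    abel

/-- The vertical coboundary
`(dᵛ F)(X) = g₁₀ • F(∂ᵛ₀ X) + ∑_{1 ≤ k ≤ p + 1} (-1)ᵏ F(∂ᵛₖ X)`. -/
def dv (p q : ℕ) : (Grid G₁ G₂ p q → A) →+ (Grid G₁ G₂ (p + 1) q → A) where
  toFun F X := (X.1.1 0 0 : G) • F (vFace 0 X) +
    ∑ k : Fin (p + 1), (-1 : ℤ) ^ ((k : ℕ) + 1) • F (vFace k.succ X)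
  map_zero' := by ext; simp
  map_add' f f' := by
    ext
    simp only [Pi.add_apply, smul_add, Finset.sum_add_distrib]
    abel

/-- Families `F = (F_{pq})` of functions `F_{pq} : Γ_{pq} → A`, in all bidegrees `p, q ≥ 0`. -/
abbrev Bicochain : Type _ := ∀ p q : ℕ, Grid G₁ G₂ p q → A

variable {G₁ G₂ A} in
/-- The components of `d F`, where `d = dʰ + (-1)^q dᵛ` on functions on `Γ_{pq}`. -/
def totalDFun (F : Bicochain G₁ G₂ A) : Bicochain G₁ G₂ A
  | 0, 0 => 0
  | 0, q + 1 => dh G₁ G₂ A 0 q (F 0 q)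
  | p + 1, 0 => dv G₁ G₂ A p 0 (F p 0)
  | p + 1, q + 1 => dh G₁ G₂ A (p + 1) q (F (p + 1) q) +
      (-1 : ℤ) ^ (q + 1) • dv G₁ G₂ A p (q + 1) (F p (q + 1))

/-- The coboundary of the total complex. -/
def totalD : Bicochain G₁ G₂ A →+ Bicochain G₁ G₂ A where
  toFun := totalDFun
  map_zero' := by
    funext p q
    rcases p with _ | p <;> rcases q with _ | q <;> simp [totalDFun]
  map_add' F F' := by
    funext p q
    rcases p with _ | p <;> rcases q with _ | q <;> simp [totalDFun]
    abel

/-- The restriction of `F_{n0}` to the grids in `Γ_{n0} = G₁ⁿ`. -/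
def toLeft (n : ℕ) : Bicochain G₁ G₂ A →+ ((Fin n → G₁) → A) where
  toFun F g := F n 0 ⟨(fun i _ => g i, fun _ j => j.elim0), fun _ j => j.elim0⟩
  map_zero' := rfl
  map_add' _ _ := rfl

/-- The restriction of `F_{0n}` to the grids in `Γ_{0n} = G₂ⁿ`. -/
def toRight (n : ℕ) : Bicochain G₁ G₂ A →+ ((Fin n → G₂) → A) where
  toFun F s := F 0 n ⟨(fun i _ => i.elim0, fun _ j => s j), fun i _ => i.elim0⟩
  map_zero' := rfl
  map_add' _ _ := rfl

section Measurability

variable [MeasurableSpace G] [MeasurableSpace A] [MeasurableAdd₂ A] [MeasurableNeg A]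

/-- The measurable cochains of total degree `n`, representing the elements of
`Dⁿ(A) = ⨁_{p + q = n} L(Γ_{pq}, A)`. -/
def totalMeas (n : ℕ) : AddSubgroup (Bicochain G₁ G₂ A) where
  carrier := {F | ∀ p q, Measurable (F p q) ∧ (p + q ≠ n → F p q = 0)}
  add_mem' hF hF' p q :=
    ⟨(hF p q).1.add (hF' p q).1, fun h => by simp [(hF p q).2 h, (hF' p q).2 h]⟩
  zero_mem' _ _ := ⟨measurable_const, fun _ => rfl⟩
  neg_mem' hF p q := ⟨(hF p q).1.neg, fun h => by simp [(hF p q).2 h]⟩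

variable (μ₁ : Measure G₁) (μ₂ : Measure G₂)

/-- The bicochains all of whose components vanish almost everywhere. -/
noncomputable def totalNull : AddSubgroup (Bicochain G₁ G₂ A) where
  carrier := {F | ∀ p q, F p q ∈ nullFun (gridMeasure μ₁ μ₂ p q) A}
  add_mem' hF hF' p q := add_mem (hF p q) (hF' p q)
  zero_mem' _ _ := zero_mem _
  neg_mem' hF p q := neg_mem (hF p q)

noncomputable def totalCocycles (n : ℕ) : AddSubgroup (Bicochain G₁ G₂ A) :=
  cocycles (totalMeas G₁ G₂ A n) (totalNull G₁ G₂ A μ₁ μ₂) (totalD G₁ G₂ A)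

noncomputable def totalCoboundaries : (n : ℕ) → AddSubgroup (Bicochain G₁ G₂ A)
  | 0 => totalNull G₁ G₂ A μ₁ μ₂
  | n + 1 => coboundaries (totalMeas G₁ G₂ A n) (totalNull G₁ G₂ A μ₁ μ₂) (totalD G₁ G₂ A)

/-- The cohomology `Hⁿ(D(A))` of the total complex `D(A)` of the bicomplex
`(L(Γ_{pq}, A))_{p, q ≥ 0}`. -/
abbrev TotalCohomology (n : ℕ) : Type _ :=
  Cohomology (totalCocycles G₁ G₂ A μ₁ μ₂ n) (totalCoboundaries G₁ G₂ A μ₁ μ₂ n)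

/-- The ambient group of the cochains `Mⁿ(A) = Dⁿ⁺¹(A) ⊕ L(G₁ⁿ, A) ⊕ L(G₂ⁿ, A)` of the mapping
cone of the restriction map `J : Dⁿ(A) → L(G₁ⁿ, A) ⊕ L(G₂ⁿ, A)`. -/
abbrev ConeCochain (n : ℕ) : Type _ :=
  Bicochain G₁ G₂ A × ((Fin n → G₁) → A) × ((Fin n → G₂) → A)

/-- The first coboundary `M⁻¹(A) = D⁰(A) → M⁰(A)` of the mapping cone, `F ↦ (d F, J F)`. -/
def coneDStart : Bicochain G₁ G₂ A →+ ConeCochain G₁ G₂ A 0 :=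
  (totalD G₁ G₂ A).prod ((toLeft G₁ G₂ A 0).prod (toRight G₁ G₂ A 0))

/-- The coboundary `Mⁿ(A) → Mⁿ⁺¹(A)` of the mapping cone, `(F, K) ↦ (d F, -d K + J F)`. -/
def coneD (n : ℕ) : ConeCochain G₁ G₂ A n →+ ConeCochain G₁ G₂ A (n + 1) where
  toFun c := (totalD G₁ G₂ A c.1,
    -groupD G₁ A n c.2.1 + toLeft G₁ G₂ A (n + 1) c.1,
    -groupD G₂ A n c.2.2 + toRight G₁ G₂ A (n + 1) c.1)
  map_zero' := by simp
  map_add' c c' := by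
    simp only [Prod.fst_add, Prod.snd_add, map_add, Prod.mk_add_mk, Prod.mk.injEq, true_and]
    constructor <;> abel

def coneMeas (n : ℕ) : AddSubgroup (ConeCochain G₁ G₂ A n) :=
  (totalMeas G₁ G₂ A (n + 1)).prod ((measFun (Fin n → G₁) A).prod (measFun (Fin n → G₂) A))

noncomputable def coneNull (n : ℕ) : AddSubgroup (ConeCochain G₁ G₂ A n) :=
  (totalNull G₁ G₂ A μ₁ μ₂).prod ((groupNull G₁ A μ₁ n).prod (groupNull G₂ A μ₂ n))

noncomputable def kacCocycles (n : ℕ) : AddSubgroup (ConeCochain G₁ G₂ A n) :=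
  cocycles (coneMeas G₁ G₂ A n) (coneNull G₁ G₂ A μ₁ μ₂ (n + 1)) (coneD G₁ G₂ A n)

noncomputable def kacCoboundaries : (n : ℕ) → AddSubgroup (ConeCochain G₁ G₂ A n)
  | 0 => coboundaries (totalMeas G₁ G₂ A 0) (coneNull G₁ G₂ A μ₁ μ₂ 0) (coneDStart G₁ G₂ A)
  | n + 1 =>
    coboundaries (coneMeas G₁ G₂ A n) (coneNull G₁ G₂ A μ₁ μ₂ (n + 1)) (coneD G₁ G₂ A n)

/-- The Kac cohomology `Hⁿ(m.p., A)` of the matched pair `G₁, G₂ ⊆ G`: the cohomology of the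
mapping cone of `J`. -/
abbrev KacCohomology (n : ℕ) : Type _ :=
  Cohomology (kacCocycles G₁ G₂ A μ₁ μ₂ n) (kacCoboundaries G₁ G₂ A μ₁ μ₂ n)

end Measurability

end KacCohomology

/-! ### From Borel cochains on `G` to bicochains -/

section PathSum

variable {G : Type*} [Group G] {G₁ G₂ : Subgroup G} {A : Type*} [AddCommGroup A]

/-- The sum, over the monotone lattice paths in `X ∈ Γ_{pq}` from the top left corner to the bottom
right corner, of `(-1)` to the number of small squares above the path, times the value of `F` on
the list of the `p + q` edge labels along the path.  (If a path starts to the right, then no square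
of the first column lies above it; if it starts downwards, then all `q` squares of the first row
lie above it.) -/
def pathSum : (p q : ℕ) → (List G → A) → Grid G₁ G₂ p q → A
  | 0, 0, F, _ => F []
  | 0, q + 1, F, X => pathSum 0 q (fun l => F ((X.1.2 0 0 : G) :: l)) (hFace 0 X)
  | p + 1, 0, F, X => pathSum p 0 (fun l => F ((X.1.1 0 0 : G) :: l)) (vFace 0 X)
  | p + 1, q + 1, F, X =>
    pathSum (p + 1) q (fun l => F ((X.1.2 0 0 : G) :: l)) (hFace 0 X) +
      (-1 : ℤ) ^ (q + 1) • pathSum p (q + 1) (fun l => F ((X.1.1 0 0 : G) :: l)) (vFace 0 X)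
  termination_by p q => p + q

/-- The map `I` that sends a function `f : Gⁿ → A` to the bicochain of total degree `n` given by
the signed sums of `f` over paths. -/
def pathCochain (G₁ G₂ : Subgroup G) (n : ℕ) (f : (Fin n → G) → A) : Bicochain G₁ G₂ A :=
  fun p q X => if p + q = n then pathSum p q (fun l => f fun i => l.getD i 1) X else 0

end PathSum

/-! ### The group of extensions of a matched pair -/

section Extensions

variable {G : Type*} [Group G] (G₁ G₂ : Subgroup G)

open Classical in
/-- The factorization `x = p₁(x) p₂(x)` with `p₁(x) ∈ G₁` and `p₂(x) ∈ G₂`, for `x ∈ G₁G₂`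
(and a dummy value outside the conull set `G₁G₂`). -/
noncomputable def factor (x : G) : G₁ × G₂ :=
  if h : ∃ y : G₁ × G₂, x = y.1 * y.2 then h.choose else 1

noncomputable def p₁ (x : G) : G₁ := (factor G₁ G₂ x).1

noncomputable def p₂ (x : G) : G₂ := (factor G₁ G₂ x).2

/-- Pairs `(U, V)` of functions `U : G₂ × G₁ × G₁ → ℝ/ℤ` and `V : G₂ × G₂ × G₁ → ℝ/ℤ`. -/
abbrev ExtCochain : Type _ := (G₂ × G₁ × G₁ → UnitAddCircle) × (G₂ × G₂ × G₁ → UnitAddCircle)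

/-- The trivial pair `(U_R, V_R)` defined by `R : G₂ × G₁ → ℝ/ℤ`. -/
noncomputable def extTrivial : (G₂ × G₁ → UnitAddCircle) →+ ExtCochain G₁ G₂ where
  toFun R :=
    (fun (s, g, h) => -R (p₂ G₁ G₂ (s * g), h) + R (s, g * h) - R (s, g),
     fun (s, t, g) => R (t, g) - R (s * t, g) + R (s, p₁ G₁ G₂ (t * g)))
  map_zero' := by ext <;> simp
  map_add' R R' := by ext <;> simp <;> abel

/-- The left hand sides, written additively, of the three relations that define the compatible
pairs of 2-cocycles; they are functions of `(s, g, h, k)`, `(s, t, r, g)` and `(s, t, g, h)`. -/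
noncomputable def extRelations : ExtCochain G₁ G₂ →+
    (G₂ × G₁ × G₁ × G₁ → UnitAddCircle) × (G₂ × G₂ × G₂ × G₁ → UnitAddCircle) ×
      (G₂ × G₂ × G₁ × G₁ → UnitAddCircle) where
  toFun c :=
    (fun (s, g, h, k) =>
      c.1 (p₂ G₁ G₂ (s * g), h, k) - c.1 (s, g * h, k) + c.1 (s, g, h * k) - c.1 (s, g, h),
     fun (s, t, r, g) =>
      c.2 (t, r, g) - c.2 (s * t, r, g) + c.2 (s, t * r, g) - c.2 (s, t, p₁ G₁ G₂ (r * g)),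
     fun (s, t, g, h) =>
      c.1 (t, g, h) - c.1 (s * t, g, h)
        + c.1 (s, p₁ G₁ G₂ (t * g), p₁ G₁ G₂ (p₂ G₁ G₂ (t * g) * h))
        + c.2 (p₂ G₁ G₂ (s * p₁ G₁ G₂ (t * g)), p₂ G₁ G₂ (t * g), h)
        - c.2 (s, t, g * h) + c.2 (s, t, g))
  map_zero' := by ext <;> simp
  map_add' c c' := by ext <;> simp <;> abel

variable [MeasurableSpace G] (μ₁ : Measure G₁) (μ₂ : Measure G₂)

/-- The compatible pairs of 2-cocycles: pairs of measurable functions that satisfy the three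
relations almost everywhere. -/
noncomputable def extCocycles : AddSubgroup (ExtCochain G₁ G₂) :=
  cocycles ((measFun _ _).prod (measFun _ _))
    ((nullFun (μ₂.prod (μ₁.prod (μ₁.prod μ₁))) _).prod
      ((nullFun (μ₂.prod (μ₂.prod (μ₂.prod μ₁))) _).prod
        (nullFun (μ₂.prod (μ₂.prod (μ₁.prod μ₁))) _)))
    (extRelations G₁ G₂)

/-- The pairs that agree almost everywhere with a trivial pair `(U_R, V_R)`, `R` measurable. -/
noncomputable def extCoboundaries : AddSubgroup (ExtCochain G₁ G₂) :=
  coboundaries (measFun _ _)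
    ((nullFun (μ₂.prod (μ₁.prod μ₁)) _).prod (nullFun (μ₂.prod (μ₂.prod μ₁)) _))
    (extTrivial G₁ G₂)

/-- The group of extensions of the matched pair. -/
abbrev ExtensionGroup : Type _ :=
  Cohomology (extCocycles G₁ G₂ μ₁ μ₂) (extCoboundaries G₁ G₂ μ₁ μ₂)

variable {G₁ G₂} in
/-- The bicochain defined by a pair `(U, V)`: on `Γ₂₁` it is `U` of the top edge and the two edges
of the right column; on `Γ₁₂` it is `V` of the two edges of the top row and the right edge. -/
def extBicochain (c : ExtCochain G₁ G₂) : Bicochain G₁ G₂ UnitAddCircle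
  | 2, 1 => fun X => c.1 (X.1.2 0 0, X.1.1 0 1, X.1.1 1 1)
  | 1, 2 => fun X => c.2 (X.1.2 0 0, X.1.2 0 1, X.1.1 0 2)
  | _, _ => 0

/-- The trivial action of a group on an abelian group. -/
abbrev trivialAction (G A : Type*) [Group G] [AddCommGroup A] : DistribMulAction G A where
  smul _ a := a
  one_smul _ := rfl
  mul_smul _ _ _ := rfl
  smul_zero _ := rfl
  smul_add _ _ _ := rfl

end Extensions

end Kac

set_option linter.unusedSectionVars false

/-! The core is the isomorphism between the measurable cohomology of G and the cohomology of the
total complex D(A). Once it is known, the exact sequence is the long exact sequence of a mapping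
cone.

The vertices of a grid that lie on one row line belong to one coset yG₂, those on one column line to
one coset zG₁. Because G₁ ∩ G₂ is trivial, two such cosets meet in at most one point, and they do
meet for almost all (y, z) because G₁G₂ is conull (`vert_eq`, `ae_good`). Up to null sets a p × q
grid is therefore a configuration of p + 1 points of G/G₂ and q + 1 points of G/G₁ modulo left
translation, and a function on Γ_{pq} is an equivariant function of such points. Likewise a function
on Gⁿ is an equivariant function of n + 1 points of G. Both complexes sit on the boundary of one
triple complex of equivariant functions φ(a, b, c) of three lists, in G, G/G₂ and G/G₁, where empty
lists are allowed and each differential is the alternating sum over omitted entries (`triD`).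
Bicochains live where a is empty, group cochains where b and c are empty. The cochains are honest
measurable functions, equivariant everywhere; only identities between them are taken almost
everywhere.

Inserting an extra point in front of one of the lists contracts that direction, provided that the
point depends equivariantly on the other lists. For b or c this point is a₀w; for a it is vw, with v
the common vertex of the cosets of b₀ and c₀. Fubini supplies a w for which the contraction identity
holds almost everywhere (`exists_contraction`), and an induction over the length of the contracted
list (`exists_primitive`) gives three acyclic pieces: `exists_triD_primitive_of_supB_supC`,
`exists_triD_primitive_of_supA_supC`, `exists_triD_primitive_of_supA_supNoB`.

A function f on Gⁿ and a bicochain F are `Comparable` if some τ, supported where b and c are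
nonempty, restricts to F on empty a and has total coboundary (-1)ⁿ d₂d₃f. Acyclicity in direction a
yields F from f (`exists_comparable_right`); acyclicity in directions b and c yields f from F by a
zigzag (`exists_comparable_left`). The same arguments match coboundaries, so this relation induces
the isomorphism (`exists_cohomology_addEquiv`). For a strict cocycle f the signed sum over lattice
paths is an explicit τ (`comparable_pathCochain`): omitting a corner of a path gives terms that
cancel in pairs (`pathList_listD`).

Null sets on G, on G₁ × G₂ and on grids are compared by `ae_mul_iff`, `ae_vertices_iff` and
`ae_colRow_iff`. They rest on Fubini and on the fact that translations preserve Haar null sets.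

For the group of extensions, a cone cocycle of degree 2 is changed by a coboundary so that its
components along G₁ and G₂ disappear. What remains are functions on Γ₂₁ and Γ₁₂, and in the
coordinates given by the top row and the right column the cocycle equations become the three
relations for (U, V). This needs those coordinates to define the same null sets as the left column
and the top row (`ae_rowCol_iff`). -/

namespace Kac

/-! ### The simplicial coboundary on functions of lists -/

section ListCoboundary

variable {α β A B : Type*} [AddCommGroup A] [AddCommGroup B]

/-- The alternating sum `∑ₖ (-1)ᵏ φ(l without its k-th entry)`. -/
def listD : List α → (List α → A) →+ A
  | [] => 0
  | v :: l =>
    { toFun := fun φ => φ l - listD l fun l' => φ (v :: l')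
      map_zero' := by
        have : (fun l' : List α => (0 : List α → A) (v :: l')) = 0 := rfl
        rw [this]; simp
      map_add' := fun φ ψ => by
        have : (fun l' : List α => (φ + ψ) (v :: l')) =
          (fun l' => φ (v :: l')) + fun l' => ψ (v :: l') := rfl
        rw [this, map_add, Pi.add_apply]; abel }

@[simp] theorem listD_nil (φ : List α → A) : listD [] φ = 0 := rfl

theorem listD_cons (v : α) (l : List α) (φ : List α → A) :
    listD (v :: l) φ = φ l - listD l fun l' => φ (v :: l') := rfl

theorem listD_zero' (l : List α) : listD l (fun _ => (0 : A)) = 0 := map_zero (listD l)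

theorem listD_add' (l : List α) (φ ψ : List α → A) :
    listD l (fun l' => φ l' + ψ l') = listD l φ + listD l ψ := map_add (listD l) φ ψ

theorem listD_sub' (l : List α) (φ ψ : List α → A) :
    listD l (fun l' => φ l' - ψ l') = listD l φ - listD l ψ := map_sub (listD l) φ ψ

theorem listD_map (ψ : A →+ B) (l : List α) (φ : List α → A) :
    listD l (fun l' => ψ (φ l')) = ψ (listD l φ) := by
  induction l generalizing φ with
  | nil => simp
  | cons v l ih => simp [listD_cons, ih fun l' => φ (v :: l')]

theorem listD_zsmul' (l : List α) (n : ℤ) (φ : List α → A) :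
    listD l (fun l' => n • φ l') = n • listD l φ :=
  listD_map (zsmulAddGroupHom n) l φ

/-- Each differential is an additive map applied to values of the other, and `listD` commutes with
additive maps. -/
theorem listD_comm (l : List α) (m : List β) (φ : List α → List β → A) :
    listD l (fun l' => listD m (φ l')) = listD m fun m' => listD l fun l' => φ l' m' := by
  rw [listD_map (listD m) l φ]
  congr 1
  funext m'
  exact (listD_map (Pi.evalAddMonoidHom (fun _ => A) m') l φ).symm

/-- Omitting the head first or second gives the same terms with opposite signs; the terms that keep
the head vanish by induction. -/
theorem listD_listD (l : List α) (φ : List α → A) :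
    listD l (fun l' => listD l' φ) = 0 := by
  induction l generalizing φ with
  | nil => simp
  | cons v l ih =>
    simp only [listD_cons]
    rw [listD_sub', ih, sub_zero, sub_self]

theorem listD_congr {l : List α} {φ ψ : List α → A}
    (h : ∀ l', l'.length + 1 = l.length → φ l' = ψ l') : listD l φ = listD l ψ := by
  induction l generalizing φ ψ with
  | nil => simp
  | cons v l ih =>
    rw [listD_cons, listD_cons, h l (by simp), ih fun l' hl' => h _ (by simp [hl'])]

/-- The differential evaluates on lists shorter by one, so it anticommutes with the sign of the
length. All sign rules of the triple complex come from this. -/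
theorem listD_sign (l : List α) (φ : List α → A) :
    listD l (fun l' => (-1 : ℤ) ^ l'.length • φ l') = -((-1 : ℤ) ^ l.length • listD l φ) := by
  rw [← neg_smul, ← listD_zsmul']
  refine listD_congr fun l' hl' => ?_
  rw [← hl', pow_succ]; simp

/-- With `ψ` the action of a group element and `R` equality up to a translation or a coset, this
passes equivariance from a cochain to its coboundary. -/
theorem listD_rel {R : α → β → Prop} {φ : List α → A} {φ' : List β → A} (ψ : A →+ A)
    (h : ∀ l l', List.Forall₂ R l l' → φ l = ψ (φ' l')) {l : List α} {l' : List β}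
    (hl : List.Forall₂ R l l') : listD l φ = ψ (listD l' φ') := by
  induction hl generalizing φ φ' with
  | nil => simp
  | cons hv hl ih =>
    rw [listD_cons, listD_cons, map_sub, h _ _ hl,
      ih fun l l' hl' => h _ _ (List.Forall₂.cons hv hl')]

theorem listD_ofFn {n : ℕ} (x : Fin (n + 1) → α) (φ : List α → A) :
    listD (List.ofFn x) φ =
      ∑ k : Fin (n + 1), (-1 : ℤ) ^ (k : ℕ) • φ (List.ofFn fun i => x (k.succAbove i)) := by
  induction n generalizing φ with
  | zero => simp [listD_cons]
  | succ n ih =>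
    rw [List.ofFn_succ, listD_cons, ih]
    conv_rhs => rw [Fin.sum_univ_succ]
    simp only [Fin.val_zero, pow_zero, one_smul, Fin.zero_succAbove, Fin.val_succ, sub_eq_add_neg]
    congr 1
    rw [← Finset.sum_neg_distrib]
    refine Finset.sum_congr rfl fun k _ => ?_
    rw [pow_succ, mul_neg_one, neg_smul, List.ofFn_succ]
    simp

/-- A Leibniz rule. It turns the cocycle identity on a concatenated list into a trade between
omissions in the two halves. -/
theorem listD_append (a l : List α) (φ : List α → A) :
    listD (a ++ l) φ = listD a (fun a' => φ (a' ++ l)) +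
      (-1 : ℤ) ^ a.length • listD l fun l' => φ (a ++ l') := by
  induction a generalizing φ with
  | nil => simp
  | cons v a ih =>
    simp only [List.cons_append, listD_cons, ih, List.length_cons, pow_succ]
    simp only [mul_neg, mul_one, neg_smul]
    abel

end ListCoboundary

/-! ### The triple complex -/

section TripleComplex

variable {G A : Type*} [AddCommGroup A]

variable (G A) in
/-- Homogeneous cochains in a list of points of `G` and lists of representatives of points of
`G/G₂` and `G/G₁`. -/
abbrev TriCochain : Type _ := List G → List G → List G → A

/-- Empty lists are admitted as arguments, so every direction includes its augmentation: on a list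
of length one the differential returns the value on the empty list. -/
def d₁ : TriCochain G A →+ TriCochain G A where
  toFun φ a b c := listD a fun a' => φ a' b c
  map_zero' := by ext; exact listD_zero' _
  map_add' _ _ := by ext; exact listD_add' _ _ _

def d₂ : TriCochain G A →+ TriCochain G A where
  toFun φ a b c := listD b fun b' => φ a b' c
  map_zero' := by ext; exact listD_zero' _
  map_add' _ _ := by ext; exact listD_add' _ _ _

def d₃ : TriCochain G A →+ TriCochain G A where
  toFun φ a b c := listD c fun c' => φ a b c'
  map_zero' := by ext; exact listD_zero' _
  map_add' _ _ := by ext; exact listD_add' _ _ _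

theorem d₁_apply (φ : TriCochain G A) (a b c) : d₁ φ a b c = listD a fun a' => φ a' b c := rfl
theorem d₂_apply (φ : TriCochain G A) (a b c) : d₂ φ a b c = listD b fun b' => φ a b' c := rfl
theorem d₃_apply (φ : TriCochain G A) (a b c) : d₃ φ a b c = listD c fun c' => φ a b c' := rfl

/-- The total coboundary; the coefficient `ε` switches the second direction on and off. -/
def triD (ε : ℤ) : TriCochain G A →+ TriCochain G A where
  toFun φ a b c := d₃ φ a b c + (ε * (-1) ^ (c.length + 1)) • d₂ φ a b c +
    ((-1 : ℤ) ^ (b.length + c.length)) • d₁ φ a b c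
  map_zero' := by ext; simp
  map_add' φ ψ := by
    ext
    simp only [map_add, Pi.add_apply, smul_add]
    abel

theorem triD_apply (ε : ℤ) (φ : TriCochain G A) (a b c : List G) :
    triD ε φ a b c = d₃ φ a b c + (ε * (-1) ^ (c.length + 1)) • d₂ φ a b c +
      ((-1 : ℤ) ^ (b.length + c.length)) • d₁ φ a b c := rfl

/-- The three differentials commute and have square zero. A sign depending on a length changes when
that list is shortened, so the two occurrences of each mixed term cancel. -/
theorem triD_triD (ε : ℤ) (φ : TriCochain G A) : triD ε (triD ε φ) = 0 := by
  funext a b c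
  have e3 : d₃ (triD ε φ) a b c = -((ε * (-1) ^ (c.length + 1)) • d₃ (d₂ φ) a b c) -
      (-1 : ℤ) ^ (b.length + c.length) • d₃ (d₁ φ) a b c := by
    rw [d₃_apply]
    simp only [triD_apply]
    rw [listD_add', listD_add']
    have h1 : listD c (fun c' => d₃ φ a b c') = 0 := listD_listD c _
    have h2 : listD c (fun c' => (ε * (-1) ^ (c'.length + 1)) • d₂ φ a b c') =
        -((ε * (-1) ^ (c.length + 1)) • d₃ (d₂ φ) a b c) := by
      have := listD_sign c (fun c' => (-ε) • d₂ φ a b c')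
      rw [listD_zsmul'] at this
      simp only [smul_smul] at this
      rw [d₃_apply, ← neg_smul, show -(ε * (-1) ^ (c.length + 1)) = -((-1) ^ c.length * -ε) by ring,
        neg_smul, ← this]
      congr 1; funext c'; congr 1; ring
    have h3 : listD c (fun c' => (-1 : ℤ) ^ (b.length + c'.length) • d₁ φ a b c') =
        -((-1 : ℤ) ^ (b.length + c.length) • d₃ (d₁ φ) a b c) := by
      have := listD_sign c (fun c' => (-1 : ℤ) ^ b.length • d₁ φ a b c')
      rw [listD_zsmul'] at this
      simp only [smul_smul, ← pow_add] at this
      rw [d₃_apply, add_comm b.length, ← this]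
      congr 1; funext c'; rw [add_comm]
    rw [h1, h2, h3]; abel
  have e2 : d₂ (triD ε φ) a b c = d₃ (d₂ φ) a b c -
      (-1 : ℤ) ^ (b.length + c.length) • d₂ (d₁ φ) a b c := by
    rw [d₂_apply]
    simp only [triD_apply]
    rw [listD_add', listD_add']
    have h1 : listD b (fun b' => d₃ φ a b' c) = d₃ (d₂ φ) a b c := listD_comm _ _ _
    have h2 : listD b (fun b' => (ε * (-1) ^ (c.length + 1)) • d₂ φ a b' c) = 0 := by
      rw [listD_zsmul']
      have : listD b (fun b' => d₂ φ a b' c) = 0 := listD_listD b _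
      rw [this, smul_zero]
    have h3 : listD b (fun b' => (-1 : ℤ) ^ (b'.length + c.length) • d₁ φ a b' c) =
        -((-1 : ℤ) ^ (b.length + c.length) • d₂ (d₁ φ) a b c) := by
      have := listD_sign b (fun b' => (-1 : ℤ) ^ c.length • d₁ φ a b' c)
      rw [listD_zsmul'] at this
      simp only [smul_smul, ← pow_add] at this
      exact this
    rw [h1, h2, h3]; abel
  have e1 : d₁ (triD ε φ) a b c = d₃ (d₁ φ) a b c +
      (ε * (-1) ^ (c.length + 1)) • d₂ (d₁ φ) a b c := by
    rw [d₁_apply]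
    simp only [triD_apply]
    rw [listD_add', listD_add', listD_zsmul', listD_zsmul']
    have h1 : listD a (fun a' => d₃ φ a' b c) = d₃ (d₁ φ) a b c := listD_comm _ _ _
    have h2 : listD a (fun a' => d₂ φ a' b c) = d₂ (d₁ φ) a b c := listD_comm _ _ _
    have h3 : listD a (fun a' => d₁ φ a' b c) = 0 := listD_listD a _
    rw [h1, h2, h3, smul_zero, add_zero]
  rw [triD_apply, e1, e2, e3]
  simp only [smul_sub, smul_add, smul_smul, Pi.zero_apply]
  rw [mul_comm ((-1 : ℤ) ^ (b.length + c.length)) (ε * _)]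
  abel

end TripleComplex

/-! ### Lists as a measure space -/

section ListMeasure

variable {α ρ β : Type*} [MeasurableSpace α] [MeasurableSpace ρ] [MeasurableSpace β]

/-- The disjoint union of the product measurable structures on `αⁿ`. -/
instance listMeasurableSpace : MeasurableSpace (List α) :=
  ⨅ n : ℕ, MeasurableSpace.map (List.ofFn (n := n)) inferInstance

theorem measurableSet_list {s : Set (List α)} :
    MeasurableSet s ↔ ∀ n : ℕ, MeasurableSet ((List.ofFn (n := n)) ⁻¹' s) := by
  unfold listMeasurableSpace
  simp only [MeasurableSpace.measurableSet_iInf]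
  rfl

theorem measurableEmbedding_ofFn (n : ℕ) :
    MeasurableEmbedding (List.ofFn : (Fin n → α) → List α) where
  injective := List.ofFn_injective
  measurable _ hs := measurableSet_list.1 hs n
  measurableSet_image' s hs := by
    refine measurableSet_list.2 fun m => ?_
    by_cases h : m = n
    · subst h
      rwa [Set.preimage_image_eq _ List.ofFn_injective]
    · convert! MeasurableSet.empty
      ext x
      simp only [Set.mem_preimage, Set.mem_image, Set.mem_empty_iff_false, iff_false]
      rintro ⟨y, -, hy⟩
      exact h (by simpa using (congrArg List.length hy).symm)

/-- The length cuts the product into countably many pieces, each a measurably embedded copy of a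
product with a finite power. -/
theorem measurable_list_prod {f : List α × ρ → β} :
    Measurable f ↔ ∀ n : ℕ, Measurable fun z : (Fin n → α) × ρ => f (List.ofFn z.1, z.2) := by
  have hE (n : ℕ) : MeasurableEmbedding
      (Prod.map List.ofFn id : (Fin n → α) × ρ → List α × ρ) :=
    (measurableEmbedding_ofFn n).prodMap MeasurableEmbedding.id
  refine ⟨fun h n => h.comp (hE n).measurable, fun h s hs => ?_⟩
  have : f ⁻¹' s = ⋃ n : ℕ, (Prod.map List.ofFn id : (Fin n → α) × ρ → List α × ρ) ''
      ((fun z => f (List.ofFn z.1, z.2)) ⁻¹' s) := by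
    ext ⟨l, r⟩
    simp only [Set.mem_preimage, Set.mem_iUnion, Set.mem_image, Prod.exists, Prod.map_apply, id_eq,
      Prod.mk.injEq]
    constructor
    · intro h
      exact ⟨l.length, l.get, r, by simpa using h, by simp, rfl⟩
    · rintro ⟨n, x, r', h, rfl, rfl⟩
      exact h
  rw [this]
  exact MeasurableSet.iUnion fun n => (hE n).measurableSet_image.2 (h n hs)

theorem measurable_list {f : List α → β} (h : ∀ n : ℕ, Measurable fun x : Fin n → α => f (List.ofFn x)) :
    Measurable f :=
  fun _ hs => measurableSet_list.2 fun n => h n hs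

theorem measurable_list_length : Measurable (List.length : List α → ℕ) :=
  measurable_list fun n => by simp

theorem measurable_list_cons : Measurable fun p : α × List α => p.1 :: p.2 := by
  have : Measurable fun p : List α × α => p.2 :: p.1 := by
    refine measurable_list_prod.2 fun n => ?_
    have h : (fun z : (Fin n → α) × α => z.2 :: List.ofFn z.1) =
        fun z => List.ofFn (Fin.cons z.2 z.1 : Fin (n + 1) → α) := by
      funext z; simp [List.ofFn_succ]
    simp only [h]
    refine (measurableEmbedding_ofFn _).measurable.comp (measurable_pi_lambda _ fun i => ?_)
    refine Fin.cases ?_ (fun j => ?_) i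
    · simpa using measurable_snd
    · simpa [Function.comp_def] using (measurable_pi_apply j).comp (measurable_fst (α := Fin n → α) (β := α))
  exact this.comp measurable_swap

theorem measurable_list_headD (d : α) : Measurable fun l : List α => l.headD d :=
  measurable_list fun n => by
    rcases n with _ | n
    · simp
    · simpa [List.ofFn_succ] using measurable_pi_apply 0

variable {A : Type*} [AddCommGroup A] [MeasurableSpace A] [MeasurableAdd₂ A] [MeasurableNeg A]

omit [MeasurableAdd₂ A] in
theorem measurable_sign_smul {f : β → A} (hf : Measurable f) (n : ℕ) :
    Measurable fun x => (-1 : ℤ) ^ n • f x := by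
  rcases neg_one_pow_eq_or ℤ n with h | h <;> simp only [h, one_smul, neg_smul]
  · exact hf
  · exact hf.neg

theorem measurable_listD {f : List α → ρ → A} (hf : Measurable fun z : List α × ρ => f z.1 z.2) :
    Measurable fun z : List α × ρ => listD z.1 fun l => f l z.2 := by
  refine measurable_list_prod.2 fun n => ?_
  rcases n with _ | n
  · simp
  · simp only [listD_ofFn]
    refine Finset.measurable_fun_sum _ fun k _ => measurable_sign_smul ?_ _
    refine hf.comp (Measurable.prodMk ((measurableEmbedding_ofFn n).measurable.comp ?_)
      measurable_snd)
    exact measurable_pi_lambda _ fun i => (measurable_pi_apply _).comp measurable_fst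

/-- The sum of the product measures on `αⁿ`. -/
noncomputable def listMeasure (μ : Measure α) : Measure (List α) :=
  Measure.sum fun n : ℕ => Measure.map List.ofFn (Measure.pi fun _ : Fin n => μ)

variable (μ : Measure α) [SigmaFinite μ] (ν : Measure ρ) [SFinite ν]

instance : SFinite (listMeasure μ) := by
  unfold listMeasure; infer_instance

theorem ae_listMeasure_prod {P : List α × ρ → Prop} :
    (∀ᵐ z ∂(listMeasure μ).prod ν, P z) ↔
      ∀ n : ℕ, ∀ᵐ z ∂(Measure.pi fun _ : Fin n => μ).prod ν, P (List.ofFn z.1, z.2) := by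
  unfold listMeasure
  rw [Measure.prod_sum_left, Measure.ae_sum_iff]
  refine forall_congr' fun n => ?_
  have hE : MeasurableEmbedding (Prod.map List.ofFn id : (Fin n → α) × ρ → List α × ρ) :=
    (measurableEmbedding_ofFn n).prodMap MeasurableEmbedding.id
  conv_lhs => rw [← Measure.map_id (μ := ν)]
  rw [Measure.map_prod_map _ _ (measurableEmbedding_ofFn n).measurable measurable_id,
    hE.ae_map_iff]
  rfl

theorem quasiMeasurePreserving_succAbove {n : ℕ} (k : Fin (n + 1)) :
    Measure.QuasiMeasurePreserving (fun x : Fin (n + 1) → α => fun i => x (k.succAbove i))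
      (Measure.pi fun _ => μ) (Measure.pi fun _ => μ) :=
  Measure.quasiMeasurePreserving_snd.comp
    (measurePreserving_piFinSuccAbove (fun _ => μ) k).quasiMeasurePreserving

theorem measurePreserving_finCons (n : ℕ) :
    MeasurePreserving (fun z : α × (Fin n → α) => (Fin.cons z.1 z.2 : Fin (n + 1) → α))
      (μ.prod (Measure.pi fun _ => μ)) (Measure.pi fun _ => μ) := by
  have := (measurePreserving_piFinSuccAbove (fun _ : Fin (n + 1) => μ) 0).symm
  simpa [MeasurableEquiv.piFinSuccAbove, Fin.insertNthEquiv] using this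

/-- Lets a statement about a generic nonempty list be read as one about a generic head and an
independent generic tail, to which Fubini applies. -/
theorem ae_listMeasure_cons {P : List α × ρ → Prop} (h : ∀ᵐ z ∂(listMeasure μ).prod ν, P z) :
    ∀ᵐ z ∂μ.prod ((listMeasure μ).prod ν), P (z.1 :: z.2.1, z.2.2) := by
  have key : ∀ᵐ z ∂(listMeasure μ).prod (μ.prod ν), P (z.2.1 :: z.1, z.2.2) := by
    refine (ae_listMeasure_prod μ _).2 fun n => ?_
    have h' := (ae_listMeasure_prod μ ν).1 h (n + 1)
    have q : Measure.QuasiMeasurePreserving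
        (fun z : (Fin n → α) × (α × ρ) => ((Fin.cons z.2.1 z.1 : Fin (n + 1) → α), z.2.2))
        ((Measure.pi fun _ => μ).prod (μ.prod ν)) ((Measure.pi fun _ => μ).prod ν) := by
      have q1 := QuasiMeasurePreserving.prodMap (measurePreserving_finCons μ n).quasiMeasurePreserving
        (Measure.QuasiMeasurePreserving.id ν)
      have q2 : MeasurePreserving (fun z : (Fin n → α) × (α × ρ) => ((z.2.1, z.1), z.2.2))
          ((Measure.pi fun _ => μ).prod (μ.prod ν))
          ((μ.prod (Measure.pi fun _ => μ)).prod ν) :=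
        (Measure.measurePreserving_swap.prod (MeasurePreserving.id ν)).comp
          ((measurePreserving_prodAssoc _ _ _).symm MeasurableEquiv.prodAssoc)
      exact q1.comp q2.quasiMeasurePreserving
    filter_upwards [q.ae h'] with z hz
    simpa [List.ofFn_succ] using hz
  have q : MeasurePreserving (fun z : α × (List α × ρ) => (z.2.1, (z.1, z.2.2)))
      (μ.prod ((listMeasure μ).prod ν)) ((listMeasure μ).prod (μ.prod ν)) :=
    (measurePreserving_prodAssoc _ _ _).comp
      ((Measure.measurePreserving_swap.prod (MeasurePreserving.id ν)).comp
        ((measurePreserving_prodAssoc _ _ _).symm MeasurableEquiv.prodAssoc))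
  exact q.quasiMeasurePreserving.ae key

omit [MeasurableSpace A] [MeasurableAdd₂ A] [MeasurableNeg A] in
-- Omitting one entry is a coordinate projection of powers, and projections pull null sets back to
-- null sets.
theorem ae_listD_eq_zero {f : List α → ρ → A} {n : ℕ}
    (h : ∀ᵐ z ∂(listMeasure μ).prod ν, z.1.length = n → f z.1 z.2 = 0) :
    ∀ᵐ z ∂(listMeasure μ).prod ν, z.1.length = n + 1 → listD z.1 (fun l => f l z.2) = 0 := by
  refine (ae_listMeasure_prod μ ν).2 fun m => ?_
  by_cases hm : m = n + 1
  · subst hm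
    have h' := (ae_listMeasure_prod μ ν).1 h n
    have q (k : Fin (n + 1)) :=
      (QuasiMeasurePreserving.prodMap (quasiMeasurePreserving_succAbove μ k)
        (Measure.QuasiMeasurePreserving.id ν)).ae h'
    filter_upwards [ae_all_iff.2 q] with z hz _
    rw [listD_ofFn]
    refine Finset.sum_eq_zero fun k _ => ?_
    have := hz k (by simp)
    simp only [Prod.map_fst, Prod.map_snd, id] at this
    rw [this, smul_zero]
  · filter_upwards with z hz
    exact absurd (by simpa using hz) hm

end ListMeasure

/-! ### Matched pairs: factorization and measure classes -/

section MatchedPairFacts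

instance {G : Type*} [Group G] [TopologicalSpace G] [SecondCountableTopology G] (K : Subgroup G) :
    SecondCountableTopology K :=
  inferInstanceAs (SecondCountableTopology (K : Set G))

variable {G : Type*} [Group G]

section Algebra

variable (G₁ G₂ : Subgroup G)

/-- The set `G₁G₂`. -/
def InProd (x : G) : Prop := ∃ y : G₁ × G₂, x = y.1 * y.2

/-- `yG₂` meets `zG₁`. -/
def Good (y z : G) : Prop := InProd G₁ G₂ (z⁻¹ * y)

/-- The point of `yG₂ ∩ zG₁`, for `Good y z`. -/
noncomputable def vert (y z : G) : G := z * p₁ G₁ G₂ (z⁻¹ * y)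

variable {G₁ G₂}

/-- Two factorizations differ by an element of G₁ ∩ G₂, so the arbitrary choice inside `factor` is
forced. -/
theorem factor_mul (h : G₁ ⊓ G₂ = ⊥) (g : G₁) (s : G₂) : factor G₁ G₂ ((g : G) * s) = (g, s) := by
  have hx : ∃ y : G₁ × G₂, (g : G) * s = y.1 * y.2 := ⟨(g, s), rfl⟩
  rw [factor, dif_pos hx]
  have hc := hx.choose_spec
  set y := hx.choose
  have e : (y.1 : G)⁻¹ * g = y.2 * (s : G)⁻¹ := by
    rw [inv_mul_eq_iff_eq_mul, ← mul_assoc, ← hc]; simp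
  have h1 : (y.1 : G)⁻¹ * g ∈ G₁ ⊓ G₂ :=
    ⟨G₁.mul_mem (G₁.inv_mem y.1.2) g.2, e ▸ G₂.mul_mem y.2.2 (G₂.inv_mem s.2)⟩
  rw [h, Subgroup.mem_bot] at h1
  rw [h1] at e
  refine Prod.ext (Subtype.ext ?_) (Subtype.ext ?_)
  · exact inv_mul_eq_one.1 h1
  · exact (mul_inv_eq_one.1 e.symm)

theorem p₁_mul (h : G₁ ⊓ G₂ = ⊥) (g : G₁) (s : G₂) : p₁ G₁ G₂ ((g : G) * s) = g := by
  rw [p₁, factor_mul h]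

theorem p₂_mul (h : G₁ ⊓ G₂ = ⊥) (g : G₁) (s : G₂) : p₂ G₁ G₂ ((g : G) * s) = s := by
  rw [p₂, factor_mul h]

theorem InProd.eq {x : G} (hx : InProd G₁ G₂ x) : x = p₁ G₁ G₂ x * p₂ G₁ G₂ x := by
  have hx' : ∃ y : G₁ × G₂, x = y.1 * y.2 := hx
  simp only [p₁, p₂, factor, dif_pos hx']
  exact hx'.choose_spec

/-- A common point x of yG₂ and zG₁ gives the factorization z⁻¹y = (z⁻¹x)(y⁻¹x)⁻¹, and
factorizations are unique. -/
theorem vert_eq (h : G₁ ⊓ G₂ = ⊥) {x y z : G} (hy : y⁻¹ * x ∈ G₂) (hz : z⁻¹ * x ∈ G₁) :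
    Good G₁ G₂ y z ∧ vert G₁ G₂ y z = x := by
  have e : z⁻¹ * y = ((⟨_, hz⟩ : G₁) : G) * ((⟨_, inv_mem hy⟩ : G₂) : G) := by
    simp [mul_assoc]
  refine ⟨⟨(⟨_, hz⟩, ⟨_, inv_mem hy⟩), e⟩, ?_⟩
  rw [vert, e, p₁_mul h]
  simp

theorem vert_mem_left {y z : G} (h : Good G₁ G₂ y z) : y⁻¹ * vert G₁ G₂ y z ∈ G₂ := by
  have e := InProd.eq h
  have e' : vert G₁ G₂ y z = y * (p₂ G₁ G₂ (z⁻¹ * y) : G)⁻¹ := by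
    rw [vert, eq_mul_inv_iff_mul_eq, mul_assoc, ← e]; simp
  rw [e']
  simp

/-- No genericity is needed here: `vert` is z times an element of G₁ by construction. Only the other
membership needs `Good`. -/
theorem vert_mem_right (y z : G) : z⁻¹ * vert G₁ G₂ y z ∈ G₁ := by
  simp [vert]

theorem vert_mul_left (h y z : G) : vert G₁ G₂ (h * y) (h * z) = h * vert G₁ G₂ y z := by
  simp [vert, mul_assoc]

theorem good_mul_left (h y z : G) : Good G₁ G₂ (h * y) (h * z) ↔ Good G₁ G₂ y z := by
  simp [Good, mul_assoc]

theorem vert_congr (h : G₁ ⊓ G₂ = ⊥) {y y' z z' : G} (hy : y⁻¹ * y' ∈ G₂) (hz : z⁻¹ * z' ∈ G₁)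
    (hg : Good G₁ G₂ y z) : Good G₁ G₂ y' z' ∧ vert G₁ G₂ y' z' = vert G₁ G₂ y z := by
  refine vert_eq h ?_ ?_
  · have := mul_mem (inv_mem hy) (vert_mem_left hg)
    simpa [mul_assoc] using this
  · have := mul_mem (inv_mem hz) (vert_mem_right (G₁ := G₁) (G₂ := G₂) y z)
    simpa [mul_assoc] using this

theorem good_congr (h : G₁ ⊓ G₂ = ⊥) {y y' z z' : G} (hy : y⁻¹ * y' ∈ G₂) (hz : z⁻¹ * z' ∈ G₁) :
    Good G₁ G₂ y z ↔ Good G₁ G₂ y' z' := by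
  refine ⟨fun hg => (vert_congr h hy hz hg).1, fun hg => (vert_congr h ?_ ?_ hg).1⟩
  · simpa using inv_mem hy
  · simpa using inv_mem hz

end Algebra

variable [TopologicalSpace G] [IsTopologicalGroup G]

section

variable [LocallyCompactSpace G] [SecondCountableTopology G]

open scoped Uniformity Topology in
-- The right uniformity of a locally compact group is complete, and it is countably generated
-- because e has a countable neighbourhood basis.
theorem polishSpace_of_locallyCompact [T2Space G] : PolishSpace G := by
  let := IsTopologicalGroup.rightUniformSpace G
  have : IsRightUniformGroup G := { uniformity_eq := rfl }
  have : CompleteSpace G := IsRightUniformGroup.completeSpace_of_weaklyLocallyCompactSpace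
  have : (𝓤 G).IsCountablyGenerated := by
    rw [uniformity_eq_comap_mul_inv_nhds_one]
    infer_instance
  infer_instance

variable [MeasurableSpace G] [BorelSpace G]

theorem sigmaFinite_subgroup {K : Subgroup G} (hK : IsClosed (K : Set G)) (μ : Measure K)
    [μ.IsHaarMeasure] : SigmaFinite μ := by
  have : LocallyCompactSpace K := hK.isClosedEmbedding_subtypeVal.locallyCompactSpace
  infer_instance

end

variable [T2Space G] [LocallyCompactSpace G] [SecondCountableTopology G] [MeasurableSpace G]
  [BorelSpace G] {G₁ G₂ : Subgroup G} {μ : Measure G} {μ₁ : Measure G₁} {μ₂ : Measure G₂}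

omit [LocallyCompactSpace G] in
-- Inversion exchanges G₁G₂ and G₂G₁ and preserves Haar null sets.
theorem IsMatchedPair.swap [μ.IsMulLeftInvariant] [SFinite μ] (hG : IsMatchedPair G₁ G₂ μ) :
    IsMatchedPair G₂ G₁ μ where
  isClosed_left := hG.isClosed_right
  isClosed_right := hG.isClosed_left
  inf_eq_bot := inf_comm G₁ G₂ ▸ hG.inf_eq_bot
  measure_compl := by
    rw [← measure_inv_null, ← hG.measure_compl]
    congr 1
    ext x
    simp only [Set.mem_inv, Set.mem_ofPred_eq, not_iff_not]
    constructor
    · rintro ⟨s, hs, g, hg, e⟩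
      exact ⟨g⁻¹, inv_mem hg, s⁻¹, inv_mem hs, by rw [← mul_inv_rev, ← e, inv_inv]⟩
    · rintro ⟨g, hg, s, hs, e⟩
      exact ⟨s⁻¹, inv_mem hs, g⁻¹, inv_mem hg, by rw [← mul_inv_rev, ← e]⟩

/-- Lusin–Souslin: a continuous injection between Polish spaces maps Borel sets to Borel sets. The
measurability of `p₁` and `p₂` rests on this. -/
theorem measurableEmbedding_mul (hG : IsMatchedPair G₁ G₂ μ) :
    MeasurableEmbedding fun y : G₁ × G₂ => (y.1 : G) * y.2 := by
  have : PolishSpace G := polishSpace_of_locallyCompact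
  have : PolishSpace G₁ := hG.isClosed_left.polishSpace
  have : PolishSpace G₂ := hG.isClosed_right.polishSpace
  refine Continuous.measurableEmbedding (by fun_prop) fun y y' h => ?_
  have e : factor G₁ G₂ (y.1 * y.2) = factor G₁ G₂ (y'.1 * y'.2) := congrArg _ h
  rwa [factor_mul hG.inf_eq_bot, factor_mul hG.inf_eq_bot] at e

theorem measurableSet_inProd (hG : IsMatchedPair G₁ G₂ μ) :
    MeasurableSet {x | InProd G₁ G₂ x} := by
  convert! (measurableEmbedding_mul hG).measurableSet_range
  ext x
  simp only [InProd, Set.mem_ofPred_eq, Set.mem_range]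
  exact exists_congr fun _ => eq_comm

theorem measurable_factor (hG : IsMatchedPair G₁ G₂ μ) : Measurable (factor G₁ G₂) := by
  intro s hs
  classical
  have : factor G₁ G₂ ⁻¹' s = ((fun y : G₁ × G₂ => (y.1 : G) * y.2) '' s) ∪
      ({x | InProd G₁ G₂ x}ᶜ ∩ {_x | (1 : G₁ × G₂) ∈ s}) := by
    ext x
    by_cases hx : InProd G₁ G₂ x
    · obtain ⟨⟨g, t⟩, rfl⟩ := hx
      simp only [Set.mem_preimage, factor_mul hG.inf_eq_bot, Set.mem_union, Set.mem_image,
        Set.mem_inter_iff, Set.mem_compl_iff, Set.mem_ofPred_eq]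
      constructor
      · exact fun h => Or.inl ⟨_, h, rfl⟩
      · rintro (⟨y, hy, e⟩ | ⟨h, -⟩)
        · have e' : y = (g, t) := (measurableEmbedding_mul hG).injective e
          rwa [← e']
        · exact absurd ⟨(g, t), rfl⟩ h
    · have hx' : ¬ ∃ y : G₁ × G₂, x = y.1 * y.2 := hx
      simp only [Set.mem_preimage, factor, dif_neg hx', Set.mem_union, Set.mem_image,
        Set.mem_inter_iff, Set.mem_compl_iff, Set.mem_ofPred_eq, hx, not_false_eq_true, true_and]
      refine ⟨Or.inr, ?_⟩
      rintro (⟨y, hy, e⟩ | h)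
      · exact absurd ⟨y, e.symm⟩ hx
      · exact h
  rw [this]
  exact ((measurableEmbedding_mul hG).measurableSet_image.2 hs).union
    ((measurableSet_inProd hG).compl.inter (MeasurableSet.const _))

theorem measurable_p₁ (hG : IsMatchedPair G₁ G₂ μ) : Measurable (p₁ G₁ G₂) :=
  (measurable_factor hG).fst

theorem measurable_p₂ (hG : IsMatchedPair G₁ G₂ μ) : Measurable (p₂ G₁ G₂) :=
  (measurable_factor hG).snd

theorem measurable_vert (hG : IsMatchedPair G₁ G₂ μ) :
    Measurable fun z : G × G => vert G₁ G₂ z.1 z.2 := by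
  unfold vert
  exact measurable_snd.mul (measurable_subtype_coe.comp
    ((measurable_p₁ hG).comp (measurable_snd.inv.mul measurable_fst)))

theorem measurableSet_good (hG : IsMatchedPair G₁ G₂ μ) :
    MeasurableSet {z : G × G | Good G₁ G₂ z.1 z.2} :=
  (measurable_snd.inv.mul measurable_fst : Measurable fun z : G × G => z.2⁻¹ * z.1)
    (measurableSet_inProd hG)

omit [IsTopologicalGroup G] [T2Space G] [LocallyCompactSpace G]
  [SecondCountableTopology G] [BorelSpace G] in
theorem ae_inProd (hG : IsMatchedPair G₁ G₂ μ) : ∀ᵐ x ∂μ, InProd G₁ G₂ x := by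
  have := hG.measure_compl
  rw [measure_eq_zero_iff_ae_notMem] at this
  filter_upwards [this] with x hx
  simp only [not_not] at hx
  obtain ⟨g, hg, s, hs, e⟩ := hx
  exact ⟨(⟨g, hg⟩, ⟨s, hs⟩), e⟩

variable [μ.IsHaarMeasure] [μ₁.IsHaarMeasure] [μ₂.IsHaarMeasure] [SigmaFinite μ₁] [SigmaFinite μ₂]

omit [μ₁.IsHaarMeasure] [μ₂.IsHaarMeasure] [SigmaFinite μ₁] [SigmaFinite μ₂] in
theorem ae_good (hG : IsMatchedPair G₁ G₂ μ) (y : G) : ∀ᵐ z ∂μ, Good G₁ G₂ y z := by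
  have q : Measure.QuasiMeasurePreserving (fun z : G => z⁻¹ * y) μ μ :=
    (quasiMeasurePreserving_mul_right μ y).comp (quasiMeasurePreserving_inv μ)
  exact q.ae (ae_inProd hG)

/-- Multiplication `G₁ × G₂ → G` identifies null sets. -/
theorem ae_mul_iff (hG : IsMatchedPair G₁ G₂ μ) {P : G → Prop} (hP : MeasurableSet {x | P x}) :
    (∀ᵐ x ∂μ, P x) ↔ ∀ᵐ z ∂μ₁.prod μ₂, P (z.1 * z.2) := by
  -- Both directions apply Fubini to this set, which mixes the three measures through (x, (g, s)) ↦
  -- gxs.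
  have hm : MeasurableSet {w : G × (G₁ × G₂) | P (w.2.1 * w.1 * w.2.2)} := by
    refine (?_ : Measurable fun w : G × (G₁ × G₂) => (w.2.1 : G) * w.1 * w.2.2) hP
    fun_prop
  have trans (g : G₁) (s : G₂) {Q : G₁ × G₂ → Prop} (h : ∀ᵐ z ∂μ₁.prod μ₂, Q z) :
      ∀ᵐ z ∂μ₁.prod μ₂, Q (z.1 * g, s * z.2) :=
    (QuasiMeasurePreserving.prodMap (quasiMeasurePreserving_mul_right μ₁ g)
      (measurePreserving_mul_left μ₂ s).quasiMeasurePreserving).ae h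
  have transG (g s : G) {Q : G → Prop} (h : ∀ᵐ x ∂μ, Q x) : ∀ᵐ x ∂μ, Q (g * x * s) :=
    ((quasiMeasurePreserving_mul_right μ s).comp
      (measurePreserving_mul_left μ g).quasiMeasurePreserving).ae h
  constructor
  · intro h
    -- For every (g, s) the point gxs is generic with x. Fubini then yields a single x = g₀s₀ in
    -- G₁G₂ that works for almost all (g, s), and translating in G₁ and G₂ removes g₀ and s₀.
    have h1 : ∀ᵐ x ∂μ, ∀ᵐ z ∂μ₁.prod μ₂, P (z.1 * x * z.2) :=
      (Measure.ae_ae_comm hm).2 (Filter.Eventually.of_forall fun z => transG _ _ h)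
    obtain ⟨x, hx, ⟨⟨g, s⟩, rfl⟩⟩ := (h1.and (ae_inProd hG)).exists
    have := trans g⁻¹ s⁻¹ hx
    filter_upwards [this] with z hz
    simpa [mul_assoc] using hz
  · intro h
    -- For x = g₀s₀ the pair (gg₀, s₀s) is generic in G₁ × G₂. After Fubini one fixed (g, s)
    -- suffices, and it is removed by translating in G.
    have h1 : ∀ᵐ x ∂μ, ∀ᵐ z ∂μ₁.prod μ₂, P (z.1 * x * z.2) := by
      filter_upwards [ae_inProd hG] with x hx
      obtain ⟨⟨g, s⟩, rfl⟩ := hx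
      filter_upwards [trans g s h] with z hz
      simpa [mul_assoc] using hz
    obtain ⟨z, hz⟩ := ((Measure.ae_ae_comm hm).1 h1).exists
    filter_upwards [transG (z.1 : G)⁻¹ (z.2 : G)⁻¹ hz] with x hx
    simpa [mul_assoc] using hx

/-- A right `G₂`-invariant property holds almost everywhere on `G` iff it does so on a translate
of `G₁`. -/
theorem ae_iff_left (μ₂ : Measure G₂) [μ₂.IsHaarMeasure] [SigmaFinite μ₂] (hG : IsMatchedPair G₁ G₂ μ) {P : G → Prop} (hP : MeasurableSet {x | P x})
    (hinv : ∀ y y', y⁻¹ * y' ∈ G₂ → (P y ↔ P y')) (x : G) :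
    (∀ᵐ y ∂μ, P y) ↔ ∀ᵐ g : G₁ ∂μ₁, P (x * g) := by
  have e : (∀ᵐ y ∂μ, P y) ↔ ∀ᵐ y ∂μ, P (x * y) := by
    refine ⟨fun h => (measurePreserving_mul_left μ x).quasiMeasurePreserving.ae h, fun h => ?_⟩
    filter_upwards [(measurePreserving_mul_left μ x⁻¹).quasiMeasurePreserving.ae h] with y hy
    simpa using hy
  have hP' : MeasurableSet {y | P (x * y)} := measurable_const_mul x hP
  rw [e, ae_mul_iff (μ₁ := μ₁) (μ₂ := μ₂) hG hP']
  -- By invariance the G₂-coordinate plays no role and can be integrated out.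
  have e2 : (∀ᵐ z ∂μ₁.prod μ₂, P (x * (z.1 * z.2))) ↔ ∀ᵐ z ∂μ₁.prod μ₂, P (x * z.1) := by
    refine Filter.eventually_congr (Filter.Eventually.of_forall fun z => (hinv _ _ ?_).symm)
    simp [mul_assoc]
  rw [e2, Measure.ae_prod_iff_ae_ae (p := fun z : G₁ × G₂ => P (x * z.1))]
  · simp
  · exact (by fun_prop : Measurable fun z : G₁ × G₂ => x * (z.1 : G)) hP

end MatchedPairFacts

/-! ### Almost everywhere statements on powers -/

section PiMeasure

variable {X X' ρ : Type*} [MeasurableSpace X] [MeasurableSpace X'] [MeasurableSpace ρ]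

theorem ae_pi_succ_prod (μ : Measure X) [SigmaFinite μ] (ν : Measure ρ) [SFinite ν] {n : ℕ}
    {P : (Fin (n + 1) → X) × ρ → Prop} (hP : MeasurableSet {z | P z}) :
    (∀ᵐ z ∂(Measure.pi fun _ : Fin (n + 1) => μ).prod ν, P z) ↔
      ∀ᵐ x ∂μ, ∀ᵐ z ∂(Measure.pi fun _ : Fin n => μ).prod ν,
        P ((Fin.cons x z.1 : Fin (n + 1) → X), z.2) := by
  have m : MeasurePreserving (fun z : X × ((Fin n → X) × ρ) =>
      ((Fin.cons z.1 z.2.1 : Fin (n + 1) → X), z.2.2))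
      (μ.prod ((Measure.pi fun _ => μ).prod ν)) ((Measure.pi fun _ => μ).prod ν) :=
    ((measurePreserving_finCons μ n).prod (MeasurePreserving.id ν)).comp
      ((measurePreserving_prodAssoc _ _ _).symm MeasurableEquiv.prodAssoc)
  rw [← m.map_eq, ae_map_iff m.measurable.aemeasurable hP]
  exact Measure.ae_prod_iff_ae_ae (m.measurable hP)

theorem ae_pi_zero_prod (μ : Measure X) (ν : Measure ρ) [SFinite ν]
    {P : (Fin 0 → X) × ρ → Prop} (hP : MeasurableSet {z | P z}) :
    (∀ᵐ z ∂(Measure.pi fun _ : Fin 0 => μ).prod ν, P z) ↔ ∀ᵐ t ∂ν, P (Fin.elim0, t) := by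
  rw [Measure.pi_of_empty (fun _ : Fin 0 => μ) Fin.elim0, Measure.dirac_prod,
    ae_map_iff (by fun_prop) hP]

/-- One coordinate is exchanged at a time: with the others frozen, the property is invariant in this
coordinate and `H` applies; Fubini then passes to the remaining ones. In the application `r` means
lying in the same coset and `ι` parametrizes a translate of a subgroup. -/
theorem ae_pi_prod_iff {μ : Measure X} [SigmaFinite μ] {μ' : Measure X'} [SigmaFinite μ']
    {ι : X' → X} (hι : Measurable ι) {r : X → X → Prop} (hr : ∀ x, r x x)
    (H : ∀ P : X → Prop, MeasurableSet {x | P x} → (∀ x y, r x y → (P x ↔ P y)) →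
      ((∀ᵐ x ∂μ, P x) ↔ ∀ᵐ x ∂μ', P (ι x)))
    (ν : Measure ρ) [SFinite ν] {n : ℕ} {P : (Fin n → X) × ρ → Prop} (hP : MeasurableSet {z | P z})
    (hinv : ∀ x y t, (∀ i, r (x i) (y i)) → (P (x, t) ↔ P (y, t))) :
    (∀ᵐ z ∂(Measure.pi fun _ : Fin n => μ).prod ν, P z) ↔
      ∀ᵐ z ∂(Measure.pi fun _ : Fin n => μ').prod ν, P (fun i => ι (z.1 i), z.2) := by
  have hm (n : ℕ) {P : (Fin n → X) × ρ → Prop} (hP : MeasurableSet {z | P z}) :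
      MeasurableSet {z : (Fin n → X') × ρ | P (fun i => ι (z.1 i), z.2)} :=
    (by fun_prop : Measurable fun z : (Fin n → X') × ρ => ((fun i => ι (z.1 i)), z.2)) hP
  induction n with
  | zero =>
    rw [ae_pi_zero_prod μ ν hP, ae_pi_zero_prod μ' ν (hm 0 hP)]
    have (t : ρ) : P (Fin.elim0, t) ↔ P (fun i : Fin 0 => ι (Fin.elim0 i), t) :=
      hinv _ _ _ fun i => i.elim0
    simp only [this]
  | succ n ih =>
    have mc : Measurable fun w : X × ((Fin n → X) × ρ) =>
        ((Fin.cons w.1 w.2.1 : Fin (n + 1) → X), w.2.2) :=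
      ((measurePreserving_finCons μ n).measurable.comp
        (measurable_fst.prodMk measurable_snd.fst)).prodMk measurable_snd.snd
    have mx (x : X) : MeasurableSet
        {z : (Fin n → X) × ρ | P ((Fin.cons x z.1 : Fin (n + 1) → X), z.2)} :=
      (mc.comp (measurable_prodMk_left (x := x))) hP
    rw [ae_pi_succ_prod μ ν hP, ae_pi_succ_prod μ' ν (hm _ hP), Measure.ae_ae_comm
      (p := fun (x : X) (z : (Fin n → X) × ρ) => P ((Fin.cons x z.1 : Fin (n + 1) → X), z.2)) (mc hP)]
    have e1 (z : (Fin n → X) × ρ) : (∀ᵐ x ∂μ, P ((Fin.cons x z.1 : Fin (n + 1) → X), z.2)) ↔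
        ∀ᵐ x ∂μ', P ((Fin.cons (ι x) z.1 : Fin (n + 1) → X), z.2) := by
      refine H (fun x => P ((Fin.cons x z.1 : Fin (n + 1) → X), z.2))
        ((mc.comp (measurable_prodMk_right (y := z))) hP) fun x y hxy => hinv _ _ _ ?_
      refine Fin.cases (by simpa using hxy) fun i => by simpa using hr _
    simp only [e1]
    rw [← Measure.ae_ae_comm
      (p := fun (x : X') (z : (Fin n → X) × ρ) => P ((Fin.cons (ι x) z.1 : Fin (n + 1) → X), z.2))
      (mc.comp (hι.prodMap measurable_id) hP)]
    refine Filter.eventually_congr (Filter.Eventually.of_forall fun x => ?_)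
    refine (ih (P := fun z => P ((Fin.cons (ι x) z.1 : Fin (n + 1) → X), z.2)) (mx (ι x))
      fun y z t h => ?_).trans ?_
    · refine hinv _ _ _ (Fin.cases (by simpa using hr _) fun i => by simpa using h i)
    · have e2 (z : Fin n → X') : (fun i => ι ((Fin.cons x z : Fin (n + 1) → X') i)) =
          (Fin.cons (ι x) fun i => ι (z i) : Fin (n + 1) → X) := by
        funext i; refine Fin.cases ?_ (fun j => ?_) i <;> simp
      simp only [e2]

end PiMeasure

/-! ### Partial products as a measure preserving change of coordinates -/

section CumulativeProduct

variable {H : Type*} [Group H]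

/-- `(x₁, …, xₙ) ↦ (x₁, x₁x₂, …, x₁⋯xₙ)`. -/
def cumProd {n : ℕ} (x : Fin n → H) (i : Fin n) : H := Fin.partialProd x i.succ

theorem cumProd_cons {n : ℕ} (g : H) (x : Fin n → H) :
    cumProd (Fin.cons g x : Fin (n + 1) → H) = Fin.cons g (fun i => g * cumProd x i) := by
  funext i
  refine Fin.cases ?_ (fun j => ?_) i
  · rw [cumProd, Fin.partialProd_succ]; simp
  · simp [cumProd, Fin.partialProd_succ' (n := n)]

theorem partialProd_eq_cons {n : ℕ} (x : Fin n → H) :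
    Fin.partialProd x = (Fin.cons 1 (cumProd x) : Fin (n + 1) → H) := by
  funext i
  refine Fin.cases ?_ (fun j => ?_) i
  · simp
  · simp [cumProd]

theorem map_partialProd {K : Type*} [Group K] (f : H →* K) {n : ℕ} (x : Fin n → H)
    (i : Fin (n + 1)) : f (Fin.partialProd x i) = Fin.partialProd (fun i => f (x i)) i := by
  induction i using Fin.induction with
  | zero => simp
  | succ i ih => rw [Fin.partialProd_succ, Fin.partialProd_succ, map_mul, ih]

variable [MeasurableSpace H] [MeasurableMul₂ H]

theorem measurable_partialProd {n : ℕ} (i : Fin (n + 1)) :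
    Measurable fun x : Fin n → H => Fin.partialProd x i := by
  induction i using Fin.induction with
  | zero => simp
  | succ i ih =>
    simp only [Fin.partialProd_succ]
    exact ih.mul (measurable_pi_apply i)

/-- After the first entry g is split off, the map is a skew product: the partial products of the
tail, all multiplied by g on the left. Left invariance preserves each fibre measure. -/
theorem measurePreserving_cumProd (μ : Measure H) [SigmaFinite μ] [μ.IsMulLeftInvariant] (n : ℕ) :
    MeasurePreserving (cumProd : (Fin n → H) → Fin n → H) (Measure.pi fun _ => μ)
      (Measure.pi fun _ => μ) := by
  induction n with
  | zero =>
    have : (cumProd : (Fin 0 → H) → Fin 0 → H) = id := by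
      funext x i; exact i.elim0
    rw [this]; exact MeasurePreserving.id _
  | succ n ih =>
    have m1 : MeasurePreserving
        (fun z : H × (Fin n → H) => (z.1, fun i => z.1 * cumProd z.2 i))
        (μ.prod (Measure.pi fun _ => μ)) (μ.prod (Measure.pi fun _ => μ)) := by
      refine (MeasurePreserving.id μ).skew_product (g := fun g x i => g * cumProd x i) ?_ ?_
      · exact measurable_pi_lambda _ fun i => measurable_fst.mul
          ((measurable_pi_apply i).comp (ih.measurable.comp measurable_snd))
      · refine Filter.Eventually.of_forall fun g => ?_
        have := (measurePreserving_mul_left (Measure.pi fun _ : Fin n => μ) (fun _ => g)).comp ih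
        exact this.map_eq
    have m2 := (measurePreserving_finCons μ n).comp m1
    have m3 := (measurePreserving_piFinSuccAbove (fun _ : Fin (n + 1) => μ) 0)
    have m4 := m2.comp m3
    convert! m4 using 1
    funext x
    conv_lhs => rw [← Fin.cons_self_tail x, cumProd_cons]
    rfl

end CumulativeProduct

/-! ### Null sets of vertex configurations -/

section Vertices

variable {G : Type*} [Group G] [TopologicalSpace G] [IsTopologicalGroup G]
  [T2Space G] [LocallyCompactSpace G] [SecondCountableTopology G] [MeasurableSpace G]
  [BorelSpace G] {G₁ G₂ : Subgroup G} {μ : Measure G} {μ₁ : Measure G₁} {μ₂ : Measure G₂}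
  [μ.IsHaarMeasure] [μ₁.IsHaarMeasure] [μ₂.IsHaarMeasure] [SigmaFinite μ₁] [SigmaFinite μ₂]

theorem ae_pi_left_iff (μ₂ : Measure G₂) [μ₂.IsHaarMeasure] [SigmaFinite μ₂]
    (hG : IsMatchedPair G₁ G₂ μ) {ρ : Type*} [MeasurableSpace ρ] (ν : Measure ρ) [SFinite ν] (x : G)
    {n : ℕ} {P : (Fin n → G) × ρ → Prop} (hP : MeasurableSet {z | P z})
    (hinv : ∀ y y' t, (∀ i, (y i)⁻¹ * y' i ∈ G₂) → (P (y, t) ↔ P (y', t))) :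
    (∀ᵐ z ∂(Measure.pi fun _ : Fin n => μ).prod ν, P z) ↔
      ∀ᵐ z ∂(Measure.pi fun _ : Fin n => μ₁).prod ν, P (fun i => x * (z.1 i : G), z.2) :=
  ae_pi_prod_iff (ι := fun g : G₁ => x * (g : G)) (by fun_prop) (r := fun y y' => y⁻¹ * y' ∈ G₂)
    (by simp) (fun _ hP hinv => ae_iff_left μ₂ hG hP hinv x) ν hP hinv

theorem ae_pi_right_iff (μ₁ : Measure G₁) [μ₁.IsHaarMeasure] [SigmaFinite μ₁]
    (hG : IsMatchedPair G₁ G₂ μ) {ρ : Type*} [MeasurableSpace ρ] (ν : Measure ρ) [SFinite ν] (x : G)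
    {n : ℕ} {P : (Fin n → G) × ρ → Prop} (hP : MeasurableSet {z | P z})
    (hinv : ∀ y y' t, (∀ i, (y i)⁻¹ * y' i ∈ G₁) → (P (y, t) ↔ P (y', t))) :
    (∀ᵐ z ∂(Measure.pi fun _ : Fin n => μ).prod ν, P z) ↔
      ∀ᵐ z ∂(Measure.pi fun _ : Fin n => μ₂).prod ν, P (fun i => x * (z.1 i : G), z.2) :=
  ae_pi_left_iff μ₁ hG.swap ν x hP hinv

theorem ae_prod_swap_iff {X Y : Type*} [MeasurableSpace X] [MeasurableSpace Y] (μ : Measure X)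
    (ν : Measure Y) [SFinite μ] [SFinite ν] {P : X × Y → Prop} :
    (∀ᵐ z ∂μ.prod ν, P z) ↔ ∀ᵐ z ∂ν.prod μ, P z.swap := by
  have e : MeasurableEmbedding (Prod.swap : Y × X → X × Y) :=
    MeasurableEquiv.prodComm.measurableEmbedding
  rw [← Measure.prod_swap, e.ae_map_iff]

/-- Invariant properties of vertex labels hold almost everywhere iff they hold for almost every
first column and first row. -/
theorem ae_vertices_iff (hG : IsMatchedPair G₁ G₂ μ) {p q : ℕ}
    {P : (Fin (p + 1) → G) × (Fin (q + 1) → G) → Prop} (hP : MeasurableSet {z | P z})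
    (hinv : ∀ h y y' z z', (∀ i, (h * y i)⁻¹ * y' i ∈ G₂) → (∀ j, (h * z j)⁻¹ * z' j ∈ G₁) →
      (P (y, z) ↔ P (y', z'))) :
    (∀ᵐ w ∂(Measure.pi fun _ => μ).prod (Measure.pi fun _ => μ), P w) ↔
      ∀ᵐ w ∂(Measure.pi fun _ : Fin p => μ₁).prod (Measure.pi fun _ : Fin q => μ₂),
        P (fun i => (Fin.partialProd w.1 i : G₁), fun j => (Fin.partialProd w.2 j : G₂)) := by
  have mc (n : ℕ) : Measurable fun w : G × (Fin n → G) => (Fin.cons w.1 w.2 : Fin (n + 1) → G) :=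
    (measurePreserving_finCons μ n).measurable
  have mQ : Measurable fun w : (G × G) × ((Fin p → G) × (Fin q → G)) =>
      ((Fin.cons w.1.1 w.2.1 : Fin (p + 1) → G), (Fin.cons w.1.2 w.2.2 : Fin (q + 1) → G)) :=
    ((mc p).comp (measurable_fst.fst.prodMk measurable_snd.fst)).prodMk
      ((mc q).comp (measurable_fst.snd.prodMk measurable_snd.snd))
  let ν := (Measure.pi fun _ : Fin p => μ).prod (Measure.pi fun _ : Fin q => μ)
  have split : (∀ᵐ w ∂(Measure.pi fun _ => μ).prod (Measure.pi fun _ => μ), P w) ↔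
      ∀ᵐ y₀ ∂μ, ∀ᵐ z₀ ∂μ, ∀ᵐ w ∂ν,
        P ((Fin.cons y₀ w.1 : Fin (p + 1) → G), (Fin.cons z₀ w.2 : Fin (q + 1) → G)) := by
    rw [ae_pi_succ_prod μ _ hP]
    refine Filter.eventually_congr (Filter.Eventually.of_forall fun y₀ => ?_)
    rw [ae_prod_swap_iff, ae_pi_succ_prod μ]
    · refine Filter.eventually_congr (Filter.Eventually.of_forall fun z₀ => ?_)
      rw [ae_prod_swap_iff]
      rfl
    · refine (?_ : Measurable fun z : (Fin (q + 1) → G) × (Fin p → G) =>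
        ((Fin.cons y₀ z.2 : Fin (p + 1) → G), z.1)) hP
      exact ((mc p).comp (measurable_const.prodMk measurable_snd)).prodMk measurable_fst
  let C := ∀ᵐ w ∂(Measure.pi fun _ : Fin p => μ₁).prod (Measure.pi fun _ : Fin q => μ₂),
    P ((Fin.cons 1 (fun i => (w.1 i : G)) : Fin (p + 1) → G),
      (Fin.cons 1 (fun j => (w.2 j : G)) : Fin (q + 1) → G))
  -- With x the common vertex of y₀G₂ and z₀G₁, the other points may be taken in xG₁ and xG₂
  -- respectively. Translating by x⁻¹ and using invariance replaces y₀ and z₀ by 1, so the condition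
  -- becomes `C`, which no longer depends on them.
  have slice (y₀ z₀ : G) (hg : Good G₁ G₂ y₀ z₀) : (∀ᵐ w ∂ν,
      P ((Fin.cons y₀ w.1 : Fin (p + 1) → G), (Fin.cons z₀ w.2 : Fin (q + 1) → G))) ↔ C := by
    have m0 : MeasurableSet {w : (Fin p → G) × (Fin q → G) |
        P ((Fin.cons y₀ w.1 : Fin (p + 1) → G), (Fin.cons z₀ w.2 : Fin (q + 1) → G))} :=
      mQ.comp (measurable_prodMk_left (x := (y₀, z₀))) hP
    set x := vert G₁ G₂ y₀ z₀ with hx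
    rw [ae_pi_left_iff (μ₁ := μ₁) μ₂ hG _ x m0, ae_prod_swap_iff,
      ae_pi_right_iff (μ₂ := μ₂) μ₁ hG _ x, ae_prod_swap_iff]
    · refine Filter.eventually_congr (Filter.Eventually.of_forall fun w => ?_)
      simp only [Prod.fst_swap, Prod.snd_swap]
      refine (hinv x _ _ _ _ ?_ ?_).symm
      · refine Fin.cases ?_ fun i => ?_
        · simpa using inv_mem (vert_mem_left hg)
        · simp
      · refine Fin.cases ?_ fun i => ?_
        · simpa using inv_mem (vert_mem_right (G₁ := G₁) (G₂ := G₂) y₀ z₀)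
        · simp
    · refine (?_ : Measurable fun z : (Fin q → G) × (Fin p → G₁) =>
        ((fun i => x * (z.2 i : G)), z.1)) m0
      fun_prop
    · intro y y' t h
      refine hinv 1 _ _ _ _ (by simp) ?_
      refine Fin.cases (by simp) fun j => by simpa using h j
    · intro y y' t h
      refine hinv 1 _ _ _ _ ?_ (by simp)
      refine Fin.cases (by simp) fun j => by simpa using h j
  have hC : (∀ᵐ w ∂(Measure.pi fun _ => μ).prod (Measure.pi fun _ => μ), P w) ↔ C := by
    rw [split]
    refine ⟨fun h => ?_, fun h => ?_⟩
    · obtain ⟨y₀, hy⟩ := h.exists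
      obtain ⟨z₀, hz, hg⟩ := (hy.and (ae_good hG y₀)).exists
      exact (slice y₀ z₀ hg).1 hz
    · refine Filter.Eventually.of_forall fun y₀ => ?_
      filter_upwards [ae_good hG y₀] with z₀ hg
      exact (slice y₀ z₀ hg).2 h
  rw [hC]
  have mp := (measurePreserving_cumProd μ₁ p).prod (measurePreserving_cumProd μ₂ q)
  simp only [C]
  have mC : MeasurableSet {w : (Fin p → G₁) × (Fin q → G₂) |
      P ((Fin.cons 1 (fun i => (w.1 i : G)) : Fin (p + 1) → G),
        (Fin.cons 1 (fun j => (w.2 j : G)) : Fin (q + 1) → G))} :=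
    mQ.comp (by fun_prop : Measurable fun w : (Fin p → G₁) × (Fin q → G₂) =>
      (((1 : G), (1 : G)), ((fun i => (w.1 i : G)), fun j => (w.2 j : G)))) hP
  conv_lhs => rw [← mp.map_eq]
  rw [ae_map_iff mp.measurable.aemeasurable mC]
  refine Filter.eventually_congr (Filter.Eventually.of_forall fun w => ?_)
  have e {K : Subgroup G} {n : ℕ} (x : Fin n → K) :
      (fun i => ((Fin.partialProd x i : K) : G)) =
        (Fin.cons 1 fun i => ((cumProd x i : K) : G) : Fin (n + 1) → G) := by
    rw [partialProd_eq_cons]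
    funext i; refine Fin.cases ?_ (fun j => ?_) i <;> simp
  simp only [Prod.map_fst, Prod.map_snd, e]

end Vertices

/-! ### Vertices of grids -/

section GridVertices

variable {G : Type*} [Group G] {G₁ G₂ : Subgroup G} {p q : ℕ}

/-- The vertex in row line `i` and column line `j`, when the top left vertex is `1`. -/
def gridVertex (X : Grid G₁ G₂ p q) (i : Fin (p + 1)) (j : Fin (q + 1)) : G :=
  (Fin.partialProd (fun i' => (X.1.1 i' 0 : G)) i) * Fin.partialProd (fun j' => (X.1.2 i j' : G)) j

theorem gridVertex_zero_right (X : Grid G₁ G₂ p q) (i : Fin (p + 1)) :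
    gridVertex X i 0 = Fin.partialProd (fun i' => (X.1.1 i' 0 : G)) i := by
  simp [gridVertex]

theorem gridVertex_zero_left (X : Grid G₁ G₂ p q) (j : Fin (q + 1)) :
    gridVertex X 0 j = Fin.partialProd (fun j' => (X.1.2 0 j' : G)) j := by
  simp [gridVertex]

theorem gridVertex_succ_right (X : Grid G₁ G₂ p q) (i : Fin (p + 1)) (j : Fin q) :
    gridVertex X i j.succ = gridVertex X i j.castSucc * X.1.2 i j := by
  rw [gridVertex, Fin.partialProd_succ, ← mul_assoc, gridVertex]

/-- The vertex is defined by going down the first column and then right. Commutation of the small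
squares, used one column at a time, makes the other routes agree. -/
theorem gridVertex_succ_left (X : Grid G₁ G₂ p q) (i : Fin p) (j : Fin (q + 1)) :
    gridVertex X i.succ j = gridVertex X i.castSucc j * X.1.1 i j := by
  induction j using Fin.induction with
  | zero => rw [gridVertex_zero_right, gridVertex_zero_right, Fin.partialProd_succ]
  | succ j ih =>
    rw [gridVertex_succ_right, gridVertex_succ_right, ih, mul_assoc, mul_assoc, X.2 i j]

theorem coe_partialProd {K : Subgroup G} {n : ℕ} (x : Fin n → K) (i : Fin (n + 1)) :
    ((Fin.partialProd x i : K) : G) = Fin.partialProd (fun i => (x i : G)) i :=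
  map_partialProd K.subtype x i

theorem partialProd_mem {K : Subgroup G} {n : ℕ} (x : Fin n → K) (i : Fin (n + 1)) :
    Fin.partialProd (fun i => (x i : G)) i ∈ K := by
  rw [← coe_partialProd]; exact SetLike.coe_mem _

theorem gridVertex_row_mem (X : Grid G₁ G₂ p q) (i : Fin (p + 1)) (j : Fin (q + 1)) :
    (gridVertex X i 0)⁻¹ * gridVertex X i j ∈ G₂ := by
  rw [gridVertex_zero_right, gridVertex, inv_mul_cancel_left]
  exact partialProd_mem _ _

theorem gridVertex_col_mem (X : Grid G₁ G₂ p q) (i : Fin (p + 1)) (j : Fin (q + 1)) :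
    (gridVertex X 0 j)⁻¹ * gridVertex X i j ∈ G₁ := by
  induction i using Fin.induction with
  | zero => simp
  | succ i ih =>
    rw [gridVertex_succ_left, ← mul_assoc]
    exact G₁.mul_mem ih (X.1.1 i j).2

theorem good_gridVertex (h : G₁ ⊓ G₂ = ⊥) (X : Grid G₁ G₂ p q) (i : Fin (p + 1))
    (j : Fin (q + 1)) : Good G₁ G₂ (gridVertex X i 0) (gridVertex X 0 j) ∧
      vert G₁ G₂ (gridVertex X i 0) (gridVertex X 0 j) = gridVertex X i j :=
  vert_eq h (gridVertex_row_mem X i j) (gridVertex_col_mem X i j)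

theorem coe_vertical_edge (X : Grid G₁ G₂ p q) (i : Fin p) (j : Fin (q + 1)) :
    (X.1.1 i j : G) = (gridVertex X i.castSucc j)⁻¹ * gridVertex X i.succ j := by
  rw [gridVertex_succ_left, inv_mul_cancel_left]

theorem coe_horizontal_edge (X : Grid G₁ G₂ p q) (i : Fin (p + 1)) (j : Fin q) :
    (X.1.2 i j : G) = (gridVertex X i j.castSucc)⁻¹ * gridVertex X i j.succ := by
  rw [gridVertex_succ_right, inv_mul_cancel_left]

theorem grid_ext {X Y : Grid G₁ G₂ p q} (h : ∀ i j, gridVertex X i j = gridVertex Y i j) :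
    X = Y := by
  refine Subtype.ext (Prod.ext ?_ ?_)
  · funext i j
    exact Subtype.ext (by rw [coe_vertical_edge, coe_vertical_edge, h, h])
  · funext i j
    exact Subtype.ext (by rw [coe_horizontal_edge, coe_horizontal_edge, h, h])

/-- The grid with given vertices. -/
def gridOf (x : Fin (p + 1) → Fin (q + 1) → G)
    (h₁ : ∀ i j, (x (Fin.castSucc i) j)⁻¹ * x i.succ j ∈ G₁)
    (h₂ : ∀ i j, (x i (Fin.castSucc j))⁻¹ * x i j.succ ∈ G₂) : Grid G₁ G₂ p q :=
  ⟨(fun i j => ⟨_, h₁ i j⟩, fun i j => ⟨_, h₂ i j⟩), by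
    intro i j
    simp [mul_assoc]⟩

theorem gridVertex_gridOf {x : Fin (p + 1) → Fin (q + 1) → G}
    (h₁ : ∀ i j, (x (Fin.castSucc i) j)⁻¹ * x i.succ j ∈ G₁)
    (h₂ : ∀ i j, (x i (Fin.castSucc j))⁻¹ * x i j.succ ∈ G₂) (i : Fin (p + 1)) (j : Fin (q + 1)) :
    gridVertex (gridOf x h₁ h₂) i j = (x 0 0)⁻¹ * x i j := by
  induction j using Fin.induction with
  | zero =>
    induction i using Fin.induction with
    | zero => simp [gridVertex_zero_right]
    | succ i ih => rw [gridVertex_succ_left, ih]; simp [gridOf, mul_assoc]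
  | succ j ih => rw [gridVertex_succ_right, ih]; simp [gridOf, mul_assoc]

theorem gridVertex_hFace_succ (k : Fin (q + 1)) (X : Grid G₁ G₂ p (q + 1)) (i : Fin (p + 1))
    (j : Fin (q + 1)) : gridVertex (hFace k.succ X) i j = gridVertex X i (k.succ.succAbove j) := by
  have e : (fun j' => ((hFace k.succ X).1.2 i j' : G)) =
      Fin.contractNth k (· * ·) fun j' => (X.1.2 i j' : G) := by
    funext j'
    simp only [hFace, coe_face]
    simp [face]
  rw [gridVertex, gridVertex, e, Fin.partialProd_contractNth]
  simp [hFace]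

theorem gridVertex_vFace_succ (k : Fin (p + 1)) (X : Grid G₁ G₂ (p + 1) q) (i : Fin (p + 1))
    (j : Fin (q + 1)) : gridVertex (vFace k.succ X) i j = gridVertex X (k.succ.succAbove i) j := by
  have e : (fun i' => ((vFace k.succ X).1.1 i' 0 : G)) =
      Fin.contractNth k (· * ·) fun i' => (X.1.1 i' 0 : G) := by
    funext j'
    simp only [vFace, coe_face]
    simp [face]
  rw [gridVertex, gridVertex, e, Fin.partialProd_contractNth]
  simp [vFace]

/-- Deleting the first line moves the vertex that is normalized to 1, so all vertices are translated
by the first edge. The group action in the zeroth term of the coboundary compensates for exactly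
this. -/
theorem gridVertex_vFace_zero (X : Grid G₁ G₂ (p + 1) q) (i : Fin (p + 1)) (j : Fin (q + 1)) :
    X.1.1 0 0 * gridVertex (vFace 0 X) i j = gridVertex X i.succ j := by
  rw [gridVertex, gridVertex, Fin.partialProd_succ', mul_assoc]
  rfl

theorem gridVertex_hFace_zero (X : Grid G₁ G₂ p (q + 1)) (i : Fin (p + 1)) (j : Fin (q + 1)) :
    X.1.2 0 0 * gridVertex (hFace 0 X) i j = gridVertex X i j.succ := by
  have key : (X.1.2 0 0 : G) * Fin.partialProd (fun i' => ((hFace 0 X).1.1 i' 0 : G)) i =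
      gridVertex X i (Fin.succ 0) := by
    induction i using Fin.induction with
    | zero => rw [gridVertex_succ_right]; simp [gridVertex]
    | succ i ih => rw [Fin.partialProd_succ, ← mul_assoc, ih, gridVertex_succ_left]; simp [hFace]
  rw [gridVertex, ← mul_assoc, key, gridVertex, gridVertex, Fin.partialProd_succ', mul_assoc,
    Fin.partialProd_succ' _ j]
  congr 1
  simp only [Fin.partialProd_zero, mul_one]
  rfl

end GridVertices

/-! ### The measure class on grids, expressed through vertices -/

section GridMeasure

variable {G : Type*} [Group G] [TopologicalSpace G] [IsTopologicalGroup G]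
  [T2Space G] [LocallyCompactSpace G] [SecondCountableTopology G] [MeasurableSpace G]
  [BorelSpace G] {G₁ G₂ : Subgroup G} {μ : Measure G} {μ₁ : Measure G₁} {μ₂ : Measure G₂}

/-- Each vertex is the intersection of the row coset through its first vertex with the column coset
through its top vertex, so the first column and the first row determine the grid. -/
theorem colRow_injective (h : G₁ ⊓ G₂ = ⊥) {p q : ℕ} :
    Function.Injective (colRow : Grid G₁ G₂ p q → _) := by
  intro X Y e
  have e1 (i : Fin p) : X.1.1 i 0 = Y.1.1 i 0 := congrFun (congrArg Prod.fst e) i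
  have e2 (j : Fin q) : X.1.2 0 j = Y.1.2 0 j := congrFun (congrArg Prod.snd e) j
  refine grid_ext fun i j => ?_
  rw [← (good_gridVertex h X i j).2, ← (good_gridVertex h Y i j).2]
  simp only [gridVertex_zero_right, gridVertex_zero_left, e1, e2]

theorem measurableEmbedding_colRow (hG : IsMatchedPair G₁ G₂ μ) (p q : ℕ) :
    MeasurableEmbedding (colRow : Grid G₁ G₂ p q → _) := by
  have : PolishSpace G := polishSpace_of_locallyCompact
  have : PolishSpace G₁ := hG.isClosed_left.polishSpace
  have : PolishSpace G₂ := hG.isClosed_right.polishSpace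
  have hc : IsClosed (Grid G₁ G₂ p q) := by
    simp only [Grid, Set.ofPred_forall]
    refine isClosed_iInter fun i => isClosed_iInter fun j => isClosed_eq ?_ ?_ <;> fun_prop
  have : PolishSpace (Grid G₁ G₂ p q) := hc.polishSpace
  refine Continuous.measurableEmbedding ?_ (colRow_injective hG.inf_eq_bot)
  unfold colRow
  fun_prop

variable [μ.IsHaarMeasure] [μ₁.IsHaarMeasure] [μ₂.IsHaarMeasure] [SigmaFinite μ₁] [SigmaFinite μ₂]

/-- If all the cosets in question meet, their intersection points have neighbouring quotients in G₁
and G₂, hence form the vertices of a grid. -/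
theorem mem_range_colRow (h : G₁ ⊓ G₂ = ⊥) {p q : ℕ} {w : (Fin p → G₁) × (Fin q → G₂)}
    (hw : ∀ i j, Good G₁ G₂ (Fin.partialProd w.1 i : G₁) (Fin.partialProd w.2 j : G₂)) :
    w ∈ Set.range (colRow : Grid G₁ G₂ p q → _) := by
  obtain ⟨y, hy'⟩ : ∃ y : Fin (p + 1) → G, ∀ i, (Fin.partialProd w.1 i : G₁) = y i :=
    ⟨_, fun _ => rfl⟩
  obtain ⟨z, hz'⟩ : ∃ z : Fin (q + 1) → G, ∀ j, (Fin.partialProd w.2 j : G₂) = z j :=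
    ⟨_, fun _ => rfl⟩
  have hy (i : Fin (p + 1)) : y i ∈ G₁ := hy' i ▸ (Fin.partialProd w.1 i).2
  have hz (j : Fin (q + 1)) : z j ∈ G₂ := hz' j ▸ (Fin.partialProd w.2 j).2
  simp only [hy', hz'] at hw
  have m1 (i : Fin p) (j) : (vert G₁ G₂ (y i.castSucc) (z j))⁻¹ * vert G₁ G₂ (y i.succ) (z j) ∈ G₁ := by
    have := G₁.mul_mem (G₁.inv_mem (vert_mem_right (G₁ := G₁) (G₂ := G₂) (y i.castSucc) (z j)))
      (vert_mem_right (G₁ := G₁) (G₂ := G₂) (y i.succ) (z j))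
    simpa [mul_assoc] using this
  have m2 (i) (j : Fin q) : (vert G₁ G₂ (y i) (z j.castSucc))⁻¹ * vert G₁ G₂ (y i) (z j.succ) ∈ G₂ := by
    have := G₂.mul_mem (G₂.inv_mem (vert_mem_left (hw i j.castSucc))) (vert_mem_left (hw i j.succ))
    simpa [mul_assoc] using this
  have y0 : y 0 = 1 := by simp [← hy']
  have z0 : z 0 = 1 := by simp [← hz']
  have v1 (i) : vert G₁ G₂ (y i) 1 = y i := (vert_eq h (by simp) (by simpa using hy i)).2
  have v2 (j) : vert G₁ G₂ 1 (z j) = z j := (vert_eq h (by simpa using hz j) (by simp)).2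
  refine ⟨gridOf (fun i j => vert G₁ G₂ (y i) (z j)) m1 m2, Prod.ext ?_ ?_⟩
  · funext i
    refine Subtype.ext ?_
    simp only [colRow, gridOf, z0, v1]
    simp [← hy', Fin.partialProd_succ]
  · funext i
    refine Subtype.ext ?_
    simp only [colRow, gridOf, y0, v2]
    simp [← hz', Fin.partialProd_succ]

theorem ae_good_vertices (hG : IsMatchedPair G₁ G₂ μ) (p q : ℕ) :
    ∀ᵐ w ∂(Measure.pi fun _ : Fin p => μ).prod (Measure.pi fun _ : Fin q => μ),
      ∀ i j, Good G₁ G₂ (w.1 i) (w.2 j) := by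
  refine ae_all_iff.2 fun i => ae_all_iff.2 fun j => ?_
  have h : ∀ᵐ w ∂μ.prod μ, Good G₁ G₂ w.1 w.2 :=
    (Measure.ae_prod_iff_ae_ae (measurableSet_good hG)).2 (Filter.Eventually.of_forall (ae_good hG))
  exact (QuasiMeasurePreserving.prodMap (Measure.quasiMeasurePreserving_eval (fun _ => μ) i)
    (Measure.quasiMeasurePreserving_eval (fun _ => μ) j)).ae h

theorem measurableSet_good_vertices (hG : IsMatchedPair G₁ G₂ μ) (p q : ℕ) :
    MeasurableSet {w : (Fin p → G) × (Fin q → G) | ∀ i j, Good G₁ G₂ (w.1 i) (w.2 j)} := by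
  simp only [Set.ofPred_forall]
  refine MeasurableSet.iInter fun i => MeasurableSet.iInter fun j => ?_
  exact (by fun_prop : Measurable fun w : (Fin p → G) × (Fin q → G) => (w.1 i, w.2 j))
    (measurableSet_good hG)

theorem good_vertices_inv (h : G₁ ⊓ G₂ = ⊥) {x y y' z z' : G} (hy : (x * y)⁻¹ * y' ∈ G₂)
    (hz : (x * z)⁻¹ * z' ∈ G₁) : Good G₁ G₂ y z ↔ Good G₁ G₂ y' z' := by
  rw [← good_mul_left x, good_congr h hy hz]

/-- A pulled back measure only sees the range of `colRow`. This range is conull because meeting of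
all cosets is an invariant property of vertices that holds almost everywhere. -/
theorem ae_colRow_iff (hG : IsMatchedPair G₁ G₂ μ) {p q : ℕ}
    {Q : (Fin p → G₁) × (Fin q → G₂) → Prop} :
    (∀ᵐ X ∂gridMeasure μ₁ μ₂ p q, Q (colRow X)) ↔
      ∀ᵐ w ∂(Measure.pi fun _ : Fin p => μ₁).prod (Measure.pi fun _ : Fin q => μ₂), Q w := by
  have hE := measurableEmbedding_colRow hG p q
  rw [gridMeasure, ← hE.ae_map_iff, hE.map_comap, Measure.restrict_eq_self_of_ae_mem]
  have := (ae_vertices_iff (μ₁ := μ₁) (μ₂ := μ₂) hG (measurableSet_good_vertices hG _ _) ?_).1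
    (ae_good_vertices (μ := μ) hG (p + 1) (q + 1))
  · filter_upwards [this] with w hw
    exact mem_range_colRow hG.inf_eq_bot hw
  · intro x y y' z z' hy hz
    exact forall_congr' fun i => forall_congr' fun j =>
      good_vertices_inv hG.inf_eq_bot (hy i) (hz j)

theorem ae_grid_iff (hG : IsMatchedPair G₁ G₂ μ) {p q : ℕ}
    {P : (Fin (p + 1) → G) × (Fin (q + 1) → G) → Prop} (hP : MeasurableSet {z | P z})
    (hinv : ∀ h y y' z z', (∀ i, (h * y i)⁻¹ * y' i ∈ G₂) → (∀ j, (h * z j)⁻¹ * z' j ∈ G₁) →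
      (P (y, z) ↔ P (y', z'))) :
    (∀ᵐ w ∂(Measure.pi fun _ => μ).prod (Measure.pi fun _ => μ), P w) ↔
      ∀ᵐ X ∂gridMeasure μ₁ μ₂ p q, P (fun i => gridVertex X i 0, fun j => gridVertex X 0 j) := by
  rw [ae_vertices_iff (μ₁ := μ₁) (μ₂ := μ₂) hG hP hinv, ← ae_colRow_iff hG]
  simp only [gridVertex_zero_right, gridVertex_zero_left, colRow, coe_partialProd]

end GridMeasure

/-! ### Invariant measurable cochains -/

section Invariant

variable {G : Type*} [Group G] {A : Type*} [AddCommGroup A] [DistribMulAction G A]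

/-- Invariance under left translations by `G`, under right translations by `G₂` in the second list
and under right translations by `G₁` in the third list. -/
def TriInvariant (G₁ G₂ : Subgroup G) (φ : TriCochain G A) : Prop :=
  ∀ (h : G) (a a' b b' c c' : List G), List.Forall₂ (fun x x' => x = h * x') a a' →
    List.Forall₂ (fun y y' => (h * y')⁻¹ * y ∈ G₂) b b' →
    List.Forall₂ (fun z z' => (h * z')⁻¹ * z ∈ G₁) c c' → φ a b c = h • φ a' b' c'

variable [MeasurableSpace G] [MeasurableSpace A] [MeasurableAdd₂ A] [MeasurableNeg A]

theorem measurable_zsmul_fun {X : Type*} [MeasurableSpace X] {n : X → ℤ} {f : X → A}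
    (hn : Measurable n) (hf : Measurable f) : Measurable fun x => n x • f x :=
  hn.smul hf

variable (A) in
/-- The measurable invariant cochains of total length `K`. -/
def adm (G₁ G₂ : Subgroup G) (K : ℕ) : AddSubgroup (TriCochain G A) where
  carrier := {φ | Measurable (fun w : List G × List G × List G => φ w.1 w.2.1 w.2.2) ∧
    TriInvariant G₁ G₂ φ ∧ ∀ a b c, a.length + b.length + c.length ≠ K → φ a b c = 0}
  add_mem' hφ hψ := ⟨hφ.1.add hψ.1,
    fun h a a' b b' c c' ha hb hc => by
      simp only [Pi.add_apply, hφ.2.1 h a a' b b' c c' ha hb hc, hψ.2.1 h a a' b b' c c' ha hb hc,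
        smul_add],
    fun a b c h => by simp [hφ.2.2 a b c h, hψ.2.2 a b c h]⟩
  zero_mem' := ⟨measurable_const, fun h a a' b b' c c' _ _ _ => by simp, fun _ _ _ _ => rfl⟩
  neg_mem' hφ := ⟨hφ.1.neg,
    fun h a a' b b' c c' ha hb hc => by
      simp only [Pi.neg_apply, hφ.2.1 h a a' b b' c c' ha hb hc, smul_neg],
    fun a b c h => by simp [hφ.2.2 a b c h]⟩

/-- Cochains that vanish when the first list is empty. -/
def supA : AddSubgroup (TriCochain G A) where
  carrier := {φ | ∀ b c, φ [] b c = 0}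
  add_mem' hφ hψ b c := by simp [hφ b c, hψ b c]
  zero_mem' _ _ := rfl
  neg_mem' hφ b c := by simp [hφ b c]

/-- Cochains that vanish when the second list is empty. -/
def supB : AddSubgroup (TriCochain G A) where
  carrier := {φ | ∀ a c, φ a [] c = 0}
  add_mem' hφ hψ b c := by simp [hφ b c, hψ b c]
  zero_mem' _ _ := rfl
  neg_mem' hφ b c := by simp [hφ b c]

/-- Cochains that vanish when the third list is empty. -/
def supC : AddSubgroup (TriCochain G A) where
  carrier := {φ | ∀ a b, φ a b [] = 0}
  add_mem' hφ hψ b c := by simp [hφ b c, hψ b c]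
  zero_mem' _ _ := rfl
  neg_mem' hφ b c := by simp [hφ b c]

/-- Cochains that vanish unless the second list is empty. -/
def supNoB : AddSubgroup (TriCochain G A) where
  carrier := {φ | ∀ a b c, b ≠ [] → φ a b c = 0}
  add_mem' hφ hψ a b c h := by simp [hφ a b c h, hψ a b c h]
  zero_mem' _ _ _ _ := rfl
  neg_mem' hφ a b c h := by simp [hφ a b c h]

variable {G₁ G₂ : Subgroup G} {K : ℕ} {φ : TriCochain G A}

theorem d₁_mem_adm (h : φ ∈ adm A G₁ G₂ K) : d₁ φ ∈ adm A G₁ G₂ (K + 1) := by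
  refine ⟨measurable_listD (f := fun a (r : List G × List G) => φ a r.1 r.2) h.1, ?_, ?_⟩
  · intro x a a' b b' c c' ha hb hc
    exact listD_rel (DistribSMul.toAddMonoidHom A x)
      (fun l l' hl => h.2.1 x _ _ _ _ _ _ hl hb hc) ha
  · intro a b c hne
    refine (listD_congr (ψ := fun _ => 0) fun l hl => h.2.2 _ _ _ ?_).trans (listD_zero' _)
    omega

theorem d₂_mem_adm (h : φ ∈ adm A G₁ G₂ K) : d₂ φ ∈ adm A G₁ G₂ (K + 1) := by
  refine ⟨?_, ?_, ?_⟩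
  · have h1 : Measurable fun z : List G × (List G × List G) => φ z.2.1 z.1 z.2.2 :=
      h.1.comp (measurable_snd.fst.prodMk (measurable_fst.prodMk measurable_snd.snd))
    exact (measurable_listD (f := fun b (r : List G × List G) => φ r.1 b r.2) h1).comp
      (measurable_snd.fst.prodMk (measurable_fst.prodMk measurable_snd.snd))
  · intro x a a' b b' c c' ha hb hc
    exact listD_rel (DistribSMul.toAddMonoidHom A x)
      (fun l l' hl => h.2.1 x _ _ _ _ _ _ ha hl hc) hb
  · intro a b c hne
    refine (listD_congr (ψ := fun _ => 0) fun l hl => h.2.2 _ _ _ ?_).trans (listD_zero' _)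
    omega

theorem d₃_mem_adm (h : φ ∈ adm A G₁ G₂ K) : d₃ φ ∈ adm A G₁ G₂ (K + 1) := by
  refine ⟨?_, ?_, ?_⟩
  · have h1 : Measurable fun z : List G × (List G × List G) => φ z.2.1 z.2.2 z.1 :=
      h.1.comp (measurable_snd.fst.prodMk (measurable_snd.snd.prodMk measurable_fst))
    exact (measurable_listD (f := fun c (r : List G × List G) => φ r.1 r.2 c) h1).comp
      (measurable_snd.snd.prodMk (measurable_fst.prodMk measurable_snd.fst))
  · intro x a a' b b' c c' ha hb hc
    exact listD_rel (DistribSMul.toAddMonoidHom A x)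
      (fun l l' hl => h.2.1 x _ _ _ _ _ _ ha hb hl) hc
  · intro a b c hne
    refine (listD_congr (ψ := fun _ => 0) fun l hl => h.2.2 _ _ _ ?_).trans (listD_zero' _)
    omega

/-- Multiplication by integers that depend on the lengths of the lists. -/
theorem smul_length_mem_adm (k : ℕ → ℕ → ℕ → ℤ) (h : φ ∈ adm A G₁ G₂ K) :
    (fun a b c => k a.length b.length c.length • φ a b c : TriCochain G A) ∈ adm A G₁ G₂ K := by
  refine ⟨?_, ?_, ?_⟩
  · refine measurable_zsmul_fun ?_ h.1
    have : Measurable fun n : ℕ × ℕ × ℕ => k n.1 n.2.1 n.2.2 := measurable_of_countable _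
    exact this.comp ((measurable_list_length.comp measurable_fst).prodMk
      ((measurable_list_length.comp measurable_snd.fst).prodMk
        (measurable_list_length.comp measurable_snd.snd)))
  · intro x a a' b b' c c' ha hb hc
    beta_reduce
    rw [h.2.1 x a a' b b' c c' ha hb hc, ha.length_eq, hb.length_eq, hc.length_eq]
    exact ((DistribSMul.toAddMonoidHom A x).map_zsmul _ _).symm
  · intro a b c hne
    beta_reduce
    rw [h.2.2 a b c hne, smul_zero]

theorem triD_mem_adm (ε : ℤ) (h : φ ∈ adm A G₁ G₂ K) : triD ε φ ∈ adm A G₁ G₂ (K + 1) :=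
  add_mem (add_mem (d₃_mem_adm h)
    (smul_length_mem_adm (fun _ _ n => ε * (-1) ^ (n + 1)) (d₂_mem_adm h)))
    (smul_length_mem_adm (fun _ m n => (-1) ^ (m + n)) (d₁_mem_adm h))

theorem triD_mem_supA (ε : ℤ) (h : φ ∈ supA) : triD ε φ ∈ supA := fun b c => by
  have h' (b c) : φ [] b c = 0 := h b c
  simp [triD_apply, d₁_apply, d₂_apply, d₃_apply, h', listD_zero']

theorem triD_mem_supB (ε : ℤ) (h : φ ∈ supB) : triD ε φ ∈ supB := fun b c => by
  have h' (b c) : φ b [] c = 0 := h b c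
  simp [triD_apply, d₁_apply, d₂_apply, d₃_apply, h', listD_zero']

theorem triD_mem_supC (ε : ℤ) (h : φ ∈ supC) : triD ε φ ∈ supC := fun b c => by
  have h' (b c) : φ b c [] = 0 := h b c
  simp [triD_apply, d₁_apply, d₂_apply, d₃_apply, h', listD_zero']

/-- The reason for the coefficient 0: the differential d₂ would leave the layer where the second
list is empty. -/
theorem triD_zero_mem_supNoB (h : φ ∈ supNoB) : triD 0 φ ∈ supNoB := fun a b c hb => by
  have h' (a c) : φ a b c = 0 := h a b c hb
  simp [triD_apply, d₁_apply, d₃_apply, h', listD_zero']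

end Invariant

/-! ### Null cochains -/

section Null

variable {G : Type*} [MeasurableSpace G] (μ : Measure G)
  {A : Type*} [AddCommGroup A]

/-- The measure on triples of lists. -/
noncomputable def triMeasure : Measure (List G × List G × List G) :=
  (listMeasure μ).prod ((listMeasure μ).prod (listMeasure μ))

/-- The cochains that vanish almost everywhere on lists whose lengths satisfy a condition. -/
def triNullOn (P : ℕ → ℕ → ℕ → Prop) : AddSubgroup (TriCochain G A) where
  carrier := {φ | ∀ᵐ w ∂triMeasure μ, P w.1.length w.2.1.length w.2.2.length →
    φ w.1 w.2.1 w.2.2 = 0}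
  add_mem' {φ ψ} hφ hψ := by
    change ∀ᵐ w ∂triMeasure μ, P w.1.length w.2.1.length w.2.2.length →
      (φ + ψ) w.1 w.2.1 w.2.2 = 0
    filter_upwards [hφ.out, hψ.out] with w h1 h2 hP
    simp [h1 hP, h2 hP]
  zero_mem' := by
    change ∀ᵐ w ∂triMeasure μ, P w.1.length w.2.1.length w.2.2.length →
      (0 : TriCochain G A) w.1 w.2.1 w.2.2 = 0
    exact Filter.Eventually.of_forall fun _ _ => rfl
  neg_mem' {φ} hφ := by
    change ∀ᵐ w ∂triMeasure μ, P w.1.length w.2.1.length w.2.2.length →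
      (-φ) w.1 w.2.1 w.2.2 = 0
    filter_upwards [hφ.out] with w h1 hP
    simp [h1 hP]

/-- The cochains that vanish almost everywhere. -/
abbrev triNull : AddSubgroup (TriCochain G A) := triNullOn μ fun _ _ _ => True

variable {μ} {φ : TriCochain G A} {P : ℕ → ℕ → ℕ → Prop}

theorem mem_triNullOn : φ ∈ triNullOn μ P ↔
    ∀ᵐ w ∂triMeasure μ, P w.1.length w.2.1.length w.2.2.length → φ w.1 w.2.1 w.2.2 = 0 := Iff.rfl

theorem mem_triNull : φ ∈ triNull μ ↔ ∀ᵐ w ∂triMeasure μ, φ w.1 w.2.1 w.2.2 = 0 := by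
  simp [triNull, mem_triNullOn]

theorem triNullOn_mono {Q : ℕ → ℕ → ℕ → Prop} (hPQ : ∀ i j k, Q i j k → P i j k)
    (h : φ ∈ triNullOn μ P) : φ ∈ triNullOn μ Q := by
  filter_upwards [mem_triNullOn.1 h] with w hw hQ
  exact hw (hPQ _ _ _ hQ)

theorem smul_length_mem_triNullOn (k : ℕ → ℕ → ℕ → ℤ) (h : φ ∈ triNullOn μ P) :
    (fun a b c => k a.length b.length c.length • φ a b c : TriCochain G A) ∈ triNullOn μ P := by
  filter_upwards [mem_triNullOn.1 h] with w hw hQ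
  rw [hw hQ, smul_zero]

variable [SigmaFinite μ]

theorem ae_triMeasure_b {Q : List G × List G × List G → Prop} :
    (∀ᵐ w ∂triMeasure μ, Q w) ↔ ∀ᵐ w ∂triMeasure μ, Q (w.2.1, w.1, w.2.2) := by
  have key {Q : List G × List G × List G → Prop} (h : ∀ᵐ w ∂triMeasure μ, Q w) :
      ∀ᵐ w ∂triMeasure μ, Q (w.2.1, w.1, w.2.2) := by
    have q : MeasurePreserving (fun z : List G × (List G × List G) => (z.2.1, (z.1, z.2.2)))
        (triMeasure μ) (triMeasure μ) :=
      (measurePreserving_prodAssoc _ _ _).comp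
        ((Measure.measurePreserving_swap.prod (MeasurePreserving.id _)).comp
          ((measurePreserving_prodAssoc _ _ _).symm MeasurableEquiv.prodAssoc))
    exact q.quasiMeasurePreserving.ae h
  exact ⟨key, fun h => key h⟩

theorem ae_triMeasure_c {Q : List G × List G × List G → Prop} :
    (∀ᵐ w ∂triMeasure μ, Q w) ↔ ∀ᵐ w ∂triMeasure μ, Q (w.2.1, w.2.2, w.1) := by
  have q : MeasurePreserving (fun z : List G × (List G × List G) => (z.2.1, (z.2.2, z.1)))
      (triMeasure μ) (triMeasure μ) :=
    (measurePreserving_prodAssoc _ _ _).comp Measure.measurePreserving_swap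
  refine ⟨fun h => q.quasiMeasurePreserving.ae h, fun h => ?_⟩
  have := q.quasiMeasurePreserving.ae (q.quasiMeasurePreserving.ae h)
  exact this

theorem ae_listD_of_ae {ρ : Type*} [MeasurableSpace ρ] (ν : Measure ρ) [SFinite ν] {S : ρ → Prop}
    {f : List G → ρ → A} (h : ∀ᵐ z ∂(listMeasure μ).prod ν, S z.2 → f z.1 z.2 = 0) :
    ∀ᵐ z ∂(listMeasure μ).prod ν, S z.2 → listD z.1 (fun l => f l z.2) = 0 := by
  classical
  have h' (n : ℕ) := ae_listD_eq_zero μ ν (f := fun l r => if S r then f l r else 0) (n := n) <| by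
    filter_upwards [h] with z hz _
    split_ifs with hS
    · exact hz hS
    · rfl
  filter_upwards [ae_all_iff.2 h'] with z hz hS
  simp only [hS, if_true] at hz
  rcases hz' : z.1 with _ | ⟨v, l⟩
  · simp
  · rw [← hz']
    exact hz l.length (by simp [hz'])

/-- This differential leaves the other two lists untouched, so vanishing on a range of their lengths
survives. That makes the filtrations by a single length usable. -/
theorem d₁_mem_triNullOn {S : ℕ → ℕ → Prop} (h : φ ∈ triNullOn μ fun _ j k => S j k) :
    d₁ φ ∈ triNullOn μ fun _ j k => S j k :=
  ae_listD_of_ae (μ := μ) _ (S := fun r : List G × List G => S r.1.length r.2.length)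
    (f := fun a r => φ a r.1 r.2) h

theorem d₂_mem_triNullOn {S : ℕ → ℕ → Prop} (h : φ ∈ triNullOn μ fun i _ k => S i k) :
    d₂ φ ∈ triNullOn μ fun i _ k => S i k := by
  rw [mem_triNullOn, ae_triMeasure_b] at h ⊢
  exact ae_listD_of_ae (μ := μ) _ (S := fun r : List G × List G => S r.1.length r.2.length)
    (f := fun b r => φ r.1 b r.2) h

theorem d₃_mem_triNullOn {S : ℕ → ℕ → Prop} (h : φ ∈ triNullOn μ fun i j _ => S i j) :
    d₃ φ ∈ triNullOn μ fun i j _ => S i j := by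
  rw [mem_triNullOn, ae_triMeasure_c] at h ⊢
  exact ae_listD_of_ae (μ := μ) _ (S := fun r : List G × List G => S r.1.length r.2.length)
    (f := fun c r => φ r.1 r.2 c) h

theorem triD_mem_triNull (ε : ℤ) (h : φ ∈ triNull μ) : triD ε φ ∈ triNull μ :=
  add_mem (add_mem (d₃_mem_triNullOn (S := fun _ _ => True) h)
    (smul_length_mem_triNullOn (fun _ _ n => ε * (-1) ^ (n + 1))
      (d₂_mem_triNullOn (S := fun _ _ => True) h)))
    (smul_length_mem_triNullOn (fun _ m n => (-1) ^ (m + n))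
      (d₁_mem_triNullOn (S := fun _ _ => True) h))

end Null

/-! ### Acyclicity -/

/-- A filtration argument, with `N n` read as being null in filtration degrees at least n. Each step
subtracts a coboundary to gain one degree, and D² = 0 keeps the hypothesis on `D e` intact; the
partial primitives are added up. -/
theorem exists_primitive {E : Type*} [AddCommGroup E] (D : E →+ E) (M N : ℕ → AddSubgroup E)
    (hD : ∀ K e, e ∈ M K → D e ∈ M (K + 1)) (hDD : ∀ e, D (D e) = 0)
    (step : ∀ n K e, e ∈ M (K + 1) → e ∈ N (n + 1) → D e ∈ N 0 → ∃ t ∈ M K, e - D t ∈ N n)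
    (n K : ℕ) (e : E) (he : e ∈ M (K + 1)) (hn : e ∈ N n) (hDe : D e ∈ N 0) :
    ∃ t ∈ M K, e - D t ∈ N 0 := by
  induction n generalizing e with
  | zero => exact ⟨0, zero_mem _, by simpa using hn⟩
  | succ n ih =>
    obtain ⟨t, ht, h⟩ := step n K e he hn hDe
    obtain ⟨t', ht', h'⟩ := ih (e - D t) (sub_mem he (hD _ _ ht)) h (by simpa [hDD] using hDe)
    exact ⟨t + t', add_mem ht ht', by rw [map_add, ← sub_sub]; exact h'⟩

theorem neg_one_pow_smul_smul {A : Type*} [AddCommGroup A] (n : ℕ) (x : A) : (-1 : ℤ) ^ n • (-1 : ℤ) ^ n • x = x := by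
  rw [smul_smul, ← mul_pow]; simp

theorem neg_one_pow_smul_eq_zero {A : Type*} [AddCommGroup A] (n : ℕ) {x : A} (h : (-1 : ℤ) ^ n • x = 0) : x = 0 := by
  rw [← neg_one_pow_smul_smul n x, h, smul_zero]

section Contraction

variable {G : Type*} [Group G] [MeasurableSpace G] [MeasurableMul₂ G]
  {μ : Measure G} [SigmaFinite μ] [μ.IsMulLeftInvariant] [NeZero μ]
  {A : Type*} [AddCommGroup A] [MeasurableSpace A] [MeasurableAdd₂ A] [MeasurableNeg A]
  [MeasurableSingletonClass A]

/-- A cocycle is almost everywhere the coboundary of its contraction by a generic point. -/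
theorem exists_contraction {ρ : Type*} [MeasurableSpace ρ] (ν : Measure ρ) [SFinite ν] {g : ρ → G}
    (hg : Measurable g) {e : List G → ρ → A}
    (he : Measurable fun z : List G × ρ => e z.1 z.2) {n : ℕ}
    (h : ∀ᵐ z ∂(listMeasure μ).prod ν, z.1.length = n + 1 → listD z.1 (fun l => e l z.2) = 0) :
    ∃ w : G, ∀ᵐ z ∂(listMeasure μ).prod ν, z.1.length = n →
      e z.1 z.2 = listD z.1 fun l => e ((g z.2 * w) :: l) z.2 := by
  -- With a generic head v, the cocycle identity on v :: l says that the defect `f v` of the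
  -- contraction by v vanishes.
  have h1 := ae_listMeasure_cons μ ν h
  let f : G → List G × ρ → A := fun v z => e z.1 z.2 - listD z.1 fun l => e (v :: l) z.2
  have hf : Measurable fun y : G × (List G × ρ) => f y.1 y.2 := by
    refine (he.comp measurable_snd).sub ?_
    have m : Measurable fun z : List G × (G × ρ) => e (z.2.1 :: z.1) z.2.2 :=
      he.comp ((measurable_list_cons.comp (measurable_snd.fst.prodMk measurable_fst)).prodMk
        measurable_snd.snd)
    exact (measurable_listD (f := fun l (r : G × ρ) => e (r.1 :: l) r.2) m).comp
      (measurable_snd.fst.prodMk (measurable_fst.prodMk measurable_snd.snd))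
  have h2 : ∀ᵐ y ∂μ.prod ((listMeasure μ).prod ν), y.2.1.length = n → f y.1 y.2 = 0 := by
    filter_upwards [h1] with y hy hn
    exact hy (by simp [hn])
  have hS : MeasurableSet {y : G × (List G × ρ) | y.2.1.length = n → f y.1 y.2 = 0} := by
    have m1 : MeasurableSet {y : G × (List G × ρ) | y.2.1.length = n} :=
      (measurable_list_length.comp measurable_snd.fst) (measurableSet_singleton n)
    have m2 : MeasurableSet {y : G × (List G × ρ) | f y.1 y.2 = 0} := hf (measurableSet_singleton 0)
    convert! m1.compl.union m2 using 1
    ext y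
    simp only [Set.mem_ofPred_eq, Set.mem_union, Set.mem_compl_iff]
    tauto
  have h3 : ∀ᵐ z ∂(listMeasure μ).prod ν, ∀ᵐ v ∂μ, z.1.length = n → f v z = 0 :=
    (Measure.ae_ae_comm hS).1 (Measure.ae_ae_of_ae_prod h2)
  -- For fixed z the generic v may be translated by g. After that Fubini gives one w valid for
  -- almost all z, and the inserted point g·w moves with the parameters, so equivariance of the
  -- contraction is possible.
  have h4 : ∀ᵐ z ∂(listMeasure μ).prod ν, ∀ᵐ v ∂μ, z.1.length = n → f (g z.2 * v) z = 0 := by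
    filter_upwards [h3] with z hz
    exact (measurePreserving_mul_left μ (g z.2)).quasiMeasurePreserving.ae hz
  have hS' : MeasurableSet
      {y : G × (List G × ρ) | y.2.1.length = n → f (g y.2.2 * y.1) y.2 = 0} :=
    (((hg.comp measurable_snd.snd).mul measurable_fst).prodMk measurable_snd :
      Measurable fun y : G × (List G × ρ) => (g y.2.2 * y.1, y.2)) hS
  obtain ⟨w, hw⟩ := ((Measure.ae_ae_comm
    (p := fun (v : G) (z : List G × ρ) => z.1.length = n → f (g z.2 * v) z = 0) hS').2 h4).exists
  refine ⟨w, ?_⟩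
  filter_upwards [hw] with z hz hn
  exact sub_eq_zero.1 (hz hn)

end Contraction

/-! ### Three acyclic pieces of the triple complex -/

section Acyclic

variable {G : Type*} [Group G] [TopologicalSpace G] [IsTopologicalGroup G]
  [T2Space G] [LocallyCompactSpace G] [SecondCountableTopology G] [MeasurableSpace G]
  [BorelSpace G] {G₁ G₂ : Subgroup G} {μ : Measure G} [μ.IsHaarMeasure]
  {A : Type*} [AddCommGroup A] [MeasurableSpace A] [MeasurableAdd₂ A] [MeasurableNeg A]
  [MeasurableSingletonClass A] [DistribMulAction G A] {K : ℕ} {e : TriCochain G A}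

theorem headD_rel {h : G} {a a' : List G} (ha : a ≠ [])
    (H : List.Forall₂ (fun x x' => x = h * x') a a') : a.headD 1 = h * a'.headD 1 := by
  cases H with
  | nil => exact absurd rfl ha
  | cons h1 _ => simpa using h1

omit [LocallyCompactSpace G] [T2Space G] [IsTopologicalGroup G] [SecondCountableTopology G] 
  [TopologicalSpace G] [BorelSpace G] [MeasurableSingletonClass A] in
theorem measurable_ite_length {X : Type*} [MeasurableSpace X] {P : X → Prop} [DecidablePred P]
    (hP : MeasurableSet {x | P x}) {f : X → A} (hf : Measurable f) :
    Measurable fun x => if P x then f x else 0 :=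
  Measurable.ite hP hf measurable_const

/-- Contraction of the second direction: a nonempty first list offers the equivariant point a₀w,
which is inserted in front of b. -/
theorem exists_triD_primitive_of_supA_supC (he : e ∈ adm A G₁ G₂ (K + 1)) (hA : e ∈ supA)
    (hC : e ∈ supC) (hD : triD 1 e ∈ triNull μ) :
    ∃ t ∈ adm A G₁ G₂ K, t ∈ supA ∧ t ∈ supC ∧ e - triD 1 t ∈ triNull μ := by
  -- The descent starts in degree K + 2, where the total length K + 1 leaves nothing to check.
  refine Exists.elim (exists_primitive (triD 1) (fun K => adm A G₁ G₂ K ⊓ (supA ⊓ supC))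
    (fun n => triNullOn μ fun _ j _ => n ≤ j)
    (fun K e he => ⟨triD_mem_adm 1 he.1, triD_mem_supA 1 he.2.1, triD_mem_supC 1 he.2.2⟩)
    (triD_triD 1) ?_ (K + 2) K e ⟨he, hA, hC⟩
    (mem_triNullOn.2 (Filter.Eventually.of_forall fun w hw => he.2.2 _ _ _ (by omega)))
    (triNullOn_mono (fun _ _ _ _ => trivial) hD)) ?_
  rotate_left
  · rintro t ⟨ht, h⟩
    exact ⟨t, ht.1, ht.2.1, ht.2.2, triNullOn_mono (fun _ _ _ _ => Nat.zero_le _) h⟩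
  · rintro n K e ⟨he, hA, hC⟩ hn hD
    -- On lists b of length n + 1 the terms with d₁ and d₃ are already null, so the total cocycle
    -- condition reduces to d₂.
    have hd₂ : ∀ᵐ w ∂triMeasure μ, w.2.1.length = n + 1 → d₂ e w.1 w.2.1 w.2.2 = 0 := by
      filter_upwards [mem_triNullOn.1 hD, mem_triNullOn.1 (d₁_mem_triNullOn hn),
        mem_triNullOn.1 (d₃_mem_triNullOn hn)] with w h h1 h3 hw
      have := h (Nat.zero_le _)
      rw [triD_apply, h1 hw.ge, h3 hw.ge, smul_zero, zero_add, add_zero, one_mul] at this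
      exact neg_one_pow_smul_eq_zero _ this
    rw [ae_triMeasure_b] at hd₂
    have me : Measurable fun z : List G × (List G × List G) => e z.2.1 z.1 z.2.2 :=
      he.1.comp (measurable_snd.fst.prodMk (measurable_fst.prodMk measurable_snd.snd))
    obtain ⟨w, hw⟩ := exists_contraction (μ := μ) ((listMeasure μ).prod (listMeasure μ))
      (g := fun r : List G × List G => r.1.headD 1)
      ((measurable_list_headD 1).comp measurable_fst) (e := fun b r => e r.1 b r.2) me hd₂
    -- The sign is that of d₂ in `triD`. For n = 0 no list qualifies and t = 0; there the
    -- contraction identity says directly that e is null, since its right side is a differential on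
    -- the empty list.
    let t : TriCochain G A := fun a b c =>
      if b.length + 1 = n then (-1 : ℤ) ^ (c.length + 1) • e a ((a.headD 1 * w) :: b) c else 0
    refine ⟨t, ⟨⟨?_, ?_, ?_⟩, ?_, ?_⟩, ?_⟩
    · refine measurable_ite_length ?_ ?_
      · exact (measurable_list_length.comp measurable_snd.fst)
          (measurableSet_eq_fun (measurable_id.add_const 1) measurable_const)
      · refine measurable_zsmul_fun ?_ (he.1.comp (f := fun v : List G × List G × List G => 
          (v.1, (v.1.headD 1 * w) :: v.2.1, v.2.2)) ?_)
        · exact (measurable_of_countable fun n : ℕ => (-1 : ℤ) ^ (n + 1)).comp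
            (measurable_list_length.comp measurable_snd.snd)
        · exact measurable_fst.prodMk ((measurable_list_cons.comp
            ((((measurable_list_headD 1).comp measurable_fst).mul_const w).prodMk
              measurable_snd.fst)).prodMk measurable_snd.snd)
    · intro h a a' b b' c c' ha hb hc
      simp only [t, hb.length_eq, hc.length_eq]
      split_ifs
      -- For empty a the default head 1 is not equivariant, but there e vanishes.
      · by_cases ha0 : a = []
        · subst ha0
          cases ha
          rw [hA, hA]; simp
        · rw [he.2.1 h a a' _ ((a'.headD 1 * w) :: b') c c' ha (List.Forall₂.cons ?_ hb) hc]
          · exact ((DistribSMul.toAddMonoidHom A h).map_zsmul _ _).symm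
          · rw [headD_rel ha0 ha]; simp [mul_assoc]
      · simp
    · intro a b c hne
      simp only [t]
      rw [he.2.2, smul_zero, ite_self]
      simp only [List.length_cons]; omega
    · intro b c
      simp only [t]
      rw [hA, smul_zero, ite_self]
    · intro a b
      simp only [t]
      rw [hC, smul_zero, ite_self]
    · rw [mem_triNullOn]
      replace hw := (ae_triMeasure_b (Q := fun w' : List G × List G × List G => w'.2.1.length = n →
        e w'.1 w'.2.1 w'.2.2 = listD w'.2.1 fun l => e w'.1 ((w'.1.headD 1 * w) :: l) w'.2.2)).2 hw
      filter_upwards [hw, mem_triNullOn.1 hn] with ⟨a, b, c⟩ h h' hb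
      simp only at h h' hb
      simp only [Pi.sub_apply, triD_apply, one_mul]
      have t0 (a' c') : t a' b c' = 0 := if_neg (by omega)
      rw [d₁_apply, d₃_apply]
      simp only [t0, listD_zero', smul_zero, zero_add, add_zero]
      rw [d₂_apply]
      rcases hb.eq_or_lt with hb' | hb'
      · rw [listD_congr (ψ := fun l => (-1 : ℤ) ^ (c.length + 1) • e a ((a.headD 1 * w) :: l) c),
          listD_zsmul', neg_one_pow_smul_smul, h hb'.symm, sub_self]
        intro l hl
        exact if_pos (by omega)
      · rw [h' hb', listD_congr (ψ := fun _ => 0), listD_zero', smul_zero, sub_zero]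
        intro l hl
        exact if_neg (by omega)

/-- Contraction of the third direction inside the layer of empty b, again by the point a₀w. The
third list may be empty here, so that group cochains occur at the end of this complex. -/
theorem exists_triD_primitive_of_supA_supNoB (he : e ∈ adm A G₁ G₂ (K + 1)) (hA : e ∈ supA)
    (hB : e ∈ supNoB) (hD : triD 0 e ∈ triNull μ) :
    ∃ t ∈ adm A G₁ G₂ K, t ∈ supA ∧ t ∈ supNoB ∧ e - triD 0 t ∈ triNull μ := by
  refine Exists.elim (exists_primitive (triD 0) (fun K => adm A G₁ G₂ K ⊓ (supA ⊓ supNoB))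
    (fun n => triNullOn μ fun _ _ k => n ≤ k)
    (fun K e he => ⟨triD_mem_adm 0 he.1, triD_mem_supA 0 he.2.1, triD_zero_mem_supNoB he.2.2⟩)
    (triD_triD 0) ?_ (K + 2) K e ⟨he, hA, hB⟩
    (mem_triNullOn.2 (Filter.Eventually.of_forall fun w hw => he.2.2 _ _ _ (by omega)))
    (triNullOn_mono (fun _ _ _ _ => trivial) hD)) ?_
  rotate_left
  · rintro t ⟨ht, h⟩
    exact ⟨t, ht.1, ht.2.1, ht.2.2, triNullOn_mono (fun _ _ _ _ => Nat.zero_le _) h⟩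
  · rintro n K e ⟨he, hA, hB⟩ hn hD
    have hd₃ : ∀ᵐ w ∂triMeasure μ, w.2.2.length = n + 1 → d₃ e w.1 w.2.1 w.2.2 = 0 := by
      filter_upwards [mem_triNullOn.1 hD, mem_triNullOn.1 (d₁_mem_triNullOn hn)] with w h h1 hw
      have := h (Nat.zero_le _)
      rwa [triD_apply, h1 hw.ge, smul_zero, add_zero, zero_mul, zero_smul, add_zero] at this
    rw [ae_triMeasure_c] at hd₃
    have me : Measurable fun z : List G × (List G × List G) => e z.2.1 z.2.2 z.1 :=
      he.1.comp (measurable_snd.fst.prodMk (measurable_snd.snd.prodMk measurable_fst))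
    obtain ⟨w, hw⟩ := exists_contraction (μ := μ) ((listMeasure μ).prod (listMeasure μ))
      (g := fun r : List G × List G => r.1.headD 1)
      ((measurable_list_headD 1).comp measurable_fst) (e := fun c r => e r.1 r.2 c) me hd₃
    let t : TriCochain G A := fun a b c =>
      if c.length + 1 = n then e a b ((a.headD 1 * w) :: c) else 0
    refine ⟨t, ⟨⟨?_, ?_, ?_⟩, ?_, ?_⟩, ?_⟩
    · refine measurable_ite_length ?_ (he.1.comp (f := fun v : List G × List G × List G => 
        (v.1, v.2.1, (v.1.headD 1 * w) :: v.2.2)) ?_)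
      · exact (measurable_list_length.comp measurable_snd.snd)
          (measurableSet_eq_fun (measurable_id.add_const 1) measurable_const)
      · exact measurable_fst.prodMk (measurable_snd.fst.prodMk (measurable_list_cons.comp
            ((((measurable_list_headD 1).comp measurable_fst).mul_const w).prodMk
              measurable_snd.snd)))
    · intro h a a' b b' c c' ha hb hc
      simp only [t, hc.length_eq]
      split_ifs
      · by_cases ha0 : a = []
        · subst ha0
          cases ha
          rw [hA, hA]; simp
        · rw [he.2.1 h a a' b b' _ ((a'.headD 1 * w) :: c') ha hb (List.Forall₂.cons ?_ hc)]
          rw [headD_rel ha0 ha]; simp [mul_assoc]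
      · simp
    · intro a b c hne
      simp only [t]
      rw [he.2.2, ite_self]
      simp only [List.length_cons]; omega
    · intro b c
      simp only [t]
      rw [hA, ite_self]
    · intro a b c hb
      simp only [t]
      rw [hB _ _ _ hb, ite_self]
    · rw [mem_triNullOn]
      replace hw := (ae_triMeasure_c (Q := fun w' : List G × List G × List G => w'.2.2.length = n →
        e w'.1 w'.2.1 w'.2.2 = listD w'.2.2 fun l => e w'.1 w'.2.1 ((w'.1.headD 1 * w) :: l))).2 hw
      filter_upwards [hw, mem_triNullOn.1 hn] with ⟨a, b, c⟩ h h' hc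
      simp only at h h' hc
      simp only [Pi.sub_apply, triD_apply, zero_mul, zero_smul, add_zero]
      have t0 (a' b') : t a' b' c = 0 := if_neg (by omega)
      rw [d₁_apply]
      simp only [t0, listD_zero', smul_zero, add_zero]
      rw [d₃_apply]
      rcases hc.eq_or_lt with hc' | hc'
      · rw [listD_congr (ψ := fun l => e a b ((a.headD 1 * w) :: l)), h hc'.symm, sub_self]
        intro l hl
        exact if_pos (by omega)
      · rw [h' hc', listD_congr (ψ := fun _ => 0), listD_zero', sub_zero]
        intro l hl
        exact if_neg (by omega)

theorem ae_good_headD (hG : IsMatchedPair G₁ G₂ μ) :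
    ∀ᵐ r ∂(listMeasure μ).prod (listMeasure μ), r.1 ≠ [] → r.2 ≠ [] →
      Good G₁ G₂ (r.1.headD 1) (r.2.headD 1) := by
  refine (ae_listMeasure_prod μ _).2 fun n => ?_
  rw [ae_prod_swap_iff]
  refine (ae_listMeasure_prod μ _).2 fun m => ?_
  rcases n with _ | n
  · exact Filter.Eventually.of_forall fun w h => absurd (by simp) h
  rcases m with _ | m
  · exact Filter.Eventually.of_forall fun w _ h => absurd (by simp) h
  rw [ae_prod_swap_iff]
  filter_upwards [ae_good_vertices hG (n + 1) (m + 1)] with w hw _ _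
  simpa [List.ofFn_succ] using hw 0 0

/-- Contraction of the first direction. The equivariant point is now the common vertex of the cosets
of b₀ and c₀, times w; of the three acyclicity statements only this one uses the matched pair. -/
theorem exists_triD_primitive_of_supB_supC (hG : IsMatchedPair G₁ G₂ μ)
    (he : e ∈ adm A G₁ G₂ (K + 1)) (hB : e ∈ supB)
    (hC : e ∈ supC) (hD : triD 1 e ∈ triNull μ) :
    ∃ t ∈ adm A G₁ G₂ K, t ∈ supB ∧ t ∈ supC ∧ e - triD 1 t ∈ triNull μ := by
  classical
  refine Exists.elim (exists_primitive (triD 1) (fun K => adm A G₁ G₂ K ⊓ (supB ⊓ supC))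
    (fun n => triNullOn μ fun i _ _ => n ≤ i)
    (fun K e he => ⟨triD_mem_adm 1 he.1, triD_mem_supB 1 he.2.1, triD_mem_supC 1 he.2.2⟩)
    (triD_triD 1) ?_ (K + 2) K e ⟨he, hB, hC⟩
    (mem_triNullOn.2 (Filter.Eventually.of_forall fun w hw => he.2.2 _ _ _ (by omega)))
    (triNullOn_mono (fun _ _ _ _ => trivial) hD)) ?_
  rotate_left
  · rintro t ⟨ht, h⟩
    exact ⟨t, ht.1, ht.2.1, ht.2.2, triNullOn_mono (fun _ _ _ _ => Nat.zero_le _) h⟩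
  · rintro n K e ⟨he, hB, hC⟩ hn hD
    have hd₁ : ∀ᵐ w ∂triMeasure μ, w.1.length = n + 1 → d₁ e w.1 w.2.1 w.2.2 = 0 := by
      filter_upwards [mem_triNullOn.1 hD, mem_triNullOn.1 (d₂_mem_triNullOn hn),
        mem_triNullOn.1 (d₃_mem_triNullOn hn)] with w h h2 h3 hw
      have := h (Nat.zero_le _)
      rw [triD_apply, h2 hw.ge, h3 hw.ge, smul_zero, zero_add, zero_add] at this
      exact neg_one_pow_smul_eq_zero _ this
    have mheads : Measurable fun r : List G × List G => (r.1.headD 1, r.2.headD 1) :=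
      ((measurable_list_headD 1).comp measurable_fst).prodMk
        ((measurable_list_headD 1).comp measurable_snd)
    have mg : Measurable fun r : List G × List G => vert G₁ G₂ (r.1.headD 1) (r.2.headD 1) :=
      (measurable_vert hG).comp mheads
    obtain ⟨w, hw⟩ := exists_contraction (μ := μ) ((listMeasure μ).prod (listMeasure μ))
      mg (e := fun a r => e a r.1 r.2) he.1 hd₁
    -- The cut-off to heads with a common vertex makes t equivariant everywhere; it removes only a
    -- null set of nonempty lists.
    let t : TriCochain G A := fun a b c =>
      if a.length + 1 = n ∧ Good G₁ G₂ (b.headD 1) (c.headD 1) then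
        (-1 : ℤ) ^ (b.length + c.length) • e ((vert G₁ G₂ (b.headD 1) (c.headD 1) * w) :: a) b c
      else 0
    refine ⟨t, ⟨⟨?_, ?_, ?_⟩, ?_, ?_⟩, ?_⟩
    · refine measurable_ite_length ?_ ?_
      · exact MeasurableSet.inter ((measurable_list_length.comp measurable_fst)
          (measurableSet_eq_fun (measurable_id.add_const 1) measurable_const))
          ((mheads.comp measurable_snd) (measurableSet_good hG))
      · refine measurable_zsmul_fun ?_ (he.1.comp (f := fun v : List G × List G × List G => 
          ((vert G₁ G₂ (v.2.1.headD 1) (v.2.2.headD 1) * w) :: v.1, v.2)) ?_)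
        · exact (measurable_of_countable fun n : ℕ × ℕ => (-1 : ℤ) ^ (n.1 + n.2)).comp
            ((measurable_list_length.comp measurable_snd.fst).prodMk
              (measurable_list_length.comp measurable_snd.snd))
        · exact (measurable_list_cons.comp
            (((mg.comp measurable_snd).mul_const w).prodMk measurable_fst)).prodMk measurable_snd
    · intro h a a' b b' c c' ha hb hc
      cases hb with
      | nil => simp only [t]; rw [hB, hB]; simp
      | @cons y y' b b' hy hb =>
      cases hc with
      | nil => simp only [t]; rw [hC, hC]; simp
      | @cons z z' c c' hz hc =>
      have hgg : Good G₁ G₂ y z ↔ Good G₁ G₂ y' z' :=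
        (good_vertices_inv hG.inf_eq_bot hy hz).symm
      by_cases hif : a'.length + 1 = n ∧ Good G₁ G₂ y' z'
      · have hv : vert G₁ G₂ y z = h * vert G₁ G₂ y' z' := by
          rw [← vert_mul_left]
          exact (vert_congr hG.inf_eq_bot hy hz ((good_mul_left h _ _).2 hif.2)).2
        have e1 : t a (y :: b) (z :: c) = _ := if_pos ⟨ha.length_eq ▸ hif.1, hgg.2 hif.2⟩
        have e2 : t a' (y' :: b') (z' :: c') = _ := if_pos hif
        simp only [List.headD_cons] at e1 e2
        rw [e1, e2, he.2.1 h _ ((vert G₁ G₂ y' z' * w) :: a') _ (y' :: b') _ (z' :: c')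
          (List.Forall₂.cons (by rw [hv, mul_assoc]) ha) (List.Forall₂.cons hy hb)
          (List.Forall₂.cons hz hc)]
        simp only [List.length_cons, hb.length_eq, hc.length_eq]
        exact ((DistribSMul.toAddMonoidHom A h).map_zsmul _ _).symm
      · have e1 : t a (y :: b) (z :: c) = 0 :=
          if_neg fun h' => hif ⟨ha.length_eq ▸ h'.1, hgg.1 h'.2⟩
        have e2 : t a' (y' :: b') (z' :: c') = 0 := if_neg hif
        rw [e1, e2, smul_zero]
    · intro a b c hne
      simp only [t]
      rw [he.2.2, smul_zero, ite_self]
      simp only [List.length_cons]; omega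
    · intro a c
      simp only [t]
      rw [hB, smul_zero, ite_self]
    · intro a b
      simp only [t]
      rw [hC, smul_zero, ite_self]
    · rw [mem_triNullOn]
      have hgood : ∀ᵐ w' ∂triMeasure μ, w'.2.1 ≠ [] → w'.2.2 ≠ [] →
          Good G₁ G₂ (w'.2.1.headD 1) (w'.2.2.headD 1) :=
        Measure.quasiMeasurePreserving_snd.ae (ae_good_headD hG)
      filter_upwards [hw, mem_triNullOn.1 hn, hgood] with ⟨a, b, c⟩ h h' hg ha
      simp only at h h' ha hg
      -- If b or c is empty there is no vertex to insert, but e and the coboundary of t vanish by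
      -- their support.
      by_cases hb0 : b = []
      · subst hb0
        have hB' := sub_mem (H := (supB : AddSubgroup (TriCochain G A))) hB
          (triD_mem_supB 1 (φ := t) fun a c => by simp only [t]; rw [hB, smul_zero, ite_self])
        exact hB' a c
      by_cases hc0 : c = []
      · subst hc0
        have hC' := sub_mem (H := (supC : AddSubgroup (TriCochain G A))) hC
          (triD_mem_supC 1 (φ := t) fun a c => by simp only [t]; rw [hC, smul_zero, ite_self])
        exact hC' a b
      have hg' := hg hb0 hc0
      simp only [Pi.sub_apply, triD_apply, one_mul]
      have t0 (b' c') : t a b' c' = 0 := if_neg (by omega)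
      rw [d₂_apply, d₃_apply]
      simp only [t0, listD_zero', smul_zero, zero_add]
      rw [d₁_apply]
      rcases ha.eq_or_lt with ha' | ha'
      · rw [listD_congr (ψ := fun l => (-1 : ℤ) ^ (b.length + c.length) •
          e ((vert G₁ G₂ (b.headD 1) (c.headD 1) * w) :: l) b c),
          listD_zsmul', neg_one_pow_smul_smul, h ha'.symm, sub_self]
        intro l hl
        exact if_pos ⟨by omega, hg'⟩
      · rw [h' ha', listD_congr (ψ := fun _ => 0), listD_zero', smul_zero, sub_zero]
        intro l hl
        exact if_neg (by omega)

end Acyclic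

/-! ### Homogeneous cochains -/

section Homogeneous

variable {G : Type*} [Group G] {A : Type*} [AddCommGroup A] [DistribMulAction G A]

theorem exists_eq_ofFn {α : Type*} {l : List α} {n : ℕ} (h : l.length = n) :
    ∃ x : Fin n → α, l = List.ofFn x := by
  subst h; exact ⟨l.get, (List.ofFn_get l).symm⟩

theorem forall₂_ofFn_iff {α β : Type*} {R : α → β → Prop} {n : ℕ} {x : Fin n → α} {y : Fin n → β} :
    List.Forall₂ R (List.ofFn x) (List.ofFn y) ↔ ∀ i, R (x i) (y i) := by
  induction n with
  | zero => simp
  | succ n ih =>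
    rw [List.ofFn_succ, List.ofFn_succ, List.forall₂_cons, ih, Fin.forall_fin_succ]

/-- The successive quotients of a family of group elements. -/
def edges {n : ℕ} (x : Fin (n + 1) → G) (i : Fin n) : G := (x i.castSucc)⁻¹ * x i.succ

theorem edges_mul_left {n : ℕ} (h : G) (x : Fin (n + 1) → G) :
    edges (fun i => h * x i) = edges x := by
  funext i; simp [edges, mul_assoc]

theorem edges_partialProd {n : ℕ} (x : Fin n → G) : edges (Fin.partialProd x) = x := by
  funext i; simp [edges, Fin.partialProd_succ]

theorem partialProd_edges {n : ℕ} (x : Fin (n + 1) → G) (i : Fin (n + 1)) :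
    x 0 * Fin.partialProd (edges x) i = x i := by
  induction i using Fin.induction with
  | zero => simp
  | succ i ih => rw [Fin.partialProd_succ, ← mul_assoc, ih]; simp [edges]

/-- An instance of `face_comm`: a strip of squares whose upper edges are all 1, with the given
points as its vertical edges. -/
theorem face_edges {n : ℕ} (x : Fin (n + 2) → G) (k : Fin (n + 2)) :
    face k (edges x) = edges fun i => x (k.succAbove i) := by
  funext j
  have := face_comm (fun _ => 1) (edges x) x (fun j => by simp [edges]) k j
  have h1 : face k (fun _ : Fin (n + 1) => (1 : G)) j = 1 := by
    refine Fin.cases ?_ (fun m => ?_) k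
    · simp [face]
    · simp only [face, Fin.cases_succ]
      unfold Fin.contractNth
      split_ifs <;> simp
  rw [h1, one_mul] at this
  rw [edges, this, inv_mul_cancel_left]

/-- The invariant homogeneous cochain of an inhomogeneous cochain, as a cochain of three
lists that is supported where the last two are empty. -/
def homCochain (n : ℕ) : ((Fin n → G) → A) →+ TriCochain G A where
  toFun f a b c := if a.length = n + 1 ∧ b.length = 0 ∧ c.length = 0 then
    a.headD 1 • f (edges fun i : Fin (n + 1) => a.getD i 1) else 0
  map_zero' := by ext; simp
  map_add' f f' := by
    ext
    simp only [Pi.add_apply, smul_add]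
    split_ifs <;> simp

theorem homCochain_ofFn {n : ℕ} (f : (Fin n → G) → A) (x : Fin (n + 1) → G) :
    homCochain n f (List.ofFn x) [] [] = x 0 • f (edges x) := by
  have h1 : (List.ofFn x).headD 1 = x 0 := by rw [List.ofFn_succ]; rfl
  have h2 : (fun i : Fin (n + 1) => (List.ofFn x).getD i 1) = x := by
    funext i
    rw [List.getD_eq_getElem _ _ (by rw [List.length_ofFn]; exact i.2), List.getElem_ofFn]
  refine (if_pos (by simp)).trans ?_
  rw [h1, h2]

theorem homCochain_eq_zero {n : ℕ} (f : (Fin n → G) → A) {a b c : List G}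
    (h : ¬(a.length = n + 1 ∧ b.length = 0 ∧ c.length = 0)) : homCochain n f a b c = 0 :=
  if_neg h

theorem homCochain_nil {n : ℕ} (f : (Fin n → G) → A) (b c : List G) :
    homCochain n f [] b c = 0 := homCochain_eq_zero f (by simp)

theorem triInvariant_homCochain {G₁ G₂ : Subgroup G} {n : ℕ} (f : (Fin n → G) → A) :
    TriInvariant G₁ G₂ (homCochain n f) := by
  intro h a a' b b' c c' ha hb hc
  by_cases hl : a'.length = n + 1 ∧ b'.length = 0 ∧ c'.length = 0
  · obtain ⟨x', rfl⟩ := exists_eq_ofFn hl.1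
    obtain ⟨x, rfl⟩ := exists_eq_ofFn (ha.length_eq.trans hl.1)
    obtain rfl := List.length_eq_zero_iff.1 hl.2.1
    obtain rfl := List.length_eq_zero_iff.1 hl.2.2
    obtain rfl := List.length_eq_zero_iff.1 hb.length_eq
    obtain rfl := List.length_eq_zero_iff.1 hc.length_eq
    obtain rfl : x = fun i => h * x' i := funext ((forall₂_ofFn_iff (R := fun x x' => x = h * x')).1 ha)
    rw [homCochain_ofFn, homCochain_ofFn, edges_mul_left, mul_smul]
  · rw [homCochain_eq_zero f hl, homCochain_eq_zero f, smul_zero]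
    rwa [ha.length_eq, hb.length_eq, hc.length_eq]

/-- The usual passage from homogeneous to inhomogeneous cochains: omitting x₀ changes the base point
from x₀ to x₁ = x₀g₀, which produces the action of g₀ in the zeroth term. -/
theorem d₁_homCochain {n : ℕ} (f : (Fin n → G) → A) :
    d₁ (homCochain n f) = homCochain (n + 1) (groupD G A n f) := by
  funext a b c
  rw [d₁_apply]
  by_cases hl : a.length = n + 2 ∧ b.length = 0 ∧ c.length = 0
  · obtain ⟨x, rfl⟩ := exists_eq_ofFn hl.1
    obtain rfl := List.length_eq_zero_iff.1 hl.2.1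
    obtain rfl := List.length_eq_zero_iff.1 hl.2.2
    rw [listD_ofFn, homCochain_ofFn, Fin.sum_univ_succ]
    simp only [homCochain_ofFn, ← face_edges]
    simp only [groupD, AddMonoidHom.coe_mk, ZeroHom.coe_mk, smul_add, Finset.smul_sum]
    congr 1
    · simp [edges, smul_smul]
    · refine Finset.sum_congr rfl fun k _ => ?_
      rw [Fin.succ_succAbove_zero, Fin.val_succ]
      exact ((DistribSMul.toAddMonoidHom A (x 0)).map_zsmul _ _).symm
  · rw [homCochain_eq_zero _ hl]
    refine (listD_congr (ψ := fun _ => 0) fun l h => ?_).trans (listD_zero' _)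
    refine homCochain_eq_zero f fun h' => hl ⟨?_, h'.2⟩
    omega

/-- Equivariance moves the first point to 1; the remaining points are then the partial products of
the edges. -/
theorem eq_homCochain {G₁ G₂ : Subgroup G} {n : ℕ} {φ : TriCochain G A}
    (h : TriInvariant G₁ G₂ φ)
    (hs : ∀ a b c, ¬(a.length = n + 1 ∧ b.length = 0 ∧ c.length = 0) → φ a b c = 0) :
    φ = homCochain n fun g => φ (List.ofFn (Fin.partialProd g)) [] [] := by
  funext a b c
  by_cases hl : a.length = n + 1 ∧ b.length = 0 ∧ c.length = 0
  · obtain ⟨x, rfl⟩ := exists_eq_ofFn hl.1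
    obtain rfl := List.length_eq_zero_iff.1 hl.2.1
    obtain rfl := List.length_eq_zero_iff.1 hl.2.2
    rw [homCochain_ofFn]
    exact h (x 0) _ _ _ _ _ _ (forall₂_ofFn_iff.2 fun i => (partialProd_edges x i).symm)
      List.Forall₂.nil List.Forall₂.nil
  · rw [homCochain_eq_zero _ hl, hs a b c hl]

end Homogeneous

/-! ### Measurability and null sets of homogeneous cochains -/

section MeasurableHomogeneous

variable {G : Type*} [Group G] [MeasurableSpace G] {A : Type*} [AddCommGroup A]
  [DistribMulAction G A] [MeasurableSpace A] [MeasurableAdd₂ A] [MeasurableNeg A]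

theorem ae_triMeasure_iff (μ : Measure G) [SigmaFinite μ]
    {Q : List G × List G × List G → Prop} :
    (∀ᵐ w ∂triMeasure μ, Q w) ↔ ∀ m p q : ℕ,
      ∀ᵐ w ∂(Measure.pi fun _ : Fin m => μ).prod
        ((Measure.pi fun _ : Fin p => μ).prod (Measure.pi fun _ : Fin q => μ)),
        Q (List.ofFn w.1, List.ofFn w.2.1, List.ofFn w.2.2) := by
  unfold triMeasure
  rw [ae_listMeasure_prod]
  refine forall_congr' fun m => ?_
  rw [ae_prod_swap_iff]
  have h1 {P : (List G × List G) × (Fin m → G) → Prop} :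
      (∀ᵐ w ∂((listMeasure μ).prod (listMeasure μ)).prod (Measure.pi fun _ : Fin m => μ), P w) ↔
      ∀ᵐ w ∂(listMeasure μ).prod ((listMeasure μ).prod (Measure.pi fun _ : Fin m => μ)),
        P ((w.1, w.2.1), w.2.2) := by
    rw [← Measure.prodAssoc_prod (μ := listMeasure μ), MeasurableEquiv.prodAssoc.measurableEmbedding.ae_map_iff]
    rfl
  rw [h1, ae_listMeasure_prod]
  refine forall_congr' fun p => ?_
  have h2 {P : (Fin p → G) × (List G × (Fin m → G)) → Prop} :
      (∀ᵐ w ∂(Measure.pi fun _ : Fin p => μ).prod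
        ((listMeasure μ).prod (Measure.pi fun _ : Fin m => μ)), P w) ↔
      ∀ᵐ w ∂(listMeasure μ).prod ((Measure.pi fun _ : Fin m => μ).prod
        (Measure.pi fun _ : Fin p => μ)), P (w.2.2, w.1, w.2.1) := by
    rw [ae_prod_swap_iff, ← Measure.prodAssoc_prod (μ := listMeasure μ),
      MeasurableEquiv.prodAssoc.measurableEmbedding.ae_map_iff]
    rfl
  rw [h2, ae_listMeasure_prod]
  refine forall_congr' fun q => ?_
  rw [ae_prod_swap_iff (μ := Measure.pi fun _ : Fin q => μ),
    ← Measure.prodAssoc_prod (μ := Measure.pi fun _ : Fin m => μ),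
    MeasurableEquiv.prodAssoc.measurableEmbedding.ae_map_iff]
  rfl

theorem ae_prod_fst_iff {X Y : Type*} [MeasurableSpace X] [MeasurableSpace Y] (μ : Measure X)
    (ν : Measure Y) [SFinite μ] [SFinite ν] [NeZero ν] {P : X → Prop} :
    (∀ᵐ z ∂μ.prod ν, P z.1) ↔ ∀ᵐ x ∂μ, P x := by
  refine ⟨fun h => ?_, fun h => Measure.quasiMeasurePreserving_fst.ae h⟩
  filter_upwards [Measure.ae_ae_of_ae_prod h] with x hx
  simpa using hx

variable [MeasurableMul₂ G] [MeasurableInv G]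

theorem measurable_edges {n : ℕ} : Measurable (edges : (Fin (n + 1) → G) → Fin n → G) :=
  measurable_pi_lambda _ fun _ => (measurable_pi_apply _).inv.mul (measurable_pi_apply _)

theorem homCochain_mem_adm [MeasurableSMul₂ G A] (G₁ G₂ : Subgroup G) {n : ℕ}
    {f : (Fin n → G) → A} (hf : Measurable f) :
    homCochain n f ∈ adm A G₁ G₂ (n + 1) := by
  refine ⟨measurable_ite_length ?_ ?_, triInvariant_homCochain f, fun a b c h => ?_⟩
  · have h1 : Measurable fun w : List G × List G × List G =>
        (w.1.length, w.2.1.length, w.2.2.length) :=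
      (measurable_list_length.comp measurable_fst).prodMk
        ((measurable_list_length.comp measurable_snd.fst).prodMk
          (measurable_list_length.comp measurable_snd.snd))
    exact h1 (t := {k : ℕ × ℕ × ℕ | k.1 = n + 1 ∧ k.2.1 = 0 ∧ k.2.2 = 0}) .of_discrete
  · refine Measurable.comp (g := fun a : List G =>
      a.headD 1 • f (edges fun i : Fin (n + 1) => a.getD i 1)) ?_ measurable_fst
    refine (measurable_list_headD 1).smul (hf.comp (measurable_edges.comp ?_))
    refine measurable_pi_lambda _ fun i => measurable_list fun m => ?_
    by_cases h : (i : ℕ) < m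
    · simpa [List.getD_eq_getElem?_getD, h] using
        measurable_pi_apply (X := fun _ : Fin m => G) ⟨i, h⟩
    · simp [List.getD_eq_getElem?_getD, h]
  · exact homCochain_eq_zero f fun h' => h (by omega)

theorem measurable_of_adm {G₁ G₂ : Subgroup G} {K n : ℕ} {φ : TriCochain G A}
    (h : φ ∈ adm A G₁ G₂ K) :
    Measurable fun g : Fin n → G => φ (List.ofFn (Fin.partialProd g)) [] [] := by
  have m : Measurable fun g : Fin n → G =>
      ((List.ofFn (Fin.partialProd g), [], []) : List G × List G × List G) :=
    ((measurableEmbedding_ofFn (n + 1)).measurable.comp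
      (measurable_pi_lambda _ measurable_partialProd)).prodMk measurable_const
  exact h.1.comp m

/-- In the coordinates (x₀, edges) the measure is again the product measure, the action of x₀ does
not affect vanishing, and x₀ is then a dummy variable. -/
theorem homCochain_mem_triNull_iff [MeasurableSMul₂ G A] [MeasurableSingletonClass A]
    (μ : Measure G) [SigmaFinite μ] [μ.IsMulLeftInvariant] [NeZero μ] {n : ℕ}
    {f : (Fin n → G) → A} (hf : Measurable f) :
    homCochain n f ∈ triNull μ ↔ f ∈ groupNull G A μ n := by
  have key : (∀ᵐ x ∂(Measure.pi fun _ : Fin (n + 1) => μ), x 0 • f (edges x) = 0) ↔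
      ∀ᵐ g ∂(Measure.pi fun _ : Fin n => μ), f g = 0 := by
    have hm : MeasurableSet {x : Fin (n + 1) → G | x 0 • f (edges x) = 0} :=
      ((measurable_pi_apply 0).smul (hf.comp measurable_edges)) (measurableSet_singleton 0)
    rw [← (measurePreserving_cumProd μ (n + 1)).map_eq,
      ae_map_iff (measurePreserving_cumProd μ (n + 1)).measurable.aemeasurable hm,
      ← (measurePreserving_finCons μ n).map_eq]
    refine (ae_map_iff (measurePreserving_finCons μ n).measurable.aemeasurable
      ((measurePreserving_cumProd μ (n + 1)).measurable hm)).trans ?_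
    have e (z : G × (Fin n → G)) : edges (cumProd (Fin.cons z.1 z.2 : Fin (n + 1) → G)) = z.2 := by
      rw [cumProd_cons]
      have : (Fin.cons z.1 fun i => z.1 * cumProd z.2 i : Fin (n + 1) → G) =
          fun i => z.1 * Fin.partialProd z.2 i := by
        rw [partialProd_eq_cons]
        funext i
        refine Fin.cases ?_ (fun _ => ?_) i <;> simp
      rw [this, edges_mul_left, edges_partialProd]
    simp only [Set.mem_ofPred_eq, e, smul_eq_zero_iff_eq]
    rw [ae_prod_swap_iff]
    exact ae_prod_fst_iff (Measure.pi fun _ : Fin n => μ) μ (P := fun g => f g = 0)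
  have : IsProbabilityMeasure (Measure.pi fun _ : Fin 0 => μ) := by
    rw [Measure.pi_of_empty _ Fin.elim0]; infer_instance
  rw [mem_triNull, ae_triMeasure_iff]
  refine Iff.trans ⟨fun h => ?_, fun h m p q => ?_⟩ key
  · have := h (n + 1) 0 0
    simp only [List.ofFn_zero, homCochain_ofFn] at this
    exact (ae_prod_fst_iff _ _).1 this
  · by_cases hl : m = n + 1 ∧ p = 0 ∧ q = 0
    · obtain ⟨rfl, rfl, rfl⟩ := hl
      simp only [List.ofFn_zero, homCochain_ofFn]
      exact (ae_prod_fst_iff _ _).2 h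
    · exact Filter.Eventually.of_forall fun w => homCochain_eq_zero f (by simpa using hl)

end MeasurableHomogeneous

/-! ### Bicochains as invariant cochains -/

section Evaluation

variable {G : Type*} [Group G] {G₁ G₂ : Subgroup G} {A : Type*} [AddCommGroup A]

/-- The bicochain of a cochain: its value on the first column and the first row of vertices. -/
def evalGrid (G₁ G₂ : Subgroup G) : TriCochain G A →+ Bicochain G₁ G₂ A where
  toFun φ _ _ X := φ [] (List.ofFn fun i => gridVertex X i 0) (List.ofFn fun j => gridVertex X 0 j)
  map_zero' := rfl
  map_add' _ _ := rfl

theorem evalGrid_apply (φ : TriCochain G A) {p q : ℕ} (X : Grid G₁ G₂ p q) :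
    evalGrid G₁ G₂ φ p q X =
      φ [] (List.ofFn fun i => gridVertex X i 0) (List.ofFn fun j => gridVertex X 0 j) := rfl

variable [DistribMulAction G A]

/-- Faces with k ≥ 1 keep the base vertex and merely omit a column. For k = 0 the base vertex moves
by s₀₁, and the row representatives pass to the second column, which stays in the same G₂-cosets;
equivariance absorbs both. -/
theorem dh_evalGrid {φ : TriCochain G A} (h : TriInvariant G₁ G₂ φ) {p q : ℕ}
    (X : Grid G₁ G₂ p (q + 1)) :
    dh G₁ G₂ A p q (evalGrid G₁ G₂ φ p q) X = evalGrid G₁ G₂ (d₃ φ) p (q + 1) X := by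
  rw [evalGrid_apply, d₃_apply, listD_ofFn, Fin.sum_univ_succ]
  simp only [dh, AddMonoidHom.coe_mk, ZeroHom.coe_mk, evalGrid_apply]
  congr 1
  · rw [Fin.val_zero, pow_zero, one_smul]
    refine (h _ _ _ _ _ _ _ List.Forall₂.nil (forall₂_ofFn_iff.2 fun i => ?_)
      (forall₂_ofFn_iff.2 fun j => ?_)).symm
    · rw [gridVertex_hFace_zero, gridVertex_succ_right, mul_inv_rev, mul_assoc]
      simp
    · rw [gridVertex_hFace_zero, Fin.zero_succAbove, inv_mul_cancel]
      exact one_mem _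
  · simp only [gridVertex_hFace_succ, Fin.succ_succAbove_zero, Fin.val_succ]

theorem dv_evalGrid {φ : TriCochain G A} (h : TriInvariant G₁ G₂ φ) {p q : ℕ}
    (X : Grid G₁ G₂ (p + 1) q) :
    dv G₁ G₂ A p q (evalGrid G₁ G₂ φ p q) X = evalGrid G₁ G₂ (d₂ φ) (p + 1) q X := by
  rw [evalGrid_apply, d₂_apply, listD_ofFn, Fin.sum_univ_succ]
  simp only [dv, AddMonoidHom.coe_mk, ZeroHom.coe_mk, evalGrid_apply]
  congr 1
  · rw [Fin.val_zero, pow_zero, one_smul]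
    refine (h _ _ _ _ _ _ _ List.Forall₂.nil (forall₂_ofFn_iff.2 fun i => ?_)
      (forall₂_ofFn_iff.2 fun j => ?_)).symm
    · rw [gridVertex_vFace_zero, Fin.zero_succAbove, inv_mul_cancel]
      exact one_mem _
    · rw [gridVertex_vFace_zero, gridVertex_succ_left, mul_inv_rev, mul_assoc]
      simp
  · simp only [gridVertex_vFace_succ, Fin.succ_succAbove_zero, Fin.val_succ]

variable [MeasurableSpace G] [MeasurableSpace A] [MeasurableAdd₂ A] [MeasurableNeg A]

/-- On empty a the term with d₁ drops out. The third list has length q + 1, so the sign of d₂ in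
`triD` is (-1)^q; the support conditions kill the augmentation terms at p = 0 and q = 0. -/
theorem totalD_evalGrid {φ : TriCochain G A} (h : TriInvariant G₁ G₂ φ) (hB : φ ∈ supB)
    (hC : φ ∈ supC) : totalD G₁ G₂ A (evalGrid G₁ G₂ φ) = evalGrid G₁ G₂ (triD 1 φ) := by
  have hB (a c) : φ a [] c = 0 := hB a c
  have hC (a b) : φ a b [] = 0 := hC a b
  have e {p q : ℕ} (X : Grid G₁ G₂ p q) : evalGrid G₁ G₂ (triD 1 φ) p q X =
      evalGrid G₁ G₂ (d₃ φ) p q X + (-1 : ℤ) ^ q • evalGrid G₁ G₂ (d₂ φ) p q X := by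
    simp only [evalGrid_apply, triD_apply, d₁_apply, listD_nil, smul_zero, add_zero,
      one_mul, List.length_ofFn, pow_succ, mul_neg, mul_one, neg_neg]
  have e3 {p : ℕ} (X : Grid G₁ G₂ p 0) : evalGrid G₁ G₂ (d₃ φ) p 0 X = 0 := by
    rw [evalGrid_apply, d₃_apply, listD_ofFn]; simp [hC]
  have e2 {q : ℕ} (X : Grid G₁ G₂ 0 q) : evalGrid G₁ G₂ (d₂ φ) 0 q X = 0 := by
    rw [evalGrid_apply, d₂_apply, listD_ofFn]; simp [hB]
  funext p q X
  rw [e]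
  rcases p with _ | p <;> rcases q with _ | q
  · rw [e3, e2]; simp [totalD, totalDFun]
  · rw [e2, smul_zero, add_zero]; exact dh_evalGrid h X
  · rw [e3, zero_add, pow_zero, one_smul]; exact dv_evalGrid h X
  · rw [← dh_evalGrid h, ← dv_evalGrid h]; rfl

theorem measurable_gridVertex [MeasurableMul₂ G] {p q : ℕ} (i : Fin (p + 1)) (j : Fin (q + 1)) :
    Measurable fun X : Grid G₁ G₂ p q => gridVertex X i j := by
  unfold gridVertex
  refine ((measurable_partialProd i).comp ?_).mul ((measurable_partialProd j).comp ?_)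
  · refine measurable_pi_lambda _ fun i' => measurable_subtype_coe.comp ?_
    fun_prop
  · refine measurable_pi_lambda _ fun j' => measurable_subtype_coe.comp ?_
    fun_prop

theorem evalGrid_mem_totalMeas [MeasurableMul₂ G] {n : ℕ} {φ : TriCochain G A}
    (h : φ ∈ adm A G₁ G₂ (n + 2)) : evalGrid G₁ G₂ φ ∈ totalMeas G₁ G₂ A n := by
  refine fun p q => ⟨?_, fun hne => ?_⟩
  · refine h.1.comp (f := fun X : Grid G₁ G₂ p q => (([], List.ofFn fun i => gridVertex X i 0,
      List.ofFn fun j => gridVertex X 0 j) : List G × List G × List G)) ?_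
    refine measurable_const.prodMk (Measurable.prodMk ?_ ?_)
    · exact (measurableEmbedding_ofFn _).measurable.comp
        (measurable_pi_lambda _ fun i => measurable_gridVertex i 0)
    · exact (measurableEmbedding_ofFn _).measurable.comp
        (measurable_pi_lambda _ fun j => measurable_gridVertex 0 j)
  · funext X
    refine h.2.2 _ _ _ ?_
    simp only [List.length_nil, List.length_ofFn]
    omega

end Evaluation

/-! ### Lifting bicochains to equivariant cochains -/

section Lift

variable {G : Type*} [Group G] [TopologicalSpace G] [IsTopologicalGroup G]
  [T2Space G] [LocallyCompactSpace G] [SecondCountableTopology G] [MeasurableSpace G]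
  [BorelSpace G] {G₁ G₂ : Subgroup G} {μ : Measure G} {μ₁ : Measure G₁} {μ₂ : Measure G₂}
  {A : Type*} [AddCommGroup A] [DistribMulAction G A]
  [MeasurableSpace A] [MeasurableAdd₂ A] [MeasurableNeg A]

/-- Vanishing of an equivariant cochain is an invariant property of its points, so `ae_grid_iff`
applies in each bidegree. The supports dispose of empty b or c. -/
theorem evalGrid_mem_totalNull_iff [MeasurableSingletonClass A] [μ.IsHaarMeasure]
    [μ₁.IsHaarMeasure] [μ₂.IsHaarMeasure]
    [SigmaFinite μ₁] [SigmaFinite μ₂] (hG : IsMatchedPair G₁ G₂ μ) {φ : TriCochain G A} {K : ℕ}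
    (h : φ ∈ adm A G₁ G₂ K) (hB : φ ∈ supB) (hC : φ ∈ supC) :
    evalGrid G₁ G₂ φ ∈ totalNull G₁ G₂ A μ₁ μ₂ ↔ φ ∈ triNullOn μ fun i _ _ => i = 0 := by
  have hB (a c) : φ a [] c = 0 := hB a c
  have hC (a b) : φ a b [] = 0 := hC a b
  have : IsProbabilityMeasure (Measure.pi fun _ : Fin 0 => μ) := by
    rw [Measure.pi_of_empty _ Fin.elim0]; infer_instance
  have key (p q : ℕ) := ae_grid_iff (μ₁ := μ₁) (μ₂ := μ₂) hG (p := p) (q := q)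
    (P := fun z => φ [] (List.ofFn z.1) (List.ofFn z.2) = 0)
    ((h.1.comp (measurable_const.prodMk
      (((measurableEmbedding_ofFn _).measurable.comp measurable_fst).prodMk
        ((measurableEmbedding_ofFn _).measurable.comp measurable_snd))) :
      Measurable fun z : (Fin (p + 1) → G) × (Fin (q + 1) → G) =>
        φ [] (List.ofFn z.1) (List.ofFn z.2)) (measurableSet_singleton 0))
    (by
      intro x y y' z z' hy hz
      rw [h.2.1 x [] [] (List.ofFn y') (List.ofFn y) (List.ofFn z') (List.ofFn z) List.Forall₂.nil
        (forall₂_ofFn_iff.2 hy) (forall₂_ofFn_iff.2 hz), smul_eq_zero_iff_eq])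
  have h0 : evalGrid G₁ G₂ φ ∈ totalNull G₁ G₂ A μ₁ μ₂ ↔ ∀ p q : ℕ,
      ∀ᵐ X ∂gridMeasure μ₁ μ₂ p q, evalGrid G₁ G₂ φ p q X = 0 := Iff.rfl
  rw [h0, mem_triNullOn, ae_triMeasure_iff]
  simp only [evalGrid_apply]
  refine ⟨fun h m p q => ?_, fun h p q => ?_⟩
  · simp only [List.length_ofFn]
    rcases m with _ | m
    · rcases p with _ | p
      · simp [hB]
      rcases q with _ | q
      · simp [hC]
      rw [ae_prod_swap_iff]
      simp only [Prod.fst_swap, Prod.snd_swap, List.ofFn_zero, forall_const]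
      exact (ae_prod_fst_iff _ _).2 ((key p q).2 (h p q))
    · simp
  · refine (key p q).1 ?_
    have h1 := h 0 (p + 1) (q + 1)
    rw [ae_prod_swap_iff] at h1
    simp only [Prod.fst_swap, Prod.snd_swap, List.ofFn_zero, List.length_nil, forall_const] at h1
    exact (ae_prod_fst_iff _ (Measure.pi fun _ : Fin 0 => μ)
      (P := fun z : (Fin (p + 1) → G) × (Fin (q + 1) → G) =>
        φ [] (List.ofFn z.1) (List.ofFn z.2) = 0)).1 h1

/-- The grid with given first column and first row of vertices. -/
noncomputable def gridOfVertices {p q : ℕ} (w : (Fin (p + 1) → G) × (Fin (q + 1) → G))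
    (hw : ∀ i j, Good G₁ G₂ (w.1 i) (w.2 j)) : Grid G₁ G₂ p q :=
  gridOf (fun i j => vert G₁ G₂ (w.1 i) (w.2 j))
    (fun i j => by
      have := G₁.mul_mem (G₁.inv_mem (vert_mem_right (G₁ := G₁) (G₂ := G₂) (w.1 i.castSucc) (w.2 j)))
        (vert_mem_right (G₁ := G₁) (G₂ := G₂) (w.1 i.succ) (w.2 j))
      simpa [mul_assoc] using this)
    (fun i j => by
      have := G₂.mul_mem (G₂.inv_mem (vert_mem_left (hw i j.castSucc)))
        (vert_mem_left (hw i j.succ))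
      simpa [mul_assoc] using this)

open Classical in
/-- The invariant function on vertices of a function on grids. -/
noncomputable def liftGrid {p q : ℕ} (F : Grid G₁ G₂ p q → A)
    (w : (Fin (p + 1) → G) × (Fin (q + 1) → G)) : A :=
  if hw : ∀ i j, Good G₁ G₂ (w.1 i) (w.2 j) then
    vert G₁ G₂ (w.1 0) (w.2 0) • F (gridOfVertices w hw) else 0

theorem measurable_liftGrid [μ.IsHaarMeasure] [MeasurableSMul₂ G A] (hG : IsMatchedPair G₁ G₂ μ) {p q : ℕ}
    {F : Grid G₁ G₂ p q → A} (hF : Measurable F) : Measurable (liftGrid F) := by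
  classical
  have mv (i : Fin (p + 1)) (j : Fin (q + 1)) : Measurable
      fun w : {w : (Fin (p + 1) → G) × (Fin (q + 1) → G) | ∀ i j, Good G₁ G₂ (w.1 i) (w.2 j)} =>
        vert G₁ G₂ (w.1.1 i) (w.1.2 j) :=
    (measurable_vert hG).comp (f := fun w : {w : (Fin (p + 1) → G) × (Fin (q + 1) → G) |
      ∀ i j, Good G₁ G₂ (w.1 i) (w.2 j)} => (w.1.1 i, w.1.2 j)) (by fun_prop)
  refine Measurable.dite (s := {w | ∀ i j, Good G₁ G₂ (w.1 i) (w.2 j)})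
    (f := fun w => vert G₁ G₂ (w.1.1 0) (w.1.2 0) • F (gridOfVertices w.1 w.2.out))
    ((mv 0 0).smul (hF.comp ?_)) (g := fun _ => 0) measurable_const
    (measurableSet_good_vertices hG _ _)
  refine Measurable.subtype_mk (Measurable.prodMk ?_ ?_)
  · exact measurable_pi_lambda _ fun i => measurable_pi_lambda _ fun j =>
      Measurable.subtype_mk ((mv _ _).inv.mul (mv _ _))
  · exact measurable_pi_lambda _ fun i => measurable_pi_lambda _ fun j =>
      Measurable.subtype_mk ((mv _ _).inv.mul (mv _ _))

theorem liftGrid_inv (hG : IsMatchedPair G₁ G₂ μ) {p q : ℕ} (F : Grid G₁ G₂ p q → A) (h : G)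
    {y y' : Fin (p + 1) → G} {z z' : Fin (q + 1) → G} (hy : ∀ i, (h * y' i)⁻¹ * y i ∈ G₂)
    (hz : ∀ j, (h * z' j)⁻¹ * z j ∈ G₁) :
    liftGrid F (y, z) = h • liftGrid F (y', z') := by
  have hgg (i j) : Good G₁ G₂ (y i) (z j) ↔ Good G₁ G₂ (y' i) (z' j) :=
    (good_vertices_inv hG.inf_eq_bot (hy i) (hz j)).symm
  by_cases hw : ∀ i j, Good G₁ G₂ (y' i) (z' j)
  · have hw' : ∀ i j, Good G₁ G₂ (y i) (z j) := fun i j => (hgg i j).2 (hw i j)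
    have hv (i j) : vert G₁ G₂ (y i) (z j) = h * vert G₁ G₂ (y' i) (z' j) := by
      rw [← vert_mul_left]
      exact (vert_congr hG.inf_eq_bot (hy i) (hz j) ((good_mul_left h _ _).2 (hw i j))).2
    rw [liftGrid, dif_pos hw', liftGrid, dif_pos hw, hv, mul_smul]
    congr 3
    refine grid_ext fun i j => ?_
    simp only [gridOfVertices]
    rw [gridVertex_gridOf, gridVertex_gridOf]
    simp only [hv]
    simp [mul_assoc]
  · rw [liftGrid, dif_neg (fun h' => hw fun i j => (hgg i j).1 (h' i j)), liftGrid, dif_neg hw,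
      smul_zero]

theorem liftGrid_gridVertex (hG : IsMatchedPair G₁ G₂ μ) {p q : ℕ} (F : Grid G₁ G₂ p q → A)
    (X : Grid G₁ G₂ p q) :
    liftGrid F (fun i => gridVertex X i 0, fun j => gridVertex X 0 j) = F X := by
  have hv := good_gridVertex hG.inf_eq_bot X
  have h00 : gridVertex X 0 0 = 1 := by simp [gridVertex]
  rw [liftGrid, dif_pos fun i j => (hv i j).1, (hv 0 0).2, h00, one_smul]
  congr 1
  refine grid_ext fun i j => ?_
  rw [gridOfVertices, gridVertex_gridOf]
  change (vert G₁ G₂ (gridVertex X 0 0) (gridVertex X 0 0))⁻¹ *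
    vert G₁ G₂ (gridVertex X i 0) (gridVertex X 0 j) = _
  rw [(hv 0 0).2, (hv i j).2, h00, inv_one, one_mul]

/-- The invariant cochain of a bicochain. -/
noncomputable def liftCochain (F : Bicochain G₁ G₂ A) : TriCochain G A := fun a b c =>
  if a.length = 0 ∧ b.length ≠ 0 ∧ c.length ≠ 0 then
    -- Truncated subtraction and default entries are harmless because both lists are nonempty.
    liftGrid (F (b.length - 1) (c.length - 1)) (fun i => b.getD i 1, fun j => c.getD j 1) else 0

theorem liftCochain_ofFn (F : Bicochain G₁ G₂ A) {p q : ℕ} (y : Fin (p + 1) → G)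
    (z : Fin (q + 1) → G) :
    liftCochain F [] (List.ofFn y) (List.ofFn z) = liftGrid (F p q) (y, z) := by
  refine (if_pos (by simp)).trans ?_
  have h1 : (List.ofFn y).length - 1 = p := by simp
  have h2 : (List.ofFn z).length - 1 = q := by simp
  generalize (List.ofFn y).length - 1 = p' at h1
  generalize (List.ofFn z).length - 1 = q' at h2
  subst h1 h2
  have e1 : (fun i : Fin (p' + 1) => (List.ofFn y).getD i 1) = y := by
    funext i
    rw [List.getD_eq_getElem _ _ (by rw [List.length_ofFn]; exact i.2), List.getElem_ofFn]
  have e2 : (fun i : Fin (q' + 1) => (List.ofFn z).getD i 1) = z := by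
    funext i
    rw [List.getD_eq_getElem _ _ (by rw [List.length_ofFn]; exact i.2), List.getElem_ofFn]
  rw [e1, e2]

theorem liftCochain_eq_zero (F : Bicochain G₁ G₂ A) {a b c : List G}
    (h : ¬(a.length = 0 ∧ b.length ≠ 0 ∧ c.length ≠ 0)) : liftCochain F a b c = 0 := if_neg h

theorem liftCochain_mem_adm [μ.IsHaarMeasure] [MeasurableSMul₂ G A] (hG : IsMatchedPair G₁ G₂ μ) {n : ℕ}
    {F : Bicochain G₁ G₂ A} (hF : F ∈ totalMeas G₁ G₂ A n) :
    liftCochain F ∈ adm A G₁ G₂ (n + 2) := by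
  refine ⟨?_, ?_, ?_⟩
  · refine measurable_list_prod.2 fun m => ?_
    rcases m with _ | m
    · have h1 : Measurable fun z : List G × List G => liftCochain F [] z.1 z.2 := by
        refine measurable_list_prod.2 fun p => ?_
        have h2 : Measurable fun z : List G × (Fin p → G) =>
            liftCochain F [] (List.ofFn z.2) z.1 := by
          refine measurable_list_prod.2 fun q => ?_
          rcases p with _ | p
          · simp [liftCochain_eq_zero]
          rcases q with _ | q
          · simp [liftCochain_eq_zero]
          simp only [liftCochain_ofFn]
          exact (measurable_liftGrid hG (hF p q).1).comp measurable_swap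
        exact h2.comp measurable_swap
      simpa using! h1.comp (measurable_snd (α := Fin 0 → G))
    · simp [liftCochain_eq_zero]
  · intro h a a' b b' c c' ha hb hc
    by_cases hl : a'.length = 0 ∧ b'.length ≠ 0 ∧ c'.length ≠ 0
    · obtain ⟨p, hp⟩ := Nat.exists_eq_succ_of_ne_zero hl.2.1
      obtain ⟨q, hq⟩ := Nat.exists_eq_succ_of_ne_zero hl.2.2
      obtain rfl := List.length_eq_zero_iff.1 hl.1
      obtain rfl := List.length_eq_zero_iff.1 ha.length_eq
      obtain ⟨y', rfl⟩ := exists_eq_ofFn hp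
      obtain ⟨y, rfl⟩ := exists_eq_ofFn (hb.length_eq.trans hp)
      obtain ⟨z', rfl⟩ := exists_eq_ofFn hq
      obtain ⟨z, rfl⟩ := exists_eq_ofFn (hc.length_eq.trans hq)
      rw [liftCochain_ofFn, liftCochain_ofFn]
      exact liftGrid_inv hG _ h
        ((forall₂_ofFn_iff (R := fun y y' => (h * y')⁻¹ * y ∈ G₂)).1 hb)
        ((forall₂_ofFn_iff (R := fun y y' => (h * y')⁻¹ * y ∈ G₁)).1 hc)
    · rw [liftCochain_eq_zero F hl, liftCochain_eq_zero F, smul_zero]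
      rwa [ha.length_eq, hb.length_eq, hc.length_eq]
  · intro a b c hne
    by_cases hl : a.length = 0 ∧ b.length ≠ 0 ∧ c.length ≠ 0
    · have := (hF (b.length - 1) (c.length - 1)).2 (by omega)
      refine (if_pos hl).trans ?_
      rw [this]
      simp [liftGrid]
    · exact liftCochain_eq_zero F hl

theorem liftCochain_mem_supB (F : Bicochain G₁ G₂ A) : liftCochain F ∈ supB :=
  fun _ _ => liftCochain_eq_zero F (by simp)

theorem liftCochain_mem_supC (F : Bicochain G₁ G₂ A) : liftCochain F ∈ supC :=
  fun _ _ => liftCochain_eq_zero F (by simp)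

theorem evalGrid_liftCochain (hG : IsMatchedPair G₁ G₂ μ) (F : Bicochain G₁ G₂ A) :
    evalGrid G₁ G₂ (liftCochain F) = F := by
  funext p q X
  rw [evalGrid_apply, liftCochain_ofFn, liftGrid_gridVertex hG]

end Lift

/-! ### The comparison of the two complexes -/

section Weights

variable {G : Type*} {A : Type*} [AddCommGroup A]

/-- Multiplication by integers that depend on the lengths of the lists. -/
def weight (k : ℕ → ℕ → ℕ → ℤ) : TriCochain G A →+ TriCochain G A where
  toFun φ a b c := k a.length b.length c.length • φ a b c
  map_zero' := by ext; simp
  map_add' φ ψ := by ext; simp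

theorem weight_apply (k : ℕ → ℕ → ℕ → ℤ) (φ : TriCochain G A) (a b c : List G) :
    weight k φ a b c = k a.length b.length c.length • φ a b c := rfl

theorem d₃_d₂ (φ : TriCochain G A) : d₃ (d₂ φ) = d₂ (d₃ φ) := by
  funext a b c; exact listD_comm c b fun c' b' => φ a b' c'

theorem d₂_d₁ (φ : TriCochain G A) : d₂ (d₁ φ) = d₁ (d₂ φ) := by
  funext a b c; exact listD_comm b a fun b' a' => φ a' b' c

theorem d₃_d₁ (φ : TriCochain G A) : d₃ (d₁ φ) = d₁ (d₃ φ) := by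
  funext a b c; exact listD_comm c a fun c' a' => φ a' b c'

theorem d₂_d₂ (φ : TriCochain G A) : d₂ (d₂ φ) = 0 := by
  funext a b c; exact listD_listD b _

theorem d₃_d₃ (φ : TriCochain G A) : d₃ (d₃ φ) = 0 := by
  funext a b c; exact listD_listD c _

theorem triD_zero_eq (φ : TriCochain G A) :
    triD 0 φ = d₃ φ + weight (fun _ j k => (-1) ^ (j + k)) (d₁ φ) := by
  funext a b c; simp [triD_apply, weight_apply]

theorem triD_one_eq (φ : TriCochain G A) :
    triD 1 φ = triD 0 φ + weight (fun _ _ k => (-1) ^ (k + 1)) (d₂ φ) := by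
  funext a b c
  simp only [triD_apply, weight_apply, Pi.add_apply, one_mul, zero_mul, zero_smul, add_zero]
  abel

/-- Since d₂ has square zero, only d₁ and d₃ act on a d₂-coboundary. With the sign of the third
length, d₂ therefore intertwines the coboundary without d₂ and the full one, up to sign. -/
theorem triD_one_weight_d₂ (φ : TriCochain G A) :
    triD 1 (weight (fun _ _ k => (-1) ^ k) (d₂ φ)) =
      weight (fun _ _ k => (-1) ^ (k + 1)) (d₂ (triD 0 φ)) := by
  funext a b c
  have e1 : d₃ (weight (fun _ _ k => (-1) ^ k) (d₂ φ)) a b c =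
      -((-1 : ℤ) ^ c.length • d₂ (d₃ φ) a b c) := by
    rw [← d₃_d₂]; exact listD_sign c _
  have e2 : d₂ (weight (fun _ _ k => (-1) ^ k) (d₂ φ)) a b c = 0 := by
    rw [d₂_apply]
    simp only [weight_apply]
    rw [listD_zsmul']
    exact (congrArg _ (listD_listD b _)).trans (smul_zero _)
  have e3 : d₁ (weight (fun _ _ k => (-1) ^ k) (d₂ φ)) a b c =
      (-1 : ℤ) ^ c.length • d₁ (d₂ φ) a b c := by
    rw [d₁_apply]
    simp only [weight_apply]
    rw [listD_zsmul', d₁_apply]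
  have e4 : d₂ (weight (fun _ j k => (-1) ^ (j + k)) (d₁ φ)) a b c =
      -((-1 : ℤ) ^ (b.length + c.length) • d₁ (d₂ φ) a b c) := by
    rw [d₂_apply, ← d₂_d₁]
    have : (fun b' => weight (fun _ j k => (-1) ^ (j + k)) (d₁ φ) a b' c) = fun b' : List G =>
        (-1 : ℤ) ^ b'.length • (-1 : ℤ) ^ c.length • d₁ φ a b' c := by
      funext b'; rw [weight_apply, pow_add, mul_smul]
    rw [this, listD_sign, listD_zsmul', smul_smul, ← pow_add, d₂_apply]
  rw [triD_apply, e1, e2, e3, weight_apply, triD_zero_eq, map_add]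
  simp only [Pi.add_apply, e4, smul_zero, add_zero, pow_succ, smul_add, smul_neg, mul_neg, mul_one,
    neg_smul, neg_neg]
  rw [smul_comm]

/-- On an empty second list d₂ contributes nothing, and d₁, d₃ never look outside this layer. -/
theorem triD_one_nil_b (φ : TriCochain G A) (a c : List G) :
    triD 1 φ a [] c = triD 0 (weight (fun _ j _ => if j = 0 then 1 else 0) φ) a [] c := by
  simp [triD_apply, d₁_apply, d₂_apply, d₃_apply, weight_apply]

end Weights

/-! ### The term d₂d₃f that links the two complexes -/

section CrossCochain

variable {G : Type*} [Group G] {A : Type*} [AddCommGroup A] [DistribMulAction G A] {n : ℕ}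

theorem d₂_d₃_homCochain_eq_zero (f : (Fin n → G) → A) {a b c : List G}
    (h : ¬(b.length = 1 ∧ c.length = 1)) : d₂ (d₃ (homCochain n f)) a b c = 0 := by
  rw [d₂_apply]
  refine (listD_congr (ψ := fun _ => 0) fun b' hb => ?_).trans (listD_zero' _)
  rw [d₃_apply]
  refine (listD_congr (ψ := fun _ => 0) fun c' hc => ?_).trans (listD_zero' _)
  exact homCochain_eq_zero f fun h' => h ⟨by omega, by omega⟩

theorem weight_d₂_d₃_homCochain {k : ℕ → ℕ → ℕ → ℤ} (hk : ∀ i, k i 1 1 = 1)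
    (f : (Fin n → G) → A) :
    weight k (d₂ (d₃ (homCochain n f))) = d₂ (d₃ (homCochain n f)) := by
  funext a b c
  rw [weight_apply]
  by_cases h : b.length = 1 ∧ c.length = 1
  · rw [h.1, h.2, hk, one_smul]
  · rw [d₂_d₃_homCochain_eq_zero f h, smul_zero]

/-- Only the term with d₁ survives, as d₂ and d₃ have square zero. The cochain is supported on
second and third lists of length one, where the sign of d₁ is +1. -/
theorem triD_d₂_d₃_homCochain (f : (Fin n → G) → A) :
    triD 1 (d₂ (d₃ (homCochain n f))) = d₂ (d₃ (homCochain (n + 1) (groupD G A n f))) := by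
  rw [triD_one_eq, triD_zero_eq, d₃_d₂, d₃_d₃, d₂_d₂, map_zero, map_zero, add_zero, zero_add,
    ← d₂_d₁, ← d₃_d₁, d₁_homCochain, weight_d₂_d₃_homCochain]
  intro i; rfl

end CrossCochain

/-! ### Zigzags between group cocycles and bicochains -/

section Comparison

variable {G : Type*} [Group G] [TopologicalSpace G] [IsTopologicalGroup G]
  [T2Space G] [LocallyCompactSpace G] [SecondCountableTopology G] [MeasurableSpace G]
  [BorelSpace G] {G₁ G₂ : Subgroup G} {μ : Measure G} [μ.IsHaarMeasure]
  {μ₁ : Measure G₁} {μ₂ : Measure G₂}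
  [μ₁.IsHaarMeasure] [μ₂.IsHaarMeasure] [SigmaFinite μ₁] [SigmaFinite μ₂]
  {A : Type*} [AddCommGroup A] [DistribMulAction G A]
  [MeasurableSpace A] [MeasurableAdd₂ A] [MeasurableNeg A] [MeasurableSingletonClass A]
  [MeasurableSMul₂ G A] {n : ℕ}

theorem weight_mem_adm {K : ℕ} (k : ℕ → ℕ → ℕ → ℤ) {φ : TriCochain G A}
    (h : φ ∈ adm A G₁ G₂ K) : weight k φ ∈ adm A G₁ G₂ K := smul_length_mem_adm k h

theorem weight_mem_triNullOn {P : ℕ → ℕ → ℕ → Prop} (k : ℕ → ℕ → ℕ → ℤ) {φ : TriCochain G A}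
    (h : φ ∈ triNullOn μ P) : weight k φ ∈ triNullOn μ P := smul_length_mem_triNullOn k h

theorem measurable_groupD {f : (Fin n → G) → A} (hf : Measurable f) :
    Measurable (groupD G A n f) := by
  -- Invariance under subgroups is irrelevant for measurability, so the trivial subgroups serve.
  have h := measurable_of_adm (n := n + 1) (d₁_mem_adm (homCochain_mem_adm ⊥ ⊥ hf))
  simpa only [d₁_homCochain, homCochain_ofFn, Fin.partialProd_zero, one_smul, edges_partialProd]
    using h

theorem d₂_d₃_mem_triNull {φ : TriCochain G A} (h : φ ∈ triNull μ) : d₂ (d₃ φ) ∈ triNull μ :=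
  d₂_mem_triNullOn (S := fun _ _ => True) (d₃_mem_triNullOn (S := fun _ _ => True) h)

theorem evalGrid_mem_totalNull (hG : IsMatchedPair G₁ G₂ μ) {φ : TriCochain G A} {K : ℕ}
    (h : φ ∈ adm A G₁ G₂ K) (hB : φ ∈ supB) (hC : φ ∈ supC) (hn : φ ∈ triNull μ) :
    evalGrid G₁ G₂ φ ∈ totalNull G₁ G₂ A μ₁ μ₂ :=
  (evalGrid_mem_totalNull_iff hG h hB hC).2 (triNullOn_mono (fun _ _ _ _ => trivial) hn)

theorem evalGrid_eq_zero {φ : TriCochain G A} (h : φ ∈ supA) : evalGrid G₁ G₂ φ = 0 := by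
  funext p q X; exact h _ _

theorem homCochain_mem_supA (f : (Fin n → G) → A) : homCochain n f ∈ supA :=
  fun b c => homCochain_nil f b c

theorem d₃_homCochain_mem_supA (f : (Fin n → G) → A) : d₃ (homCochain n f) ∈ supA := by
  intro b c
  simp [d₃_apply, homCochain_nil, listD_zero']

theorem d₂_d₃_homCochain_mem_supA (f : (Fin n → G) → A) : d₂ (d₃ (homCochain n f)) ∈ supA := by
  intro b c
  simp [d₂_apply, d₃_apply, homCochain_nil, listD_zero']

theorem d₂_d₃_homCochain_mem_supB (f : (Fin n → G) → A) : d₂ (d₃ (homCochain n f)) ∈ supB :=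
  fun _ _ => d₂_d₃_homCochain_eq_zero f (by simp)

theorem d₂_d₃_homCochain_mem_supC (f : (Fin n → G) → A) : d₂ (d₃ (homCochain n f)) ∈ supC :=
  fun _ _ => d₂_d₃_homCochain_eq_zero f (by simp)

variable (G₁ G₂ A) (μ μ₁ μ₂) in
/-- The comparison relation between functions on `Gⁿ` and bicochains of total degree `n`. -/
noncomputable def Comparable (n : ℕ) : AddSubgroup (((Fin n → G) → A) × Bicochain G₁ G₂ A) where
  carrier := {x | ∃ τ ∈ adm A G₁ G₂ (n + 2), τ ∈ supB ∧ τ ∈ supC ∧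
    triD 1 τ - (-1 : ℤ) ^ n • d₂ (d₃ (homCochain n x.1)) ∈ triNull μ ∧
    evalGrid G₁ G₂ τ - x.2 ∈ totalNull G₁ G₂ A μ₁ μ₂}
  add_mem' := by
    rintro x y ⟨τ, h1, h2, h3, h4, h5⟩ ⟨σ, k1, k2, k3, k4, k5⟩
    refine ⟨τ + σ, add_mem h1 k1, add_mem h2 k2, add_mem h3 k3, ?_, ?_⟩
    · simp only [Prod.fst_add, map_add, smul_add, add_sub_add_comm]
      exact add_mem h4 k4
    · simp only [Prod.snd_add, map_add, add_sub_add_comm]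
      exact add_mem h5 k5
  zero_mem' := ⟨0, zero_mem _, zero_mem _, zero_mem _, by simp [zero_mem], by simp [zero_mem]⟩
  neg_mem' := by
    rintro x ⟨τ, h1, h2, h3, h4, h5⟩
    refine ⟨-τ, neg_mem h1, neg_mem h2, neg_mem h3, ?_, ?_⟩
    · simp only [Prod.fst_neg, map_neg, smul_neg, ← neg_sub']
      exact neg_mem h4
    · simp only [Prod.snd_neg, map_neg, ← neg_sub']
      exact neg_mem h5

/-- On empty a the cross term d₂d₃f vanishes, so the coboundary of τ is null there. -/
theorem evalGrid_mem_totalCocycles (hG : IsMatchedPair G₁ G₂ μ) {f : (Fin n → G) → A}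
    {τ : TriCochain G A} (ht : τ ∈ adm A G₁ G₂ (n + 2)) (htB : τ ∈ supB) (htC : τ ∈ supC)
    (h : triD 1 τ - (-1 : ℤ) ^ n • d₂ (d₃ (homCochain n f)) ∈ triNull μ) :
    evalGrid G₁ G₂ τ ∈ totalCocycles G₁ G₂ A μ₁ μ₂ n := by
  refine ⟨evalGrid_mem_totalMeas ht, ?_⟩
  change totalD G₁ G₂ A (evalGrid G₁ G₂ τ) ∈ totalNull G₁ G₂ A μ₁ μ₂
  rw [totalD_evalGrid ht.2.1 htB htC, evalGrid_mem_totalNull_iff (μ := μ) hG (triD_mem_adm 1 ht)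
    (triD_mem_supB 1 htB) (triD_mem_supC 1 htC), mem_triNullOn]
  filter_upwards [mem_triNull.1 h] with ⟨a, b, c⟩ h' ha
  obtain rfl := List.length_eq_zero_iff.1 ha
  have h2 : d₂ (d₃ (homCochain n f)) [] b c = 0 := d₂_d₃_homCochain_mem_supA f b c
  simpa [h2] using h'

/-- For a cocycle f the cross term is closed up to a null cochain and is supported where b and c are
nonempty; acyclicity in direction a provides τ. -/
theorem exists_comparable_right (hG : IsMatchedPair G₁ G₂ μ) {f : (Fin n → G) → A}
    (hf : f ∈ groupCocycles G A μ n) :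
    ∃ F ∈ totalCocycles G₁ G₂ A μ₁ μ₂ n, (f, F) ∈ Comparable G₁ G₂ μ μ₁ μ₂ A n := by
  have hfm : Measurable f := hf.1
  have hd : homCochain (n + 1) (groupD G A n f) ∈ triNull μ :=
    (homCochain_mem_triNull_iff μ (measurable_groupD hfm)).2 hf.2
  obtain ⟨τ, ht, htB, htC, h⟩ := exists_triD_primitive_of_supB_supC (K := n + 2) hG
    (e := (-1 : ℤ) ^ n • d₂ (d₃ (homCochain n f)))
    (zsmul_mem (d₂_mem_adm (d₃_mem_adm (homCochain_mem_adm G₁ G₂ hfm))) _)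
    (zsmul_mem (d₂_d₃_homCochain_mem_supB f) _) (zsmul_mem (d₂_d₃_homCochain_mem_supC f) _)
    (by
      rw [map_zsmul, triD_d₂_d₃_homCochain]
      exact zsmul_mem (d₂_d₃_mem_triNull hd) _)
  rw [← neg_mem_iff, neg_sub] at h
  exact ⟨evalGrid G₁ G₂ τ, evalGrid_mem_totalCocycles hG ht htB htC h, τ, ht, htB, htC, h,
    by simp [zero_mem]⟩

theorem eq_zero_of_adm {φ : TriCochain G A} {a b c : List G} {K : ℕ} (h : φ ∈ adm A G₁ G₂ K)
    (hl : a.length + b.length + c.length ≠ K) : φ a b c = 0 := h.2.2 a b c hl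

/-- A zigzag from the layer a = [] to the layer b = c = []: lift F, solve in direction b, restrict
to empty b, solve in direction c, and restrict to empty c. The intermediate primitives are then
assembled into τ. -/
theorem exists_comparable_left (hG : IsMatchedPair G₁ G₂ μ) {F : Bicochain G₁ G₂ A}
    (hF : F ∈ totalCocycles G₁ G₂ A μ₁ μ₂ n) :
    ∃ f ∈ groupCocycles G A μ n, (f, F) ∈ Comparable G₁ G₂ μ μ₁ μ₂ A n := by
  have hFm : F ∈ totalMeas G₁ G₂ A n := hF.1
  set φ : TriCochain G A := liftCochain F
  have hφ : φ ∈ adm A G₁ G₂ (n + 2) := liftCochain_mem_adm hG hFm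
  have hφB : φ ∈ supB := liftCochain_mem_supB F
  have hφC : φ ∈ supC := liftCochain_mem_supC F
  have hφn : triD 1 φ ∈ triNullOn μ fun i _ _ => i = 0 := by
    rw [← evalGrid_mem_totalNull_iff (μ₁ := μ₁) (μ₂ := μ₂) hG (triD_mem_adm 1 hφ)
      (triD_mem_supB 1 hφB) (triD_mem_supC 1 hφC), ← totalD_evalGrid hφ.2.1 hφB hφC,
      evalGrid_liftCochain hG]
    exact hF.2
  -- The coboundary of the lift is null on empty a; dropping that part puts it strictly into the
  -- acyclic piece where a and c are nonempty.
  set e : TriCochain G A := weight (fun i _ _ => if i = 0 then 0 else 1) (triD 1 φ) with e_def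
  have he : e ∈ adm A G₁ G₂ (n + 3) := weight_mem_adm _ (triD_mem_adm 1 hφ)
  have heA : e ∈ supA := fun b c => by simp [e_def, weight_apply]
  have heB (a c) : e a [] c = 0 := by
    have : triD 1 φ a [] c = 0 := triD_mem_supB 1 hφB a c
    rw [e_def, weight_apply, this, smul_zero]
  have heC : e ∈ supC := fun a b => by
    have : triD 1 φ a b [] = 0 := triD_mem_supC 1 hφC a b
    rw [e_def, weight_apply, this, smul_zero]
  have hee : triD 1 φ - e ∈ triNull μ := by
    rw [mem_triNull]
    filter_upwards [mem_triNullOn.1 hφn] with ⟨a, b, c⟩ h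
    simp only [Pi.sub_apply, e_def, weight_apply]
    split_ifs with ha
    · simpa using h ha
    · simp
  have heD : triD 1 e ∈ triNull μ := by
    have := triD_mem_triNull 1 hee
    rwa [map_sub, triD_triD, zero_sub, neg_mem_iff] at this
  obtain ⟨u, hu, huA, huC, hue⟩ := exists_triD_primitive_of_supA_supC he heA heC heD
  have huA' (b c) : u [] b c = 0 := huA b c
  have huC' (a b) : u a b [] = 0 := huC a b
  -- Since e vanishes on empty b, this layer of the primitive is closed for the coboundary without
  -- d₂.
  set uB : TriCochain G A := weight (fun _ j _ => if j = 0 then 1 else 0) u with uB_def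
  have huB : uB ∈ adm A G₁ G₂ (n + 2) := weight_mem_adm _ hu
  have huBA : uB ∈ supA := fun b c => by rw [uB_def, weight_apply, huA', smul_zero]
  have huBC (a b) : uB a b [] = 0 := by rw [uB_def, weight_apply, huC', smul_zero]
  have huBB : uB ∈ supNoB := fun a b c hb => by simp [uB_def, weight_apply, hb]
  have huBD : triD 0 uB ∈ triNull μ := by
    rw [mem_triNull]
    filter_upwards [mem_triNull.1 hue] with ⟨a, b, c⟩ h
    by_cases hb : b = []
    · subst hb
      simpa [heB, triD_one_nil_b] using h
    · exact triD_zero_mem_supNoB huBB a b c hb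
  obtain ⟨w, hw, hwA, hwB, hwu⟩ := exists_triD_primitive_of_supA_supNoB huB huBA huBB huBD
  have hwA' (b c) : w [] b c = 0 := hwA b c
  -- The end of the zigzag. As uB vanishes on empty c, this part of w is d₁-closed up to a null
  -- cochain, hence comes from a group cocycle.
  set wC : TriCochain G A := weight (fun _ _ k => if k = 0 then 1 else 0) w with wC_def
  have hwC : wC ∈ adm A G₁ G₂ (n + 1) := weight_mem_adm _ hw
  have hwC0 (a b c) (h : b ≠ [] ∨ c ≠ []) : wC a b c = 0 := by
    rw [wC_def, weight_apply]
    rcases h with h | h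
    · rw [hwB a b c h, smul_zero]
    · simp [h]
  obtain ⟨f, hfm, hf⟩ : ∃ f : (Fin n → G) → A, Measurable f ∧ wC = homCochain n f := by
    refine ⟨_, measurable_of_adm hwC, eq_homCochain hwC.2.1 fun a b c h => ?_⟩
    by_cases hbc : b ≠ [] ∨ c ≠ []
    · exact hwC0 a b c hbc
    · push Not at hbc
      obtain ⟨rfl, rfl⟩ := hbc
      exact eq_zero_of_adm hwC (by simpa using h)
  have hdf : homCochain (n + 1) (groupD G A n f) ∈ triNull μ := by
    rw [← d₁_homCochain, ← hf, mem_triNull]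
    filter_upwards [mem_triNull.1 hwu] with ⟨a, b, c⟩ h
    by_cases hbc : b ≠ [] ∨ c ≠ []
    · simp [d₁_apply, hwC0 _ b c hbc, listD_zero']
    · push Not at hbc
      obtain ⟨rfl, rfl⟩ := hbc
      simpa [triD_apply, d₁_apply, d₃_apply, wC_def, weight_apply, huBC] using h
  have hfZ : f ∈ groupCocycles G A μ n :=
    ⟨hfm, (homCochain_mem_triNull_iff μ (measurable_groupD hfm)).1 hdf⟩
  -- Removing uB from u leaves an error ±d₂uB. The coboundary of v cancels it up to d₂ of the
  -- coboundary of wC, and the latter is the desired cross term modulo null cochains. Subtracting wC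
  -- keeps v zero on empty c.
  set v : TriCochain G A := weight (fun _ _ k => (-1) ^ k) (d₂ (w - wC)) with v_def
  have hvA : v ∈ supA := fun b c => by
    have h (b c) : wC [] b c = 0 := by rw [wC_def, weight_apply, hwA', smul_zero]
    simp [v_def, weight_apply, d₂_apply, hwA', h, listD_zero']
  have huuA : u - uB ∈ supA := sub_mem huA huBA
  -- The sign cancels the one in `Comparable`. The corrections to φ all vanish on empty a, so the
  -- evaluation is still F.
  refine ⟨(-1 : ℤ) ^ n • f, zsmul_mem hfZ _, φ - (u - uB) - v, ?_, ?_, ?_, ?_, ?_⟩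
  · exact sub_mem (sub_mem hφ (sub_mem hu huB)) (weight_mem_adm _ (d₂_mem_adm (sub_mem hw hwC)))
  · refine sub_mem (sub_mem hφB fun a c => ?_) fun a c => ?_
    · simp [uB_def, weight_apply]
    · simp [v_def, weight_apply, d₂_apply]
  · refine sub_mem (sub_mem hφC fun a c => ?_) fun a c => ?_
    · simp [huBC, huC']
    · simp [v_def, weight_apply, d₂_apply, wC_def]
  · have e1 : weight (fun _ _ k => (-1) ^ (k + 1)) (d₂ (triD 0 wC)) =
        d₂ (d₃ (homCochain n f)) + weight (fun _ _ k => (-1) ^ (k + 1))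
          (d₂ (weight (fun _ j k => (-1) ^ (j + k)) (homCochain (n + 1) (groupD G A n f)))) := by
      rw [hf, triD_zero_eq, map_add, map_add, d₁_homCochain, weight_d₂_d₃_homCochain]
      intro i; rfl
    have e2 : triD 1 v = weight (fun _ _ k => (-1) ^ (k + 1)) (d₂ (triD 0 w)) -
        weight (fun _ _ k => (-1) ^ (k + 1)) (d₂ (triD 0 wC)) := by
      rw [v_def, triD_one_weight_d₂, map_sub, map_sub, map_sub]
    have e3 : triD 1 (φ - (u - uB) - v) -
        (-1 : ℤ) ^ n • d₂ (d₃ (homCochain n ((-1 : ℤ) ^ n • f))) =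
        (triD 1 φ - e) + (e - triD 1 u) + triD 0 uB +
          weight (fun _ _ k => (-1) ^ (k + 1)) (d₂ (uB - triD 0 w)) +
          weight (fun _ _ k => (-1) ^ (k + 1))
            (d₂ (weight (fun _ j k => (-1) ^ (j + k)) (homCochain (n + 1) (groupD G A n f)))) := by
      rw [map_zsmul, map_zsmul, map_zsmul, neg_one_pow_smul_smul, map_sub, map_sub, map_sub, e2, e1,
        triD_one_eq uB, map_sub (d₂ (G := G) (A := A)) uB, map_sub (weight _) (d₂ uB)]
      abel
    rw [e3]
    exact add_mem (add_mem (add_mem (add_mem hee hue) huBD)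
      (weight_mem_triNullOn _ (d₂_mem_triNullOn (S := fun _ _ => True) hwu)))
      (weight_mem_triNullOn _ (d₂_mem_triNullOn (S := fun _ _ => True)
        (weight_mem_triNullOn _ hdf)))
  · rw [map_sub, map_sub, evalGrid_eq_zero huuA, evalGrid_eq_zero hvA, evalGrid_liftCochain hG]
    simp [zero_mem]

theorem mem_coboundaries_iff {M N : Type*} [AddCommGroup M] [AddCommGroup N]
    {measM : AddSubgroup M} {nullN : AddSubgroup N} {d : M →+ N} {x : N} :
    x ∈ coboundaries measM nullN d ↔ ∃ y ∈ measM, x - d y ∈ nullN := by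
  rw [coboundaries, AddSubgroup.mem_sup]
  constructor
  · rintro ⟨_, ⟨y, hy, rfl⟩, z, hz, rfl⟩
    exact ⟨y, hy, by simpa using hz⟩
  · rintro ⟨y, hy, h⟩
    exact ⟨d y, ⟨y, hy, rfl⟩, _, h, by abel⟩

/-- If f = dg, subtracting the cross term of g makes τ closed without changing its values on empty
a. Acyclicity in direction a writes it as a coboundary, and evaluating the primitive gives a
primitive of F. -/
theorem Comparable.totalCoboundary (hG : IsMatchedPair G₁ G₂ μ) {f : (Fin n → G) → A}
    {F : Bicochain G₁ G₂ A} (h : (f, F) ∈ Comparable G₁ G₂ μ μ₁ μ₂ A n)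
    (hf : Measurable f) (hfB : f ∈ groupCoboundaries G A μ n) :
    F ∈ totalCoboundaries G₁ G₂ A μ₁ μ₂ n := by
  obtain ⟨τ, ht, htB, htC, hτ, hev⟩ := h
  simp only at hτ hev
  obtain ⟨σ, hs, hsB, hsC, hσ, hσev⟩ : ∃ σ ∈ adm A G₁ G₂ (n + 2), σ ∈ supB ∧ σ ∈ supC ∧
      triD 1 σ ∈ triNull μ ∧ evalGrid G₁ G₂ σ = evalGrid G₁ G₂ τ := by
    rcases n with _ | n
    · refine ⟨τ, ht, htB, htC, ?_, rfl⟩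
      have := d₂_d₃_mem_triNull ((homCochain_mem_triNull_iff μ hf).2 hfB)
      simpa using add_mem hτ this
    · obtain ⟨g, hg, hn⟩ := mem_coboundaries_iff.1 hfB
      have hgm : Measurable g := hg
      refine ⟨τ - (-1 : ℤ) ^ (n + 1) • d₂ (d₃ (homCochain n g)),
        sub_mem ht (zsmul_mem (d₂_mem_adm (d₃_mem_adm (homCochain_mem_adm G₁ G₂ hgm))) _),
        sub_mem htB (zsmul_mem (d₂_d₃_homCochain_mem_supB g) _),
        sub_mem htC (zsmul_mem (d₂_d₃_homCochain_mem_supC g) _), ?_, ?_⟩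
      · have h1 := zsmul_mem (d₂_d₃_mem_triNull ((homCochain_mem_triNull_iff μ
          (hf.sub (measurable_groupD hgm))).2 hn)) ((-1 : ℤ) ^ (n + 1))
        have h2 := add_mem hτ h1
        rw [map_sub, map_zsmul, triD_d₂_d₃_homCochain]
        convert! h2 using 1
        change _ = _ + (-1 : ℤ) ^ (n + 1) • d₂ (d₃ (homCochain (n + 1) (f - groupD G A n g)))
        rw [map_sub, map_sub, map_sub, smul_sub]
        abel
      · rw [map_sub, map_zsmul, evalGrid_eq_zero (d₂_d₃_homCochain_mem_supA g), smul_zero, sub_zero]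
  obtain ⟨t, ht', htB', htC', h⟩ := exists_triD_primitive_of_supB_supC hG hs hsB hsC hσ
  have h1 := evalGrid_mem_totalNull (μ₁ := μ₁) (μ₂ := μ₂) hG
    (sub_mem hs (triD_mem_adm 1 ht')) (sub_mem hsB (triD_mem_supB 1 htB'))
    (sub_mem hsC (triD_mem_supC 1 htC')) h
  rw [map_sub, hσev, ← totalD_evalGrid ht'.2.1 htB' htC'] at h1
  have h2 := sub_mem h1 hev
  rw [sub_sub_sub_cancel_left] at h2
  rcases n with _ | n
  -- In degree 0 the primitive has total length 1, too short for both b and c to be nonempty.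
  · have : t = 0 := by
      funext a b c
      rcases b with _ | ⟨y, b⟩
      · exact htB' a c
      rcases c with _ | ⟨z, c⟩
      · exact htC' a _
      · exact eq_zero_of_adm ht' (by simp; omega)
    subst this
    rw [map_zero, map_zero, sub_zero] at h2
    exact h2
  · exact mem_coboundaries_iff.2 ⟨evalGrid G₁ G₂ t, evalGrid_mem_totalMeas ht', h2⟩

/-- The zigzag again: after a coboundary is subtracted, τ is null on empty a, so acyclicity in
direction b and then in direction c leads to a primitive of f. -/
theorem Comparable.groupCoboundary (hG : IsMatchedPair G₁ G₂ μ) {f : (Fin n → G) → A}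
    {F : Bicochain G₁ G₂ A} (h : (f, F) ∈ Comparable G₁ G₂ μ μ₁ μ₂ A n)
    (hf : f ∈ groupCocycles G A μ n) (hFB : F ∈ totalCoboundaries G₁ G₂ A μ₁ μ₂ n) :
    f ∈ groupCoboundaries G A μ n := by
  obtain ⟨τ, ht, htB, htC, hτ, hev⟩ := h
  simp only at hτ hev
  set g : (Fin n → G) → A := (-1 : ℤ) ^ n • f with g_def
  have hg : g ∈ groupCocycles G A μ n := zsmul_mem hf _
  have hgm : Measurable g := hg.1
  rw [← map_zsmul, ← map_zsmul, ← map_zsmul, ← g_def] at hτ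
  have hdg : homCochain (n + 1) (groupD G A n g) ∈ triNull μ :=
    (homCochain_mem_triNull_iff μ (measurable_groupD hgm)).2 hg.2
  obtain ⟨ρ, hr, hrB, hrC, hρ, hρev⟩ : ∃ ρ ∈ adm A G₁ G₂ (n + 2), ρ ∈ supB ∧ ρ ∈ supC ∧
      triD 1 ρ - d₂ (d₃ (homCochain n g)) ∈ triNull μ ∧
      evalGrid G₁ G₂ ρ ∈ totalNull G₁ G₂ A μ₁ μ₂ := by
    rcases n with _ | n
    · refine ⟨τ, ht, htB, htC, hτ, ?_⟩
      simpa using add_mem hev hFB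
    · obtain ⟨F', hF', hn⟩ := mem_coboundaries_iff.1 hFB
      have hl := liftCochain_mem_adm hG hF'
      have hlB := liftCochain_mem_supB F'
      have hlC := liftCochain_mem_supC F'
      refine ⟨τ - triD 1 (liftCochain F'), sub_mem ht (triD_mem_adm 1 hl),
        sub_mem htB (triD_mem_supB 1 hlB), sub_mem htC (triD_mem_supC 1 hlC), ?_, ?_⟩
      · rwa [map_sub, triD_triD, sub_zero]
      · rw [map_sub, ← totalD_evalGrid hl.2.1 hlB hlC, evalGrid_liftCochain hG]
        simpa using add_mem hev hn
  set σ : TriCochain G A := weight (fun i _ _ => if i = 0 then 0 else 1) ρ with σ_def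
  have hs : σ ∈ adm A G₁ G₂ (n + 2) := weight_mem_adm _ hr
  have hsA : σ ∈ supA := fun b c => by simp [σ_def, weight_apply]
  have hsB (a c) : σ a [] c = 0 := by
    have : ρ a [] c = 0 := hrB a c
    rw [σ_def, weight_apply, this, smul_zero]
  have hsC : σ ∈ supC := fun a b => by
    have : ρ a b [] = 0 := hrC a b
    rw [σ_def, weight_apply, this, smul_zero]
  have hsρ : σ - ρ ∈ triNull μ := by
    rw [mem_triNull]
    filter_upwards [mem_triNullOn.1 ((evalGrid_mem_totalNull_iff hG hr hrB hrC).1 hρev)]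
      with ⟨a, b, c⟩ h
    simp only [Pi.sub_apply, σ_def, weight_apply]
    split_ifs with ha
    · simpa using h ha
    · simp
  -- The cross term of g is, modulo null cochains, the coboundary of κ. So σ - κ is closed where a
  -- and c are nonempty.
  set κ : TriCochain G A := d₃ (homCochain n g) with κ_def
  have hκ : κ ∈ adm A G₁ G₂ (n + 2) := d₃_mem_adm (homCochain_mem_adm G₁ G₂ hgm)
  have hκC (a b) : κ a b [] = 0 := by simp [κ_def, d₃_apply]
  have hdκ : triD 0 κ ∈ triNull μ := by
    rw [triD_zero_eq, κ_def, d₃_d₃, zero_add, ← d₃_d₁, d₁_homCochain]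
    exact weight_mem_triNullOn _ (d₃_mem_triNullOn (S := fun _ _ => True) hdg)
  have hsκ : triD 1 (σ - κ) ∈ triNull μ := by
    have e1 : triD 1 κ = triD 0 κ + d₂ (d₃ (homCochain n g)) := by
      rw [triD_one_eq, κ_def, weight_d₂_d₃_homCochain]
      intro i; rfl
    have := sub_mem (add_mem (triD_mem_triNull 1 hsρ) hρ) hdκ
    convert! this using 1
    rw [map_sub, map_sub, e1]
    abel
  obtain ⟨t, ht', htA, htC', hte⟩ := exists_triD_primitive_of_supA_supC (sub_mem hs hκ)
    (sub_mem hsA (d₃_homCochain_mem_supA g)) (sub_mem hsC fun a b => hκC a b) hsκ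
  set tB : TriCochain G A := weight (fun _ j _ => if j = 0 then 1 else 0) t with tB_def
  have htB : tB ∈ supNoB := fun a b c hb => by simp [tB_def, weight_apply, hb]
  have htBA : tB ∈ supA := fun b c => by
    have : t [] b c = 0 := htA b c
    rw [tB_def, weight_apply, this, smul_zero]
  have htC'' (a b) : t a b [] = 0 := htC' a b
  have hxB : homCochain n g + tB ∈ supNoB := add_mem
    (fun a b c hb => homCochain_eq_zero g fun h => hb (List.length_eq_zero_iff.1 h.2.1)) htB
  -- On empty b, σ vanishes and the equation for t reads -d₃g = D tB with d₂ omitted; since g is a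
  -- cocycle, g + tB is closed.
  have hxD : triD 0 (homCochain n g + tB) ∈ triNull μ := by
    rw [mem_triNull]
    filter_upwards [mem_triNull.1 hte, mem_triNull.1 (weight_mem_triNullOn
      (fun _ j k => (-1) ^ (j + k)) hdg)] with ⟨a, b, c⟩ h h'
    by_cases hb : b = []
    · subst hb
      rw [← d₁_homCochain] at h'
      rw [map_add, triD_zero_eq (homCochain n g)]
      simp only [Pi.add_apply, Pi.sub_apply, hsB, triD_one_nil_b, zero_sub] at h h' ⊢
      rw [h', add_zero, ← neg_eq_zero, ← h]
      abel
    · exact triD_zero_mem_supNoB hxB a b c hb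
  obtain ⟨w, hw, hwA, hwB, hwx⟩ := exists_triD_primitive_of_supA_supNoB
    (add_mem (homCochain_mem_adm G₁ G₂ hgm) (weight_mem_adm _ ht'))
    (add_mem (homCochain_mem_supA g) htBA) hxB hxD
  set wC : TriCochain G A := weight (fun _ _ k => if k = 0 then 1 else 0) w with wC_def
  have hwC : wC ∈ adm A G₁ G₂ n := weight_mem_adm _ hw
  have hwC0 (a b c) (h : b ≠ [] ∨ c ≠ []) : wC a b c = 0 := by
    rw [wC_def, weight_apply]
    rcases h with h | h
    · rw [hwB a b c h, smul_zero]
    · simp [h]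
  have hgw : homCochain n g - d₁ wC ∈ triNull μ := by
    rw [mem_triNull]
    filter_upwards [mem_triNull.1 hwx] with ⟨a, b, c⟩ h
    by_cases hbc : b ≠ [] ∨ c ≠ []
    · have : homCochain n g a b c = 0 := homCochain_eq_zero g fun h => by
        rw [List.length_eq_zero_iff, List.length_eq_zero_iff] at h
        exact hbc.elim (fun h' => h' h.2.1) fun h' => h' h.2.2
      simp [this, d₁_apply, hwC0 _ b c hbc, listD_zero']
    · push Not at hbc
      obtain ⟨rfl, rfl⟩ := hbc
      simpa [triD_apply, d₁_apply, d₃_apply, wC_def, weight_apply, htC'' a []] using h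
  have hfg : f = (-1 : ℤ) ^ n • g := by rw [g_def, neg_one_pow_smul_smul]
  rcases n with _ | n
  -- In degree 0 the primitive has total length 0, so its first list is empty, and there it
  -- vanishes.
  · have : wC = 0 := by
      funext a b c
      rcases a with _ | ⟨x, a⟩
      · have : w [] b c = 0 := hwA b c
        rw [wC_def, weight_apply, this, smul_zero]; rfl
      · exact eq_zero_of_adm hwC (by simp)
    rw [this, map_zero, sub_zero, homCochain_mem_triNull_iff μ hgm] at hgw
    rw [hfg]
    exact zsmul_mem hgw _
  · obtain ⟨h, hhm, hh⟩ : ∃ h : (Fin n → G) → A, Measurable h ∧ wC = homCochain n h := by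
      refine ⟨_, measurable_of_adm hwC, eq_homCochain hwC.2.1 fun a b c h => ?_⟩
      by_cases hbc : b ≠ [] ∨ c ≠ []
      · exact hwC0 a b c hbc
      · push Not at hbc
        obtain ⟨rfl, rfl⟩ := hbc
        exact eq_zero_of_adm hwC (by simpa using h)
    rw [hh, d₁_homCochain, ← map_sub, homCochain_mem_triNull_iff μ
      (hgm.sub (measurable_groupD hhm))] at hgw
    refine mem_coboundaries_iff.2 ⟨(-1 : ℤ) ^ (n + 1) • h,
      zsmul_mem (show h ∈ measFun _ A from hhm) _, ?_⟩
    rw [hfg, map_zsmul, ← smul_sub]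
    exact zsmul_mem hgw _

end Comparison

/-! ### Signed sums over lattice paths -/

section PathList

variable {G : Type*} [Group G] {A : Type*} [AddCommGroup A]

/-- Evaluation on lists with a given first element. -/
def consHom (v : G) : (List G → A) →+ (List G → A) where
  toFun φ l := φ (v :: l)
  map_zero' := rfl
  map_add' _ _ := rfl

/-- The signed sum over the monotone lattice paths in the grid with the row lines `b` and the
column lines `c`, of the values on the lists of vertices along the paths. -/
noncomputable def pathList (G₁ G₂ : Subgroup G) : List G → List G → (List G → A) →+ A
  | [], _ => 0
  | _ :: _, [] => 0
  | y :: b, z :: c => (pathList G₁ G₂ (y :: b) c).comp (consHom (vert G₁ G₂ y z)) +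
      (-1 : ℤ) ^ c.length • (pathList G₁ G₂ b (z :: c)).comp (consHom (vert G₁ G₂ y z)) +
      if b.length = 0 ∧ c.length = 0 then
        Pi.evalAddMonoidHom (fun _ => A) [vert G₁ G₂ y z] else 0
  termination_by b c => b.length + c.length

variable {G₁ G₂ : Subgroup G}

theorem pathList_nil_left (c : List G) (φ : List G → A) : pathList G₁ G₂ [] c φ = 0 := by
  rw [pathList]; rfl

theorem pathList_nil_right (b : List G) (φ : List G → A) : pathList G₁ G₂ b [] φ = 0 := by
  cases b <;> rw [pathList] <;> rfl

theorem pathList_cons (y z : G) (b c : List G) (φ : List G → A) :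
    pathList G₁ G₂ (y :: b) (z :: c) φ =
      pathList G₁ G₂ (y :: b) c (fun l => φ (vert G₁ G₂ y z :: l)) +
      (-1 : ℤ) ^ c.length • pathList G₁ G₂ b (z :: c) (fun l => φ (vert G₁ G₂ y z :: l)) +
      if b.length = 0 ∧ c.length = 0 then φ [vert G₁ G₂ y z] else 0 := by
  rw [pathList]
  split_ifs <;> rfl

/-- Omitting a corner gives the same list for the two paths around a square, with opposite signs, so
these terms cancel. Otherwise an omitted vertex corresponds to a deleted row or column line. The
last term is the single vertex omitted from a path of length zero. The proof follows the recursion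
on the first step of the path. -/
theorem pathList_listD (b c : List G) (φ : List G → A) :
    pathList G₁ G₂ b c (fun l => listD l φ) =
      listD c (fun c' => pathList G₁ G₂ b c' φ) +
      (-1 : ℤ) ^ (c.length + 1) • listD b (fun b' => pathList G₁ G₂ b' c φ) +
      if b.length = 1 ∧ c.length = 1 then φ [] else 0 := by
  obtain ⟨N, hN⟩ : ∃ N, b.length + c.length = N := ⟨_, rfl⟩
  induction N using Nat.strong_induction_on generalizing b c φ with
  | _ N ih =>
  rcases b with _ | ⟨y, b⟩
  · simp [pathList_nil_left, listD_zero']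
  rcases c with _ | ⟨z, c⟩
  · simp [pathList_nil_right, listD_zero']
  set v := vert G₁ G₂ y z with hv
  set ψ : List G → A := fun l => φ (v :: l) with hψ
  have e0 (b c : List G) : pathList G₁ G₂ b c (fun l => listD (v :: l) φ) =
      pathList G₁ G₂ b c φ - pathList G₁ G₂ b c (fun l => listD l ψ) := by
    rw [← map_sub]; rfl
  have e1 : listD c (fun c' => pathList G₁ G₂ (y :: b) (z :: c') φ) =
      listD c (fun c' => pathList G₁ G₂ (y :: b) c' ψ) -
      (-1 : ℤ) ^ c.length • (pathList G₁ G₂ b c ψ - listD (z :: c) fun c' => pathList G₁ G₂ b c' ψ) +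
      if b.length = 0 ∧ c.length = 1 then ψ [] else 0 := by
    simp only [pathList_cons, ← hv]
    rw [listD_add', listD_add', listD_sign c (fun c' => pathList G₁ G₂ b (z :: c') ψ), listD_cons,
      sub_sub_cancel, ← sub_eq_add_neg]
    congr 1
    rcases c with _ | ⟨z', _ | ⟨z'', c⟩⟩
    · simp
    · simp [listD_cons, hψ]
    · rw [if_neg (by simp)]
      refine (listD_congr (ψ := fun _ => 0) fun l hl => if_neg ?_).trans (listD_zero' _)
      simp only [List.length_cons] at hl
      omega
  have e2 : listD b (fun b' => pathList G₁ G₂ (y :: b') (z :: c) φ) =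
      (pathList G₁ G₂ b c ψ - listD (y :: b) fun b' => pathList G₁ G₂ b' c ψ) +
      (-1 : ℤ) ^ c.length • listD b (fun b' => pathList G₁ G₂ b' (z :: c) ψ) +
      if b.length = 1 ∧ c.length = 0 then ψ [] else 0 := by
    simp only [pathList_cons, ← hv]
    rw [listD_add', listD_add', listD_zsmul', listD_cons, sub_sub_cancel]
    congr 1
    rcases b with _ | ⟨z', _ | ⟨z'', b⟩⟩
    · simp
    · simp [listD_cons, hψ]
    · rw [if_neg (by simp)]
      refine (listD_congr (ψ := fun _ => 0) fun l hl => if_neg ?_).trans (listD_zero' _)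
      simp only [List.length_cons] at hl
      omega
  rw [pathList_cons, e0, e0, ih _ (by rw [← hN]; simp) (y :: b) c ψ rfl,
    ih _ (by rw [← hN]; simp) b (z :: c) ψ rfl,
    listD_cons z c (fun c' => pathList G₁ G₂ (y :: b) c' φ), e1,
    listD_cons y b (fun b' => pathList G₁ G₂ b' (z :: c) φ), e2]
  have s : (-1 : ℤ) ^ c.length * (-1) ^ c.length = 1 := by rw [← mul_pow]; simp
  simp only [List.length_cons, Nat.add_eq_right, listD_cons, listD_nil, sub_zero, smul_add, smul_sub,
    pow_succ, mul_neg, mul_one, neg_neg, neg_smul, smul_smul, s, one_smul]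
  by_cases hb : b.length = 0 <;> by_cases hc : c.length = 0 <;> by_cases hb1 : b.length = 1 <;>
    by_cases hc1 : c.length = 1 <;> simp only [hb, hc, hb1, hc1, and_self, if_true, if_false, and_true,
      and_false, true_and, false_and, smul_zero, pow_zero, pow_one, one_smul, neg_smul] <;>
    first | omega | abel

/-- Vertices depend only on the cosets and move along with left translations, as long as the cosets
meet; this passes to sums over paths. -/
theorem pathList_rel (h : G₁ ⊓ G₂ = ⊥) (x : G) (ψ : A →+ A) {φ φ' : List G → A}
    (hφ : ∀ l l', List.Forall₂ (fun u u' => u = x * u') l l' → φ l = ψ (φ' l'))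
    {b b' c c' : List G} (hb : List.Forall₂ (fun y y' => (x * y')⁻¹ * y ∈ G₂) b b')
    (hc : List.Forall₂ (fun z z' => (x * z')⁻¹ * z ∈ G₁) c c')
    (hg : ∀ y ∈ b', ∀ z ∈ c', Good G₁ G₂ y z) :
    pathList G₁ G₂ b c φ = ψ (pathList G₁ G₂ b' c' φ') := by
  obtain ⟨N, hN⟩ : ∃ N, b.length + c.length = N := ⟨_, rfl⟩
  induction N using Nat.strong_induction_on generalizing b b' c c' φ φ' with
  | _ N ih =>
  cases hb with
  | nil => simp [pathList_nil_left]
  | @cons y y' b b' hy hb =>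
  cases hc with
  | nil => simp [pathList_nil_right]
  | @cons z z' c c' hz hc =>
  have hv : vert G₁ G₂ y z = x * vert G₁ G₂ y' z' := by
    rw [← vert_mul_left]
    exact (vert_congr h hy hz ((good_mul_left x _ _).2 (hg _ (by simp) _ (by simp)))).2
  have hφ' : ∀ l l', List.Forall₂ (fun u u' => u = x * u') l l' →
      φ (vert G₁ G₂ y z :: l) = ψ (φ' (vert G₁ G₂ y' z' :: l')) := fun l l' hl =>
    hφ _ _ (List.Forall₂.cons hv hl)
  rw [pathList_cons, pathList_cons, map_add, map_add, map_zsmul,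
    ih _ (by rw [← hN]; simp) (φ := fun l => φ (vert G₁ G₂ y z :: l)) hφ' (List.Forall₂.cons hy hb) hc
      (fun y hy z hz => hg y hy z (by simp [hz])) rfl,
    ih _ (by rw [← hN]; simp) (φ := fun l => φ (vert G₁ G₂ y z :: l)) hφ' hb (List.Forall₂.cons hz hc)
      (fun y hy z hz => hg y (by simp [hy]) z hz) rfl, hc.length_eq, hb.length_eq]
  congr 1
  split_ifs
  · exact hφ' [] [] List.Forall₂.nil
  · simp

/-- Every path through the vertices visits |b| + |c| - 1 of them. -/
theorem pathList_eq_zero {φ : List G → A} {N : ℕ} (hφ : ∀ l, l.length ≠ N → φ l = 0) {b c : List G}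
    (h : b.length + c.length ≠ N + 1) : pathList G₁ G₂ b c φ = 0 := by
  obtain ⟨M, hM⟩ : ∃ M, b.length + c.length = M := ⟨_, rfl⟩
  induction M using Nat.strong_induction_on generalizing b c φ N with
  | _ M ih =>
  rcases b with _ | ⟨y, b⟩
  · simp [pathList_nil_left]
  rcases c with _ | ⟨z, c⟩
  · simp [pathList_nil_right]
  simp only [List.length_cons] at h hM
  have hφ' (l : List G) (hl : l.length ≠ N - 1) : φ (vert G₁ G₂ y z :: l) = 0 := by
    by_cases hl' : l.length + 1 = N
    · omega
    · exact hφ _ (by simpa using hl')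
  rw [pathList_cons]
  have i1 : (if b.length = 0 ∧ c.length = 0 then φ [vert G₁ G₂ y z] else 0) = 0 := by
    split_ifs with hbc
    · exact hφ _ (by simp; omega)
    · rfl
  rw [i1]
  rcases N with _ | N
  · have : (fun l => φ (vert G₁ G₂ y z :: l)) = 0 := by
      funext l; exact hφ _ (by simp)
    rw [this]; simp
  · rw [ih (b.length + 1 + c.length) (by omega) hφ' (b := y :: b) (c := c) (by simp; omega) (by simp),
      ih (b.length + (c.length + 1)) (by omega) hφ' (b := b) (c := z :: c) (by simp; omega) (by simp)]
    simp

end PathList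

/-! ### Measurability of path sums -/

section PathListMeasurable

universe u

variable {G : Type u} [Group G] [TopologicalSpace G] [IsTopologicalGroup G]
  [T2Space G] [LocallyCompactSpace G] [SecondCountableTopology G] [MeasurableSpace G]
  [BorelSpace G] {G₁ G₂ : Subgroup G} {μ : Measure G}
  {A : Type*} [AddCommGroup A] [MeasurableSpace A] [MeasurableAdd₂ A] [MeasurableNeg A]

theorem measurable_list_append {α : Type*} [MeasurableSpace α] :
    Measurable fun z : List α × List α => z.1 ++ z.2 := by
  refine measurable_list_prod.2 fun n => ?_
  have h : Measurable fun z : List α × (Fin n → α) => List.ofFn z.2 ++ z.1 := by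
    refine measurable_list_prod.2 fun m => ?_
    simp only [← List.ofFn_fin_append]
    refine (measurableEmbedding_ofFn _).measurable.comp (measurable_pi_lambda _ fun i => ?_)
    refine Fin.addCases (fun j => ?_) (fun j => ?_) i
    · simp only [Fin.append_left]; fun_prop
    · simp only [Fin.append_right]; fun_prop
  exact h.comp measurable_swap

/-- The recursion feeds the first vertex to the function as a further parameter, so the parameter
space ρ becomes G × ρ. For the induction, ρ has to vary and to live in the universe of G. -/
theorem measurable_pathList_ofFn (hG : IsMatchedPair G₁ G₂ μ) (N : ℕ) {ρ : Type u}
    [MeasurableSpace ρ] {f : List G → ρ → A} (hf : Measurable fun z : List G × ρ => f z.1 z.2)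
    (p q : ℕ) (hN : p + q = N) :
    Measurable fun z : (Fin p → G) × ((Fin q → G) × ρ) =>
      pathList G₁ G₂ (List.ofFn z.1) (List.ofFn z.2.1) fun l => f l z.2.2 := by
  induction N using Nat.strong_induction_on generalizing ρ p q with
  | _ N ih =>
  rcases p with _ | p
  · simp [pathList_nil_left]
  rcases q with _ | q
  · simp [pathList_nil_right]
  have hf' : Measurable fun z : List G × (G × ρ) => f (z.2.1 :: z.1) z.2.2 :=
    hf.comp ((measurable_list_cons.comp (measurable_snd.fst.prodMk measurable_fst)).prodMk
      measurable_snd.snd)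
  have hv : Measurable fun z : (Fin (p + 1) → G) × ((Fin (q + 1) → G) × ρ) =>
      vert G₁ G₂ (z.1 0) (z.2.1 0) :=
    (measurable_vert hG).comp (f := fun z : (Fin (p + 1) → G) × ((Fin (q + 1) → G) × ρ) =>
      (z.1 0, z.2.1 0)) (by fun_prop)
  have h1 := (ih (p + 1 + q) (by omega) (f := fun l (r : G × ρ) => f (r.1 :: l) r.2) hf' (p + 1) q rfl).comp
    (f := fun z : (Fin (p + 1) → G) × ((Fin (q + 1) → G) × ρ) =>
      (z.1, (fun j => z.2.1 j.succ), (vert G₁ G₂ (z.1 0) (z.2.1 0), z.2.2))) (by fun_prop)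
  have h2 := (ih (p + (q + 1)) (by omega) (f := fun l (r : G × ρ) => f (r.1 :: l) r.2) hf' p (q + 1) rfl).comp
    (f := fun z : (Fin (p + 1) → G) × ((Fin (q + 1) → G) × ρ) =>
      ((fun j => z.1 j.succ), z.2.1, (vert G₁ G₂ (z.1 0) (z.2.1 0), z.2.2))) (by fun_prop)
  have h3 : Measurable fun z : (Fin (p + 1) → G) × ((Fin (q + 1) → G) × ρ) =>
      f [vert G₁ G₂ (z.1 0) (z.2.1 0)] z.2.2 :=
    hf.comp ((measurable_list_cons.comp (hv.prodMk measurable_const)).prodMk measurable_snd.snd)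
  have e (z : (Fin (p + 1) → G) × ((Fin (q + 1) → G) × ρ)) :=
    pathList_cons (G₁ := G₁) (G₂ := G₂) (z.1 0) (z.2.1 0) (List.ofFn fun i => z.1 i.succ)
      (List.ofFn fun i => z.2.1 i.succ) (fun l => f l z.2.2)
  simp only [← List.ofFn_succ, List.length_ofFn] at e
  simp only [e]
  refine (h1.add (measurable_sign_smul h2 q)).add ?_
  split_ifs
  · exact h3
  · exact measurable_const

theorem measurable_pathList (hG : IsMatchedPair G₁ G₂ μ) {f : List G → List G → A}
    (hf : Measurable fun z : List G × List G => f z.1 z.2) :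
    Measurable fun w : List G × List G × List G =>
      pathList G₁ G₂ w.2.1 w.2.2 fun l => f l w.1 := by
  have h : Measurable fun w : List G × (List G × List G) =>
      pathList G₁ G₂ w.1 w.2.1 fun l => f l w.2.2 := by
    refine measurable_list_prod.2 fun p => ?_
    have h : Measurable fun w : List G × ((Fin p → G) × List G) =>
        pathList G₁ G₂ (List.ofFn w.2.1) w.1 fun l => f l w.2.2 :=
      measurable_list_prod.2 fun q => (measurable_pathList_ofFn hG _ hf p q rfl).comp
        (f := fun w : (Fin q → G) × ((Fin p → G) × List G) => (w.2.1, w.1, w.2.2)) (by fun_prop)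
    exact h.comp (f := fun w : (Fin p → G) × (List G × List G) => (w.2.1, w.1, w.2.2))
      (by fun_prop)
  exact h.comp (f := fun w : List G × List G × List G => (w.2.1, w.2.2, w.1)) (by fun_prop)

end PathListMeasurable

/-! ### Path sums of cocycles -/

section PathSums

variable {G : Type*} [Group G] {A : Type*} [AddCommGroup A] {G₁ G₂ : Subgroup G}

/-- The successive quotients of the list `g :: l`. -/
def edgeList : G → List G → List G
  | _, [] => []
  | g, x :: l => (g⁻¹ * x) :: edgeList x l

/-- The same sum over paths, once in terms of vertices and once in terms of edges. The base vertex g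
is arbitrary because each step of the recursion moves it along an edge. -/
theorem pathList_eq_pathSum (h : G₁ ⊓ G₂ = ⊥) {p q : ℕ} (F : List G → A) (X : Grid G₁ G₂ p q)
    (g : G) (φ : List G → A) (hφ : ∀ l, l.length = p + q → φ (g :: l) = F (edgeList g l)) :
    pathList G₁ G₂ (List.ofFn fun i => g * gridVertex X i 0)
      (List.ofFn fun j => g * gridVertex X 0 j) φ = pathSum p q F X := by
  obtain ⟨N, hN⟩ : ∃ N, p + q = N := ⟨_, rfl⟩
  induction N generalizing p q F g φ with
  | zero =>
    obtain rfl : p = 0 := by omega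
    obtain rfl : q = 0 := by omega
    have hv : vert G₁ G₂ g g = g := (vert_eq h (by simp) (by simp)).2
    simp [pathSum, pathList_cons, pathList_nil_left, pathList_nil_right, gridVertex, hv, edgeList,
      hφ [] rfl]
  | succ N ih =>
    have h00 : gridVertex X 0 0 = 1 := by simp [gridVertex]
    have hv : vert G₁ G₂ (g * gridVertex X 0 0) (g * gridVertex X 0 0) = g := by
      rw [h00]; exact (vert_eq h (by simp) (by simp)).2
    have right {p q : ℕ} (hN : p + (q + 1) = N + 1) (X : Grid G₁ G₂ p (q + 1))
        (hφ : ∀ l, l.length = p + (q + 1) → φ (g :: l) = F (edgeList g l)) :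
        pathList G₁ G₂ (List.ofFn fun i => g * gridVertex X i 0)
          (List.ofFn fun j : Fin (q + 1) => g * gridVertex X 0 j.succ) (fun l => φ (g :: l)) =
        pathSum p q (fun l => F ((X.1.2 0 0 : G) :: l)) (hFace 0 X) := by
      rw [← ih (fun l => F ((X.1.2 0 0 : G) :: l)) (hFace 0 X) (g * X.1.2 0 0) (fun l => φ (g :: l))
        (fun l hl => by rw [hφ _ (by simp; omega), edgeList]; simp) (by omega)]
      simp only [mul_assoc, gridVertex_hFace_zero]
      -- After a step to the right the rows are represented by their vertices in the second column;
      -- the cosets, hence the path sums, are the same.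
      refine pathList_rel h 1 (AddMonoidHom.id A) (fun l l' hl => ?_) (forall₂_ofFn_iff.2 fun i => ?_)
        (forall₂_ofFn_iff.2 fun j => by simp) ?_
      · simp only [one_mul, List.forall₂_eq_eq_eq] at hl
        subst hl; rfl
      · rw [gridVertex_succ_right]; simp [mul_assoc]
      · intro y hy z hz
        obtain ⟨i, rfl⟩ := List.mem_ofFn.1 hy
        obtain ⟨j, rfl⟩ := List.mem_ofFn.1 hz
        refine (good_mul_left _ _ _).2 ?_
        refine (good_congr h (y := gridVertex X i 0) (z := gridVertex X 0 j.succ) ?_ (by simp)).1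
          (good_gridVertex h X _ _).1
        rw [gridVertex_succ_right]; simp
    have down {p q : ℕ} (hN : p + 1 + q = N + 1) (X : Grid G₁ G₂ (p + 1) q)
        (hφ : ∀ l, l.length = p + 1 + q → φ (g :: l) = F (edgeList g l)) :
        pathList G₁ G₂ (List.ofFn fun i : Fin (p + 1) => g * gridVertex X i.succ 0)
          (List.ofFn fun j => g * gridVertex X 0 j) (fun l => φ (g :: l)) =
        pathSum p q (fun l => F ((X.1.1 0 0 : G) :: l)) (vFace 0 X) := by
      rw [← ih (fun l => F ((X.1.1 0 0 : G) :: l)) (vFace 0 X) (g * X.1.1 0 0) (fun l => φ (g :: l))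
        (fun l hl => by rw [hφ _ (by simp; omega), edgeList]; simp) (by omega)]
      simp only [mul_assoc, gridVertex_vFace_zero]
      refine pathList_rel h 1 (AddMonoidHom.id A) (fun l l' hl => ?_)
        (forall₂_ofFn_iff.2 fun j => by simp) (forall₂_ofFn_iff.2 fun i => ?_) ?_
      · simp only [one_mul, List.forall₂_eq_eq_eq] at hl
        subst hl; rfl
      · rw [gridVertex_succ_left]; simp [mul_assoc]
      · intro y hy z hz
        obtain ⟨i, rfl⟩ := List.mem_ofFn.1 hy
        obtain ⟨j, rfl⟩ := List.mem_ofFn.1 hz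
        refine (good_mul_left _ _ _).2 ?_
        refine (good_congr h (y := gridVertex X i.succ 0) (z := gridVertex X 0 j) (by simp) ?_).1
          (good_gridVertex h X _ _).1
        rw [gridVertex_succ_left]; simp
    rcases p with _ | p <;> rcases q with _ | q
    · omega
    · rw [List.ofFn_succ (n := 0), List.ofFn_succ (n := q + 1), pathList_cons, hv]
      simp only [List.ofFn_zero, pathList_nil_left, smul_zero, add_zero, List.length_ofFn]
      rw [if_neg (by simp), add_zero, pathSum, ← right hN X hφ, List.ofFn_succ (n := 0)]
      rfl
    · rw [List.ofFn_succ (n := p + 1), List.ofFn_succ (n := 0), pathList_cons, hv]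
      simp only [List.ofFn_zero, pathList_nil_right, zero_add, List.length_ofFn]
      rw [if_neg (by simp), add_zero, pathSum, ← down hN X hφ, List.ofFn_succ (n := 0)]
      simp
    · rw [List.ofFn_succ (n := p + 1), List.ofFn_succ (n := q + 1), pathList_cons, hv]
      simp only [List.length_ofFn]
      rw [if_neg (by simp), add_zero, pathSum, ← right hN X hφ, ← down (by omega) X hφ,
        List.ofFn_succ (n := p + 1), List.ofFn_succ (n := q + 1)]

theorem edgeList_ofFn {n : ℕ} (g : G) (x : Fin n → G) :
    edgeList g (List.ofFn x) = List.ofFn (edges (Fin.cons g x : Fin (n + 1) → G)) := by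
  induction n generalizing g with
  | zero => simp [edgeList]
  | succ n ih =>
    rw [List.ofFn_succ, edgeList, ih, List.ofFn_succ]
    have e : (Fin.cons (x 0) (fun i => x i.succ) : Fin (n + 1) → G) = x := Fin.cons_self_tail x
    rw [e]
    congr 1

variable [DistribMulAction G A]

theorem pathList_homCochain (h : G₁ ⊓ G₂ = ⊥) {n : ℕ} (f : (Fin n → G) → A) {p q : ℕ}
    (X : Grid G₁ G₂ p q) :
    pathList G₁ G₂ (List.ofFn fun i => gridVertex X i 0) (List.ofFn fun j => gridVertex X 0 j)
      (fun l => homCochain n f l [] []) = pathCochain G₁ G₂ n f p q X := by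
  unfold pathCochain
  split_ifs with hn
  · have := pathList_eq_pathSum h (fun l => f fun i => l.getD i 1) X 1
      (fun l => homCochain n f l [] []) fun l hl => ?_
    · simpa using this
    · obtain ⟨x, rfl⟩ := exists_eq_ofFn (hl.trans hn)
      have e : (1 : G) :: List.ofFn x = List.ofFn (Fin.cons 1 x : Fin (n + 1) → G) := by
        rw [List.ofFn_succ]; simp
      rw [e, homCochain_ofFn, edgeList_ofFn, Fin.cons_zero, one_smul]
      congr 1
      funext i
      rw [List.getD_eq_getElem _ _ (by rw [List.length_ofFn]; exact i.2), List.getElem_ofFn]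
  · refine pathList_eq_zero (N := n + 1) (fun l hl => homCochain_eq_zero f fun h => hl h.1) ?_
    simp only [List.length_ofFn]
    omega

end PathSums

/-! ### Strict cocycles are comparable to their path sums -/

section PathComparable

universe u

variable {G : Type u} [Group G] [TopologicalSpace G] [IsTopologicalGroup G]
  [T2Space G] [LocallyCompactSpace G] [SecondCountableTopology G] [MeasurableSpace G]
  [BorelSpace G] {G₁ G₂ : Subgroup G} {μ : Measure G} [μ.IsHaarMeasure]
  {μ₁ : Measure G₁} {μ₂ : Measure G₂}
  [μ₁.IsHaarMeasure] [μ₂.IsHaarMeasure] [SigmaFinite μ₁] [SigmaFinite μ₂]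
  {A : Type*} [AddCommGroup A] [DistribMulAction G A]
  [MeasurableSpace A] [MeasurableAdd₂ A] [MeasurableNeg A] [MeasurableSingletonClass A]
  [MeasurableSMul₂ G A] {n : ℕ}

theorem ae_good_lists (hG : IsMatchedPair G₁ G₂ μ) :
    ∀ᵐ w ∂triMeasure μ, ∀ y ∈ w.2.1, ∀ z ∈ w.2.2, Good G₁ G₂ y z := by
  rw [ae_triMeasure_iff]
  intro m p q
  have h := Measure.quasiMeasurePreserving_snd (μ := Measure.pi fun _ : Fin m => μ)
    |>.ae (ae_good_vertices hG p q)
  filter_upwards [h] with w hw y hy z hz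
  obtain ⟨i, rfl⟩ := List.mem_ofFn.1 hy
  obtain ⟨j, rfl⟩ := List.mem_ofFn.1 hz
  exact hw i j

theorem measurableSet_good_lists (hG : IsMatchedPair G₁ G₂ μ) :
    MeasurableSet {w : List G × List G | ∀ y ∈ w.1, ∀ z ∈ w.2, Good G₁ G₂ y z} := by
  have h : Measurable fun w : List G × List G => ∀ y ∈ w.1, ∀ z ∈ w.2, Good G₁ G₂ y z := by
    refine measurable_list_prod.2 fun p => ?_
    have h : Measurable fun w : List G × (Fin p → G) =>
        ∀ y ∈ List.ofFn w.2, ∀ z ∈ w.1, Good G₁ G₂ y z := by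
      refine measurable_list_prod.2 fun q => ?_
      have h := (measurableSet_good_vertices hG p q).mem.comp
        (measurable_swap : Measurable fun w : (Fin q → G) × (Fin p → G) => w.swap)
      convert! h using 1
      funext w
      simp only [List.forall_mem_ofFn_iff]
      rfl
    exact h.comp (measurable_swap : Measurable fun w : (Fin p → G) × List G => w.swap)
  exact measurableSet_setOfPred.2 h

theorem listD_congr_of_subset {α : Type*} {l : List α} {φ ψ : List α → A}
    (h : ∀ l', l' ⊆ l → φ l' = ψ l') : listD l φ = listD l ψ := by
  induction l generalizing φ ψ with
  | nil => simp
  | cons v l ih =>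
    rw [listD_cons, listD_cons, h l (List.subset_cons_self v l),
      ih fun l' hl' => h _ (List.cons_subset_cons v hl')]

open Classical in
-- The witness τ(a, b, c) is, up to sign, the path sum of f with the points of a put in front of the
-- path. On empty a it is the path cochain itself.
theorem comparable_pathCochain (hG : IsMatchedPair G₁ G₂ μ) {f : (Fin n → G) → A}
    (hf : Measurable f) (hd : groupD G A n f = 0) :
    pathCochain G₁ G₂ n f ∈ totalCocycles G₁ G₂ A μ₁ μ₂ n ∧
      (f, pathCochain G₁ G₂ n f) ∈ Comparable G₁ G₂ μ μ₁ μ₂ A n := by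
  set h : List G → A := fun l => homCochain n f l [] [] with h_def
  have hh (l : List G) : listD l h = 0 := by
    have := congrFun (congrFun (congrFun (d₁_homCochain f) l) []) []
    rwa [hd, map_zero] at this
  have hlen (l : List G) (hl : l.length ≠ n + 1) : h l = 0 :=
    homCochain_eq_zero f fun h' => hl h'.1
  set T : TriCochain G A := fun a b c => pathList G₁ G₂ b c fun l => h (a ++ l) with T_def
  -- The sign turns (-1)^|a| in front of d₁ into the sign required by `triD`. It is 1 for empty a
  -- and -(-1)ⁿ for |a| = n + 1, where the cross term lives.
  set s : ℕ → ℤ := fun k => (-1) ^ ((n + 1) * k) with s_def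
  set τ : TriCochain G A := fun a b c =>
    -- Path sums are equivariant only if all vertices exist, hence the cut-off.
    if ∀ y ∈ b, ∀ z ∈ c, Good G₁ G₂ y z then s a.length • T a b c else 0 with τ_def
  have hT (a b c : List G) : d₃ T a b c + (-1 : ℤ) ^ (c.length + 1) • d₂ T a b c +
      (-1 : ℤ) ^ a.length • d₁ T a b c = -d₂ (d₃ (homCochain n f)) a b c := by
    have e1 := pathList_listD (G₁ := G₁) (G₂ := G₂) b c (fun l => h (a ++ l))
    -- The cocycle identity holds for every list, so omissions along the path can be traded for
    -- omissions in a.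
    have e2 (l : List G) : listD l (fun l => h (a ++ l)) =
        -((-1 : ℤ) ^ a.length • listD a fun a' => h (a' ++ l)) := by
      have := listD_append a l h
      rw [hh] at this
      rw [← neg_one_pow_smul_smul a.length (listD l _), ← smul_neg]
      congr 1
      exact (neg_eq_of_add_eq_zero_right this.symm).symm
    have e3 : pathList G₁ G₂ b c (fun l => listD l fun l => h (a ++ l)) =
        -((-1 : ℤ) ^ a.length • d₁ T a b c) := by
      simp only [e2]
      have : (fun l => -((-1 : ℤ) ^ a.length • listD a fun a' => h (a' ++ l))) =
          -((-1 : ℤ) ^ a.length • listD a (fun a' l => h (a' ++ l))) := by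
        funext l
        rw [Pi.neg_apply, Pi.smul_apply]
        congr 2
        exact listD_map (Pi.evalAddMonoidHom (fun _ => A) l) a fun a' l => h (a' ++ l)
      rw [this, map_neg, map_zsmul, ← listD_map]
      rfl
    have e4 : (if b.length = 1 ∧ c.length = 1 then h (a ++ []) else 0) =
        d₂ (d₃ (homCochain n f)) a b c := by
      split_ifs with hbc
      · obtain ⟨y, rfl⟩ := List.length_eq_one_iff.1 hbc.1
        obtain ⟨z, rfl⟩ := List.length_eq_one_iff.1 hbc.2
        simp [d₂_apply, d₃_apply, listD_cons, h_def]
      · exact (d₂_d₃_homCochain_eq_zero f hbc).symm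
    rw [e3, e4] at e1
    have e5 : -((-1 : ℤ) ^ a.length • d₁ T a b c) = d₃ T a b c +
      (-1 : ℤ) ^ (c.length + 1) • d₂ T a b c + d₂ (d₃ (homCochain n f)) a b c := e1
    rw [← neg_neg ((-1 : ℤ) ^ a.length • d₁ T a b c), e5]
    abel
  have hτ : τ ∈ adm A G₁ G₂ (n + 2) := by
    refine ⟨measurable_ite_length ?_ (measurable_zsmul_fun ?_ ?_), ?_, ?_⟩
    · exact measurable_snd (measurableSet_good_lists hG)
    · exact (measurable_of_countable s).comp (measurable_list_length.comp measurable_fst)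
    · refine measurable_pathList hG (f := fun l a => h (a ++ l)) ?_
      have h1 : Measurable h := (homCochain_mem_adm G₁ G₂ hf).1.comp
        (measurable_id.prodMk measurable_const : Measurable fun l : List G => (l, ([], [])))
      exact h1.comp (measurable_list_append.comp measurable_swap)
    · intro x a a' b b' c c' ha hb hc
      have hgg : (∀ y ∈ b, ∀ z ∈ c, Good G₁ G₂ y z) ↔ ∀ y ∈ b', ∀ z ∈ c', Good G₁ G₂ y z := by
        obtain ⟨p, hp⟩ : ∃ p, b'.length = p := ⟨_, rfl⟩
        obtain ⟨q, hq⟩ : ∃ q, c'.length = q := ⟨_, rfl⟩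
        obtain ⟨y, rfl⟩ := exists_eq_ofFn (hb.length_eq.trans hp)
        obtain ⟨y', rfl⟩ := exists_eq_ofFn hp
        obtain ⟨z, rfl⟩ := exists_eq_ofFn (hc.length_eq.trans hq)
        obtain ⟨z', rfl⟩ := exists_eq_ofFn hq
        have hb' := (forall₂_ofFn_iff (R := fun y y' => (x * y')⁻¹ * y ∈ G₂)).1 hb
        have hc' := (forall₂_ofFn_iff (R := fun y y' => (x * y')⁻¹ * y ∈ G₁)).1 hc
        simp only [List.forall_mem_ofFn_iff]
        exact forall_congr' fun i => forall_congr' fun j =>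
          (good_vertices_inv hG.inf_eq_bot (hb' i) (hc' j)).symm
      by_cases hg : ∀ y ∈ b', ∀ z ∈ c', Good G₁ G₂ y z
      · rw [τ_def]
        simp only [if_pos hg, if_pos (hgg.2 hg), ha.length_eq, T_def]
        rw [pathList_rel hG.inf_eq_bot x (DistribSMul.toAddMonoidHom A x)
          (φ' := fun l => h (a' ++ l)) (fun l l' hl => ?_) hb hc hg]
        · exact ((DistribSMul.toAddMonoidHom A x).map_zsmul _ _).symm
        · exact triInvariant_homCochain (G₁ := G₁) (G₂ := G₂) f x _ _ _ _ _ _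
            (List.rel_append ha hl) List.Forall₂.nil List.Forall₂.nil
      · rw [τ_def]
        simp only [if_neg hg, if_neg (mt hgg.1 hg), smul_zero]
    · intro a b c hne
      simp only [τ_def, T_def]
      by_cases ha : a.length ≤ n + 1
      · rw [pathList_eq_zero (N := n + 1 - a.length), smul_zero, ite_self]
        · intro l hl
          exact hlen _ (by simp; omega)
        · omega
      · have : (fun l => h (a ++ l)) = 0 := by
          funext l
          exact hlen _ (by simp; omega)
        rw [this, map_zero, smul_zero, ite_self]
  have hτB : τ ∈ supB := fun a c => by simp [τ_def, T_def, pathList_nil_left]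
  have hτC : τ ∈ supC := fun a b => by simp [τ_def, T_def, pathList_nil_right]
  have hτn : triD 1 τ - (-1 : ℤ) ^ n • d₂ (d₃ (homCochain n f)) ∈ triNull μ := by
    rw [mem_triNull]
    filter_upwards [ae_good_lists hG] with ⟨a, b, c⟩ hg
    simp only at hg
    -- Only this total length matters, and there the parity of |b| + |c| is determined by |a|; this
    -- makes the signs agree.
    by_cases hl : a.length + b.length + c.length = n + 3
    · have e1 : d₁ τ a b c = ((-1 : ℤ) ^ (n + 1) * s a.length) • d₁ T a b c := by
        rw [d₁_apply, d₁_apply, ← listD_zsmul']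
        refine listD_congr fun a' ha' => ?_
        simp only [τ_def, if_pos hg]
        congr 1
        simp only [s_def]
        rw [← ha', mul_add, mul_one, pow_add (-1 : ℤ) ((n + 1) * a'.length), mul_left_comm, ← mul_pow]
        simp
      have e2 : d₂ τ a b c = s a.length • d₂ T a b c := by
        rw [d₂_apply, d₂_apply, ← listD_zsmul']
        exact listD_congr_of_subset fun b' hb' => if_pos fun y hy => hg y (hb' hy)
      have e3 : d₃ τ a b c = s a.length • d₃ T a b c := by
        rw [d₃_apply, d₃_apply, ← listD_zsmul']
        exact listD_congr_of_subset fun b' hb' => if_pos fun y hy z hz => hg y hy z (hb' hz)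
      have es : (-1 : ℤ) ^ (b.length + c.length) * ((-1) ^ (n + 1) * s a.length) =
          s a.length * (-1) ^ a.length := by
        rw [← mul_assoc, ← pow_add, mul_comm]
        congr 1
        rw [neg_one_pow_eq_pow_mod_two, neg_one_pow_eq_pow_mod_two (n := a.length)]
        congr 1
        omega
      have key := congrArg (s a.length • ·) (hT a b c)
      simp only [smul_add, smul_neg] at key
      change triD 1 τ a b c - (-1 : ℤ) ^ n • d₂ (d₃ (homCochain n f)) a b c = 0
      rw [triD_apply, e1, e2, e3, smul_smul _ _ (d₁ T a b c), es, one_mul,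
        mul_smul (s a.length), smul_comm _ (s a.length), key]
      by_cases ha : a.length = n + 1
      · have : s a.length = -(-1) ^ n := by
          rw [s_def, ha]
          rcases Nat.even_or_odd n with hn | hn
          · rw [hn.neg_one_pow]
            exact (hn.add_one.mul hn.add_one).neg_one_pow
          · rw [hn.neg_one_pow, neg_neg]
            exact (hn.add_one.mul_left _).neg_one_pow
        rw [this]
        simp
      · have : d₂ (d₃ (homCochain n f)) a b c = 0 := d₂_d₃_homCochain_eq_zero f (by omega)
        rw [this]
        simp
    · exact eq_zero_of_adm (sub_mem (triD_mem_adm 1 hτ)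
        (zsmul_mem (d₂_mem_adm (d₃_mem_adm (homCochain_mem_adm G₁ G₂ hf))) _)) hl
  have hev : evalGrid G₁ G₂ τ = pathCochain G₁ G₂ n f := by
    funext p q X
    rw [← pathList_homCochain hG.inf_eq_bot, evalGrid_apply]
    have hg : ∀ y ∈ List.ofFn (fun i => gridVertex X i 0),
        ∀ z ∈ List.ofFn (fun j => gridVertex X 0 j), Good G₁ G₂ y z := by
      simp only [List.forall_mem_ofFn_iff]
      exact fun i j => (good_gridVertex hG.inf_eq_bot X i j).1
    rw [τ_def]
    simp only [if_pos hg, T_def, s_def, List.length_nil, mul_zero, pow_zero, one_smul,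
      List.nil_append]
    rfl
  rw [← hev]
  exact ⟨evalGrid_mem_totalCocycles hG hτ hτB hτC hτn, τ, hτ, hτB, hτC, hτn, by simp [zero_mem]⟩

end PathComparable

/-! ### Isomorphisms of cohomology groups -/

/-- The pairs of related cocycles map onto both cohomology groups by `h1` and `h2`, and the two
kernels agree by `h3`. Both groups are thus the same quotient, and no choice of representatives has
to be additive. -/
theorem exists_cohomology_addEquiv {M N : Type*} [AddCommGroup M] [AddCommGroup N]
    (Z B : AddSubgroup M) (Z' B' : AddSubgroup N) (R : AddSubgroup (M × N))
    (h1 : ∀ f ∈ Z, ∃ F ∈ Z', (f, F) ∈ R) (h2 : ∀ F ∈ Z', ∃ f ∈ Z, (f, F) ∈ R)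
    (h3 : ∀ f F, f ∈ Z → F ∈ Z' → (f, F) ∈ R → (f ∈ B ↔ F ∈ B')) :
    ∃ e : Cohomology Z B ≃+ Cohomology Z' B', ∀ f F, f ∈ Z → F ∈ Z' → (f, F) ∈ R →
      ∀ x, Represents x f → Represents (e x) F := by
  let T : AddSubgroup (M × N) := R ⊓ Z.prod Z'
  let a : T →+ Cohomology Z B := (QuotientAddGroup.mk' _).comp
    (((AddMonoidHom.fst M N).comp T.subtype).codRestrict Z fun x => x.2.2.1)
  let b : T →+ Cohomology Z' B' := (QuotientAddGroup.mk' _).comp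
    (((AddMonoidHom.snd M N).comp T.subtype).codRestrict Z' fun x => x.2.2.2)
  have ha : Function.Surjective a := by
    intro x
    obtain ⟨⟨f, hf⟩, rfl⟩ := QuotientAddGroup.mk_surjective x
    obtain ⟨F, hF, hR⟩ := h1 f hf
    exact ⟨⟨(f, F), hR, hf, hF⟩, rfl⟩
  have hb : Function.Surjective b := by
    intro x
    obtain ⟨⟨F, hF⟩, rfl⟩ := QuotientAddGroup.mk_surjective x
    obtain ⟨f, hf, hR⟩ := h2 F hF
    exact ⟨⟨(f, F), hR, hf, hF⟩, rfl⟩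
  have hab : a.ker = b.ker := by
    ext x
    have e1 : x ∈ a.ker ↔ x.1.1 ∈ B :=
      (QuotientAddGroup.eq_zero_iff (N := B.addSubgroupOf Z) ⟨x.1.1, x.2.2.1⟩)
    have e2 : x ∈ b.ker ↔ x.1.2 ∈ B' :=
      (QuotientAddGroup.eq_zero_iff (N := B'.addSubgroupOf Z') ⟨x.1.2, x.2.2.2⟩)
    rw [e1, e2]
    exact h3 _ _ x.2.2.1 x.2.2.2 x.2.1
  refine ⟨(QuotientAddGroup.quotientKerEquivOfSurjective a ha).symm.trans
    ((QuotientAddGroup.quotientAddEquivOfEq hab).trans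
      (QuotientAddGroup.quotientKerEquivOfSurjective b hb)), ?_⟩
  rintro f F hf hF hR x ⟨hf', rfl⟩
  refine ⟨hF, ?_⟩
  have : (QuotientAddGroup.quotientKerEquivOfSurjective a ha).symm
      (QuotientAddGroup.mk (⟨f, hf'⟩ : Z)) =
      QuotientAddGroup.mk (s := a.ker) (⟨(f, F), hR, hf, hF⟩ : T) := by
    rw [AddEquiv.symm_apply_eq]; rfl
  simp only [AddEquiv.trans_apply, this]
  rfl

/-! ### Cohomology classes and representatives -/

section Representatives

variable {N N' : Type*} [AddCommGroup N] [AddCommGroup N'] {Z B : AddSubgroup N}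
  {Z' B' : AddSubgroup N'}

theorem exists_represents (x : Cohomology Z B) : ∃ f, Represents x f := by
  obtain ⟨f, rfl⟩ := QuotientAddGroup.mk_surjective x
  exact ⟨f.1, f.2, rfl⟩

theorem exists_represented (B : AddSubgroup N) {f : N} (hf : f ∈ Z) :
    ∃ x : Cohomology Z B, Represents x f := ⟨_, hf, rfl⟩

namespace Represents

variable {x y : Cohomology Z B} {f g : N}

theorem mem (h : Represents x f) : f ∈ Z := h.1

theorem eq_zero_iff (h : Represents x f) : x = 0 ↔ f ∈ B := by
  obtain ⟨hf, rfl⟩ := h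
  exact QuotientAddGroup.eq_zero_iff (N := B.addSubgroupOf Z) ⟨f, hf⟩

theorem add (hx : Represents x f) (hy : Represents y g) : Represents (x + y) (f + g) := by
  obtain ⟨hf, rfl⟩ := hx
  obtain ⟨hg, rfl⟩ := hy
  exact ⟨add_mem hf hg, rfl⟩

theorem sub (hx : Represents x f) (hy : Represents y g) : Represents (x - y) (f - g) := by
  obtain ⟨hf, rfl⟩ := hx
  obtain ⟨hg, rfl⟩ := hy
  exact ⟨sub_mem hf hg, rfl⟩

theorem eq_iff (hx : Represents x f) (hy : Represents y g) : x = y ↔ f - g ∈ B := by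
  rw [← sub_eq_zero, (hx.sub hy).eq_zero_iff]

theorem eq (hx : Represents x f) (hy : Represents y f) : x = y := by
  rw [hx.eq_iff hy, sub_self]; exact zero_mem B

theorem congr (hx : Represents x f) (hg : g ∈ Z) (h : f - g ∈ B) : Represents x g := by
  obtain ⟨y, hy⟩ := exists_represented B hg
  rwa [(hx.eq_iff hy).2 h]

end Represents

theorem exists_cohomology_map (T : N →+ N') (hZ : ∀ f ∈ Z, T f ∈ Z')
    (hB : ∀ f ∈ Z, f ∈ B → T f ∈ B') :
    ∃ φ : Cohomology Z B →+ Cohomology Z' B', ∀ x f, Represents x f → Represents (φ x) (T f) := by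
  refine ⟨QuotientAddGroup.map _ _ ((T.comp Z.subtype).codRestrict Z' fun x => hZ _ x.2)
    fun x hx => hB _ x.2 hx, ?_⟩
  rintro x f ⟨hf, rfl⟩
  exact ⟨hZ f hf, rfl⟩

end Representatives

/-! ### Restriction to the edges of the bicomplex -/

section Restriction

variable {G : Type*} [Group G] {G₁ G₂ : Subgroup G} {A : Type*} [AddCommGroup A]
  [DistribMulAction G A]

theorem toLeft_totalD (n : ℕ) (F : Bicochain G₁ G₂ A) :
    toLeft G₁ G₂ A (n + 1) (totalD G₁ G₂ A F) = groupD G₁ A n (toLeft G₁ G₂ A n F) := by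
  funext g
  change dv G₁ G₂ A n 0 (F n 0) _ = _
  have e (k : Fin (n + 2)) : vFace k (⟨(fun i _ => g i, fun _ j => j.elim0), fun _ j => j.elim0⟩ :
      Grid G₁ G₂ (n + 1) 0) = ⟨(fun i _ => face k g i, fun _ j => j.elim0), fun _ j => j.elim0⟩ :=
    Subtype.ext (Prod.ext rfl (by funext i j; exact j.elim0))
  simp only [dv, groupD, AddMonoidHom.coe_mk, ZeroHom.coe_mk, e]
  rfl

theorem toRight_totalD (n : ℕ) (F : Bicochain G₁ G₂ A) :
    toRight G₁ G₂ A (n + 1) (totalD G₁ G₂ A F) = groupD G₂ A n (toRight G₁ G₂ A n F) := by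
  funext g
  change dh G₁ G₂ A 0 n (F 0 n) _ = _
  have e (k : Fin (n + 2)) : hFace k (⟨(fun i _ => i.elim0, fun _ j => g j), fun i _ => i.elim0⟩ :
      Grid G₁ G₂ 0 (n + 1)) = ⟨(fun i _ => i.elim0, fun _ j => face k g j), fun i _ => i.elim0⟩ :=
    Subtype.ext (Prod.ext (by funext i j; exact i.elim0) rfl)
  simp only [dh, groupD, AddMonoidHom.coe_mk, ZeroHom.coe_mk, e]
  rfl

theorem eq_toLeft (n : ℕ) (F : Bicochain G₁ G₂ A) (X : Grid G₁ G₂ n 0) :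
    F n 0 X = toLeft G₁ G₂ A n F (colRow X).1 := by
  refine congrArg (F n 0) (Subtype.ext (Prod.ext ?_ ?_))
  · funext i j; exact congrArg (X.1.1 i) (Subsingleton.elim (α := Fin 1) j 0)
  · funext i j; exact j.elim0

theorem eq_toRight (n : ℕ) (F : Bicochain G₁ G₂ A) (X : Grid G₁ G₂ 0 n) :
    F 0 n X = toRight G₁ G₂ A n F (colRow X).2 := by
  refine congrArg (F 0 n) (Subtype.ext (Prod.ext ?_ ?_))
  · funext i j; exact i.elim0
  · funext i j; exact congrArg (X.1.2 · j) (Subsingleton.elim (α := Fin 1) i 0)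

theorem pathSum_zero_right (n : ℕ) (F : List G → A) (X : Grid G₁ G₂ n 0) :
    pathSum n 0 F X = F (List.ofFn fun i => (X.1.1 i 0 : G)) := by
  induction n generalizing F with
  | zero => simp [pathSum]
  | succ n ih => rw [pathSum, ih, List.ofFn_succ]; rfl

theorem pathSum_zero_left (n : ℕ) (F : List G → A) (X : Grid G₁ G₂ 0 n) :
    pathSum 0 n F X = F (List.ofFn fun j => (X.1.2 0 j : G)) := by
  induction n generalizing F with
  | zero => simp [pathSum]
  | succ n ih => rw [pathSum, ih, List.ofFn_succ]; rfl

theorem toLeft_pathCochain (n : ℕ) (f : (Fin n → G) → A) :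
    toLeft G₁ G₂ A n (pathCochain G₁ G₂ n f) = fun g => f fun i => (g i : G) := by
  funext g
  change pathCochain G₁ G₂ n f n 0 _ = _
  rw [pathCochain, if_pos (add_zero n), pathSum_zero_right]
  congr 1
  funext i
  rw [List.getD_eq_getElem _ _ (by rw [List.length_ofFn]; exact i.2), List.getElem_ofFn]

theorem toRight_pathCochain (n : ℕ) (f : (Fin n → G) → A) :
    toRight G₁ G₂ A n (pathCochain G₁ G₂ n f) = fun g => f fun i => (g i : G) := by
  funext g
  change pathCochain G₁ G₂ n f 0 n _ = _
  rw [pathCochain, if_pos (zero_add n), pathSum_zero_left]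
  congr 1
  funext i
  rw [List.getD_eq_getElem _ _ (by rw [List.length_ofFn]; exact i.2), List.getElem_ofFn]

variable [MeasurableSpace G] [MeasurableSpace A] [MeasurableAdd₂ A] [MeasurableNeg A]

theorem measurable_toLeft {m : ℕ} (n : ℕ) {F : Bicochain G₁ G₂ A}
    (hF : F ∈ totalMeas G₁ G₂ A m) : toLeft G₁ G₂ A n F ∈ measFun (Fin n → G₁) A := by
  refine (hF n 0).1.comp (Measurable.subtype_mk (Measurable.prodMk ?_ measurable_const))
  fun_prop

theorem measurable_toRight {m : ℕ} (n : ℕ) {F : Bicochain G₁ G₂ A}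
    (hF : F ∈ totalMeas G₁ G₂ A m) : toRight G₁ G₂ A n F ∈ measFun (Fin n → G₂) A := by
  refine (hF 0 n).1.comp (Measurable.subtype_mk (Measurable.prodMk measurable_const ?_))
  fun_prop

end Restriction

/-! ### Restriction respects null sets, cocycles and coboundaries -/

section RestrictionNull

variable {G : Type*} [Group G] [TopologicalSpace G] [IsTopologicalGroup G]
  [T2Space G] [LocallyCompactSpace G] [SecondCountableTopology G] [MeasurableSpace G]
  [BorelSpace G] {G₁ G₂ : Subgroup G} {μ : Measure G} [μ.IsHaarMeasure]
  {μ₁ : Measure G₁} {μ₂ : Measure G₂}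
  [μ₁.IsHaarMeasure] [μ₂.IsHaarMeasure] [SigmaFinite μ₁] [SigmaFinite μ₂]
  {A : Type*} [AddCommGroup A] [DistribMulAction G A]
  [MeasurableSpace A] [MeasurableAdd₂ A] [MeasurableNeg A] {n : ℕ}

theorem mem_nullFun_iff_toLeft (hG : IsMatchedPair G₁ G₂ μ) (F : Bicochain G₁ G₂ A) :
    F n 0 ∈ nullFun (gridMeasure μ₁ μ₂ n 0) A ↔
      toLeft G₁ G₂ A n F ∈ groupNull G₁ A μ₁ n := by
  have : IsProbabilityMeasure (Measure.pi fun _ : Fin 0 => μ₂) := by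
    rw [Measure.pi_of_empty _ Fin.elim0]; infer_instance
  change (∀ᵐ X ∂gridMeasure μ₁ μ₂ n 0, F n 0 X = 0) ↔
    ∀ᵐ x ∂Measure.pi fun _ : Fin n => μ₁, toLeft G₁ G₂ A n F x = 0
  rw [← ae_prod_fst_iff (Measure.pi fun _ : Fin n => μ₁) (Measure.pi fun _ : Fin 0 => μ₂),
    ← ae_colRow_iff hG]
  simp only [eq_toLeft]

theorem mem_nullFun_iff_toRight (hG : IsMatchedPair G₁ G₂ μ) (F : Bicochain G₁ G₂ A) :
    F 0 n ∈ nullFun (gridMeasure μ₁ μ₂ 0 n) A ↔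
      toRight G₁ G₂ A n F ∈ groupNull G₂ A μ₂ n := by
  have : IsProbabilityMeasure (Measure.pi fun _ : Fin 0 => μ₁) := by
    rw [Measure.pi_of_empty _ Fin.elim0]; infer_instance
  change (∀ᵐ X ∂gridMeasure μ₁ μ₂ 0 n, F 0 n X = 0) ↔
    ∀ᵐ x ∂Measure.pi fun _ : Fin n => μ₂, toRight G₁ G₂ A n F x = 0
  rw [← ae_prod_fst_iff (Measure.pi fun _ : Fin n => μ₂) (Measure.pi fun _ : Fin 0 => μ₁),
    ae_prod_swap_iff, ← ae_colRow_iff hG]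
  simp only [eq_toRight, Prod.fst_swap]

theorem toLeft_mem_groupNull (hG : IsMatchedPair G₁ G₂ μ) {F : Bicochain G₁ G₂ A}
    (hF : F ∈ totalNull G₁ G₂ A μ₁ μ₂) (n : ℕ) : toLeft G₁ G₂ A n F ∈ groupNull G₁ A μ₁ n :=
  (mem_nullFun_iff_toLeft hG F).1 (hF n 0)

theorem toRight_mem_groupNull (hG : IsMatchedPair G₁ G₂ μ) {F : Bicochain G₁ G₂ A}
    (hF : F ∈ totalNull G₁ G₂ A μ₁ μ₂) (n : ℕ) : toRight G₁ G₂ A n F ∈ groupNull G₂ A μ₂ n :=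
  (mem_nullFun_iff_toRight hG F).1 (hF 0 n)

theorem toLeft_mem_groupCocycles (hG : IsMatchedPair G₁ G₂ μ) {F : Bicochain G₁ G₂ A}
    (hF : F ∈ totalCocycles G₁ G₂ A μ₁ μ₂ n) : toLeft G₁ G₂ A n F ∈ groupCocycles G₁ A μ₁ n := by
  refine ⟨measurable_toLeft n hF.1, ?_⟩
  change groupD G₁ A n _ ∈ groupNull G₁ A μ₁ (n + 1)
  rw [← toLeft_totalD]
  exact toLeft_mem_groupNull hG hF.2 _

theorem toRight_mem_groupCocycles (hG : IsMatchedPair G₁ G₂ μ) {F : Bicochain G₁ G₂ A}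
    (hF : F ∈ totalCocycles G₁ G₂ A μ₁ μ₂ n) : toRight G₁ G₂ A n F ∈ groupCocycles G₂ A μ₂ n := by
  refine ⟨measurable_toRight n hF.1, ?_⟩
  change groupD G₂ A n _ ∈ groupNull G₂ A μ₂ (n + 1)
  rw [← toRight_totalD]
  exact toRight_mem_groupNull hG hF.2 _

theorem toLeft_mem_groupCoboundaries (hG : IsMatchedPair G₁ G₂ μ) {F : Bicochain G₁ G₂ A}
    (hF : F ∈ totalCoboundaries G₁ G₂ A μ₁ μ₂ (n + 1)) :
    toLeft G₁ G₂ A (n + 1) F ∈ groupCoboundaries G₁ A μ₁ (n + 1) := by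
  obtain ⟨y, hy, h⟩ := mem_coboundaries_iff.1 hF
  refine mem_coboundaries_iff.2 ⟨_, measurable_toLeft n hy, ?_⟩
  rw [← toLeft_totalD, ← map_sub]
  exact toLeft_mem_groupNull hG h _

theorem toRight_mem_groupCoboundaries (hG : IsMatchedPair G₁ G₂ μ) {F : Bicochain G₁ G₂ A}
    (hF : F ∈ totalCoboundaries G₁ G₂ A μ₁ μ₂ (n + 1)) :
    toRight G₁ G₂ A (n + 1) F ∈ groupCoboundaries G₂ A μ₂ (n + 1) := by
  obtain ⟨y, hy, h⟩ := mem_coboundaries_iff.1 hF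
  refine mem_coboundaries_iff.2 ⟨_, measurable_toRight n hy, ?_⟩
  rw [← toRight_totalD, ← map_sub]
  exact toRight_mem_groupNull hG h _

end RestrictionNull

/-! ### The long exact sequence of the mapping cone -/

section Cone

variable {G : Type*} [Group G] [TopologicalSpace G] [IsTopologicalGroup G]
  [T2Space G] [LocallyCompactSpace G] [SecondCountableTopology G] [MeasurableSpace G]
  [BorelSpace G] {G₁ G₂ : Subgroup G} {μ : Measure G} [μ.IsHaarMeasure]
  {μ₁ : Measure G₁} {μ₂ : Measure G₂}
  [μ₁.IsHaarMeasure] [μ₂.IsHaarMeasure] [SigmaFinite μ₁] [SigmaFinite μ₂]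
  {A : Type*} [AddCommGroup A] [DistribMulAction G A]
  [MeasurableSpace A] [MeasurableAdd₂ A] [MeasurableNeg A] {n : ℕ}

theorem coneD_zero_mk (K : ((Fin n → G₁) → A) × ((Fin n → G₂) → A)) :
    coneD G₁ G₂ A n (0, K) = (0, -groupD G₁ A n K.1, -groupD G₂ A n K.2) := by
  simp [coneD]

theorem coneD_mk_zero (F : Bicochain G₁ G₂ A) :
    coneD G₁ G₂ A n (F, 0) =
      (totalD G₁ G₂ A F, toLeft G₁ G₂ A (n + 1) F, toRight G₁ G₂ A (n + 1) F) := by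
  simp [coneD]

theorem mem_kacCocycles_iff {c : ConeCochain G₁ G₂ A n} :
    c ∈ kacCocycles G₁ G₂ A μ₁ μ₂ n ↔ c ∈ coneMeas G₁ G₂ A n ∧
      totalD G₁ G₂ A c.1 ∈ totalNull G₁ G₂ A μ₁ μ₂ ∧
      -groupD G₁ A n c.2.1 + toLeft G₁ G₂ A (n + 1) c.1 ∈ groupNull G₁ A μ₁ (n + 1) ∧
      -groupD G₂ A n c.2.2 + toRight G₁ G₂ A (n + 1) c.1 ∈ groupNull G₂ A μ₂ (n + 1) := Iff.rfl

theorem mem_groupCocycles_iff {H : Type*} [Group H] [DistribMulAction H A] [MeasurableSpace H]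
    {ν : Measure H} {f : (Fin n → H) → A} :
    f ∈ groupCocycles H A ν n ↔ Measurable f ∧ groupD H A n f ∈ groupNull H A ν (n + 1) := Iff.rfl

theorem zero_mk_mem_kacCocycles {K : ((Fin n → G₁) → A) × ((Fin n → G₂) → A)}
    (h₁ : K.1 ∈ groupCocycles G₁ A μ₁ n) (h₂ : K.2 ∈ groupCocycles G₂ A μ₂ n) :
    ((0, K) : ConeCochain G₁ G₂ A n) ∈ kacCocycles G₁ G₂ A μ₁ μ₂ n := by
  refine ⟨⟨zero_mem _, h₁.1, h₂.1⟩, ?_⟩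
  change coneD G₁ G₂ A n (0, K) ∈ coneNull G₁ G₂ A μ₁ μ₂ (n + 1)
  rw [coneD_zero_mk]
  exact ⟨zero_mem _, AddSubgroup.neg_mem _ h₁.2, AddSubgroup.neg_mem _ h₂.2⟩

theorem zero_mk_mem_kacCoboundaries {K : ((Fin (n + 1) → G₁) → A) × ((Fin (n + 1) → G₂) → A)}
    (h₁ : K.1 ∈ groupCoboundaries G₁ A μ₁ (n + 1)) (h₂ : K.2 ∈ groupCoboundaries G₂ A μ₂ (n + 1)) :
    ((0, K) : ConeCochain G₁ G₂ A (n + 1)) ∈ kacCoboundaries G₁ G₂ A μ₁ μ₂ (n + 1) := by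
  obtain ⟨k₁, hk₁, e₁⟩ := mem_coboundaries_iff.1 h₁
  obtain ⟨k₂, hk₂, e₂⟩ := mem_coboundaries_iff.1 h₂
  refine mem_coboundaries_iff.2 ⟨(0, -k₁, -k₂), ⟨zero_mem _, AddSubgroup.neg_mem _ hk₁, AddSubgroup.neg_mem _ hk₂⟩, ?_⟩
  rw [coneD_zero_mk]
  refine ⟨by simp [zero_mem], ?_, ?_⟩
  · simpa using e₁
  · simpa using e₂

theorem fst_mem_totalCoboundaries {c : ConeCochain G₁ G₂ A n}
    (h : c ∈ kacCoboundaries G₁ G₂ A μ₁ μ₂ n) :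
    c.1 ∈ totalCoboundaries G₁ G₂ A μ₁ μ₂ (n + 1) := by
  rcases n with _ | n
  · obtain ⟨y, hy, e⟩ := mem_coboundaries_iff.1 h
    exact mem_coboundaries_iff.2 ⟨y, hy, e.1⟩
  · obtain ⟨y, hy, e⟩ := mem_coboundaries_iff.1 h
    exact mem_coboundaries_iff.2 ⟨y.1, hy.1, e.1⟩

/-- This is the cone coboundary of (F, 0), up to null cochains. In degree 0 it comes from the term
of degree -1, which consists of bicochains alone. -/
theorem mk_toLeft_toRight_mem_kacCoboundaries {F F' : Bicochain G₁ G₂ A}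
    (hF : F ∈ totalMeas G₁ G₂ A n) (h : F' - totalD G₁ G₂ A F ∈ totalNull G₁ G₂ A μ₁ μ₂) :
    ((F', toLeft G₁ G₂ A n F, toRight G₁ G₂ A n F) : ConeCochain G₁ G₂ A n) ∈
      kacCoboundaries G₁ G₂ A μ₁ μ₂ n := by
  rcases n with _ | n
  · refine mem_coboundaries_iff.2 ⟨F, hF, h, ?_⟩
    simp [coneDStart, zero_mem]
  · refine mem_coboundaries_iff.2 ⟨(F, 0), ⟨hF, zero_mem _⟩, ?_⟩
    rw [coneD_mk_zero]
    exact ⟨h, by simp [zero_mem]⟩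

/-- A class of the mapping cone whose first component is a coboundary comes from `G₁` and `G₂`. -/
theorem exists_represents_zero_mk (hG : IsMatchedPair G₁ G₂ μ)
    {z : KacCohomology G₁ G₂ A μ₁ μ₂ n} {c : ConeCochain G₁ G₂ A n} (hz : Represents z c)
    (h : c.1 ∈ totalCoboundaries G₁ G₂ A μ₁ μ₂ (n + 1)) :
    ∃ K : ((Fin n → G₁) → A) × ((Fin n → G₂) → A), K.1 ∈ groupCocycles G₁ A μ₁ n ∧
      K.2 ∈ groupCocycles G₂ A μ₂ n ∧ Represents z ((0, K) : ConeCochain G₁ G₂ A n) := by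
  obtain ⟨F, hF, e⟩ := mem_coboundaries_iff.1 h
  have hc := mem_kacCocycles_iff.1 hz.mem
  have h₁ : c.2.1 - toLeft G₁ G₂ A n F ∈ groupCocycles G₁ A μ₁ n := by
    refine ⟨AddSubgroup.sub_mem _ hc.1.2.1 (measurable_toLeft n hF), ?_⟩
    have := sub_mem (toLeft_mem_groupNull hG e (n + 1)) hc.2.2.1
    rw [map_sub, toLeft_totalD] at this
    change groupD G₁ A n _ ∈ groupNull G₁ A μ₁ (n + 1)
    rw [map_sub]
    convert this using 1
    abel
  have h₂ : c.2.2 - toRight G₁ G₂ A n F ∈ groupCocycles G₂ A μ₂ n := by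
    refine ⟨AddSubgroup.sub_mem _ hc.1.2.2 (measurable_toRight n hF), ?_⟩
    have := sub_mem (toRight_mem_groupNull hG e (n + 1)) hc.2.2.2
    rw [map_sub, toRight_totalD] at this
    change groupD G₂ A n _ ∈ groupNull G₂ A μ₂ (n + 1)
    rw [map_sub]
    convert this using 1
    abel
  -- Subtracting the cone coboundary of (F, 0) removes the first component.
  refine ⟨(c.2.1 - toLeft G₁ G₂ A n F, c.2.2 - toRight G₁ G₂ A n F), h₁, h₂,
    hz.congr (zero_mk_mem_kacCocycles h₁ h₂) ?_⟩
  have := mk_toLeft_toRight_mem_kacCoboundaries hF e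
  convert this using 1
  refine Prod.ext (sub_zero _) (Prod.ext ?_ ?_) <;> simp

theorem exists_total_of_coboundaries {F : Bicochain G₁ G₂ A}
    (hF : F ∈ totalCocycles G₁ G₂ A μ₁ μ₂ (n + 1))
    (h₁ : toLeft G₁ G₂ A (n + 1) F ∈ groupCoboundaries G₁ A μ₁ (n + 1))
    (h₂ : toRight G₁ G₂ A (n + 1) F ∈ groupCoboundaries G₂ A μ₂ (n + 1)) :
    ∃ K, ((F, K) : ConeCochain G₁ G₂ A n) ∈ kacCocycles G₁ G₂ A μ₁ μ₂ n := by
  obtain ⟨k₁, hk₁, e₁⟩ := mem_coboundaries_iff.1 h₁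
  obtain ⟨k₂, hk₂, e₂⟩ := mem_coboundaries_iff.1 h₂
  refine ⟨(k₁, k₂), mem_kacCocycles_iff.2 ⟨⟨hF.1, hk₁, hk₂⟩, hF.2, ?_, ?_⟩⟩
  · rwa [neg_add_eq_sub]
  · rwa [neg_add_eq_sub]

theorem toLeft_mem_groupCoboundaries_of_kacCocycles {c : ConeCochain G₁ G₂ A n}
    (hc : c ∈ kacCocycles G₁ G₂ A μ₁ μ₂ n) :
    toLeft G₁ G₂ A (n + 1) c.1 ∈ groupCoboundaries G₁ A μ₁ (n + 1) ∧
      toRight G₁ G₂ A (n + 1) c.1 ∈ groupCoboundaries G₂ A μ₂ (n + 1) := by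
  have h := mem_kacCocycles_iff.1 hc
  simp only [neg_add_eq_sub] at h
  exact ⟨mem_coboundaries_iff.2 ⟨_, h.1.2.1, h.2.2.1⟩, mem_coboundaries_iff.2 ⟨_, h.1.2.2, h.2.2.2⟩⟩

/-- Classes of `G₁` and `G₂` that vanish in the mapping cone are restrictions. -/
theorem exists_total_of_zero_mk_mem_kacCoboundaries
    {K : ((Fin (n + 1) → G₁) → A) × ((Fin (n + 1) → G₂) → A)}
    (h : ((0, K) : ConeCochain G₁ G₂ A (n + 1)) ∈ kacCoboundaries G₁ G₂ A μ₁ μ₂ (n + 1)) :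
    ∃ F ∈ totalCocycles G₁ G₂ A μ₁ μ₂ (n + 1),
      K.1 - toLeft G₁ G₂ A (n + 1) F ∈ groupCoboundaries G₁ A μ₁ (n + 1) ∧
      K.2 - toRight G₁ G₂ A (n + 1) F ∈ groupCoboundaries G₂ A μ₂ (n + 1) := by
  obtain ⟨⟨F, k₁, k₂⟩, hy, e⟩ := mem_coboundaries_iff.1 h
  refine ⟨F, ⟨hy.1, ?_⟩, ?_, ?_⟩
  · have := e.1
    simpa [coneD] using this
  · refine mem_coboundaries_iff.2 ⟨-k₁, neg_mem hy.2.1, ?_⟩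
    have : K.1 - (-groupD G₁ A n k₁ + toLeft G₁ G₂ A (n + 1) F) ∈ groupNull G₁ A μ₁ (n + 1) :=
      e.2.1
    convert this using 1
    rw [map_neg]
    abel
  · refine mem_coboundaries_iff.2 ⟨-k₂, neg_mem hy.2.2, ?_⟩
    have : K.2 - (-groupD G₂ A n k₂ + toRight G₁ G₂ A (n + 1) F) ∈ groupNull G₂ A μ₂ (n + 1) :=
      e.2.2
    convert this using 1
    rw [map_neg]
    abel

end Cone

/-! ### Invariants -/

section Invariants

section

variable {H : Type*} [Group H] [MeasurableSpace H] [MeasurableMul H] {ν : Measure H}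
  [ν.IsMulLeftInvariant] [NeZero ν] {A : Type*} [AddCommGroup A]

/-- A conull subset of a group that is closed under quotients is everything. -/
theorem forall_of_ae_of_mul_inv (ν : Measure H) [ν.IsMulLeftInvariant] [NeZero ν] {P : H → Prop}
    (h : ∀ᵐ x ∂ν, P x) (hP : ∀ x y, P x → P y → P (x * y⁻¹)) (x : H) : P x := by
  have h' : ∀ᵐ y ∂ν, P (x * y) := (measurePreserving_mul_left ν x).quasiMeasurePreserving.ae h
  -- With y and xy both in the conull set, x = (xy)y⁻¹.
  obtain ⟨y, hy, hxy⟩ := (h.and h').exists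
  simpa using hP _ _ hxy hy

theorem mem_groupNull_zero_iff {f : (Fin 0 → H) → A} : f ∈ groupNull H A ν 0 ↔ f default = 0 := by
  change (∀ᵐ x ∂Measure.pi fun _ : Fin 0 => ν, f x = 0) ↔ _
  rw [Measure.pi_of_empty _ default, ae_dirac_eq]
  exact Iff.rfl

/-- The elements fixing a given vector are closed under quotients; if they are conull, they are
everything. Degree 0 cocycles are therefore genuine fixed points. -/
theorem mem_groupCocycles_zero_iff [SigmaFinite ν] [DistribMulAction H A] [MeasurableSpace A]
    [MeasurableAdd₂ A] [MeasurableNeg A] {f : (Fin 0 → H) → A} :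
    f ∈ groupCocycles H A ν 0 ↔ ∀ x : H, x • f default = f default := by
  have hf : Measurable f := Subsingleton.measurable
  have hd (x : Fin 1 → H) : groupD H A 0 f x = x 0 • f default - f default := by
    simp only [groupD, AddMonoidHom.coe_mk, ZeroHom.coe_mk,
      Subsingleton.elim (face _ _) default, sub_eq_add_neg]
    simp
  have : (groupD H A 0 f ∈ groupNull H A ν 1) ↔ ∀ᵐ x ∂ν, x • f default = f default := by
    change (∀ᵐ x ∂Measure.pi fun _ : Fin 1 => ν, groupD H A 0 f x = 0) ↔ _
    simp only [hd, sub_eq_zero]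
    have := (measurePreserving_funUnique ν (Fin 1)).map_eq
    conv_rhs => rw [← this]
    rw [(MeasurableEquiv.funUnique (Fin 1) H).measurableEmbedding.ae_map_iff]
    rfl
  rw [mem_groupCocycles_iff, this, and_iff_right hf]
  refine ⟨fun h => forall_of_ae_of_mul_inv ν h fun x y hx hy => ?_, fun h => .of_forall h⟩
  rw [mul_smul, inv_smul_eq_iff.2 hy.symm, hx]

end

variable {G : Type*} [Group G] [TopologicalSpace G] [IsTopologicalGroup G]
  [T2Space G] [LocallyCompactSpace G] [SecondCountableTopology G] [MeasurableSpace G]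
  [BorelSpace G] {G₁ G₂ : Subgroup G} {μ : Measure G} [μ.IsHaarMeasure]
  {μ₁ : Measure G₁} {μ₂ : Measure G₂}
  [μ₁.IsHaarMeasure] [μ₂.IsHaarMeasure] [SigmaFinite μ₁] [SigmaFinite μ₂]
  {A : Type*} [AddCommGroup A] [DistribMulAction G A]
  [MeasurableSpace A] [MeasurableAdd₂ A] [MeasurableNeg A]

/-- The stabilizer contains the conull set G₁G₂ and is a subgroup. -/
theorem smul_eq_of_smul_eq (hG : IsMatchedPair G₁ G₂ μ) {a : A} (h₁ : ∀ g : G₁, g • a = a)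
    (h₂ : ∀ s : G₂, s • a = a) (x : G) : x • a = a := by
  refine forall_of_ae_of_mul_inv μ (P := fun x => x • a = a) ?_ (fun x y hx hy => ?_) x
  · filter_upwards [ae_inProd hG] with x ⟨y, hy⟩
    rw [hy, mul_smul]
    have e := h₂ y.2
    rw [Subgroup.smul_def] at e
    rw [e]
    exact h₁ y.1
  · rw [mul_smul, inv_smul_eq_iff.2 hy.symm, hx]

instance : Subsingleton (Grid G₁ G₂ 0 0) :=
  ⟨fun X Y => Subtype.ext (Prod.ext (Subsingleton.elim _ _)
    (by funext i j; exact j.elim0))⟩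

variable (G₁ G₂) in
/-- The bicochain with the single value `a` in bidegree `(0, 0)`. -/
def constBicochain (a : A) : Bicochain G₁ G₂ A := fun p q _ => if p = 0 ∧ q = 0 then a else 0

theorem totalD_constBicochain {a : A} (ha : ∀ x : G, x • a = a) :
    totalD G₁ G₂ A (constBicochain G₁ G₂ a) = 0 := by
  funext p q X
  rcases p with _ | _ | p <;> rcases q with _ | _ | q <;>
    simp [totalD, totalDFun, dh, dv, constBicochain, ha, Fin.sum_univ_succ]

theorem constBicochain_mem_totalMeas (a : A) :
    constBicochain G₁ G₂ a ∈ totalMeas G₁ G₂ A 0 := by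
  refine fun p q => ⟨measurable_const, fun h => ?_⟩
  funext X
  exact if_neg (by omega)

/-- A primitive is a closed function on the one-point space Γ₀₀: its value equals both a and b and
is fixed by G₁ and G₂, hence by G. -/
theorem mem_kacCoboundaries_zero_iff (hG : IsMatchedPair G₁ G₂ μ) {a b : A} :
    ((0, (fun _ => a), (fun _ => b)) : ConeCochain G₁ G₂ A 0) ∈
      kacCoboundaries G₁ G₂ A μ₁ μ₂ 0 ↔ a = b ∧ ∀ x : G, x • a = a := by
  constructor
  · intro h
    obtain ⟨F, hF, e⟩ := mem_coboundaries_iff.1 h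
    have hFc : F ∈ totalCocycles G₁ G₂ A μ₁ μ₂ 0 := by
      refine ⟨hF, ?_⟩
      have := e.1
      simpa [coneDStart] using this
    have h₁ := mem_groupNull_zero_iff.1 e.2.1
    have h₂ := mem_groupNull_zero_iff.1 e.2.2
    have e' : toLeft G₁ G₂ A 0 F default = toRight G₁ G₂ A 0 F default :=
      congrArg (F 0 0) (Subsingleton.elim _ _)
    simp only [coneDStart, AddMonoidHom.prod_apply, Prod.snd_sub, Prod.fst_sub, Pi.sub_apply,
      sub_eq_zero] at h₁ h₂
    refine ⟨h₁.trans (e'.trans h₂.symm), smul_eq_of_smul_eq hG (fun g => ?_) fun s => ?_⟩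
    · rw [h₁]
      exact mem_groupCocycles_zero_iff.1 (toLeft_mem_groupCocycles hG hFc) g
    · rw [h₁, e']
      exact mem_groupCocycles_zero_iff.1 (toRight_mem_groupCocycles hG hFc) s
  · rintro ⟨rfl, ha⟩
    refine mk_toLeft_toRight_mem_kacCoboundaries (constBicochain_mem_totalMeas a) ?_
    rw [totalD_constBicochain ha, sub_zero]
    exact zero_mem _

end Invariants

/-! ### The Kac exact sequence -/

section ExactSequence

universe u

variable {G : Type u} [Group G] [TopologicalSpace G] [IsTopologicalGroup G]
  [T2Space G] [LocallyCompactSpace G] [SecondCountableTopology G] [MeasurableSpace G]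
  [BorelSpace G] {G₁ G₂ : Subgroup G} {μ : Measure G} [μ.IsHaarMeasure]
  {μ₁ : Measure G₁} {μ₂ : Measure G₂}
  [μ₁.IsHaarMeasure] [μ₂.IsHaarMeasure] [SigmaFinite μ₁] [SigmaFinite μ₂]
  {A : Type*} [AddCommGroup A] [DistribMulAction G A]
  [MeasurableSpace A] [MeasurableAdd₂ A] [MeasurableNeg A]

variable (μ₁ μ₂ A) in
theorem exists_comparison [MeasurableSingletonClass A] [MeasurableSMul₂ G A]
    (hG : IsMatchedPair G₁ G₂ μ) (n : ℕ) :
    ∃ Φ : GroupCohomology G A μ n ≃+ TotalCohomology G₁ G₂ A μ₁ μ₂ n,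
      ∀ f : (Fin n → G) → A, Measurable f → groupD G A n f = 0 →
        ∀ x, Represents x f → Represents (Φ x) (pathCochain G₁ G₂ n f) := by
  obtain ⟨Φ, hΦ⟩ := exists_cohomology_addEquiv (groupCocycles G A μ n) (groupCoboundaries G A μ n)
    (totalCocycles G₁ G₂ A μ₁ μ₂ n) (totalCoboundaries G₁ G₂ A μ₁ μ₂ n)
    (Comparable G₁ G₂ μ μ₁ μ₂ A n) (fun f hf => exists_comparable_right hG hf)
    (fun F hF => exists_comparable_left hG hF) fun f F hf _ h =>
      ⟨fun hB => Comparable.totalCoboundary hG h hf.1 hB, fun hB => Comparable.groupCoboundary hG h hf hB⟩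
  refine ⟨Φ, fun f hf hd x hx => ?_⟩
  obtain ⟨h₁, h₂⟩ := comparable_pathCochain (μ₁ := μ₁) (μ₂ := μ₂) hG hf hd
  exact hΦ _ _ hx.mem h₁ h₂ x hx

variable (μ₁ μ₂ A) in
theorem exists_restriction (hG : IsMatchedPair G₁ G₂ μ) (n : ℕ) :
    ∃ ρ : TotalCohomology G₁ G₂ A μ₁ μ₂ (n + 1) →+
        GroupCohomology G₁ A μ₁ (n + 1) × GroupCohomology G₂ A μ₂ (n + 1),
      ∀ x F, Represents x F → Represents (ρ x).1 (toLeft G₁ G₂ A (n + 1) F) ∧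
        Represents (ρ x).2 (toRight G₁ G₂ A (n + 1) F) := by
  obtain ⟨l, hl⟩ := exists_cohomology_map (toLeft G₁ G₂ A (n + 1))
    (fun F hF => toLeft_mem_groupCocycles (μ₁ := μ₁) (μ₂ := μ₂) hG hF)
    (fun F _ hF => toLeft_mem_groupCoboundaries (μ₁ := μ₁) (μ₂ := μ₂) hG hF)
  obtain ⟨r, hr⟩ := exists_cohomology_map (toRight G₁ G₂ A (n + 1))
    (fun F hF => toRight_mem_groupCocycles (μ₁ := μ₁) (μ₂ := μ₂) hG hF)
    (fun F _ hF => toRight_mem_groupCoboundaries (μ₁ := μ₁) (μ₂ := μ₂) hG hF)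
  exact ⟨l.prod r, fun x F h => ⟨hl x F h, hr x F h⟩⟩

variable (μ₁ μ₂ A) in
theorem exists_cone_inclusion (n : ℕ) :
    ∃ i : GroupCohomology G₁ A μ₁ (n + 1) × GroupCohomology G₂ A μ₂ (n + 1) →+
        KacCohomology G₁ G₂ A μ₁ μ₂ (n + 1),
      ∀ x y f₁ f₂, Represents x f₁ → Represents y f₂ →
        Represents (i (x, y)) ((0, f₁, f₂) : ConeCochain G₁ G₂ A (n + 1)) := by
  obtain ⟨l, hl⟩ := exists_cohomology_map
    (Z := groupCocycles G₁ A μ₁ (n + 1)) (B := groupCoboundaries G₁ A μ₁ (n + 1))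
    (Z' := kacCocycles G₁ G₂ A μ₁ μ₂ (n + 1)) (B' := kacCoboundaries G₁ G₂ A μ₁ μ₂ (n + 1))
    ((AddMonoidHom.inr _ _).comp (AddMonoidHom.inl _ _))
    (fun f hf => zero_mk_mem_kacCocycles hf (zero_mem _))
    (fun f _ hf => zero_mk_mem_kacCoboundaries hf (zero_mem _))
  obtain ⟨r, hr⟩ := exists_cohomology_map
    (Z := groupCocycles G₂ A μ₂ (n + 1)) (B := groupCoboundaries G₂ A μ₂ (n + 1))
    (Z' := kacCocycles G₁ G₂ A μ₁ μ₂ (n + 1)) (B' := kacCoboundaries G₁ G₂ A μ₁ μ₂ (n + 1))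
    ((AddMonoidHom.inr _ _).comp (AddMonoidHom.inr _ _))
    (fun f hf => zero_mk_mem_kacCocycles (zero_mem _) hf)
    (fun f _ hf => zero_mk_mem_kacCoboundaries (zero_mem _) hf)
  refine ⟨l.coprod r, fun x y f₁ f₂ hx hy => ?_⟩
  have := (hl _ _ hx).add (hr _ _ hy)
  simpa using this

variable (G₁ G₂ μ₁ μ₂ A) in
theorem exists_cone_projection (n : ℕ) :
    ∃ π : KacCohomology G₁ G₂ A μ₁ μ₂ n →+ TotalCohomology G₁ G₂ A μ₁ μ₂ (n + 1),
      ∀ z c, Represents z c → Represents (π z) c.1 :=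
  exists_cohomology_map (Z := kacCocycles G₁ G₂ A μ₁ μ₂ n)
    (Z' := totalCocycles G₁ G₂ A μ₁ μ₂ (n + 1)) (AddMonoidHom.fst _ _)
    (fun _ hc => ⟨hc.1.1, (mem_kacCocycles_iff.1 hc).2.1⟩)
    (fun _ _ hc => fst_mem_totalCoboundaries hc)

variable (G₁ G₂ μ₁ μ₂ A) in
theorem exists_cone_inclusion_zero :
    ∃ i : FixedPoints.addSubgroup G₁ A × FixedPoints.addSubgroup G₂ A →+
        KacCohomology G₁ G₂ A μ₁ μ₂ 0,
      ∀ a b, Represents (i (a, b))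
        ((0, (fun _ => (a : A)), (fun _ => (b : A))) : ConeCochain G₁ G₂ A 0) := by
  let T : FixedPoints.addSubgroup G₁ A × FixedPoints.addSubgroup G₂ A →+
      kacCocycles G₁ G₂ A μ₁ μ₂ 0 :=
    { toFun x := ⟨(0, (fun _ => (x.1 : A)), (fun _ => (x.2 : A))), zero_mk_mem_kacCocycles
        (mem_groupCocycles_zero_iff.2 x.1.2) (mem_groupCocycles_zero_iff.2 x.2.2)⟩
      map_zero' := rfl
      map_add' x y := by
        refine Subtype.ext (Prod.ext (add_zero 0).symm rfl) }
  exact ⟨(QuotientAddGroup.mk' _).comp T, fun a b => ⟨(T (a, b)).2, rfl⟩⟩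

/-- The long exact sequence of the mapping cone, with the cohomology of the total complex replaced
by that of G through `Φ`. Exactness is checked on representatives by the cone lemmas; the start in
degree 0 uses fixed points. -/
theorem exact_sequence [MeasurableSingletonClass A] [MeasurableSMul₂ G A]
    (hG : IsMatchedPair G₁ G₂ μ) :
    ∃ (Φ : ∀ n : ℕ, GroupCohomology G A μ n ≃+ TotalCohomology G₁ G₂ A μ₁ μ₂ n)
      (ι : FixedPoints.addSubgroup G A →+
        FixedPoints.addSubgroup G₁ A × FixedPoints.addSubgroup G₂ A)
      (inc₀ : FixedPoints.addSubgroup G₁ A × FixedPoints.addSubgroup G₂ A →+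
        KacCohomology G₁ G₂ A μ₁ μ₂ 0)
      (conn : ∀ n : ℕ, KacCohomology G₁ G₂ A μ₁ μ₂ n →+ GroupCohomology G A μ (n + 1))
      (res : ∀ n : ℕ, GroupCohomology G A μ (n + 1) →+
        GroupCohomology G₁ A μ₁ (n + 1) × GroupCohomology G₂ A μ₂ (n + 1))
      (inc : ∀ n : ℕ, GroupCohomology G₁ A μ₁ (n + 1) × GroupCohomology G₂ A μ₂ (n + 1) →+
        KacCohomology G₁ G₂ A μ₁ μ₂ (n + 1)),
      (∀ (n : ℕ) (f : (Fin n → G) → A), Measurable f → groupD G A n f = 0 →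
        ∀ x, Represents x f → Represents (Φ n x) (pathCochain G₁ G₂ n f)) ∧
      (∀ a, ((ι a).1 : A) = a ∧ ((ι a).2 : A) = a) ∧
      (∀ a b, Represents (inc₀ (a, b)) (0, (fun _ => (a : A)), (fun _ => (b : A)))) ∧
      (∀ (n : ℕ) x y f₁ f₂, Represents x f₁ → Represents y f₂ →
        Represents (inc n (x, y)) (0, f₁, f₂)) ∧
      (∀ (n : ℕ) z c, Represents z c → Represents (Φ (n + 1) (conn n z)) c.1) ∧
      (∀ (n : ℕ) x F, Represents (Φ (n + 1) x) F →
        Represents (res n x).1 (toLeft G₁ G₂ A (n + 1) F) ∧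
        Represents (res n x).2 (toRight G₁ G₂ A (n + 1) F)) ∧
      (∀ (n : ℕ) (f : (Fin (n + 1) → G) → A), Measurable f → groupD G A (n + 1) f = 0 →
        ∀ x, Represents x f →
          Represents (res n x).1 (fun g : Fin (n + 1) → G₁ => f fun i => (g i : G)) ∧
          Represents (res n x).2 (fun s : Fin (n + 1) → G₂ => f fun i => (s i : G))) ∧
      Function.Injective ι ∧ Function.Exact ι inc₀ ∧ Function.Exact inc₀ (conn 0) ∧
      (∀ n, Function.Exact (conn n) (res n)) ∧ (∀ n, Function.Exact (res n) (inc n)) ∧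
      (∀ n, Function.Exact (inc n) (conn (n + 1))) := by
  choose Φ hΦ using exists_comparison μ₁ μ₂ A hG
  choose ρ hρ using exists_restriction μ₁ μ₂ A hG
  choose inc hinc using exists_cone_inclusion (G₁ := G₁) (G₂ := G₂) μ₁ μ₂ A
  choose π hπ using exists_cone_projection G₁ G₂ μ₁ μ₂ A
  obtain ⟨inc₀, hinc₀⟩ := exists_cone_inclusion_zero G₁ G₂ μ₁ μ₂ A
  let ι : FixedPoints.addSubgroup G A →+
      FixedPoints.addSubgroup G₁ A × FixedPoints.addSubgroup G₂ A :=
    { toFun a := (⟨a, fun g => a.2 (g : G)⟩, ⟨a, fun s => a.2 (s : G)⟩)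
      map_zero' := rfl
      map_add' _ _ := rfl }
  refine ⟨Φ, ι, inc₀, fun n => (Φ (n + 1)).symm.toAddMonoidHom.comp (π n),
    fun n => (ρ n).comp (Φ (n + 1)).toAddMonoidHom, inc, hΦ, fun a => ⟨rfl, rfl⟩, hinc₀, hinc,
    ?_, fun n x F h => hρ n _ F h, ?_, ?_, ?_, ?_, ?_, ?_, ?_⟩
  · intro n z c h
    simpa using hπ n z c h
  · intro n f hf hd x hx
    have := hρ n _ _ (hΦ (n + 1) f hf hd x hx)
    rwa [toLeft_pathCochain, toRight_pathCochain] at this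
  · intro a b h
    exact Subtype.ext (congrArg (fun x => (x.1 : A)) h)
  · rintro ⟨a, b⟩
    rw [(hinc₀ a b).eq_zero_iff, mem_kacCoboundaries_zero_iff hG]
    constructor
    · rintro ⟨e, h⟩
      exact ⟨⟨a, h⟩, Prod.ext rfl (Subtype.ext e)⟩
    · rintro ⟨x, hx⟩
      obtain ⟨rfl, rfl⟩ := Prod.ext_iff.1 hx
      exact ⟨rfl, x.2⟩
  · intro z
    obtain ⟨c, hc⟩ := exists_represents z
    change (Φ 1).symm (π 0 z) = 0 ↔ _
    rw [EmbeddingLike.map_eq_zero_iff, (hπ 0 z c hc).eq_zero_iff]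
    constructor
    · intro h
      obtain ⟨K, h₁, h₂, h⟩ := exists_represents_zero_mk hG hc h
      refine ⟨(⟨_, mem_groupCocycles_zero_iff.1 h₁⟩, ⟨_, mem_groupCocycles_zero_iff.1 h₂⟩),
        (hinc₀ _ _).eq ?_⟩
      convert h using 1
      refine Prod.ext rfl (Prod.ext ?_ ?_)
      · exact funext fun x => congrArg K.1 (Subsingleton.elim _ _)
      · exact funext fun x => congrArg K.2 (Subsingleton.elim _ _)
    · rintro ⟨⟨a, b⟩, rfl⟩
      rw [← (hπ 0 _ c hc).eq_zero_iff, (hπ 0 _ _ (hinc₀ a b)).eq_zero_iff]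
      exact zero_mem _
  · intro n x
    obtain ⟨F, hF⟩ := exists_represents (Φ (n + 1) x)
    obtain ⟨h₁, h₂⟩ := hρ n _ F hF
    change ρ n (Φ (n + 1) x) = 0 ↔ _
    rw [Prod.ext_iff, Prod.fst_zero, Prod.snd_zero, h₁.eq_zero_iff, h₂.eq_zero_iff]
    constructor
    · rintro ⟨e₁, e₂⟩
      obtain ⟨K, hK⟩ := exists_total_of_coboundaries hF.mem e₁ e₂
      obtain ⟨z, hz⟩ := exists_represented (kacCoboundaries G₁ G₂ A μ₁ μ₂ n) hK
      refine ⟨z, ?_⟩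
      change (Φ (n + 1)).symm (π n z) = x
      rw [AddEquiv.symm_apply_eq]
      exact (hπ n z _ hz).eq hF
    · rintro ⟨z, rfl⟩
      obtain ⟨c, hc⟩ := exists_represents z
      have := toLeft_mem_groupCoboundaries_of_kacCocycles hc.mem
      have hz : Represents (Φ (n + 1) ((Φ (n + 1)).symm (π n z))) c.1 := by
        simpa using hπ n z c hc
      rw [← h₁.eq_zero_iff, ← h₂.eq_zero_iff]
      rw [← (hρ n _ _ hz).1.eq_zero_iff, ← (hρ n _ _ hz).2.eq_zero_iff] at this
      exact this
  · rintro n ⟨x, y⟩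
    obtain ⟨f₁, hf₁⟩ := exists_represents x
    obtain ⟨f₂, hf₂⟩ := exists_represents y
    rw [(hinc n x y f₁ f₂ hf₁ hf₂).eq_zero_iff]
    constructor
    · intro h
      obtain ⟨F, hF, e₁, e₂⟩ := exists_total_of_zero_mk_mem_kacCoboundaries h
      obtain ⟨w, hw⟩ := exists_represented (totalCoboundaries G₁ G₂ A μ₁ μ₂ (n + 1)) hF
      refine ⟨(Φ (n + 1)).symm w, ?_⟩
      change ρ n (Φ (n + 1) ((Φ (n + 1)).symm w)) = _
      rw [AddEquiv.apply_symm_apply]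
      obtain ⟨h₁, h₂⟩ := hρ n _ F hw
      exact Prod.ext ((hf₁.eq_iff h₁).2 e₁).symm ((hf₂.eq_iff h₂).2 e₂).symm
    · rintro ⟨w, hw⟩
      obtain ⟨F, hF⟩ := exists_represents (Φ (n + 1) w)
      obtain ⟨h₁, h₂⟩ := hρ n _ F hF
      change ρ n (Φ (n + 1) w) = (x, y) at hw
      rw [hw] at h₁ h₂
      rw [← (hinc n x y f₁ f₂ hf₁ hf₂).eq_zero_iff, (hinc n x y _ _ h₁ h₂).eq_zero_iff]
      refine mk_toLeft_toRight_mem_kacCoboundaries hF.mem.1 ?_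
      rw [zero_sub]
      exact neg_mem hF.mem.2
  · intro n z
    obtain ⟨c, hc⟩ := exists_represents z
    change (Φ (n + 2)).symm (π (n + 1) z) = 0 ↔ _
    rw [EmbeddingLike.map_eq_zero_iff, (hπ (n + 1) z c hc).eq_zero_iff]
    constructor
    · intro h
      obtain ⟨K, h₁, h₂, h⟩ := exists_represents_zero_mk hG hc h
      obtain ⟨x, hx⟩ := exists_represented (groupCoboundaries G₁ A μ₁ (n + 1)) h₁
      obtain ⟨y, hy⟩ := exists_represented (groupCoboundaries G₂ A μ₂ (n + 1)) h₂
      exact ⟨(x, y), (hinc n x y _ _ hx hy).eq h⟩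
    · rintro ⟨⟨x, y⟩, rfl⟩
      obtain ⟨f₁, hf₁⟩ := exists_represents x
      obtain ⟨f₂, hf₂⟩ := exists_represents y
      rw [← (hπ (n + 1) _ c hc).eq_zero_iff,
        (hπ (n + 1) _ _ (hinc n x y f₁ f₂ hf₁ hf₂)).eq_zero_iff]
      exact zero_mem _

end ExactSequence

/-! ### The coordinates given by the top row and the right column -/

section RowCol

variable {G : Type*} [Group G] {G₁ G₂ : Subgroup G} {p q : ℕ}

/-- The top row and the right column of a grid. -/
def rowCol (X : Grid G₁ G₂ p q) : (Fin q → G₂) × (Fin p → G₁) :=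
  (fun j => X.1.2 0 j, fun i => X.1.1 i (Fin.last q))

theorem gridVertex_last (X : Grid G₁ G₂ p q) (i : Fin (p + 1)) :
    gridVertex X i (Fin.last q) =
      (Fin.partialProd (rowCol X).1 (Fin.last q) : G₂) * (Fin.partialProd (rowCol X).2 i : G₁) := by
  induction i using Fin.induction with
  | zero => rw [gridVertex_zero_left, coe_partialProd]; simp [rowCol]
  | succ i ih =>
    rw [gridVertex_succ_left, ih, Fin.partialProd_succ, Subgroup.coe_mul, ← mul_assoc]
    rfl

theorem InProd.mul_right {x : G} (h : InProd G₁ G₂ x) {s : G} (hs : s ∈ G₂) :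
    InProd G₁ G₂ (x * s) := by
  obtain ⟨y, rfl⟩ := h
  exact ⟨(y.1, y.2 * ⟨s, hs⟩), by simp [mul_assoc]⟩

/-- The set G₁G₂ is stable under right multiplication by G₂, and outside it both values are the
dummy 1. So no genericity is needed. -/
theorem p₁_eq_of_inv_mul_mem (h : G₁ ⊓ G₂ = ⊥) {x y : G} (hxy : x⁻¹ * y ∈ G₂) :
    p₁ G₁ G₂ x = p₁ G₁ G₂ y := by
  by_cases hx : InProd G₁ G₂ x
  · obtain ⟨z, rfl⟩ := hx
    have e : y = z.1 * ((z.2 * ⟨_, hxy⟩ : G₂) : G) := by simp [mul_assoc]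
    rw [p₁_mul h, e, p₁_mul h]
  · have hy : ¬InProd G₁ G₂ y := fun hy => hx (by
      simpa using hy.mul_right (G₂.inv_mem hxy))
    have hx' : ¬∃ z : G₁ × G₂, x = z.1 * z.2 := hx
    have hy' : ¬∃ z : G₁ × G₂, y = z.1 * z.2 := hy
    rw [p₁, p₁, factor, factor, dif_neg hx', dif_neg hy']

/-- Seen from the top right corner, a vertex of the right column lies in the same row coset as the
translate of the left vertex by the inverse product of the top row, and it lies in G₁. -/
theorem partialProd_rowCol_snd (h : G₁ ⊓ G₂ = ⊥) (X : Grid G₁ G₂ p q) (i : Fin (p + 1)) :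
    p₁ G₁ G₂ (((Fin.partialProd (colRow X).2 (Fin.last q) : G₂) : G)⁻¹ *
      (Fin.partialProd (colRow X).1 i : G₁)) = Fin.partialProd (rowCol X).2 i := by
  have e := gridVertex_row_mem X i (Fin.last q)
  rw [gridVertex_last, gridVertex_zero_right] at e
  conv_rhs => rw [← p₁_mul h (Fin.partialProd (rowCol X).2 i) 1]
  refine p₁_eq_of_inv_mul_mem h ?_
  rw [coe_partialProd (colRow X).1]
  simpa [mul_assoc, colRow, rowCol] using e

/-- The list of factors whose partial products are `x`. -/
def factors {H : Type*} [Group H] {n : ℕ} (x : Fin n → H) : Fin n → H :=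
  edges (Fin.cons 1 x : Fin (n + 1) → H)

theorem factors_cumProd {H : Type*} [Group H] {n : ℕ} (x : Fin n → H) :
    factors (cumProd x) = x := by
  rw [factors, ← partialProd_eq_cons, edges_partialProd]

theorem measurable_factors {H : Type*} [Group H] [MeasurableSpace H] [MeasurableMul₂ H]
    [MeasurableInv H] {n : ℕ} : Measurable (factors : (Fin n → H) → Fin n → H) := by
  have hc (i : Fin (n + 1)) : Measurable fun x : Fin n → H => (Fin.cons 1 x : Fin (n + 1) → H) i := by
    refine Fin.cases ?_ (fun j => ?_) i
    · simp
    · simpa using measurable_pi_apply j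
  exact measurable_pi_lambda _ fun i => (hc _).inv.mul (hc _)

theorem rowCol_eq (h : G₁ ⊓ G₂ = ⊥) (X : Grid G₁ G₂ p q) :
    rowCol X = ((colRow X).2, factors fun i => p₁ G₁ G₂
      (((Fin.partialProd (colRow X).2 (Fin.last q) : G₂) : G)⁻¹ * cumProd (colRow X).1 i)) := by
  refine Prod.ext rfl ?_
  simp only [cumProd, partialProd_rowCol_snd h]
  exact (factors_cumProd _).symm

end RowCol

/-! ### Null sets in the coordinates of the top row and the right column -/

section RowColMeasure

variable {G : Type*} [Group G] [TopologicalSpace G] [IsTopologicalGroup G]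
  [T2Space G] [LocallyCompactSpace G] [SecondCountableTopology G] [MeasurableSpace G]
  [BorelSpace G] {G₁ G₂ : Subgroup G} {μ : Measure G} [μ.IsHaarMeasure]
  {μ₁ : Measure G₁} {μ₂ : Measure G₂}
  [μ₁.IsHaarMeasure] [μ₂.IsHaarMeasure] [SigmaFinite μ₁] [SigmaFinite μ₂] {p q : ℕ}

/-- The map g ↦ p₁(xg) is translation by x on G/G₂ read off in G₁. A right G₂-invariant property of
points of G can be tested on any translate of G₁, so xG₁ and G₁ give the same answer. -/
theorem ae_p₁_mul_iff (μ₂ : Measure G₂) [μ₂.IsHaarMeasure] [SigmaFinite μ₂]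
    (hG : IsMatchedPair G₁ G₂ μ) (x : G) {n : ℕ} {P : (Fin n → G₁) → Prop}
    (hP : MeasurableSet {z | P z}) :
    (∀ᵐ y ∂Measure.pi fun _ : Fin n => μ₁, P fun i => p₁ G₁ G₂ (x * (y i : G))) ↔
      ∀ᵐ y ∂Measure.pi fun _ : Fin n => μ₁, P y := by
  have hm : Measurable fun z : (Fin n → G) × Unit => fun i => p₁ G₁ G₂ (z.1 i) :=
    measurable_pi_lambda _ fun i =>
      (measurable_p₁ hG).comp (f := fun z : (Fin n → G) × Unit => z.1 i) (by fun_prop)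
  have key (x : G) := ae_pi_left_iff (μ₁ := μ₁) μ₂ hG (Measure.dirac ()) x
    (P := fun z : (Fin n → G) × Unit => P fun i => p₁ G₁ G₂ (z.1 i)) (hm hP)
    fun y y' t h => by
      have : (fun i => p₁ G₁ G₂ (y i)) = fun i => p₁ G₁ G₂ (y' i) :=
        funext fun i => p₁_eq_of_inv_mul_mem hG.inf_eq_bot (h i)
      simp only [this]
  have h := (key x).symm.trans (key 1)
  rw [ae_prod_fst_iff _ _ (P := fun z : Fin n → G₁ => P fun i => p₁ G₁ G₂ (x * (z i : G))),
    ae_prod_fst_iff _ _ (P := fun z : Fin n → G₁ => P fun i => p₁ G₁ G₂ (1 * (z i : G)))] at h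
  rw [h]
  have e (g : G₁) : p₁ G₁ G₂ (1 * (g : G)) = g := by
    simpa using p₁_mul hG.inf_eq_bot g (1 : G₂)
  simp only [e]

/-- For a fixed top row with product σ, the partial products of the right column arise from those of
the left column by y ↦ p₁(σ⁻¹y), which respects null sets. Fubini over the top row and passage to
partial products reduce everything to this. -/
theorem ae_rowCol_iff (hG : IsMatchedPair G₁ G₂ μ) {Q : (Fin q → G₂) × (Fin p → G₁) → Prop}
    (hQ : MeasurableSet {w | Q w}) :
    (∀ᵐ X ∂gridMeasure μ₁ μ₂ p q, Q (rowCol X)) ↔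
      ∀ᵐ w ∂(Measure.pi fun _ : Fin q => μ₂).prod (Measure.pi fun _ : Fin p => μ₁), Q w := by
  have mc {H : Subgroup G} {n : ℕ} (i : Fin n) : Measurable fun x : Fin n → H => cumProd x i :=
    measurable_partialProd i.succ
  have hψ : Measurable fun w : (Fin q → G₂) × (Fin p → G₁) => (w.1, factors fun i => p₁ G₁ G₂
      (((Fin.partialProd w.1 (Fin.last q) : G₂) : G)⁻¹ * cumProd w.2 i)) := by
    refine measurable_fst.prodMk (measurable_factors.comp (measurable_pi_lambda _ fun i =>
      (measurable_p₁ hG).comp (Measurable.mul ?_ ?_)))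
    · exact (measurable_subtype_coe.comp ((measurable_partialProd _).comp measurable_fst)).inv
    · exact measurable_subtype_coe.comp ((mc i).comp measurable_snd)
  simp only [rowCol_eq hG.inf_eq_bot]
  rw [ae_colRow_iff (μ₁ := μ₁) (μ₂ := μ₂) hG (Q := fun w => Q (w.2, factors fun i => p₁ G₁ G₂
      (((Fin.partialProd w.2 (Fin.last q) : G₂) : G)⁻¹ * cumProd w.1 i))), ae_prod_swap_iff]
  simp only [Prod.fst_swap, Prod.snd_swap]
  rw [Measure.ae_prod_iff_ae_ae (p := fun w : (Fin q → G₂) × (Fin p → G₁) =>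
      Q (w.1, factors fun i => p₁ G₁ G₂
        (((Fin.partialProd w.1 (Fin.last q) : G₂) : G)⁻¹ * cumProd w.2 i))) (hψ hQ), Measure.ae_prod_iff_ae_ae hQ]
  refine Filter.eventually_congr (.of_forall fun s => ?_)
  have hs : MeasurableSet {g : Fin p → G₁ | Q (s, factors g)} :=
    (measurable_const.prodMk measurable_factors) hQ
  have mp : Measurable fun y : Fin p → G₁ => fun i => p₁ G₁ G₂
      (((Fin.partialProd s (Fin.last q) : G₂) : G)⁻¹ * y i) :=
    measurable_pi_lambda _ fun i => (measurable_p₁ hG).comp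
      (f := fun y : Fin p → G₁ => ((Fin.partialProd s (Fin.last q) : G₂) : G)⁻¹ * y i) (by fun_prop)
  have hcum := measurePreserving_cumProd μ₁ p
  have e₁ := ae_map_iff (μ := Measure.pi fun _ : Fin p => μ₁) hcum.measurable.aemeasurable
    (p := fun y => Q (s, factors fun i => p₁ G₁ G₂
      (((Fin.partialProd s (Fin.last q) : G₂) : G)⁻¹ * y i))) (mp hs)
  have e₂ := ae_map_iff (μ := Measure.pi fun _ : Fin p => μ₁) hcum.measurable.aemeasurable (p := fun y => Q (s, factors y)) hs
  rw [hcum.map_eq] at e₁ e₂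
  simp only [factors_cumProd] at e₂
  rw [← e₁, ← e₂]
  exact ae_p₁_mul_iff (μ₁ := μ₁) μ₂ hG _ hs

/-- The function of the top row and the right column defined by a function on grids. -/
noncomputable def rowColFun {A : Type*} [AddCommGroup A] [DistribMulAction G A]
    (F : Grid G₁ G₂ p q → A) (w : (Fin q → G₂) × (Fin p → G₁)) : A :=
  liftGrid F (fun i => (Fin.partialProd w.2 i : G₁),
    fun j => ((Fin.partialProd w.1 (Fin.last q) : G₂) : G)⁻¹ * (Fin.partialProd w.1 j : G₂))

variable {A : Type*} [AddCommGroup A] [DistribMulAction G A]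
  [MeasurableSpace A] [MeasurableAdd₂ A] [MeasurableNeg A]

/-- Both sides are values of the lift with different normalizations: the base is the top right
corner on the left, the top left one on the right. The change of base acts on the value, which is
why a trivial action is required. -/
theorem rowColFun_rowCol (hG : IsMatchedPair G₁ G₂ μ) (hA : ∀ (x : G) (a : A), x • a = a)
    (F : Grid G₁ G₂ p q → A) (X : Grid G₁ G₂ p q) : rowColFun F (rowCol X) = F X := by
  conv_rhs => rw [← liftGrid_gridVertex hG F X]
  rw [rowColFun, liftGrid_inv hG F (((Fin.partialProd (rowCol X).1 (Fin.last q) : G₂) : G)⁻¹)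
    (y' := fun i => gridVertex X i 0) (z' := fun j => gridVertex X 0 j) ?_ ?_, hA]
  · intro i
    have e := gridVertex_row_mem X i (Fin.last q)
    rw [gridVertex_last] at e
    simpa [mul_assoc] using e
  · intro j
    rw [gridVertex_zero_left, coe_partialProd (rowCol X).1 j]
    simp [rowCol]

variable [MeasurableSMul₂ G A]

theorem measurable_rowColFun (hG : IsMatchedPair G₁ G₂ μ) {F : Grid G₁ G₂ p q → A}
    (hF : Measurable F) : Measurable (rowColFun F) := by
  refine (measurable_liftGrid hG hF).comp (Measurable.prodMk ?_ ?_)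
  · exact measurable_pi_lambda _ fun i => measurable_subtype_coe.comp
      ((measurable_partialProd i).comp measurable_snd)
  · exact measurable_pi_lambda _ fun j =>
      (measurable_subtype_coe.comp ((measurable_partialProd _).comp measurable_fst)).inv.mul
        (measurable_subtype_coe.comp ((measurable_partialProd j).comp measurable_fst))

/-! ### Elementary properties of the total coboundary -/

variable [MeasurableSingletonClass A] {n : ℕ} {F : Bicochain G₁ G₂ A}

/-- Transports measurability, square zero and preservation of null cochains from the triple complex,
so that no identities between faces of grids have to be checked. -/
theorem totalD_eq_evalGrid (hG : IsMatchedPair G₁ G₂ μ) (hF : F ∈ totalMeas G₁ G₂ A n) :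
    totalD G₁ G₂ A F = evalGrid G₁ G₂ (triD 1 (liftCochain F)) := by
  rw [← totalD_evalGrid (liftCochain_mem_adm hG hF).2.1 (liftCochain_mem_supB F)
    (liftCochain_mem_supC F), evalGrid_liftCochain hG]

theorem totalD_mem_totalMeas (hG : IsMatchedPair G₁ G₂ μ) (hF : F ∈ totalMeas G₁ G₂ A n) :
    totalD G₁ G₂ A F ∈ totalMeas G₁ G₂ A (n + 1) := by
  rw [totalD_eq_evalGrid hG hF]
  exact evalGrid_mem_totalMeas (triD_mem_adm 1 (liftCochain_mem_adm hG hF))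

theorem totalD_totalD (hG : IsMatchedPair G₁ G₂ μ) (hF : F ∈ totalMeas G₁ G₂ A n) :
    totalD G₁ G₂ A (totalD G₁ G₂ A F) = 0 := by
  rw [totalD_eq_evalGrid hG hF, totalD_evalGrid (triD_mem_adm 1 (liftCochain_mem_adm hG hF)).2.1
    (triD_mem_supB 1 (liftCochain_mem_supB F)) (triD_mem_supC 1 (liftCochain_mem_supC F)),
    triD_triD, map_zero]

theorem totalD_mem_totalNull (hG : IsMatchedPair G₁ G₂ μ) (hF : F ∈ totalMeas G₁ G₂ A n)
    (h : F ∈ totalNull G₁ G₂ A μ₁ μ₂) : totalD G₁ G₂ A F ∈ totalNull G₁ G₂ A μ₁ μ₂ := by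
  have hl := liftCochain_mem_adm hG hF
  have hB := liftCochain_mem_supB F
  have hC := liftCochain_mem_supC F
  have hn : liftCochain F ∈ triNull μ := by
    rw [← evalGrid_liftCochain hG F, evalGrid_mem_totalNull_iff hG hl hB hC, mem_triNullOn] at h
    rw [mem_triNull]
    filter_upwards [h] with w hw
    by_cases h0 : w.1.length = 0
    · exact hw h0
    · exact liftCochain_eq_zero F fun h' => h0 h'.1
  rw [totalD_eq_evalGrid hG hF]
  exact evalGrid_mem_totalNull hG (triD_mem_adm 1 hl) (triD_mem_supB 1 hB) (triD_mem_supC 1 hC)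
    (triD_mem_triNull 1 hn)

end RowColMeasure

/-! ### Finite products of measures in coordinates -/

section Coordinates

variable {X Y : Type*} [MeasurableSpace X] [MeasurableSpace Y] (μ : Measure X) [SigmaFinite μ]
  (ν : Measure Y) [SigmaFinite ν]

theorem measurePreserving_finOne :
    MeasurePreserving (fun x : Fin 1 → X => x 0) (Measure.pi fun _ => μ) μ :=
  measurePreserving_funUnique μ (Fin 1)

theorem measurePreserving_finTwo :
    MeasurePreserving (fun x : Fin 2 → X => (x 0, x 1)) (Measure.pi fun _ => μ) (μ.prod μ) :=
  measurePreserving_finTwoArrow μ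

theorem measurePreserving_finThree :
    MeasurePreserving (fun x : Fin 3 → X => (x 0, x 1, x 2)) (Measure.pi fun _ => μ)
      (μ.prod (μ.prod μ)) :=
  ((MeasurePreserving.id μ).prod (measurePreserving_finTwo μ)).comp
    (measurePreserving_piFinSuccAbove (fun _ : Fin 3 => μ) 0)

theorem measurePreserving_one_two :
    MeasurePreserving (fun w : (Fin 1 → X) × (Fin 2 → Y) => (w.1 0, w.2 0, w.2 1))
      ((Measure.pi fun _ => μ).prod (Measure.pi fun _ => ν)) (μ.prod (ν.prod ν)) :=
  (measurePreserving_finOne μ).prod (measurePreserving_finTwo ν)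

theorem measurePreserving_one_three :
    MeasurePreserving (fun w : (Fin 1 → X) × (Fin 3 → Y) => (w.1 0, w.2 0, w.2 1, w.2 2))
      ((Measure.pi fun _ => μ).prod (Measure.pi fun _ => ν)) (μ.prod (ν.prod (ν.prod ν))) :=
  (measurePreserving_finOne μ).prod (measurePreserving_finThree ν)

theorem measurePreserving_two_one :
    MeasurePreserving (fun w : (Fin 2 → X) × (Fin 1 → Y) => (w.1 0, w.1 1, w.2 0))
      ((Measure.pi fun _ => μ).prod (Measure.pi fun _ => ν)) (μ.prod (μ.prod ν)) :=
  (measurePreserving_prodAssoc μ μ ν).comp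
    ((measurePreserving_finTwo μ).prod (measurePreserving_finOne ν))

theorem measurePreserving_two_two :
    MeasurePreserving (fun w : (Fin 2 → X) × (Fin 2 → Y) => (w.1 0, w.1 1, w.2 0, w.2 1))
      ((Measure.pi fun _ => μ).prod (Measure.pi fun _ => ν)) (μ.prod (μ.prod (ν.prod ν))) :=
  (measurePreserving_prodAssoc μ μ (ν.prod ν)).comp
    ((measurePreserving_finTwo μ).prod (measurePreserving_finTwo ν))

theorem measurePreserving_three_one :
    MeasurePreserving (fun w : (Fin 3 → X) × (Fin 1 → Y) => (w.1 0, w.1 1, w.1 2, w.2 0))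
      ((Measure.pi fun _ => μ).prod (Measure.pi fun _ => ν)) (μ.prod (μ.prod (μ.prod ν))) :=
  ((MeasurePreserving.id μ).prod (measurePreserving_prodAssoc μ μ ν)).comp
    ((measurePreserving_prodAssoc μ (μ.prod μ) ν).comp
      ((measurePreserving_finThree μ).prod (measurePreserving_finOne ν)))

end Coordinates

/-! ### Bicochains defined by pairs of 2-cocycles -/

section FaceSums

variable {G : Type*} [Group G] {G₁ G₂ : Subgroup G} {A : Type*} [AddCommGroup A]
  [DistribMulAction G A] {p q : ℕ}

theorem dh_one (F : Grid G₁ G₂ p 1 → A) (X : Grid G₁ G₂ p 2) :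
    dh G₁ G₂ A p 1 F X = (X.1.2 0 0 : G) • F (hFace 0 X) - F (hFace 1 X) + F (hFace 2 X) := by
  change _ + ∑ k : Fin 2, (-1 : ℤ) ^ ((k : ℕ) + 1) • F (hFace k.succ X) = _
  rw [Fin.sum_univ_two]
  simp [sub_eq_add_neg, add_assoc]

theorem dv_one (F : Grid G₁ G₂ 1 q → A) (X : Grid G₁ G₂ 2 q) :
    dv G₁ G₂ A 1 q F X = (X.1.1 0 0 : G) • F (vFace 0 X) - F (vFace 1 X) + F (vFace 2 X) := by
  change _ + ∑ k : Fin 2, (-1 : ℤ) ^ ((k : ℕ) + 1) • F (vFace k.succ X) = _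
  rw [Fin.sum_univ_two]
  simp [sub_eq_add_neg, add_assoc]

theorem dh_two (F : Grid G₁ G₂ p 2 → A) (X : Grid G₁ G₂ p 3) :
    dh G₁ G₂ A p 2 F X = (X.1.2 0 0 : G) • F (hFace 0 X) - F (hFace 1 X) + F (hFace 2 X) -
      F (hFace 3 X) := by
  change _ + ∑ k : Fin 3, (-1 : ℤ) ^ ((k : ℕ) + 1) • F (hFace k.succ X) = _
  rw [Fin.sum_univ_three]
  simp [sub_eq_add_neg, add_assoc, pow_succ]

theorem dv_two (F : Grid G₁ G₂ 2 q → A) (X : Grid G₁ G₂ 3 q) :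
    dv G₁ G₂ A 2 q F X = (X.1.1 0 0 : G) • F (vFace 0 X) - F (vFace 1 X) + F (vFace 2 X) -
      F (vFace 3 X) := by
  change _ + ∑ k : Fin 3, (-1 : ℤ) ^ ((k : ℕ) + 1) • F (vFace k.succ X) = _
  rw [Fin.sum_univ_three]
  simp [sub_eq_add_neg, add_assoc, pow_succ]

end FaceSums

/-! ### The relations for (U, V) as components of a total coboundary -/

section ExtAlgebra

variable {G : Type*} [Group G] {G₁ G₂ : Subgroup G} {p q : ℕ}

theorem p₁_grid (h : G₁ ⊓ G₂ = ⊥) (X : Grid G₁ G₂ p q) (i : Fin p) (j : Fin q) :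
    p₁ G₁ G₂ ((X.1.2 i.castSucc j : G) * X.1.1 i j.succ) = X.1.1 i j.castSucc := by
  rw [X.2 i j, p₁_mul h]

theorem p₂_grid (h : G₁ ⊓ G₂ = ⊥) (X : Grid G₁ G₂ p q) (i : Fin p) (j : Fin q) :
    p₂ G₁ G₂ ((X.1.2 i.castSucc j : G) * X.1.1 i j.succ) = X.1.2 i.succ j := by
  rw [X.2 i j, p₂_mul h]

variable (G₁ G₂) in
/-- The additive map given by `extBicochain`. -/
def extHom : ExtCochain G₁ G₂ →+ Bicochain G₁ G₂ UnitAddCircle where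
  toFun := extBicochain
  map_zero' := by
    funext p q X
    rcases p with _ | _ | _ | p <;> rcases q with _ | _ | _ | q <;> rfl
  map_add' c c' := by
    funext p q X
    rcases p with _ | _ | _ | p <;> rcases q with _ | _ | _ | q <;>
      first
      | rfl
      | exact (add_zero _).symm

/-- The bicochain defined by a function of the top edge and the right edge of a square. -/
def squareBicochain (R : G₂ × G₁ → UnitAddCircle) : Bicochain G₁ G₂ UnitAddCircle
  | 1, 1 => fun X => R (X.1.2 0 0, X.1.1 0 1)
  | _, _ => 0

variable [DistribMulAction G UnitAddCircle]

theorem totalD_squareBicochain_two_one (hA : ∀ (x : G) (a : UnitAddCircle), x • a = a)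
    (h : G₁ ⊓ G₂ = ⊥) (R : G₂ × G₁ → UnitAddCircle) :
    totalD G₁ G₂ UnitAddCircle (squareBicochain R) 2 1 =
      extBicochain (extTrivial G₁ G₂ R) 2 1 := by
  funext X
  change dh G₁ G₂ UnitAddCircle 2 0 0 X +
    (-1 : ℤ) ^ 1 • dv G₁ G₂ UnitAddCircle 1 1 (squareBicochain R 1 1) X =
    -R (p₂ G₁ G₂ ((X.1.2 0 0 : G) * X.1.1 0 1), X.1.1 1 1) + R (X.1.2 0 0, X.1.1 0 1 * X.1.1 1 1)
      - R (X.1.2 0 0, X.1.1 0 1)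
  have e₀ : p₂ G₁ G₂ ((X.1.2 0 0 : G) * X.1.1 0 1) = X.1.2 1 0 := p₂_grid h X 0 0
  have f₀ : squareBicochain R 1 1 (vFace 0 X) = R (X.1.2 1 0, X.1.1 1 1) := rfl
  have f₁ : squareBicochain R 1 1 (vFace 1 X) =
    R (X.1.2 0 0, X.1.1 0 1 * X.1.1 1 1) := rfl
  have f₂ : squareBicochain R 1 1 (vFace 2 X) = R (X.1.2 0 0, X.1.1 0 1) := rfl
  rw [map_zero, e₀]
  rw [dv_one, hA, f₀, f₁, f₂]
  simp
  abel

theorem totalD_squareBicochain_one_two (hA : ∀ (x : G) (a : UnitAddCircle), x • a = a)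
    (h : G₁ ⊓ G₂ = ⊥) (R : G₂ × G₁ → UnitAddCircle) :
    totalD G₁ G₂ UnitAddCircle (squareBicochain R) 1 2 =
      extBicochain (extTrivial G₁ G₂ R) 1 2 := by
  funext X
  change dh G₁ G₂ UnitAddCircle 1 1 (squareBicochain R 1 1) X +
    (-1 : ℤ) ^ 2 • dv G₁ G₂ UnitAddCircle 0 2 0 X =
    R (X.1.2 0 1, X.1.1 0 2) - R (X.1.2 0 0 * X.1.2 0 1, X.1.1 0 2)
      + R (X.1.2 0 0, p₁ G₁ G₂ ((X.1.2 0 1 : G) * X.1.1 0 2))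
  have e₀ : p₁ G₁ G₂ ((X.1.2 0 1 : G) * X.1.1 0 2) = X.1.1 0 1 := p₁_grid h X 0 1
  have f₀ : squareBicochain R 1 1 (hFace 0 X) = R (X.1.2 0 1, X.1.1 0 2) := rfl
  have f₁ : squareBicochain R 1 1 (hFace 1 X) =
    R (X.1.2 0 0 * X.1.2 0 1, X.1.1 0 2) := rfl
  have f₂ : squareBicochain R 1 1 (hFace 2 X) = R (X.1.2 0 0, X.1.1 0 1) := rfl
  rw [map_zero, e₀]
  rw [dh_one, hA, f₀, f₁, f₂]
  simp

theorem totalD_squareBicochain (hA : ∀ (x : G) (a : UnitAddCircle), x • a = a)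
    (h : G₁ ⊓ G₂ = ⊥) (R : G₂ × G₁ → UnitAddCircle) :
    totalD G₁ G₂ UnitAddCircle (squareBicochain R) = extBicochain (extTrivial G₁ G₂ R) := by
  funext p q
  rcases p with _ | _ | _ | p <;> rcases q with _ | _ | _ | q <;>
    first
    | exact totalD_squareBicochain_two_one hA h R
    | exact totalD_squareBicochain_one_two hA h R
    | simp [totalD, totalDFun, extBicochain, squareBicochain]

theorem totalD_extBicochain_three_one (hA : ∀ (x : G) (a : UnitAddCircle), x • a = a)
    (h : G₁ ⊓ G₂ = ⊥) (c : ExtCochain G₁ G₂) (X : Grid G₁ G₂ 3 1) :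
    totalD G₁ G₂ UnitAddCircle (extBicochain c) 3 1 X =
      -(extRelations G₁ G₂ c).1 (X.1.2 0 0, X.1.1 0 1, X.1.1 1 1, X.1.1 2 1) := by
  change dh G₁ G₂ UnitAddCircle 3 0 0 X +
    (-1 : ℤ) ^ 1 • dv G₁ G₂ UnitAddCircle 2 1 (extBicochain c 2 1) X =
    -(c.1 (p₂ G₁ G₂ ((X.1.2 0 0 : G) * X.1.1 0 1), X.1.1 1 1, X.1.1 2 1)
      - c.1 (X.1.2 0 0, X.1.1 0 1 * X.1.1 1 1, X.1.1 2 1)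
      + c.1 (X.1.2 0 0, X.1.1 0 1, X.1.1 1 1 * X.1.1 2 1)
      - c.1 (X.1.2 0 0, X.1.1 0 1, X.1.1 1 1))
  have e₀ : p₂ G₁ G₂ ((X.1.2 0 0 : G) * X.1.1 0 1) = X.1.2 1 0 := p₂_grid h X 0 0
  have f₀ : extBicochain c 2 1 (vFace 0 X) = c.1 (X.1.2 1 0, X.1.1 1 1, X.1.1 2 1) := rfl
  have f₁ : extBicochain c 2 1 (vFace 1 X) =
    c.1 (X.1.2 0 0, X.1.1 0 1 * X.1.1 1 1, X.1.1 2 1) := rfl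
  have f₂ : extBicochain c 2 1 (vFace 2 X) =
    c.1 (X.1.2 0 0, X.1.1 0 1, X.1.1 1 1 * X.1.1 2 1) := rfl
  have f₃ : extBicochain c 2 1 (vFace 3 X) =
    c.1 (X.1.2 0 0, X.1.1 0 1, X.1.1 1 1) := rfl
  rw [map_zero, e₀]
  rw [dv_two, hA, f₀, f₁, f₂, f₃]
  simp

theorem totalD_extBicochain_one_three (hA : ∀ (x : G) (a : UnitAddCircle), x • a = a)
    (h : G₁ ⊓ G₂ = ⊥) (c : ExtCochain G₁ G₂) (X : Grid G₁ G₂ 1 3) :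
    totalD G₁ G₂ UnitAddCircle (extBicochain c) 1 3 X =
      (extRelations G₁ G₂ c).2.1 (X.1.2 0 0, X.1.2 0 1, X.1.2 0 2, X.1.1 0 3) := by
  change dh G₁ G₂ UnitAddCircle 1 2 (extBicochain c 1 2) X +
    (-1 : ℤ) ^ 3 • dv G₁ G₂ UnitAddCircle 0 3 0 X =
    c.2 (X.1.2 0 1, X.1.2 0 2, X.1.1 0 3) - c.2 (X.1.2 0 0 * X.1.2 0 1, X.1.2 0 2, X.1.1 0 3)
      + c.2 (X.1.2 0 0, X.1.2 0 1 * X.1.2 0 2, X.1.1 0 3)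
      - c.2 (X.1.2 0 0, X.1.2 0 1, p₁ G₁ G₂ ((X.1.2 0 2 : G) * X.1.1 0 3))
  have e₀ : p₁ G₁ G₂ ((X.1.2 0 2 : G) * X.1.1 0 3) = X.1.1 0 2 := p₁_grid h X 0 2
  have f₀ : extBicochain c 1 2 (hFace 0 X) = c.2 (X.1.2 0 1, X.1.2 0 2, X.1.1 0 3) := rfl
  have f₁ : extBicochain c 1 2 (hFace 1 X) =
    c.2 (X.1.2 0 0 * X.1.2 0 1, X.1.2 0 2, X.1.1 0 3) := rfl
  have f₂ : extBicochain c 1 2 (hFace 2 X) =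
    c.2 (X.1.2 0 0, X.1.2 0 1 * X.1.2 0 2, X.1.1 0 3) := rfl
  have f₃ : extBicochain c 1 2 (hFace 3 X) =
    c.2 (X.1.2 0 0, X.1.2 0 1, X.1.1 0 2) := rfl
  rw [map_zero, e₀]
  rw [dh_two, hA, f₀, f₁, f₂, f₃]
  simp

/-- The nested arguments with `p₁` and `p₂` in the mixed relation are the inner edges of a 2 × 2
grid, recovered square by square from the top row and the right column. -/
theorem totalD_extBicochain_two_two (hA : ∀ (x : G) (a : UnitAddCircle), x • a = a)
    (h : G₁ ⊓ G₂ = ⊥) (c : ExtCochain G₁ G₂) (X : Grid G₁ G₂ 2 2) :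
    totalD G₁ G₂ UnitAddCircle (extBicochain c) 2 2 X =
      (extRelations G₁ G₂ c).2.2 (X.1.2 0 0, X.1.2 0 1, X.1.1 0 2, X.1.1 1 2) := by
  change dh G₁ G₂ UnitAddCircle 2 1 (extBicochain c 2 1) X +
    (-1 : ℤ) ^ 2 • dv G₁ G₂ UnitAddCircle 1 2 (extBicochain c 1 2) X =
    c.1 (X.1.2 0 1, X.1.1 0 2, X.1.1 1 2) - c.1 (X.1.2 0 0 * X.1.2 0 1, X.1.1 0 2, X.1.1 1 2)
      + c.1 (X.1.2 0 0, p₁ G₁ G₂ ((X.1.2 0 1 : G) * X.1.1 0 2),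
          p₁ G₁ G₂ ((p₂ G₁ G₂ ((X.1.2 0 1 : G) * X.1.1 0 2) : G) * X.1.1 1 2))
      + c.2 (p₂ G₁ G₂ ((X.1.2 0 0 : G) * p₁ G₁ G₂ ((X.1.2 0 1 : G) * X.1.1 0 2)),
          p₂ G₁ G₂ ((X.1.2 0 1 : G) * X.1.1 0 2), X.1.1 1 2)
      - c.2 (X.1.2 0 0, X.1.2 0 1, X.1.1 0 2 * X.1.1 1 2)
      + c.2 (X.1.2 0 0, X.1.2 0 1, X.1.1 0 2)
  have e₁ : p₁ G₁ G₂ ((X.1.2 0 1 : G) * X.1.1 0 2) = X.1.1 0 1 := p₁_grid h X 0 1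
  have e₂ : p₂ G₁ G₂ ((X.1.2 0 1 : G) * X.1.1 0 2) = X.1.2 1 1 := p₂_grid h X 0 1
  have e₃ : p₁ G₁ G₂ ((X.1.2 1 1 : G) * X.1.1 1 2) = X.1.1 1 1 := p₁_grid h X 1 1
  have e₄ : p₂ G₁ G₂ ((X.1.2 0 0 : G) * X.1.1 0 1) = X.1.2 1 0 := p₂_grid h X 0 0
  have f₀ : extBicochain c 2 1 (hFace 0 X) = c.1 (X.1.2 0 1, X.1.1 0 2, X.1.1 1 2) := rfl
  have f₁ : extBicochain c 2 1 (hFace 1 X) =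
    c.1 (X.1.2 0 0 * X.1.2 0 1, X.1.1 0 2, X.1.1 1 2) := rfl
  have f₂ : extBicochain c 2 1 (hFace 2 X) =
    c.1 (X.1.2 0 0, X.1.1 0 1, X.1.1 1 1) := rfl
  have f₃ : extBicochain c 1 2 (vFace 0 X) = c.2 (X.1.2 1 0, X.1.2 1 1, X.1.1 1 2) := rfl
  have f₄ : extBicochain c 1 2 (vFace 1 X) =
    c.2 (X.1.2 0 0, X.1.2 0 1, X.1.1 0 2 * X.1.1 1 2) := rfl
  have f₅ : extBicochain c 1 2 (vFace 2 X) =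
    c.2 (X.1.2 0 0, X.1.2 0 1, X.1.1 0 2) := rfl
  rw [e₁, e₂, e₃, e₄]
  rw [dh_one, dv_one, hA, hA, f₀, f₁, f₂, f₃, f₄, f₅]
  simp
  abel

end ExtAlgebra

/-! ### The group of extensions -/

section Extension

variable {G : Type*} [Group G] [TopologicalSpace G] [IsTopologicalGroup G]
  [T2Space G] [LocallyCompactSpace G] [SecondCountableTopology G] [MeasurableSpace G]
  [BorelSpace G] {G₁ G₂ : Subgroup G} {μ : Measure G} [μ.IsHaarMeasure]
  {μ₁ : Measure G₁} {μ₂ : Measure G₂}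
  [μ₁.IsHaarMeasure] [μ₂.IsHaarMeasure] [SigmaFinite μ₁] [SigmaFinite μ₂]

section

variable {A : Type*} [AddCommGroup A] [DistribMulAction G A]
  [MeasurableSpace A] [MeasurableAdd₂ A] [MeasurableNeg A] {n : ℕ}

theorem mem_totalNull_iff {F : Bicochain G₁ G₂ A} (hF : F ∈ totalMeas G₁ G₂ A n) :
    F ∈ totalNull G₁ G₂ A μ₁ μ₂ ↔ ∀ p q, p + q = n → F p q ∈ nullFun (gridMeasure μ₁ μ₂ p q) A := by
  refine ⟨fun h p q _ => h p q, fun h p q => ?_⟩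
  by_cases hpq : p + q = n
  · exact h p q hpq
  · rw [(hF p q).2 hpq]; exact zero_mem _

theorem rowCol_mem_nullFun_iff [MeasurableSingletonClass A] (hG : IsMatchedPair G₁ G₂ μ) {p q : ℕ}
    {Y : Type*} [MeasurableSpace Y] {ν : Measure Y} {r : (Fin q → G₂) × (Fin p → G₁) → Y}
    (hr : MeasurePreserving r
      ((Measure.pi fun _ : Fin q => μ₂).prod (Measure.pi fun _ : Fin p => μ₁)) ν)
    {f : Y → A} (hf : Measurable f) :
    (fun X => f (r (rowCol X))) ∈ nullFun (gridMeasure μ₁ μ₂ p q) A ↔ f ∈ nullFun ν A := by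
  have m : MeasurableSet {y | f y = 0} := hf (measurableSet_singleton 0)
  change (∀ᵐ X ∂gridMeasure μ₁ μ₂ p q, f (r (rowCol X)) = 0) ↔ ∀ᵐ y ∂ν, f y = 0
  rw [ae_rowCol_iff hG (Q := fun w => f (r w) = 0) (hr.measurable m), ← hr.map_eq,
    ae_map_iff hr.measurable.aemeasurable m]

/-- The bicochain with given components in bidegrees `(n, 0)` and `(0, n)`. -/
def edgeBicochain (K : ((Fin n → G₁) → A) × ((Fin n → G₂) → A)) : Bicochain G₁ G₂ A :=
  fun p q X => if h : p = n ∧ q = 0 then K.1 fun i => X.1.1 (Fin.cast h.1.symm i) 0 else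
    if h : p = 0 ∧ q = n then K.2 fun j => X.1.2 0 (Fin.cast h.2.symm j) else 0

theorem edgeBicochain_mem_totalMeas {K : ((Fin n → G₁) → A) × ((Fin n → G₂) → A)}
    (h₁ : Measurable K.1) (h₂ : Measurable K.2) : edgeBicochain K ∈ totalMeas G₁ G₂ A n := by
  refine fun p q => ⟨?_, fun hne => ?_⟩
  · unfold edgeBicochain
    split_ifs
    · exact h₁.comp (by fun_prop)
    · exact h₂.comp (by fun_prop)
    · exact measurable_const
  · funext X
    simp only [edgeBicochain]
    rw [dif_neg (by omega), dif_neg (by omega)]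
    rfl

theorem toLeft_edgeBicochain (K : ((Fin n → G₁) → A) × ((Fin n → G₂) → A)) :
    toLeft G₁ G₂ A n (edgeBicochain K) = K.1 := by
  funext g
  change edgeBicochain K n 0 _ = _
  rw [edgeBicochain, dif_pos ⟨rfl, rfl⟩]
  rfl

/-- Positive degree is essential: in degree 0 the two bidegrees coincide and the first component
takes precedence. -/
theorem toRight_edgeBicochain (K : ((Fin (n + 1) → G₁) → A) × ((Fin (n + 1) → G₂) → A)) :
    toRight G₁ G₂ A (n + 1) (edgeBicochain K) = K.2 := by
  funext g
  change edgeBicochain K 0 (n + 1) _ = _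
  rw [edgeBicochain, dif_neg (by omega), dif_pos ⟨rfl, rfl⟩]
  rfl

end

theorem extBicochain_mem_totalMeas {c : ExtCochain G₁ G₂} (h₁ : Measurable c.1)
    (h₂ : Measurable c.2) : extBicochain c ∈ totalMeas G₁ G₂ UnitAddCircle 3 := by
  intro p q
  rcases p with _ | _ | _ | p <;> rcases q with _ | _ | _ | q <;>
    first
    | exact ⟨measurable_const, fun _ => rfl⟩
    | exact ⟨h₁.comp (by fun_prop), fun h => absurd rfl h⟩
    | exact ⟨h₂.comp (by fun_prop), fun h => absurd rfl h⟩

theorem squareBicochain_mem_totalMeas {R : G₂ × G₁ → UnitAddCircle} (h : Measurable R) :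
    squareBicochain R ∈ totalMeas G₁ G₂ UnitAddCircle 2 := by
  intro p q
  rcases p with _ | _ | p <;> rcases q with _ | _ | q <;>
    first
    | exact ⟨measurable_const, fun _ => rfl⟩
    | exact ⟨h.comp (by fun_prop), fun h => absurd rfl h⟩

theorem measurable_extRelations (hG : IsMatchedPair G₁ G₂ μ) {c : ExtCochain G₁ G₂}
    (h₁ : Measurable c.1) (h₂ : Measurable c.2) :
    Measurable (extRelations G₁ G₂ c).1 ∧ Measurable (extRelations G₁ G₂ c).2.1 ∧
      Measurable (extRelations G₁ G₂ c).2.2 := by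
  have m₁ := measurable_p₁ hG
  have m₂ := measurable_p₂ hG
  refine ⟨?_, ?_, ?_⟩ <;> simp only [extRelations, AddMonoidHom.coe_mk, ZeroHom.coe_mk] <;> fun_prop

theorem measurable_extTrivial (hG : IsMatchedPair G₁ G₂ μ) {R : G₂ × G₁ → UnitAddCircle}
    (h : Measurable R) :
    Measurable (extTrivial G₁ G₂ R).1 ∧ Measurable (extTrivial G₁ G₂ R).2 := by
  have m₁ := measurable_p₁ hG
  have m₂ := measurable_p₂ hG
  refine ⟨?_, ?_⟩ <;> simp only [extTrivial, AddMonoidHom.coe_mk, ZeroHom.coe_mk] <;> fun_prop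

variable [DistribMulAction G UnitAddCircle]

theorem extBicochain_mem_totalNull_iff (hG : IsMatchedPair G₁ G₂ μ) {c : ExtCochain G₁ G₂}
    (h₁ : Measurable c.1) (h₂ : Measurable c.2) :
    extBicochain c ∈ totalNull G₁ G₂ UnitAddCircle μ₁ μ₂ ↔
      c ∈ (nullFun (μ₂.prod (μ₁.prod μ₁)) UnitAddCircle).prod
        (nullFun (μ₂.prod (μ₂.prod μ₁)) UnitAddCircle) := by
  have e₁ := rowCol_mem_nullFun_iff (μ₁ := μ₁) (μ₂ := μ₂) hG (measurePreserving_one_two μ₂ μ₁) h₁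
  have e₂ := rowCol_mem_nullFun_iff (μ₁ := μ₁) (μ₂ := μ₂) hG (measurePreserving_two_one μ₂ μ₁) h₂
  rw [AddSubgroup.mem_prod, ← e₁, ← e₂]
  refine ⟨fun h => ⟨h 2 1, h 1 2⟩, fun h p q => ?_⟩
  rcases p with _ | _ | _ | p <;> rcases q with _ | _ | _ | q <;>
    first
    | exact zero_mem _
    | exact h.1
    | exact h.2

theorem measurableSMul₂_of_trivial (hA : ∀ (x : G) (a : UnitAddCircle), x • a = a) :
    MeasurableSMul₂ G UnitAddCircle := by
  constructor
  simp only [hA]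
  exact measurable_snd

theorem totalD_extBicochain_mem_totalNull_iff (hG : IsMatchedPair G₁ G₂ μ)
    (hA : ∀ (x : G) (a : UnitAddCircle), x • a = a) {c : ExtCochain G₁ G₂}
    (h₁ : Measurable c.1) (h₂ : Measurable c.2) :
    totalD G₁ G₂ UnitAddCircle (extBicochain c) ∈ totalNull G₁ G₂ UnitAddCircle μ₁ μ₂ ↔
      extRelations G₁ G₂ c ∈ (nullFun (μ₂.prod (μ₁.prod (μ₁.prod μ₁))) UnitAddCircle).prod
        ((nullFun (μ₂.prod (μ₂.prod (μ₂.prod μ₁))) UnitAddCircle).prod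
          (nullFun (μ₂.prod (μ₂.prod (μ₁.prod μ₁))) UnitAddCircle)) := by
  have := measurableSMul₂_of_trivial hA
  obtain ⟨m₁, m₂, m₃⟩ := measurable_extRelations hG h₁ h₂
  have e₁ := rowCol_mem_nullFun_iff (μ₁ := μ₁) (μ₂ := μ₂) hG (measurePreserving_one_three μ₂ μ₁) m₁
  have e₂ := rowCol_mem_nullFun_iff (μ₁ := μ₁) (μ₂ := μ₂) hG (measurePreserving_three_one μ₂ μ₁) m₂
  have e₃ := rowCol_mem_nullFun_iff (μ₁ := μ₁) (μ₂ := μ₂) hG (measurePreserving_two_two μ₂ μ₁) m₃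
  have f₁ : totalD G₁ G₂ UnitAddCircle (extBicochain c) 3 1 = _ :=
    funext (totalD_extBicochain_three_one hA hG.inf_eq_bot c)
  have f₂ : totalD G₁ G₂ UnitAddCircle (extBicochain c) 1 3 = _ :=
    funext (totalD_extBicochain_one_three hA hG.inf_eq_bot c)
  have f₃ : totalD G₁ G₂ UnitAddCircle (extBicochain c) 2 2 = _ :=
    funext (totalD_extBicochain_two_two hA hG.inf_eq_bot c)
  rw [mem_totalNull_iff (totalD_mem_totalMeas hG (extBicochain_mem_totalMeas h₁ h₂)),
    AddSubgroup.mem_prod, AddSubgroup.mem_prod, ← e₁, ← e₂, ← e₃]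
  constructor
  · intro h
    have k₁ := h 3 1 rfl
    have k₂ := h 1 3 rfl
    have k₃ := h 2 2 rfl
    rw [f₁] at k₁
    rw [f₂] at k₂
    rw [f₃] at k₃
    exact ⟨neg_mem_iff.1 k₁, k₂, k₃⟩
  · rintro ⟨k₁, k₂, k₃⟩ p q hpq
    obtain rfl : q = 4 - p := by omega
    have hp : p ≤ 4 := by omega
    interval_cases p
    · change dh G₁ G₂ UnitAddCircle 0 3 0 ∈ _
      rw [map_zero]; exact zero_mem _
    · exact f₂ ▸ k₂
    · exact f₃ ▸ k₃
    · exact f₁ ▸ neg_mem_iff.2 k₁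
    · change dv G₁ G₂ UnitAddCircle 3 0 0 ∈ _
      rw [map_zero]; exact zero_mem _

theorem extBicochain_sub (c c' : ExtCochain G₁ G₂) :
    extBicochain (c - c') = extBicochain c - extBicochain c' := map_sub (extHom G₁ G₂) c c'

theorem mem_extCocycles_iff (hG : IsMatchedPair G₁ G₂ μ)
    (hA : ∀ (x : G) (a : UnitAddCircle), x • a = a) {c : ExtCochain G₁ G₂}
    (h₁ : Measurable c.1) (h₂ : Measurable c.2) :
    c ∈ extCocycles G₁ G₂ μ₁ μ₂ ↔ ((extBicochain c, 0) : ConeCochain G₁ G₂ UnitAddCircle 2) ∈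
      kacCocycles G₁ G₂ UnitAddCircle μ₁ μ₂ 2 := by
  have e : c ∈ extCocycles G₁ G₂ μ₁ μ₂ ↔
      totalD G₁ G₂ UnitAddCircle (extBicochain c) ∈ totalNull G₁ G₂ UnitAddCircle μ₁ μ₂ :=
    Iff.trans (and_iff_right ⟨h₁, h₂⟩) (totalD_extBicochain_mem_totalNull_iff hG hA h₁ h₂).symm
  rw [e, mem_kacCocycles_iff]
  refine ⟨fun h => ⟨⟨extBicochain_mem_totalMeas h₁ h₂, zero_mem _⟩, h, ?_, ?_⟩, fun h => h.2.1⟩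
  · change -groupD G₁ UnitAddCircle 2 0 + 0 ∈ _
    rw [map_zero, neg_zero, add_zero]; exact zero_mem _
  · change -groupD G₂ UnitAddCircle 2 0 + 0 ∈ _
    rw [map_zero, neg_zero, add_zero]; exact zero_mem _

/-- The primitive is R placed on single squares; it has no components along the edges, so the cone
coboundary has none either. -/
theorem extBicochain_mem_kacCoboundaries (hA : ∀ (x : G) (a : UnitAddCircle), x • a = a)
    (hG : IsMatchedPair G₁ G₂ μ) {c : ExtCochain G₁ G₂} (hc : c ∈ extCocycles G₁ G₂ μ₁ μ₂)
    (h : c ∈ extCoboundaries G₁ G₂ μ₁ μ₂) :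
    ((extBicochain c, 0) : ConeCochain G₁ G₂ UnitAddCircle 2) ∈
      kacCoboundaries G₁ G₂ UnitAddCircle μ₁ μ₂ 2 := by
  obtain ⟨R, hR, e⟩ := mem_coboundaries_iff.1 h
  have hm := measurable_extTrivial hG hR
  refine mem_coboundaries_iff.2
    ⟨(squareBicochain R, 0), ⟨squareBicochain_mem_totalMeas hR, zero_mem _⟩, ?_⟩
  rw [coneD_mk_zero, totalD_squareBicochain hA hG.inf_eq_bot]
  rw [← extBicochain_mem_totalNull_iff hG (hc.1.1.sub hm.1) (hc.1.2.sub hm.2),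
    extBicochain_sub] at e
  refine ⟨e, ?_, ?_⟩
  · change (0 : (Fin 2 → G₁) → UnitAddCircle) - 0 ∈ _
    rw [sub_zero]; exact zero_mem _
  · change (0 : (Fin 2 → G₂) → UnitAddCircle) - 0 ∈ _
    rw [sub_zero]; exact zero_mem _

theorem extBicochain_mem_extCoboundaries (hA : ∀ (x : G) (a : UnitAddCircle), x • a = a)
    (hG : IsMatchedPair G₁ G₂ μ) {c : ExtCochain G₁ G₂} (hc : c ∈ extCocycles G₁ G₂ μ₁ μ₂)
    (h : ((extBicochain c, 0) : ConeCochain G₁ G₂ UnitAddCircle 2) ∈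
      kacCoboundaries G₁ G₂ UnitAddCircle μ₁ μ₂ 2) :
    c ∈ extCoboundaries G₁ G₂ μ₁ μ₂ := by
  have := measurableSMul₂_of_trivial hA
  obtain ⟨⟨F, K⟩, ⟨hF, hK₁, hK₂⟩, e⟩ := mem_coboundaries_iff.1 h
  have hE : edgeBicochain K ∈ totalMeas G₁ G₂ UnitAddCircle 1 :=
    edgeBicochain_mem_totalMeas hK₁ hK₂
  -- Moving K into the bicomplex makes the edge components of the primitive null without changing
  -- its coboundary. What is left is its component on Γ₁₁, and this is R.
  set F' : Bicochain G₁ G₂ UnitAddCircle := F - totalD G₁ G₂ UnitAddCircle (edgeBicochain K)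
    with F'_def
  have hF' : F' ∈ totalMeas G₁ G₂ UnitAddCircle 2 := sub_mem hF (totalD_mem_totalMeas hG hE)
  have hdF' : totalD G₁ G₂ UnitAddCircle F' = totalD G₁ G₂ UnitAddCircle F := by
    rw [F'_def, map_sub, totalD_totalD hG hE, sub_zero]
  have hl : toLeft G₁ G₂ UnitAddCircle 2 F' ∈ groupNull G₁ UnitAddCircle μ₁ 2 := by
    have e₁ : 0 - (-groupD G₁ UnitAddCircle 1 K.1 + toLeft G₁ G₂ UnitAddCircle 2 F) ∈
      groupNull G₁ UnitAddCircle μ₁ 2 := e.2.1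
    rw [F'_def, map_sub, toLeft_totalD, toLeft_edgeBicochain, ← neg_mem_iff]
    convert e₁ using 1
    abel
  have hr : toRight G₁ G₂ UnitAddCircle 2 F' ∈ groupNull G₂ UnitAddCircle μ₂ 2 := by
    have e₂ : 0 - (-groupD G₂ UnitAddCircle 1 K.2 + toRight G₁ G₂ UnitAddCircle 2 F) ∈
      groupNull G₂ UnitAddCircle μ₂ 2 := e.2.2
    rw [F'_def, map_sub, toRight_totalD, toRight_edgeBicochain, ← neg_mem_iff]
    convert e₂ using 1
    abel
  let R : G₂ × G₁ → UnitAddCircle := fun w => rowColFun (F' 1 1) (fun _ => w.1, fun _ => w.2)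
  have hR : Measurable R :=
    (measurable_rowColFun hG (hF' 1 1).1).comp (by fun_prop)
  have hRF : squareBicochain R 1 1 = F' 1 1 := by
    funext X
    rw [← rowColFun_rowCol hG hA (F' 1 1) X]
    change rowColFun _ _ = _
    congr 1
    refine Prod.ext ?_ ?_
    · funext j; exact congrArg (X.1.2 0) (Subsingleton.elim (α := Fin 1) 0 j)
    · funext i; exact congrArg (X.1.1 · 1) (Subsingleton.elim (α := Fin 1) 0 i)
  have hS := squareBicochain_mem_totalMeas hR
  have hn : F' - squareBicochain R ∈ totalNull G₁ G₂ UnitAddCircle μ₁ μ₂ := by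
    rw [mem_totalNull_iff (sub_mem hF' hS)]
    intro p q hpq
    obtain rfl : q = 2 - p := by omega
    have hp : p ≤ 2 := by omega
    interval_cases p
    · change F' 0 2 - 0 ∈ _
      rw [sub_zero]; exact (mem_nullFun_iff_toRight hG F').2 hr
    · change F' 1 1 - squareBicochain R 1 1 ∈ _
      rw [hRF, sub_self]; exact zero_mem _
    · change F' 2 0 - 0 ∈ _
      rw [sub_zero]; exact (mem_nullFun_iff_toLeft hG F').2 hl
  have hd := totalD_mem_totalNull hG (sub_mem hF' hS) hn
  rw [map_sub, hdF', totalD_squareBicochain hA hG.inf_eq_bot] at hd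
  refine mem_coboundaries_iff.2 ⟨R, hR, ?_⟩
  have hm := measurable_extTrivial hG hR
  rw [← extBicochain_mem_totalNull_iff hG (hc.1.1.sub hm.1) (hc.1.2.sub hm.2), extBicochain_sub]
  have e₀ : extBicochain c - totalD G₁ G₂ UnitAddCircle F ∈ totalNull G₁ G₂ UnitAddCircle μ₁ μ₂ :=
    e.1
  simpa using add_mem e₀ hd

/-- Every cocycle of the mapping cone of degree 2 is cohomologous to one given by a pair of
2-cocycles. -/
theorem exists_extBicochain_sub_mem_kacCoboundaries
    (hA : ∀ (x : G) (a : UnitAddCircle), x • a = a)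
    (hG : IsMatchedPair G₁ G₂ μ) {x : ConeCochain G₁ G₂ UnitAddCircle 2}
    (hx : x ∈ kacCocycles G₁ G₂ UnitAddCircle μ₁ μ₂ 2) :
    ∃ c ∈ extCocycles G₁ G₂ μ₁ μ₂, x - ((extBicochain c, 0) : ConeCochain G₁ G₂ UnitAddCircle 2) ∈
      kacCoboundaries G₁ G₂ UnitAddCircle μ₁ μ₂ 2 := by
  have := measurableSMul₂_of_trivial hA
  obtain ⟨F, K⟩ := x
  obtain ⟨⟨hF, hK₁, hK₂⟩, hd, e₁, e₂⟩ := mem_kacCocycles_iff.1 hx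
  simp only at hF hK₁ hK₂ hd e₁ e₂
  have hE : edgeBicochain K ∈ totalMeas G₁ G₂ UnitAddCircle 2 :=
    edgeBicochain_mem_totalMeas hK₁ hK₂
  -- Subtracting the cone coboundary of (edgeBicochain K, 0) removes K, and the cocycle condition
  -- then makes the components on Γ₃₀ and Γ₀₃ null. Those on Γ₂₁ and Γ₁₂ give U and V.
  set F' : Bicochain G₁ G₂ UnitAddCircle := F - totalD G₁ G₂ UnitAddCircle (edgeBicochain K)
    with F'_def
  have hF' : F' ∈ totalMeas G₁ G₂ UnitAddCircle 3 := sub_mem hF (totalD_mem_totalMeas hG hE)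
  have hdF' : totalD G₁ G₂ UnitAddCircle F' = totalD G₁ G₂ UnitAddCircle F := by
    rw [F'_def, map_sub, totalD_totalD hG hE, sub_zero]
  have hl : toLeft G₁ G₂ UnitAddCircle 3 F' ∈ groupNull G₁ UnitAddCircle μ₁ 3 := by
    rwa [F'_def, map_sub, toLeft_totalD, toLeft_edgeBicochain, ← neg_add_eq_sub]
  have hr : toRight G₁ G₂ UnitAddCircle 3 F' ∈ groupNull G₂ UnitAddCircle μ₂ 3 := by
    rwa [F'_def, map_sub, toRight_totalD, toRight_edgeBicochain, ← neg_add_eq_sub]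
  let c : ExtCochain G₁ G₂ :=
    (fun w => rowColFun (F' 2 1) (fun _ => w.1, ![w.2.1, w.2.2]),
     fun w => rowColFun (F' 1 2) (![w.1, w.2.1], fun _ => w.2.2))
  have mv {Y : Type _} [MeasurableSpace Y] {H : Subgroup G} {f g : Y → H} (hf : Measurable f)
      (hg : Measurable g) : Measurable fun y => ![f y, g y] :=
    measurable_pi_lambda _ fun i => by fin_cases i <;> simpa
  have hc₁ : Measurable c.1 := (measurable_rowColFun hG (hF' 2 1).1).comp
    (Measurable.prodMk (by fun_prop) (mv (by fun_prop) (by fun_prop)))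
  have hc₂ : Measurable c.2 := (measurable_rowColFun hG (hF' 1 2).1).comp
    (Measurable.prodMk (mv (by fun_prop) (by fun_prop)) (by fun_prop))
  have hU : extBicochain c 2 1 = F' 2 1 := by
    funext X
    rw [← rowColFun_rowCol hG hA (F' 2 1) X]
    change rowColFun _ _ = _
    congr 1
    refine Prod.ext ?_ ?_
    · funext j; exact congrArg (X.1.2 0) (Subsingleton.elim (α := Fin 1) 0 j)
    · funext i; fin_cases i <;> rfl
  have hV : extBicochain c 1 2 = F' 1 2 := by
    funext X
    rw [← rowColFun_rowCol hG hA (F' 1 2) X]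
    change rowColFun _ _ = _
    congr 1
    refine Prod.ext ?_ ?_
    · funext i; fin_cases i <;> rfl
    · funext i; exact congrArg (X.1.1 · 2) (Subsingleton.elim (α := Fin 1) 0 i)
  have hS := extBicochain_mem_totalMeas hc₁ hc₂
  have hn : F' - extBicochain c ∈ totalNull G₁ G₂ UnitAddCircle μ₁ μ₂ := by
    rw [mem_totalNull_iff (sub_mem hF' hS)]
    intro p q hpq
    obtain rfl : q = 3 - p := by omega
    have hp : p ≤ 3 := by omega
    interval_cases p
    · change F' 0 3 - 0 ∈ _
      rw [sub_zero]; exact (mem_nullFun_iff_toRight hG F').2 hr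
    · change F' 1 2 - extBicochain c 1 2 ∈ _
      rw [hV, sub_self]; exact zero_mem _
    · change F' 2 1 - extBicochain c 2 1 ∈ _
      rw [hU, sub_self]; exact zero_mem _
    · change F' 3 0 - 0 ∈ _
      rw [sub_zero]; exact (mem_nullFun_iff_toLeft hG F').2 hl
  have hdc : totalD G₁ G₂ UnitAddCircle (extBicochain c) ∈
      totalNull G₁ G₂ UnitAddCircle μ₁ μ₂ := by
    have := totalD_mem_totalNull hG (sub_mem hF' hS) hn
    rw [map_sub, hdF'] at this
    simpa using sub_mem hd this
  refine ⟨c, ⟨⟨hc₁, hc₂⟩, (totalD_extBicochain_mem_totalNull_iff hG hA hc₁ hc₂).1 hdc⟩, ?_⟩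
  refine mem_coboundaries_iff.2 ⟨(edgeBicochain K, 0), ⟨hE, zero_mem _⟩, ?_⟩
  rw [coneD_mk_zero, toLeft_edgeBicochain, toRight_edgeBicochain]
  refine ⟨?_, ?_, ?_⟩
  · change F - extBicochain c - totalD G₁ G₂ UnitAddCircle (edgeBicochain K) ∈ _
    rwa [sub_right_comm]
  · change K.1 - 0 - K.1 ∈ _
    rw [sub_zero, sub_self]; exact zero_mem _
  · change K.2 - 0 - K.2 ∈ _
    rw [sub_zero, sub_self]; exact zero_mem _

/-- The relation used is being cohomologous to the bicochain of the pair; it is total on both sides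
because every class has a representative of this form. -/
theorem exists_extensionGroup_equiv (hA : ∀ (x : G) (a : UnitAddCircle), x • a = a)
    (hG : IsMatchedPair G₁ G₂ μ) :
    ∃ e : ExtensionGroup G₁ G₂ μ₁ μ₂ ≃+ KacCohomology G₁ G₂ UnitAddCircle μ₁ μ₂ 2,
      ∀ x c, Represents x c → Represents (e x) (extBicochain c, 0, 0) := by
  let E : ExtCochain G₁ G₂ →+ ConeCochain G₁ G₂ UnitAddCircle 2 :=
    (AddMonoidHom.inl _ _).comp (extHom G₁ G₂)
  have hE {c : ExtCochain G₁ G₂} (hc : c ∈ extCocycles G₁ G₂ μ₁ μ₂) :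
      E c ∈ kacCocycles G₁ G₂ UnitAddCircle μ₁ μ₂ 2 :=
    (mem_extCocycles_iff hG hA hc.1.1 hc.1.2).1 hc
  let R : AddSubgroup (ExtCochain G₁ G₂ × ConeCochain G₁ G₂ UnitAddCircle 2) :=
    (kacCoboundaries G₁ G₂ UnitAddCircle μ₁ μ₂ 2).comap
      (AddMonoidHom.snd _ _ - E.comp (AddMonoidHom.fst _ _))
  have hR (c : ExtCochain G₁ G₂) : (c, E c) ∈ R := by
    change E c - E c ∈ kacCoboundaries G₁ G₂ UnitAddCircle μ₁ μ₂ 2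
    rw [sub_self]; exact zero_mem _
  obtain ⟨e, he⟩ := exists_cohomology_addEquiv (extCocycles G₁ G₂ μ₁ μ₂)
    (extCoboundaries G₁ G₂ μ₁ μ₂) (kacCocycles G₁ G₂ UnitAddCircle μ₁ μ₂ 2)
    (kacCoboundaries G₁ G₂ UnitAddCircle μ₁ μ₂ 2) R (fun c hc => ⟨E c, hE hc, hR c⟩)
    (fun x hx => exists_extBicochain_sub_mem_kacCoboundaries hA hG hx) fun c x hc hx h => by
      have h' : x - E c ∈ kacCoboundaries G₁ G₂ UnitAddCircle μ₁ μ₂ 2 := h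
      refine ⟨fun hB => ?_, fun hB => extBicochain_mem_extCoboundaries hA hG hc ?_⟩
      · have hEc : E c ∈ kacCoboundaries G₁ G₂ UnitAddCircle μ₁ μ₂ 2 :=
          extBicochain_mem_kacCoboundaries hA hG hc hB
        have := add_mem h' hEc
        rwa [sub_add_cancel] at this
      · have := sub_mem hB h'
        rwa [sub_sub_cancel] at this
  exact ⟨e, fun x c hx => he c (E c) hx.mem (hE hx.mem) (hR c) x hx⟩

end Extension

end Kac

/-! ### The theorem -/

theorem mainTheorem1
    {G : Type*} [Group G] [TopologicalSpace G] [IsTopologicalGroup G] [T2Space G]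
    [LocallyCompactSpace G] [SecondCountableTopology G] [MeasurableSpace G] [BorelSpace G]
    (G₁ G₂ : Subgroup G)
    (μ : Measure G) [μ.IsHaarMeasure]
    (μ₁ : Measure G₁) [μ₁.IsHaarMeasure] (μ₂ : Measure G₂) [μ₂.IsHaarMeasure]
    (hG : Kac.IsMatchedPair G₁ G₂ μ) :
    -- the Kac exact sequence, for every Polish `G`-module `A`
    (∀ {A : Type*} [AddCommGroup A] [TopologicalSpace A] [IsTopologicalAddGroup A] [PolishSpace A]
      [MeasurableSpace A] [BorelSpace A] [DistribMulAction G A] [ContinuousSMul G A],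
      ∃ (Φ : ∀ n : ℕ, Kac.GroupCohomology G A μ n ≃+ Kac.TotalCohomology G₁ G₂ A μ₁ μ₂ n)
        (ι : FixedPoints.addSubgroup G A →+
          FixedPoints.addSubgroup G₁ A × FixedPoints.addSubgroup G₂ A)
        (inc₀ : FixedPoints.addSubgroup G₁ A × FixedPoints.addSubgroup G₂ A →+
          Kac.KacCohomology G₁ G₂ A μ₁ μ₂ 0)
        (conn : ∀ n : ℕ, Kac.KacCohomology G₁ G₂ A μ₁ μ₂ n →+
          Kac.GroupCohomology G A μ (n + 1))
        (res : ∀ n : ℕ, Kac.GroupCohomology G A μ (n + 1) →+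
          Kac.GroupCohomology G₁ A μ₁ (n + 1) × Kac.GroupCohomology G₂ A μ₂ (n + 1))
        (inc : ∀ n : ℕ,
          Kac.GroupCohomology G₁ A μ₁ (n + 1) × Kac.GroupCohomology G₂ A μ₂ (n + 1) →+
            Kac.KacCohomology G₁ G₂ A μ₁ μ₂ (n + 1)),
        -- `Φ` is induced by the signed sums of Borel cocycles over paths
        (∀ (n : ℕ) (f : (Fin n → G) → A), Measurable f → Kac.groupD G A n f = 0 →
          ∀ x, Kac.Represents x f → Kac.Represents (Φ n x) (Kac.pathCochain G₁ G₂ n f)) ∧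
        -- `ι` is the diagonal inclusion
        (∀ a, ((ι a).1 : A) = a ∧ ((ι a).2 : A) = a) ∧
        -- `inc₀` and `inc` are induced by the inclusion into the mapping cone
        (∀ a b, Kac.Represents (inc₀ (a, b)) (0, (fun _ => (a : A)), (fun _ => (b : A)))) ∧
        (∀ (n : ℕ) x y f₁ f₂, Kac.Represents x f₁ → Kac.Represents y f₂ →
          Kac.Represents (inc n (x, y)) (0, f₁, f₂)) ∧
        -- `conn` is induced by the projection of the mapping cone, followed by the inverse of `Φ`
        (∀ (n : ℕ) z c, Kac.Represents z c → Kac.Represents (Φ (n + 1) (conn n z)) c.1) ∧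
        -- `res` is restriction: of bicochains, and of Borel cocycles on `G`
        (∀ (n : ℕ) x F, Kac.Represents (Φ (n + 1) x) F →
          Kac.Represents (res n x).1 (Kac.toLeft G₁ G₂ A (n + 1) F) ∧
          Kac.Represents (res n x).2 (Kac.toRight G₁ G₂ A (n + 1) F)) ∧
        (∀ (n : ℕ) (f : (Fin (n + 1) → G) → A), Measurable f → Kac.groupD G A (n + 1) f = 0 →
          ∀ x, Kac.Represents x f →
            Kac.Represents (res n x).1 (fun g : Fin (n + 1) → G₁ => f fun i => (g i : G)) ∧
            Kac.Represents (res n x).2 (fun s : Fin (n + 1) → G₂ => f fun i => (s i : G))) ∧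
        -- the sequence is exact
        Function.Injective ι ∧
        Function.Exact ι inc₀ ∧
        Function.Exact inc₀ (conn 0) ∧
        (∀ n, Function.Exact (conn n) (res n)) ∧
        (∀ n, Function.Exact (res n) (inc n)) ∧
        (∀ n, Function.Exact (inc n) (conn (n + 1)))) ∧
    -- the group of extensions is the Kac 2-cohomology with coefficients in the trivial module `ℝ/ℤ`
    (letI : DistribMulAction G UnitAddCircle := Kac.trivialAction G UnitAddCircle
      ∃ e : Kac.ExtensionGroup G₁ G₂ μ₁ μ₂ ≃+ Kac.KacCohomology G₁ G₂ UnitAddCircle μ₁ μ₂ 2,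
        ∀ x c, Kac.Represents x c → Kac.Represents (e x) (Kac.extBicochain c, 0, 0)) := by
  -- Closed subgroups are again locally compact and second countable, so their Haar measures are
  -- σ-finite, as Fubini requires.
  have : SigmaFinite μ₁ := Kac.sigmaFinite_subgroup hG.isClosed_left μ₁
  have : SigmaFinite μ₂ := Kac.sigmaFinite_subgroup hG.isClosed_right μ₂
  refine ⟨fun {A} _ _ _ _ _ _ _ _ => Kac.exact_sequence hG, ?_⟩
  let _ : DistribMulAction G UnitAddCircle := Kac.trivialAction G UnitAddCircle
  exact Kac.exists_extensionGroup_equiv (fun _ _ => rfl) hG
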